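/- Let $k$ be a commutative ring. All DG categories are small differential graded $k$-categories (differentials of degree $+1$). For a DG category $\mathcal A$, let $\mathrm{Ho}(\mathcal A)$ be its homotopy category (same objects, morphisms $H^0\mathrm{Hom}_{\mathcal A}(X,Y)$), let $\mathcal A^{\mathrm{pretr}}$ be the DG category of one-sided twisted complexes $(\bigoplus_{i=1}^n C_i[r_i],q)$ over $\mathcal A$ ($n\ge 0$; $q$ of degree $1$, $q_{ij}=0$ for $i\ge j$, $dq+q^2=0$), and let $\mathcal A^{\mathrm{tr}}$ be its homotopy category, a triangulated category. Let $\mathcal A^\circ$ be the dual DG category, and let $D(\mathcal A)$ be the derived category of right DG $\mathcal A$-modules, i.e. the Verdier quotient of the homotopy category of right DG $\mathcal A$-modules by the acyclic ones; thus $D(\mathcal A^\circ)$ is the derived category of left DG $\mathcal A$-modules. Let $\xi:\mathcal A\to\mathcal C$ be a DG functor between DG categories and let $\mathcal B\subset\mathcal A$ be a full DG subcategory. Assume that for every object $X$ of $\mathcal B$ the object $\xi(X)$ is contractible (its identity morphism is a coboundary), and that $\mathrm{Ho}(\xi):\mathrm{Ho}(\mathcal A)\to\mathrm{Ho}(\mathcal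 C)$ is essentially surjective. Then the following properties are equivalent: (i) $\xi:\mathcal A\to\mathcal C$ is a DG quotient of $\mathcal A$ modulo $\mathcal B$, i.e. $\mathrm{Ho}(\xi)$ is essentially surjective and $\xi^{\mathrm{tr}}:\mathcal A^{\mathrm{tr}}\to\mathcal C^{\mathrm{tr}}$ induces an equivalence $\mathcal A^{\mathrm{tr}}/\mathcal B^{\mathrm{tr}}\to\mathcal C^{\mathrm{tr}}$, where $\mathcal A^{\mathrm{tr}}/\mathcal B^{\mathrm{tr}}$ is the localization of $\mathcal A^{\mathrm{tr}}$ at the morphisms whose cone is isomorphic to an object of $\mathcal B^{\mathrm{tr}}$; (ii) for every object $Y$ of $\mathcal A$ the right DG $\mathcal A$-module $$X\mapsto \mathrm{Cone}\bigl(\mathrm{Hom}_{\mathcal A}(X,Y)\to\mathrm{Hom}_{\mathcal C}(\xi(X),\xi(Y))\bigr)$$ is in the essential image of the derived induction functor $L\mathrm{Ind}:D(\mathcal B)\to D(\mathcal A)$, the left adjoint of the restriction functor $D(\mathcal A)\to D(\mathcal B)$; (ii$^\circ$) for every object $X$ of $\mathcal A$ the left DG $\mathcal A$-module $$Y\mapsto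 \mathrm{Cone}\bigl(\mathrm{Hom}_{\mathcal A}(X,Y)\to\mathrm{Hom}_{\mathcal C}(\xi(X),\xi(Y))\bigr)$$ is in the essential image of the derived induction functor $L\mathrm{Ind}:D(\mathcal B^\circ)\to D(\mathcal A^\circ)$, the left adjoint of the restriction functor $D(\mathcal A^\circ)\to D(\mathcal B^\circ)$. -/

import Mathlib

open CategoryTheory

universe w v u u' u''

namespace DG

/-- The Koszul sign `(-1)^n` as an integer. -/
def sgn (n : ℤ) : ℤ := (n.negOnePow : ℤ)

theorem sgn_add (m n : ℤ) : sgn (m + n) = sgn m * sgn n := by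
  simp [sgn, Int.negOnePow_add]

theorem sgn_sub (m n : ℤ) : sgn (m - n) = sgn m * sgn n := by
  simp [sgn, Int.negOnePow_sub]

theorem sgn_zero : sgn 0 = 1 := by simp [sgn]

theorem sgn_one : sgn 1 = -1 := by simp [sgn]

theorem sgn_mul_self (n : ℤ) : sgn n * sgn n = 1 := by
  rw [← sgn_add, sgn, Int.negOnePow_even _ ⟨n, rfl⟩]; rfl

/-! ### DG categories and DG functors -/

/-- A differential graded `k`-category with set of objects `A`.  `Hom X Y n` is the degree `n` part
of the complex `Hom(X, Y)`, and `d n m` its differential (of degree `1`). Composition is written in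
diagrammatic order: `comp p q n h f g` is `f` (of degree `p`) followed by `g` (of degree `q`), i.e.
`g ∘ f`, so that the Leibniz rule is `d (g ∘ f) = d g ∘ f + (-1) ^ deg g • g ∘ d f`. -/
class DGCategory (k : Type w) [CommRing k] (A : Type u) where
  Hom : A → A → ℤ → Type v
  [addCommGroup : ∀ X Y n, AddCommGroup (Hom X Y n)]
  [module : ∀ X Y n, Module k (Hom X Y n)]
  d : ∀ {X Y : A} (n m : ℤ), n + 1 = m → (Hom X Y n →ₗ[k] Hom X Y m)
  id : ∀ X : A, Hom X X 0
  comp : ∀ {X Y Z : A} (p q n : ℤ), p + q = n → (Hom X Y p →ₗ[k] Hom Y Z q →ₗ[k] Hom X Z n)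
  d_d : ∀ {X Y : A} (l m n : ℤ) (h : l + 1 = m) (h' : m + 1 = n) (f : Hom X Y l),
    d m n h' (d l m h f) = 0
  id_comp : ∀ {X Y : A} (n : ℤ) (f : Hom X Y n), comp 0 n n (zero_add n) (id X) f = f
  comp_id : ∀ {X Y : A} (n : ℤ) (f : Hom X Y n), comp n 0 n (add_zero n) f (id Y) = f
  assoc : ∀ {X Y Z T : A} (p q r a b n : ℤ) (h₁ : p + q = a) (h₂ : a + r = n) (h₃ : q + r = b)
    (h₄ : p + b = n) (f : Hom X Y p) (g : Hom Y Z q) (e : Hom Z T r),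
    comp a r n h₂ (comp p q a h₁ f g) e = comp p b n h₄ f (comp q r b h₃ g e)
  leibniz : ∀ {X Y Z : A} (p q n p' q' n' : ℤ) (h : p + q = n) (hp : p + 1 = p') (hq : q + 1 = q')
    (hn : n + 1 = n') (h₁ : p + q' = n') (h₂ : p' + q = n') (f : Hom X Y p) (g : Hom Y Z q),
    d n n' hn (comp p q n h f g) =
      comp p q' n' h₁ f (d q q' hq g) + sgn q • comp p' q n' h₂ (d p p' hp f) g

attribute [reducible, instance] DGCategory.addCommGroup DGCategory.module

section

variable (k : Type w) [CommRing k] {A : Type u} [DGCategory.{w, v} k A]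

/-- The degree `n` part of the Hom complex. -/
abbrev Hom (X Y : A) (n : ℤ) : Type v := DGCategory.Hom k X Y n

variable {k}

/-- The differential of the Hom complexes. -/
abbrev d {X Y : A} (n m : ℤ) (h : n + 1 = m) : Hom k X Y n →ₗ[k] Hom k X Y m :=
  DGCategory.d n m h

/-- Composition (in diagrammatic order) in a DG category. -/
abbrev comp {X Y Z : A} (p q n : ℤ) (h : p + q = n) :
    Hom k X Y p →ₗ[k] Hom k Y Z q →ₗ[k] Hom k X Z n :=
  DGCategory.comp p q n h

theorem d_id (X : A) : d 0 1 (zero_add 1) (DGCategory.id X : Hom k X X 0) = 0 := by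
  have h := DGCategory.leibniz (k := k) 0 0 0 1 1 1 (zero_add 0) (zero_add 1) (zero_add 1)
    (zero_add 1) (by simp) (by simp) (DGCategory.id X) (DGCategory.id X)
  rw [DGCategory.id_comp, DGCategory.id_comp, DGCategory.comp_id, sgn_zero, one_smul] at h
  exact left_eq_add.mp h

/-- The identity morphism, with flexible indices: if `X = Y` and `n = 0`. -/
def idOfEq {X Y : A} (hX : X = Y) {n : ℤ} (hn : n = 0) : Hom k X Y n :=
  hX ▸ hn.symm ▸ DGCategory.id X

theorem idOfEq_comp {X Y Z : A} (hX : X = Y) {p : ℤ} (hp : p = 0) (q : ℤ) (h : p + q = q)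
    (f : Hom k X Z q) : comp p q q h (idOfEq hX hp) (hX ▸ f) = f := by
  subst hX hp
  exact DGCategory.id_comp q f

theorem comp_idOfEq {X Y : A} {q : ℤ} (hq : q = 0) (p : ℤ) (h : p + q = p)
    (f : Hom k X Y p) : comp p q p h f (idOfEq rfl hq) = f := by
  subst hq
  exact DGCategory.comp_id p f

theorem d_idOfEq {X Y : A} (hX : X = Y) {n m : ℤ} (hn : n = 0) (h : n + 1 = m) :
    d n m h (idOfEq hX hn : Hom k X Y n) = 0 := by
  subst hX hn h
  exact d_id X

variable (k)

/-- An object of a DG category is contractible if its identity morphism is a coboundary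
(equivalently, if the object is zero in the homotopy category). -/
def IsContractible (X : A) : Prop :=
  ∃ h : Hom k X X (-1), d (-1) 0 (by simp) h = DGCategory.id X

end

/-- A DG functor between DG categories over `k`. -/
structure DGFunctor (k : Type w) [CommRing k] (A : Type u) (C : Type u')
    [DGCategory.{w, v} k A] [DGCategory.{w, v} k C] where
  obj : A → C
  map : ∀ {X Y : A} (n : ℤ), Hom k X Y n →ₗ[k] Hom k (obj X) (obj Y) n
  map_d : ∀ {X Y : A} (n m : ℤ) (h : n + 1 = m) (f : Hom k X Y n),
    map m (d n m h f) = d n m h (map n f)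
  map_id : ∀ X : A, map 0 (DGCategory.id X : Hom k X X 0) = DGCategory.id (obj X)
  map_comp : ∀ {X Y Z : A} (p q n : ℤ) (h : p + q = n) (f : Hom k X Y p) (g : Hom k Y Z q),
    map n (comp p q n h f g) = comp p q n h (map p f) (map q g)

/-- The dual DG category: `Hom(op X, op Y) = Hom(Y, X)` with the same differential, and the
composition `g ∘ f` in the dual is `(-1) ^ (deg f * deg g) • f ∘ g`. -/
instance opDGCategory (k : Type w) [CommRing k] (A : Type u) [DGCategory.{w, v} k A] :
    DGCategory.{w, v} k Aᵒᵖ where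
  Hom X Y n := Hom k Y.unop X.unop n
  d n m h := d n m h
  id X := DGCategory.id X.unop
  comp p q n h := sgn (p * q) • (comp q p n (by omega)).flip
  d_d l m n h h' f := DGCategory.d_d l m n h h' f
  id_comp n f := by
    simp only [zero_mul, sgn_zero, one_smul]
    exact DGCategory.comp_id n f
  comp_id n f := by
    simp only [mul_zero, sgn_zero, one_smul]
    exact DGCategory.id_comp n f
  assoc p q r a b n h₁ h₂ h₃ h₄ f g e := by
    simp only [LinearMap.smul_apply, LinearMap.flip_apply, map_zsmul, smul_smul]
    rw [DGCategory.assoc r q p b a n (by omega) (by omega) (by omega) (by omega)]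
    subst h₁ h₃
    rw [add_mul, mul_add, sgn_add, sgn_add]
    congr 1; ring
  leibniz p q n p' q' n' h hp hq hn h₁ h₂ f g := by
    simp only [LinearMap.smul_apply, LinearMap.flip_apply, map_zsmul]
    rw [DGCategory.leibniz q p n q' p' n' (by omega) hq hp hn (by omega) (by omega), smul_add,
      smul_smul, smul_smul, add_comm]
    subst hp hq
    rw [mul_add, add_mul, sgn_add, sgn_add, mul_one, one_mul, ← mul_assoc, mul_comm (sgn q),
      mul_assoc, sgn_mul_self, mul_one]

/-- The dual of a DG functor. -/
def DGFunctor.op {k : Type w} [CommRing k] {A : Type u} {C : Type u'}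
    [DGCategory.{w, v} k A] [DGCategory.{w, v} k C] (F : DGFunctor k A C) :
    DGFunctor k Aᵒᵖ Cᵒᵖ where
  obj X := Opposite.op (F.obj X.unop)
  map n := F.map n
  map_d n m h f := F.map_d n m h f
  map_id X := F.map_id X.unop
  map_comp {X Y Z} p q n h f g := by
    have h' := F.map_comp (X := Z.unop) (Y := Y.unop) (Z := X.unop) q p n (by omega) g f
    exact (map_zsmul (F.map n) (sgn (p * q)) _).trans (congrArg (sgn (p * q) • ·) h')

/-- The full DG subcategory with set of objects `B`. -/
instance subDGCategory (k : Type w) [CommRing k] (A : Type u) [DGCategory.{w, v} k A] (B : Set A) :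
    DGCategory.{w, v} k B where
  Hom X Y n := Hom k X.1 Y.1 n
  d n m h := d n m h
  id X := DGCategory.id X.1
  comp p q n h := comp p q n h
  d_d := DGCategory.d_d
  id_comp := DGCategory.id_comp
  comp_id := DGCategory.comp_id
  assoc := DGCategory.assoc
  leibniz := DGCategory.leibniz

/-- The inclusion of a full DG subcategory. -/
def incl (k : Type w) [CommRing k] {A : Type u} [DGCategory.{w, v} k A] (B : Set A) :
    DGFunctor k B A where
  obj X := X.1
  map _ := LinearMap.id
  map_d _ _ _ _ := rfl
  map_id _ := rfl
  map_comp _ _ _ _ _ _ := rfl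

/-! ### The homotopy category -/

section Ho

variable (k : Type w) [CommRing k] {A : Type u} [DGCategory.{w, v} k A]

/-- Closed morphisms of degree zero. -/
def closed (X Y : A) : Submodule k (Hom k X Y 0) := LinearMap.ker (d 0 1 (zero_add 1))

/-- Coboundaries among the closed morphisms of degree zero. -/
def exact (X Y : A) : Submodule k (closed k X Y) :=
  (LinearMap.range (d (k := k) (X := X) (Y := Y) (-1) 0 (by simp))).comap (closed k X Y).subtype

variable {k}

theorem comp_closed {X Y Z : A} {f : Hom k X Y 0} {g : Hom k Y Z 0} (hf : f ∈ closed k X Y)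
    (hg : g ∈ closed k Y Z) : comp 0 0 0 (zero_add 0) f g ∈ closed k X Z := by
  have hf' : d 0 1 (zero_add 1) f = 0 := hf
  have hg' : d 0 1 (zero_add 1) g = 0 := hg
  change d 0 1 (zero_add 1) _ = 0
  rw [DGCategory.leibniz 0 0 0 1 1 1 (zero_add 0) (zero_add 1) (zero_add 1)
    (zero_add 1) (by simp) (by simp), hf', hg']
  simp

/-- Composition of closed morphisms of degree zero. -/
def compClosed {X Y Z : A} (f : closed k X Y) (g : closed k Y Z) : closed k X Z :=
  ⟨comp 0 0 0 (zero_add 0) f.1 g.1, comp_closed f.2 g.2⟩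

theorem comp_exact {X Y Z : A} (f f' : closed k X Y) (hf : f - f' ∈ exact k X Y)
    (g g' : closed k Y Z) (hg : g - g' ∈ exact k Y Z) :
    compClosed f g - compClosed f' g' ∈ exact k X Z := by
  obtain ⟨a, ha⟩ := hf
  obtain ⟨b, hb⟩ := hg
  have ha' : d (-1) 0 (by simp) a = f.1 - f'.1 := ha
  have hb' : d (-1) 0 (by simp) b = g.1 - g'.1 := hb
  have hg0 : d 0 1 (zero_add 1) g.1 = 0 := g.2
  have hf0 : d 0 1 (zero_add 1) f'.1 = 0 := f'.2
  refine ⟨comp (-1) 0 (-1) (by simp) a g.1 + comp 0 (-1) (-1) (by simp) f'.1 b, ?_⟩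
  change d (-1) 0 _ _ = comp 0 0 0 _ f.1 g.1 - comp 0 0 0 _ f'.1 g'.1
  rw [map_add,
    DGCategory.leibniz (-1) 0 (-1) 0 1 0 (by simp) (by simp) (by simp) (by simp) (by simp)
      (by simp),
    DGCategory.leibniz 0 (-1) (-1) 1 0 0 (by simp) (by simp) (by simp) (by simp) (by simp)
      (by simp), ha', hb', hg0, hf0]
  simp [sgn_zero]

/-- The homotopy category `Ho(A)` of a DG category: same objects, and the morphisms are the
cohomology groups `H⁰ Hom(X, Y)`. -/
structure Ho (k : Type w) (A : Type u) where
  of : A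

instance : Category.{v} (Ho k A) where
  Hom X Y := closed k X.of Y.of ⧸ exact k X.of Y.of
  id X := Submodule.Quotient.mk ⟨DGCategory.id X.of, d_id X.of⟩
  comp {X Y Z} f g := Quotient.map₂ compClosed (fun f f' hf g g' hg => by
    rw [← Quotient.eq_iff_equiv, Quotient.eq, Submodule.quotientRel_def] at hf hg ⊢
    exact comp_exact f f' hf g g' hg) f g
  id_comp f := by
    induction f using Submodule.Quotient.induction_on with | _ f
    exact congrArg Submodule.Quotient.mk (Subtype.ext (DGCategory.id_comp 0 f.1))
  comp_id f := by
    induction f using Submodule.Quotient.induction_on with | _ f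
    exact congrArg Submodule.Quotient.mk (Subtype.ext (DGCategory.comp_id 0 f.1))
  assoc f g h := by
    induction f using Submodule.Quotient.induction_on with | _ f
    induction g using Submodule.Quotient.induction_on with | _ g
    induction h using Submodule.Quotient.induction_on with | _ h
    exact congrArg Submodule.Quotient.mk
      (Subtype.ext (DGCategory.assoc 0 0 0 0 0 0 _ _ _ _ f.1 g.1 h.1))

/-- The morphism of `Ho(A)` represented by a closed morphism of degree zero. -/
def Ho.homMk {X Y : A} (f : closed k X Y) : (⟨X⟩ : Ho k A) ⟶ ⟨Y⟩ := Submodule.Quotient.mk f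

end Ho

section HoFunctor

variable {k : Type w} [CommRing k] {A : Type u} {C : Type u'}
  [DGCategory.{w, v} k A] [DGCategory.{w, v} k C]

/-- The action of a DG functor on closed morphisms of degree zero. -/
def DGFunctor.mapClosed (F : DGFunctor k A C) (X Y : A) :
    closed k X Y →ₗ[k] closed k (F.obj X) (F.obj Y) :=
  (F.map 0).restrict fun f hf => by
    have hf' : d 0 1 (zero_add 1) f = 0 := hf
    change d 0 1 (zero_add 1) (F.map 0 f) = 0
    rw [← F.map_d, hf', map_zero]

theorem DGFunctor.exact_le (F : DGFunctor k A C) (X Y : A) :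
    exact k X Y ≤ (exact k (F.obj X) (F.obj Y)).comap (F.mapClosed X Y) := by
  rintro f ⟨a, ha⟩
  refine ⟨F.map (-1) a, ?_⟩
  rw [← F.map_d, ha]
  rfl

/-- The functor `Ho(A) ⥤ Ho(C)` induced by a DG functor. -/
def DGFunctor.ho (F : DGFunctor k A C) : Ho k A ⥤ Ho k C where
  obj X := ⟨F.obj X.of⟩
  map {X Y} f := Submodule.mapQ _ _ (F.mapClosed X.of Y.of) (F.exact_le X.of Y.of) f
  map_id X := congrArg Submodule.Quotient.mk (Subtype.ext (F.map_id X.of))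
  map_comp {X Y Z} f g := by
    induction f using Submodule.Quotient.induction_on with | _ f
    induction g using Submodule.Quotient.induction_on with | _ g
    exact congrArg Submodule.Quotient.mk (Subtype.ext (F.map_comp 0 0 0 _ f.1 g.1))

end HoFunctor

/-! ### The pretriangulated hull and the triangulated category attached to a DG category -/

/-- One-sided twisted complexes `(⨁ C_i[r_i], q)` over `A`: objects of the DG category `A^pretr`.
The entry `q i j : Hom(C_j, C_i)[r_i - r_j]` has degree `1`, `q i j = 0` for `i ≥ j`, and
`dq + q² = 0`.  A morphism of degree `l` from `X[r]` to `Y[s]` is an element of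
`Hom(X, Y)` of degree `l + s - r`; in this identification composition carries no sign, and the
differential is `(-1)^s d`. -/
structure PreTr (k : Type w) [CommRing k] (A : Type u) [DGCategory.{w, v} k A] where
  n : ℕ
  obj : Fin n → A
  r : Fin n → ℤ
  q : ∀ i j : Fin n, Hom k (obj j) (obj i) (1 + r i - r j)
  upper : ∀ i j : Fin n, j ≤ i → q i j = 0
  maurerCartan : ∀ i j : Fin n,
    sgn (r i) • d (1 + r i - r j) (2 + r i - r j) (by omega) (q i j) +
      ∑ a, comp (1 + r a - r j) (1 + r i - r a) (2 + r i - r j) (by omega) (q a j) (q i a) = 0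

section PreTr

variable {k : Type w} [CommRing k] {A : Type u} [DGCategory.{w, v} k A]

namespace PreTr

/-- Matrices `f i j : Hom(C_j, C'_i)[r'_i - r_j]` of degree `l`. -/
abbrev Mat (X Y : PreTr k A) (l : ℤ) : Type v :=
  ∀ (i : Fin Y.n) (j : Fin X.n), Hom k (X.obj j) (Y.obj i) (l + Y.r i - X.r j)

/-- Matrix multiplication. -/
def matComp {X Y Z : PreTr k A} (l m n : ℤ) (h : l + m = n) :
    Mat X Y l →ₗ[k] Mat Y Z m →ₗ[k] Mat X Z n :=
  LinearMap.mk₂ k (fun f g i j => ∑ a, comp (l + Y.r a - X.r j) (m + Z.r i - Y.r a)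
      (n + Z.r i - X.r j) (by omega) (f a j) (g i a))
    (fun f f' g => by ext i j; simp [Finset.sum_add_distrib])
    (fun c f g => by ext i j; simp [Finset.smul_sum])
    (fun f g g' => by ext i j; simp [Finset.sum_add_distrib])
    (fun c f g => by ext i j; simp [Finset.smul_sum])

theorem matComp_apply {X Y Z : PreTr k A} (l m n : ℤ) (h : l + m = n) (f : Mat X Y l)
    (g : Mat Y Z m) (i : Fin Z.n) (j : Fin X.n) :
    matComp l m n h f g i j = ∑ a, comp (l + Y.r a - X.r j) (m + Z.r i - Y.r a)
      (n + Z.r i - X.r j) (by omega) (f a j) (g i a) := rfl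

/-- The naive differential, entry by entry. -/
def naive {X Y : PreTr k A} (l m : ℤ) (h : l + 1 = m) : Mat X Y l →ₗ[k] Mat X Y m where
  toFun f i j := sgn (Y.r i) • d (l + Y.r i - X.r j) (m + Y.r i - X.r j) (by omega) (f i j)
  map_add' f g := by ext i j; simp
  map_smul' c f := by
    ext i j
    simp only [Pi.smul_apply, map_smul, RingHom.id_apply]
    rw [smul_comm]

theorem naive_apply {X Y : PreTr k A} (l m : ℤ) (h : l + 1 = m) (f : Mat X Y l)
    (i : Fin Y.n) (j : Fin X.n) : naive l m h f i j =
    sgn (Y.r i) • d (l + Y.r i - X.r j) (m + Y.r i - X.r j) (by omega) (f i j) := rfl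

/-- The differential `df = d_naive f + q'f - (-1)^l fq` for `f` of degree `l`. -/
def diff {X Y : PreTr k A} (l m : ℤ) (h : l + 1 = m) : Mat X Y l →ₗ[k] Mat X Y m :=
  naive l m h + (matComp l 1 m h).flip Y.q - sgn l • matComp 1 l m (by omega) X.q

theorem diff_apply {X Y : PreTr k A} (l m : ℤ) (h : l + 1 = m) (f : Mat X Y l) :
    diff l m h f = naive l m h f + matComp l 1 m h f Y.q
      - sgn l • matComp 1 l m (by omega) X.q f := rfl

/-- The identity matrix. -/
def one (X : PreTr k A) : Mat X X 0 := fun i j =>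
  if h : j = i then idOfEq (congrArg X.obj h) (by subst h; omega) else 0

theorem matComp_assoc {X Y Z T : PreTr k A} (p q r a b n : ℤ) (h₁ : p + q = a) (h₂ : a + r = n)
    (h₃ : q + r = b) (h₄ : p + b = n) (f : Mat X Y p) (g : Mat Y Z q) (e : Mat Z T r) :
    matComp a r n h₂ (matComp p q a h₁ f g) e = matComp p b n h₄ f (matComp q r b h₃ g e) := by
  ext i j
  simp only [matComp_apply, map_sum, LinearMap.sum_apply]
  rw [Finset.sum_comm]
  exact Finset.sum_congr rfl fun _ _ => Finset.sum_congr rfl fun _ _ =>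
    DGCategory.assoc _ _ _ _ _ _ _ _ _ _ _ _ _

theorem one_matComp {X Y : PreTr k A} (n : ℤ) (f : Mat X Y n) :
    matComp 0 n n (zero_add n) (one X) f = f := by
  ext i j
  rw [matComp_apply, Finset.sum_eq_single j]
  · rw [one, dif_pos rfl]
    exact idOfEq_comp rfl _ _ _ _
  · intro a _ ha
    rw [one, dif_neg (Ne.symm ha)]
    simp
  · simp

theorem matComp_one {X Y : PreTr k A} (n : ℤ) (f : Mat X Y n) :
    matComp n 0 n (add_zero n) f (one Y) = f := by
  ext i j
  rw [matComp_apply, Finset.sum_eq_single i]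
  · rw [one, dif_pos rfl]
    exact comp_idOfEq _ _ _ _
  · intro a _ ha
    rw [one, dif_neg ha]
    simp
  · simp

theorem naive_leibniz {X Y Z : PreTr k A} (p q n p' q' n' : ℤ) (h : p + q = n) (hp : p + 1 = p')
    (hq : q + 1 = q') (hn : n + 1 = n') (h₁ : p + q' = n') (h₂ : p' + q = n')
    (f : Mat X Y p) (g : Mat Y Z q) :
    naive n n' hn (matComp p q n h f g) =
      matComp p q' n' h₁ f (naive q q' hq g) + sgn q • matComp p' q n' h₂ (naive p p' hp f) g := by
  ext i j
  simp only [Pi.add_apply, Pi.smul_apply, naive_apply, matComp_apply, map_sum, Finset.smul_sum,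
    ← Finset.sum_add_distrib]
  refine Finset.sum_congr rfl fun a _ => ?_
  rw [DGCategory.leibniz (p + Y.r a - X.r j) (q + Z.r i - Y.r a) (n + Z.r i - X.r j)
    (p' + Y.r a - X.r j) (q' + Z.r i - Y.r a) (n' + Z.r i - X.r j) (by omega) (by omega)
    (by omega) (by omega) (by omega) (by omega)]
  simp only [map_zsmul, LinearMap.smul_apply, smul_add, smul_smul, sgn_sub, sgn_add]
  congr 2
  calc _ = sgn q * (sgn (Z.r i) * sgn (Z.r i)) * sgn (Y.r a) := by ring
    _ = _ := by rw [sgn_mul_self]; ring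

theorem naive_naive {X Y : PreTr k A} (l m n : ℤ) (h : l + 1 = m) (h' : m + 1 = n)
    (f : Mat X Y l) : naive m n h' (naive l m h f) = 0 := by
  ext i j
  simp [naive_apply, DGCategory.d_d]

theorem mc (X : PreTr k A) :
    naive 1 2 (by norm_num) X.q + matComp 1 1 2 (by norm_num) X.q X.q = 0 := by
  ext i j
  exact X.maurerCartan i j

theorem diff_leibniz {X Y Z : PreTr k A} (p q n p' q' n' : ℤ) (h : p + q = n) (hp : p + 1 = p')
    (hq : q + 1 = q') (hn : n + 1 = n') (h₁ : p + q' = n') (h₂ : p' + q = n')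
    (f : Mat X Y p) (g : Mat Y Z q) :
    diff n n' hn (matComp p q n h f g) =
      matComp p q' n' h₁ f (diff q q' hq g) + sgn q • matComp p' q n' h₂ (diff p p' hp f) g := by
  simp only [diff_apply, map_add, map_sub, LinearMap.add_apply, LinearMap.sub_apply, map_zsmul,
    LinearMap.smul_apply]
  rw [naive_leibniz p q n p' q' n' h hp hq hn h₁ h₂,
    matComp_assoc p q 1 n q' n' h hn hq h₁ f g Z.q,
    matComp_assoc p 1 q p' q' n' hp h₂ (by omega) h₁ f Y.q g,
    matComp_assoc 1 p q p' n n' (by omega) h₂ h (by omega) X.q f g]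
  subst h
  rw [sgn_add]
  module

theorem diff_diff {X Y : PreTr k A} (l m n : ℤ) (h : l + 1 = m) (h' : m + 1 = n)
    (f : Mat X Y l) : diff m n h' (diff l m h f) = 0 := by
  have hX := congrArg (fun e => matComp 2 l n (by omega) e f) (mc X)
  have hY := congrArg (fun e => matComp l 2 n (by omega) f e) (mc Y)
  simp only [map_add, map_zero, LinearMap.add_apply, LinearMap.zero_apply] at hX hY
  simp only [diff_apply, map_add, map_sub, map_zsmul]
  rw [naive_naive, naive_leibniz l 1 m m 2 n h h (by norm_num) h' (by omega) h',
    naive_leibniz 1 l m 2 m n (by omega) (by norm_num) h h' (by omega) (by omega),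
    matComp_assoc l 1 1 m 2 n h h' (by norm_num) (by omega),
    matComp_assoc 1 l 1 m m n (by omega) h' h (by omega),
    ← matComp_assoc 1 1 l 2 m n (by norm_num) (by omega) (by omega) (by omega) X.q X.q f]
  rw [← eq_neg_iff_add_eq_zero] at hX hY
  rw [hX, hY]
  subst h
  rw [sgn_add, sgn_one]
  simp only [smul_add, smul_sub, smul_smul, smul_neg]
  have h2 := sgn_mul_self l
  simp only [mul_neg, mul_one, h2]
  module

end PreTr

/-- The DG category `A^pretr` of one-sided twisted complexes. -/
instance preTrDGCategory : DGCategory.{w, v} k (PreTr k A) where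
  Hom X Y l := PreTr.Mat X Y l
  d l m h := PreTr.diff l m h
  id X := PreTr.one X
  comp l m n h := PreTr.matComp l m n h
  d_d l m n h h' f := PreTr.diff_diff l m n h h' f
  id_comp n f := PreTr.one_matComp n f
  comp_id n f := PreTr.matComp_one n f
  assoc p q r a b n h₁ h₂ h₃ h₄ f g e := PreTr.matComp_assoc p q r a b n h₁ h₂ h₃ h₄ f g e
  leibniz p q n p' q' n' h hp hq hn h₁ h₂ f g :=
    PreTr.diff_leibniz p q n p' q' n' h hp hq hn h₁ h₂ f g

/-- Transport of a morphism along an equality of degrees. -/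
def degCast {X Y : A} {n m : ℤ} (h : n = m) : Hom k X Y n →ₗ[k] Hom k X Y m :=
  h ▸ LinearMap.id

theorem degCast_rfl {X Y : A} {n : ℤ} (f : Hom k X Y n) : degCast rfl f = f := rfl

theorem d_degCast {X Y : A} {n m n' m' : ℤ} (hn : n' = n) (h : n + 1 = m) (h' : n' + 1 = m')
    (f : Hom k X Y n') : d n m h (degCast hn f) = degCast (by omega) (d n' m' h' f) := by
  subst hn h h'
  rfl

theorem comp_degCast {X Y Z : A} {p q n p' q' n' : ℤ} (hp : p' = p) (hq : q' = q) (h : p + q = n)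
    (h' : p' + q' = n') (f : Hom k X Y p') (g : Hom k Y Z q') :
    comp p q n h (degCast hp f) (degCast hq g) = degCast (by omega) (comp p' q' n' h' f g) := by
  subst hp hq h h'
  rfl

theorem d_degCast_neg {X Y : A} {n m n' m' : ℤ} (hn : n' = n) (h : n + 1 = m) (h' : n' + 1 = m')
    (f : Hom k X Y n') : d n m h (degCast hn (-f)) = -degCast (by omega) (d n' m' h' f) := by
  rw [d_degCast hn h h', map_neg, map_neg]

theorem comp_degCast_neg_left {X Y Z : A} {p q n p' q' n' : ℤ} (hp : p' = p) (hq : q' = q)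
    (h : p + q = n) (h' : p' + q' = n') (f : Hom k X Y p') (g : Hom k Y Z q') :
    comp p q n h (degCast hp (-f)) (degCast hq g) =
      -degCast (by omega) (comp p' q' n' h' f g) := by
  rw [comp_degCast hp hq h h', map_neg, LinearMap.neg_apply, map_neg]

theorem comp_degCast_neg_neg {X Y Z : A} {p q n p' q' n' : ℤ} (hp : p' = p) (hq : q' = q)
    (h : p + q = n) (h' : p' + q' = n') (f : Hom k X Y p') (g : Hom k Y Z q') :
    comp p q n h (degCast hp (-f)) (degCast hq (-g)) =
      degCast (by omega) (comp p' q' n' h' f g) := by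
  rw [comp_degCast hp hq h h', map_neg, map_neg, map_neg, LinearMap.neg_apply, map_neg, neg_neg]

theorem comp_degCast_left {X Y Z : A} {p q n p' n' : ℤ} (hp : p' = p) (h : p + q = n)
    (h' : p' + q = n') (f : Hom k X Y p') (g : Hom k Y Z q) :
    comp p q n h (degCast hp f) g = degCast (by omega) (comp p' q n' h' f g) := by
  subst hp h h'
  rfl

namespace PreTr

/-- The components of the cone of `X → Y`, indexed by the disjoint union of the index sets. -/
def coneObj (X Y : PreTr k A) : Fin Y.n ⊕ Fin X.n → A
  | .inl i => Y.obj i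
  | .inr i => X.obj i

/-- The shifts of the components of `Y ⊕ X[1]`. -/
def coneShift (X Y : PreTr k A) : Fin Y.n ⊕ Fin X.n → ℤ
  | .inl i => Y.r i
  | .inr i => X.r i + 1

/-- The twisting matrix of the cone of `f : X → Y`: it consists of the twisting matrices `q_Y` of
`Y` and `-q_X` of `X[1]`, and of `f`. -/
def coneMat {X Y : PreTr k A} (f : closed k X Y) : ∀ s t : Fin Y.n ⊕ Fin X.n,
    Hom k (coneObj X Y t) (coneObj X Y s) (1 + coneShift X Y s - coneShift X Y t)
  | .inl i, .inl j => Y.q i j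
  | .inl i, .inr j => degCast (by simp only [coneShift]; omega) (f.1 i j)
  | .inr _, .inl _ => 0
  | .inr i, .inr j => degCast (by simp only [coneShift]; omega) (-X.q i j)

theorem coneMat_mc {X Y : PreTr k A} (f : closed k X Y) (s t : Fin Y.n ⊕ Fin X.n) :
    sgn (coneShift X Y s) • d (1 + coneShift X Y s - coneShift X Y t)
      (2 + coneShift X Y s - coneShift X Y t) (by omega) (coneMat f s t) +
      ∑ a, comp (1 + coneShift X Y a - coneShift X Y t) (1 + coneShift X Y s - coneShift X Y a)
        (2 + coneShift X Y s - coneShift X Y t) (by omega) (coneMat f a t) (coneMat f s a) = 0 := by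
  rw [Fintype.sum_sum_type]
  rcases s with i | i <;> rcases t with j | j
  · simp only [coneMat, map_zero, LinearMap.zero_apply, Finset.sum_const_zero, add_zero]
    exact Y.maurerCartan i j
  · have hf : diff 0 1 (zero_add 1) f.1 i j = 0 :=
      congrFun (congrFun (f.2 : diff 0 1 (zero_add 1) f.1 = 0) i) j
    have hf' := congrArg (degCast (k := k) (X := X.obj j) (Y := Y.obj i)
      (n := 1 + Y.r i - X.r j) (m := 2 + Y.r i - (X.r j + 1)) (by omega)) hf
    rw [diff_apply, sgn_zero, one_smul] at hf'
    simp only [Pi.add_apply, Pi.sub_apply, naive_apply, matComp_apply, map_add, map_sub, map_zero,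
      map_sum, map_zsmul] at hf'
    refine Eq.trans ?_ ((add_assoc _ _ _).symm.trans ((sub_eq_add_neg _ _).symm.trans hf'))
    refine congrArg₂ (· + ·) ?_ (congrArg₂ (· + ·) ?_ ?_)
    · exact congrArg (sgn (Y.r i) • ·) (d_degCast _ _ (by omega) _)
    · exact Finset.sum_congr rfl fun a _ => comp_degCast_left (n' := 1 + Y.r i - X.r j) _ _
        (by simp only [coneShift]; omega) _ _
    · exact (Finset.sum_congr rfl fun a _ => comp_degCast_neg_left (n' := 1 + Y.r i - X.r j) _ _ _
        (by omega) _ _).trans (Finset.sum_neg_distrib _)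
  · simp [coneMat]
  · have hf' := congrArg (degCast (k := k) (X := X.obj j) (Y := X.obj i)
      (n := 2 + X.r i - X.r j) (m := 2 + (X.r i + 1) - (X.r j + 1)) (by omega))
      (X.maurerCartan i j)
    simp only [map_add, map_zero, map_sum, map_zsmul] at hf'
    simp only [coneMat, map_zero, Finset.sum_const_zero, zero_add]
    refine Eq.trans ?_ hf'
    refine congrArg₂ (· + ·) ?_ ?_
    · refine (congrArg (sgn (X.r i + 1) • ·) (d_degCast_neg (m' := 2 + X.r i - X.r j) _ _
        (by omega) _)).trans ?_
      rw [sgn_add, sgn_one, mul_neg_one, neg_smul]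
      exact (congrArg _ (smul_neg _ _)).trans (neg_neg _)
    · exact Finset.sum_congr rfl fun a _ =>
        comp_degCast_neg_neg (n' := 2 + X.r i - X.r j) _ _ _ (by omega) _ _

theorem coneMat_upper {X Y : PreTr k A} (f : closed k X Y) (s t : Fin Y.n ⊕ Fin X.n)
    (h : finSumFinEquiv t ≤ finSumFinEquiv s) : coneMat f s t = 0 := by
  rcases s with i | i <;> rcases t with j | j
  · have h' : (j : ℕ) ≤ (i : ℕ) := by
      have := Fin.le_def.mp h
      rwa [finSumFinEquiv_apply_left, finSumFinEquiv_apply_left] at this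
    exact Y.upper i j h'
  · exfalso
    have h' : Y.n + (j : ℕ) ≤ (i : ℕ) := by simpa [Fin.le_def] using h
    omega
  · rfl
  · have : X.q i j = 0 := X.upper i j (by simpa using h)
    simp only [coneMat, this, neg_zero]
    exact map_zero _

/-- The cone `Y ⊕ X[1]` of a closed morphism `f : X → Y` of degree zero in `A^pretr`. -/
def cone {X Y : PreTr k A} (f : closed k X Y) : PreTr k A where
  n := Y.n + X.n
  obj i := coneObj X Y (finSumFinEquiv.symm i)
  r i := coneShift X Y (finSumFinEquiv.symm i)
  q i j := coneMat f (finSumFinEquiv.symm i) (finSumFinEquiv.symm j)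
  upper i j h := coneMat_upper f _ _ (by simpa using h)
  maurerCartan i j := by
    refine Eq.trans ?_ (coneMat_mc f (finSumFinEquiv.symm i) (finSumFinEquiv.symm j))
    refine congrArg₂ (· + ·) rfl ?_
    exact Equiv.sum_comp finSumFinEquiv.symm (fun a =>
      comp (1 + coneShift X Y a - coneShift X Y (finSumFinEquiv.symm j))
        (1 + coneShift X Y (finSumFinEquiv.symm i) - coneShift X Y a)
        (2 + coneShift X Y (finSumFinEquiv.symm i) - coneShift X Y (finSumFinEquiv.symm j)) (by omega)
        (coneMat f a (finSumFinEquiv.symm j)) (coneMat f (finSumFinEquiv.symm i) a))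

end PreTr

end PreTr

section Quotient

variable {k : Type w} [CommRing k] {A : Type u} {C : Type u'}
  [DGCategory.{w, v} k A] [DGCategory.{w, v} k C]

/-- The DG functor `A^pretr → C^pretr` induced by a DG functor `A → C`. -/
def DGFunctor.pretr (F : DGFunctor k A C) : DGFunctor k (PreTr k A) (PreTr k C) where
  obj X :=
    { n := X.n
      obj := fun i => F.obj (X.obj i)
      r := X.r
      q := fun i j => F.map _ (X.q i j)
      upper := fun i j h => by rw [X.upper i j h, map_zero]
      maurerCartan := fun i j => by
        rw [← map_zero (F.map (2 + X.r i - X.r j)), ← X.maurerCartan i j, map_add, map_sum,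
          map_zsmul, F.map_d]
        simp only [F.map_comp] }
  map {X Y} n :=
    { toFun := fun f i j => F.map _ (f i j)
      map_add' := fun f g => by funext i j; exact map_add _ _ _
      map_smul' := fun c f => by funext i j; exact map_smul _ _ _ }
  map_d {X Y} n m h f := by
    funext i j
    change F.map _ (PreTr.diff n m h f i j) = PreTr.diff n m h _ i j
    simp only [PreTr.diff_apply, Pi.add_apply, Pi.sub_apply, Pi.smul_apply, PreTr.naive_apply,
      PreTr.matComp_apply, map_add, map_sub, map_sum, map_zsmul, F.map_d, F.map_comp]
    rfl
  map_id X := by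
    funext i j
    change F.map _ (PreTr.one X i j) = PreTr.one _ i j
    unfold PreTr.one
    split_ifs with h
    · subst h
      have : ∀ (n : ℤ) (hn : n = 0), F.map n (idOfEq (k := k) (X := X.obj j) rfl hn) =
          idOfEq rfl hn := by
        rintro n rfl
        exact F.map_id _
      exact this _ _
    · exact map_zero _
  map_comp {X Y Z} p q n h f g := by
    funext i j
    change F.map _ (PreTr.matComp p q n h f g i j) = PreTr.matComp p q n h _ _ i j
    simp only [PreTr.matComp_apply, map_sum, F.map_comp]
    rfl

/-- The functor `A^tr ⥤ C^tr` induced by a DG functor, where `A^tr = Ho(A^pretr)` is the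
triangulated category attached to `A`. -/
abbrev DGFunctor.tr (F : DGFunctor k A C) : Ho k (PreTr k A) ⥤ Ho k (PreTr k C) := F.pretr.ho

/-- The class of morphisms of `A^tr` whose cone is isomorphic to an object of `B^tr`, where `B` is
a full DG subcategory of `A`. The Verdier quotient `A^tr / B^tr` is the localization of `A^tr` at
this class. -/
def verdierClass (B : Set A) : MorphismProperty (Ho k (PreTr k A)) := fun X Y f =>
  ∃ g : closed k X.of Y.of, f = Ho.homMk g ∧ (incl k B).tr.essImage ⟨PreTr.cone g⟩

/-- `ξ : A → C` is a DG quotient of `A` modulo the full DG subcategory `B`: `Ho(A) ⥤ Ho(C)` is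
essentially surjective, and `A^tr ⥤ C^tr` induces an equivalence `A^tr / B^tr ≌ C^tr`, that is,
it inverts the morphisms with cone in `B^tr` and the functor which it induces on the localization
at these morphisms is an equivalence. -/
structure IsDGQuotient (ξ : DGFunctor k A C) (B : Set A) : Prop where
  essSurj : ξ.ho.EssSurj
  isLocalization : ξ.tr.IsLocalization (verdierClass B)

end Quotient

/-! ### DG modules and derived categories -/

universe t

/-- A left DG module over a DG category `A`, i.e. a DG functor from `A` to complexes of
`k`-modules. A right DG `A`-module is a left DG module over `Aᵒᵖ`. -/
structure DGMod (k : Type w) [CommRing k] (A : Type u) [DGCategory.{w, v} k A] where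
  obj : A → ℤ → Type t
  [addCommGroup : ∀ X n, AddCommGroup (obj X n)]
  [module : ∀ X n, Module k (obj X n)]
  d : ∀ {X : A} (n m : ℤ), n + 1 = m → (obj X n →ₗ[k] obj X m)
  act : ∀ {X Y : A} (p q n : ℤ), p + q = n → (Hom k X Y p →ₗ[k] obj X q →ₗ[k] obj Y n)
  d_d : ∀ {X : A} (l m n : ℤ) (h : l + 1 = m) (h' : m + 1 = n) (x : obj X l),
    d m n h' (d l m h x) = 0
  id_act : ∀ {X : A} (n : ℤ) (x : obj X n), act 0 n n (zero_add n) (DGCategory.id X) x = x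
  comp_act : ∀ {X Y Z : A} (p q r a b n : ℤ) (h₁ : p + q = a) (h₂ : a + r = n) (h₃ : p + r = b)
    (h₄ : q + b = n) (f : Hom k X Y p) (g : Hom k Y Z q) (x : obj X r),
    act a r n h₂ (comp p q a h₁ f g) x = act q b n h₄ g (act p r b h₃ f x)
  leibniz : ∀ {X Y : A} (p q n p' q' n' : ℤ) (h : p + q = n) (hp : p + 1 = p') (hq : q + 1 = q')
    (hn : n + 1 = n') (h₁ : p' + q = n') (h₂ : p + q' = n') (f : Hom k X Y p) (x : obj X q),
    d n n' hn (act p q n h f x) =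
      act p' q n' h₁ (DG.d p p' hp f) x + sgn p • act p q' n' h₂ f (d q q' hq x)

attribute [instance] DGMod.addCommGroup DGMod.module

section DGMod

variable {k : Type w} [CommRing k] {A : Type u} [DGCategory.{w, v} k A]

namespace DGMod

/-- A DG module is acyclic if all complexes `M(X)` are. -/
def Acyclic (M : DGMod.{w, v, u, t} k A) : Prop :=
  ∀ (X : A) (l m n : ℤ) (h : l + 1 = m) (h' : m + 1 = n) (x : M.obj X m),
    M.d m n h' x = 0 → ∃ y : M.obj X l, M.d l m h y = x

/-- Families of `k`-linear maps `M(X)^p → N(X)^(p+n)`. -/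
abbrev Fam (M N : DGMod.{w, v, u, t} k A) (n : ℤ) : Type (max u t) :=
  ∀ (X : A) (p : ℤ), M.obj X p →ₗ[k] N.obj X (p + n)

/-- Transport along an equality of degrees. -/
def objCast (M : DGMod.{w, v, u, t} k A) (X : A) {p q : ℤ} (h : p = q) :
    M.obj X p →ₗ[k] M.obj X q :=
  h ▸ LinearMap.id

theorem objCast_objCast (M : DGMod.{w, v, u, t} k A) (X : A) {p q : ℤ} (h : p = q) (h' : q = p)
    (x : M.obj X p) : M.objCast X h' (M.objCast X h x) = x := by
  subst h
  rfl

/-- The component `M(X)^p → N(X)^q` of a family of degree `n`, where `p + n = q`. -/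
def Fam.app {M N : DGMod.{w, v, u, t} k A} {n : ℤ} (φ : Fam M N n) (X : A) (p q : ℤ)
    (h : p + n = q) : M.obj X p →ₗ[k] N.obj X q :=
  N.objCast X h ∘ₗ φ X p

theorem Fam.ext_app {M N : DGMod.{w, v, u, t} k A} {n : ℤ} {φ ψ : Fam M N n}
    (H : ∀ (X : A) (p q : ℤ) (h : p + n = q) (x : M.obj X p),
      Fam.app φ X p q h x = Fam.app ψ X p q h x) : φ = ψ := by
  funext X p
  exact LinearMap.ext (H X p _ rfl)

theorem Fam.add_app {M N : DGMod.{w, v, u, t} k A} {n : ℤ} (φ ψ : Fam M N n) (X : A) (p q : ℤ)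
    (h : p + n = q) (x : M.obj X p) :
    Fam.app (φ + ψ) X p q h x = Fam.app φ X p q h x + Fam.app ψ X p q h x := by
  subst h
  rfl

theorem Fam.zero_app {M N : DGMod.{w, v, u, t} k A} {n : ℤ} (X : A) (p q : ℤ)
    (h : p + n = q) (x : M.obj X p) : Fam.app (0 : Fam M N n) X p q h x = 0 := by
  subst h
  rfl

theorem Fam.smul_app {M N : DGMod.{w, v, u, t} k A} {n : ℤ} (c : k) (φ : Fam M N n) (X : A)
    (p q : ℤ) (h : p + n = q) (x : M.obj X p) :
    Fam.app (c • φ) X p q h x = c • Fam.app φ X p q h x := by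
  subst h
  rfl

theorem Fam.zsmul_app {M N : DGMod.{w, v, u, t} k A} {n : ℤ} (c : ℤ) (φ : Fam M N n) (X : A)
    (p q : ℤ) (h : p + n = q) (x : M.obj X p) :
    Fam.app (c • φ) X p q h x = c • Fam.app φ X p q h x := by
  subst h
  rfl

/-- The degree `n` part of the complex `Hom(M, N)`: the families `φ` of `k`-linear maps of
degree `n` such that `φ (f x) = (-1) ^ (n * deg f) f (φ x)`. -/
def homs (M N : DGMod.{w, v, u, t} k A) (n : ℤ) : Submodule k (Fam M N n) where
  carrier := {φ | ∀ (X Y : A) (a p p' q q' : ℤ) (h : a + p = p') (hq : p + n = q)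
    (hq' : p' + n = q') (h' : a + q = q') (f : Hom k X Y a) (x : M.obj X p),
    Fam.app φ Y p' q' hq' (M.act a p p' h f x) =
      sgn (n * a) • N.act a q q' h' f (Fam.app φ X p q hq x)}
  add_mem' {φ ψ} hφ hψ := by
    intro X Y a p p' q q' h hq hq' h' f x
    simp only [Fam.add_app, map_add, smul_add]
    rw [hφ X Y a p p' q q' h hq hq' h', hψ X Y a p p' q q' h hq hq' h']
  zero_mem' := by
    intro X Y a p p' q q' h hq hq' h' f x
    simp only [Fam.zero_app, map_zero, smul_zero]
  smul_mem' c φ hφ := by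
    intro X Y a p p' q q' h hq hq' h' f x
    simp only [Fam.smul_app, map_smul]
    rw [hφ X Y a p p' q q' h hq hq' h', smul_comm]

variable {M N P Q : DGMod.{w, v, u, t} k A}

/-- Composition of families. -/
def famComp (p q n : ℤ) (h : p + q = n) (φ : Fam M N p) (ψ : Fam N P q) : Fam M P n :=
  fun X a => Fam.app ψ X (a + p) (a + n) (by omega) ∘ₗ φ X a

theorem famComp_apply (p q n : ℤ) (h : p + q = n) (φ : Fam M N p) (ψ : Fam N P q) (X : A)
    (a b c : ℤ) (hb : a + p = b) (hc : b + q = c) (hac : a + n = c) (x : M.obj X a) :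
    Fam.app (famComp p q n h φ ψ) X a c hac x = Fam.app ψ X b c hc (Fam.app φ X a b hb x) := by
  subst hb hac
  rfl

/-- The differential `dφ = d ∘ φ - (-1)^n φ ∘ d` for `φ` of degree `n`. -/
def famD (n m : ℤ) (h : n + 1 = m) (φ : Fam M N n) : Fam M N m :=
  fun X a => N.d (a + n) (a + m) (by omega) ∘ₗ φ X a -
    sgn n • (Fam.app φ X (a + 1) (a + m) (by omega) ∘ₗ M.d a (a + 1) rfl)

theorem famD_apply (n m : ℤ) (h : n + 1 = m) (φ : Fam M N n) (X : A)
    (a b c a' : ℤ) (hb : a + n = b) (hc : b + 1 = c) (ha' : a + 1 = a') (h' : a' + n = c)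
    (hac : a + m = c) (x : M.obj X a) :
    Fam.app (famD n m h φ) X a c hac x = N.d b c hc (Fam.app φ X a b hb x) -
      sgn n • Fam.app φ X a' c h' (M.d a a' ha' x) := by
  subst hb ha' hac
  rfl

/-- The identity family. -/
def famId (M : DGMod.{w, v, u, t} k A) : Fam M M 0 :=
  fun X p => M.objCast X (add_zero p).symm

theorem famId_apply (M : DGMod.{w, v, u, t} k A) (X : A) (p : ℤ) (h : p + 0 = p)
    (x : M.obj X p) : Fam.app (famId M) X p p h x = x :=
  objCast_objCast M X _ _ x

theorem famId_mem (M : DGMod.{w, v, u, t} k A) : famId M ∈ homs M M 0 := by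
  intro X Y a p p' q q' h hq hq' h' f x
  obtain rfl : p = q := by omega
  obtain rfl : p' = q' := by omega
  rw [famId_apply, famId_apply, zero_mul, sgn_zero, one_smul]

theorem famComp_mem (p q n : ℤ) (h : p + q = n) {φ : Fam M N p} {ψ : Fam N P q}
    (hφ : φ ∈ homs M N p) (hψ : ψ ∈ homs N P q) : famComp p q n h φ ψ ∈ homs M P n := by
  intro X Y a b b' c c' hb hc hc' h' f x
  rw [famComp_apply p q n h φ ψ Y b' (b' + p) c' rfl (by omega),
    famComp_apply p q n h φ ψ X b (b + p) c rfl (by omega),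
    hφ X Y a b b' (b + p) (b' + p) hb rfl rfl (by omega), map_zsmul,
    hψ X Y a (b + p) (b' + p) c c' (by omega) (by omega) (by omega) h', smul_smul]
  subst h
  rw [add_mul, sgn_add]

theorem famD_mem (n m : ℤ) (h : n + 1 = m) {φ : Fam M N n} (hφ : φ ∈ homs M N n) :
    famD n m h φ ∈ homs M N m := by
  intro X Y a b b' c c' hb hc hc' h' f x
  rw [famD_apply n m h φ Y b' (b' + n) c' (b' + 1) rfl (by omega) rfl (by omega),
    famD_apply n m h φ X b (b + n) c (b + 1) rfl (by omega) rfl (by omega),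
    hφ X Y a b b' (b + n) (b' + n) hb rfl rfl (by omega), map_zsmul,
    N.leibniz a (b + n) (b' + n) (a + 1) c c' (by omega) rfl (by omega) (by omega) (by omega)
      (by omega),
    M.leibniz a b b' (a + 1) (b + 1) (b' + 1) hb rfl rfl rfl (by omega) (by omega),
    map_add, map_zsmul,
    hφ X Y (a + 1) b (b' + 1) (b + n) c' (by omega) rfl (by omega) (by omega),
    hφ X Y a (b + 1) (b' + 1) c c' (by omega) (by omega) (by omega) (by omega), map_sub, map_zsmul]
  subst h
  have h2 := sgn_mul_self n
  rw [mul_add, add_mul, mul_one, one_mul, sgn_add, sgn_add]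
  simp only [smul_add, smul_sub, smul_smul]
  have h3 : sgn n * (sgn (n * a) * sgn n) = sgn (n * a) := by
    rw [mul_comm (sgn (n * a)), ← mul_assoc, h2, one_mul]
  rw [h3]
  module

end DGMod

/-- The DG category of (left) DG modules over `A`. -/
instance dgModDGCategory : DGCategory.{w, max u t} k (DGMod.{w, v, u, t} k A) where
  Hom M N n := DGMod.homs M N n
  d n m h :=
    { toFun := fun φ => ⟨DGMod.famD n m h φ.1, DGMod.famD_mem n m h φ.2⟩
      map_add' := fun φ ψ => Subtype.ext <| DGMod.Fam.ext_app fun X a b hb x => by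
        simp only [Submodule.coe_add, DGMod.Fam.add_app]
        rw [DGMod.famD_apply n m h _ X a (a + n) b (a + 1) rfl (by omega) rfl (by omega),
          DGMod.famD_apply n m h _ X a (a + n) b (a + 1) rfl (by omega) rfl (by omega),
          DGMod.famD_apply n m h _ X a (a + n) b (a + 1) rfl (by omega) rfl (by omega)]
        simp only [DGMod.Fam.add_app, map_add]
        module
      map_smul' := fun c φ => Subtype.ext <| DGMod.Fam.ext_app fun X a b hb x => by
        simp only [Submodule.coe_smul, DGMod.Fam.smul_app, RingHom.id_apply]
        rw [DGMod.famD_apply n m h _ X a (a + n) b (a + 1) rfl (by omega) rfl (by omega),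
          DGMod.famD_apply n m h _ X a (a + n) b (a + 1) rfl (by omega) rfl (by omega)]
        simp only [DGMod.Fam.smul_app, map_smul, smul_sub]
        rw [smul_comm c] }
  id M := ⟨DGMod.famId M, DGMod.famId_mem M⟩
  comp p q n h := LinearMap.mk₂ k
    (fun φ ψ => ⟨DGMod.famComp p q n h φ.1 ψ.1, DGMod.famComp_mem p q n h φ.2 ψ.2⟩)
    (fun _ _ _ => Subtype.ext <| DGMod.Fam.ext_app fun X a b hb x => by
      simp only [Submodule.coe_add, DGMod.Fam.add_app]
      rw [DGMod.famComp_apply p q n h _ _ X a (a + p) b rfl (by omega),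
        DGMod.famComp_apply p q n h _ _ X a (a + p) b rfl (by omega),
        DGMod.famComp_apply p q n h _ _ X a (a + p) b rfl (by omega), DGMod.Fam.add_app, map_add])
    (fun _ _ _ => Subtype.ext <| DGMod.Fam.ext_app fun X a b hb x => by
      simp only [Submodule.coe_smul, DGMod.Fam.smul_app]
      rw [DGMod.famComp_apply p q n h _ _ X a (a + p) b rfl (by omega),
        DGMod.famComp_apply p q n h _ _ X a (a + p) b rfl (by omega), DGMod.Fam.smul_app,
        map_smul])
    (fun _ _ _ => Subtype.ext <| DGMod.Fam.ext_app fun X a b hb x => by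
      simp only [Submodule.coe_add, DGMod.Fam.add_app]
      rw [DGMod.famComp_apply p q n h _ _ X a (a + p) b rfl (by omega),
        DGMod.famComp_apply p q n h _ _ X a (a + p) b rfl (by omega),
        DGMod.famComp_apply p q n h _ _ X a (a + p) b rfl (by omega), DGMod.Fam.add_app])
    (fun _ _ _ => Subtype.ext <| DGMod.Fam.ext_app fun X a b hb x => by
      simp only [Submodule.coe_smul, DGMod.Fam.smul_app]
      rw [DGMod.famComp_apply p q n h _ _ X a (a + p) b rfl (by omega),
        DGMod.famComp_apply p q n h _ _ X a (a + p) b rfl (by omega), DGMod.Fam.smul_app])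
  d_d {M N} l m n h h' φ := Subtype.ext <| DGMod.Fam.ext_app fun X a c hc x => by
    change DGMod.Fam.app (DGMod.famD m n h' (DGMod.famD l m h φ.1)) X a c hc x =
      DGMod.Fam.app 0 X a c hc x
    rw [DGMod.famD_apply m n h' _ X a (a + m) c (a + 1) rfl (by omega) rfl (by omega),
      DGMod.famD_apply l m h _ X a (a + l) (a + m) (a + 1) rfl (by omega) rfl (by omega),
      DGMod.famD_apply l m h _ X (a + 1) (a + m) c (a + 1 + 1) (by omega) (by omega) rfl
        (by omega), M.d_d, map_sub, N.d_d, map_zsmul, map_zero, DGMod.Fam.zero_app]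
    subst h
    rw [sgn_add, sgn_one]
    module
  id_comp {M N} n φ := Subtype.ext <| DGMod.Fam.ext_app fun X a c hc x => by
    change DGMod.Fam.app (DGMod.famComp 0 n n (zero_add n) (DGMod.famId M) φ.1) X a c hc x = _
    rw [DGMod.famComp_apply 0 n n _ _ _ X a a c (add_zero a) hc, DGMod.famId_apply]
  comp_id {M N} n φ := Subtype.ext <| DGMod.Fam.ext_app fun X a c hc x => by
    change DGMod.Fam.app (DGMod.famComp n 0 n (add_zero n) φ.1 (DGMod.famId N)) X a c hc x = _
    rw [DGMod.famComp_apply n 0 n _ _ _ X a c c hc (add_zero c), DGMod.famId_apply]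
  assoc {M N P Q} p q r a b n h₁ h₂ h₃ h₄ φ ψ χ := Subtype.ext <| DGMod.Fam.ext_app
      fun X i j hj x => by
    change DGMod.Fam.app (DGMod.famComp a r n h₂ (DGMod.famComp p q a h₁ φ.1 ψ.1) χ.1) X i j hj x =
      DGMod.Fam.app (DGMod.famComp p b n h₄ φ.1 (DGMod.famComp q r b h₃ ψ.1 χ.1)) X i j hj x
    rw [DGMod.famComp_apply a r n h₂ _ _ X i (i + a) j rfl (by omega),
      DGMod.famComp_apply p q a h₁ _ _ X i (i + p) (i + a) rfl (by omega),
      DGMod.famComp_apply p b n h₄ _ _ X i (i + p) j rfl (by omega),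
      DGMod.famComp_apply q r b h₃ _ _ X (i + p) (i + a) j (by omega) (by omega)]
  leibniz {M N P} p q n p' q' n' h hp hq hn h₁ h₂ φ ψ := Subtype.ext <| DGMod.Fam.ext_app
      fun X i j hj x => by
    change DGMod.Fam.app (DGMod.famD n n' hn (DGMod.famComp p q n h φ.1 ψ.1)) X i j hj x =
      DGMod.Fam.app (DGMod.famComp p q' n' h₁ φ.1 (DGMod.famD q q' hq ψ.1) +
        sgn q • DGMod.famComp p' q n' h₂ (DGMod.famD p p' hp φ.1) ψ.1) X i j hj x
    rw [DGMod.Fam.add_app, DGMod.Fam.zsmul_app,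
      DGMod.famD_apply n n' hn _ X i (i + n) j (i + 1) rfl (by omega) rfl (by omega),
      DGMod.famComp_apply p q n h _ _ X i (i + p) (i + n) rfl (by omega),
      DGMod.famComp_apply p q n h _ _ X (i + 1) (i + p') j (by omega) (by omega),
      DGMod.famComp_apply p q' n' h₁ _ _ X i (i + p) j rfl (by omega),
      DGMod.famD_apply q q' hq _ X (i + p) (i + n) j (i + p') (by omega) (by omega) (by omega)
        (by omega),
      DGMod.famComp_apply p' q n' h₂ _ _ X i (i + p') j rfl (by omega),
      DGMod.famD_apply p p' hp _ X i (i + p) (i + p') (i + 1) rfl (by omega) rfl (by omega),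
      map_sub, map_zsmul]
    subst h
    rw [sgn_add]
    module

namespace DGMod

/-- The family of maps underlying a closed morphism of degree zero. -/
def degZero {M N : DGMod.{w, v, u, t} k A} (φ : closed k M N) : Fam M N 0 :=
  (show homs M N 0 from φ.1).1

theorem degZero_mem {M N : DGMod.{w, v, u, t} k A} (φ : closed k M N) : degZero φ ∈ homs M N 0 :=
  (show homs M N 0 from φ.1).2

theorem famD_degZero {M N : DGMod.{w, v, u, t} k A} (φ : closed k M N) :
    famD 0 1 (zero_add 1) (degZero φ) = 0 :=
  congrArg (fun ψ : homs M N 1 => ψ.1) (φ.2 : DG.d 0 1 (zero_add 1) φ.1 = 0)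

/-- The differential `d (y, x) = (d y + φ x, -d x)` of the cone. -/
def coneD {M N : DGMod.{w, v, u, t} k A} (φ : closed k M N) (X : A) (n m : ℤ) (h : n + 1 = m) :
    (N.obj X n × M.obj X (n + 1)) →ₗ[k] (N.obj X m × M.obj X (m + 1)) where
  toFun x := (N.d n m h x.1 + Fam.app (degZero φ) X (n + 1) m (by omega) x.2,
    -M.d (n + 1) (m + 1) (by omega) x.2)
  map_add' x y := by
    refine Prod.ext ?_ ?_
    · simp only [Prod.fst_add, Prod.snd_add, map_add]
      abel
    · simp only [Prod.snd_add, map_add, neg_add]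
  map_smul' c x := by
    refine Prod.ext ?_ ?_
    · simp only [Prod.smul_fst, Prod.smul_snd, map_smul, RingHom.id_apply, smul_add]
    · simp only [Prod.smul_snd, map_smul, RingHom.id_apply, smul_neg]

/-- The cone `N ⊕ M[1]` of a closed morphism `φ : M → N` of degree zero of DG modules. The
differential is `d (y, x) = (d y + φ x, -d x)`, and `f` acts by `f (y, x) = (f y, (-1)^(deg f) f x)`. -/
def cone {M N : DGMod.{w, v, u, t} k A} (φ : closed k M N) : DGMod.{w, v, u, t} k A where
  obj X n := N.obj X n × M.obj X (n + 1)
  d {X} n m h := coneD φ X n m h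
  act {X Y} p q n h := LinearMap.mk₂ k
    (fun f x => (N.act p q n h f x.1, sgn p • M.act p (q + 1) (n + 1) (by omega) f x.2))
    (fun f f' x => by simp)
    (fun c f x => by simp [smul_comm c])
    (fun f x x' => by simp)
    (fun c f x => by simp [smul_comm c])
  d_d {X} l m n h h' x := by
    have hφ : Fam.app (famD 0 1 (zero_add 1) (degZero φ)) X (l + 1) n (by omega) x.2 = 0 := by
      rw [famD_degZero, Fam.zero_app]
    rw [famD_apply 0 1 _ _ X (l + 1) m n (m + 1) (by omega) (by omega) (by omega) (by omega),
      sgn_zero, one_smul] at hφ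
    refine Prod.ext ?_ ?_
    · change N.d m n h' (N.d l m h x.1 + Fam.app (degZero φ) X (l + 1) m _ x.2) +
        Fam.app (degZero φ) X (m + 1) n _ (-(M.d (l + 1) (m + 1) _ x.2)) = 0
      rw [map_add, N.d_d, map_neg, zero_add, ← sub_eq_add_neg]
      exact hφ
    · change -(M.d (m + 1) (n + 1) _ (-(M.d (l + 1) (m + 1) _ x.2))) = 0
      rw [map_neg, M.d_d, neg_zero, neg_zero]
  id_act n x := by
    refine Prod.ext (N.id_act n x.1) ?_
    change sgn 0 • _ = _
    rw [sgn_zero, one_smul]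
    exact M.id_act (n + 1) x.2
  comp_act p q r a b n h₁ h₂ h₃ h₄ f g x := by
    refine Prod.ext (N.comp_act p q r a b n h₁ h₂ h₃ h₄ f g x.1) ?_
    change sgn a • M.act a (r + 1) (n + 1) _ _ x.2 =
      sgn q • M.act q (b + 1) (n + 1) _ g (sgn p • M.act p (r + 1) (b + 1) _ f x.2)
    rw [M.comp_act p q (r + 1) a (b + 1) (n + 1) h₁ (by omega) (by omega) (by omega), map_zsmul,
      smul_smul]
    subst h₁
    rw [sgn_add, mul_comm]
  leibniz {X Y} p q n p' q' n' h hp hq hn h₁ h₂ f x := by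
    refine Prod.ext ?_ ?_
    · change N.d n n' hn (N.act p q n h f x.1) +
        Fam.app (degZero φ) Y (n + 1) n' _ (sgn p • M.act p (q + 1) (n + 1) _ f x.2) =
        N.act p' q n' h₁ _ x.1 +
          sgn p • N.act p q' n' h₂ f (N.d q q' hq x.1 + Fam.app (degZero φ) X (q + 1) q' _ x.2)
      rw [N.leibniz p q n p' q' n' h hp hq hn h₁ h₂, map_zsmul,
        degZero_mem φ X Y p (q + 1) (n + 1) q' n' (by omega) (by omega) (by omega) (by omega), zero_mul,
        sgn_zero, one_smul, map_add, smul_add, add_assoc]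
    · change -(M.d (n + 1) (n' + 1) _ (sgn p • M.act p (q + 1) (n + 1) _ f x.2)) =
        sgn p' • M.act p' (q + 1) (n' + 1) _ _ x.2 +
          sgn p • (sgn p • M.act p (q' + 1) (n' + 1) _ f (-(M.d (q + 1) (q' + 1) _ x.2)))
      rw [map_zsmul, M.leibniz p (q + 1) (n + 1) p' (q' + 1) (n' + 1) (by omega) hp (by omega)
        (by omega) (by omega) (by omega), map_neg]
      subst hp
      rw [sgn_add, sgn_one]
      module

/-- The left DG `A`-module `Y ↦ Hom(X, Y)`. Applied to `Aᵒᵖ` it yields the right DG `A`-modules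
`X ↦ Hom(X, Y)`. -/
def rep (X : A) : DGMod.{w, v, u, v} k A where
  obj Y n := Hom k X Y n
  d n m h := DG.d n m h
  act p q n h := (comp q p n (by omega)).flip
  d_d := DGCategory.d_d
  id_act n x := DGCategory.comp_id n x
  comp_act p q r a b n h₁ h₂ h₃ h₄ f g x :=
    (DGCategory.assoc r p q b a n (by omega) (by omega) (by omega) (by omega) x f g).symm
  leibniz p q n p' q' n' h hp hq hn h₁ h₂ f x :=
    DGCategory.leibniz q p n q' p' n' (by omega) hq hp hn (by omega) (by omega) x f

end DGMod

end DGMod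

section Derived

variable {k : Type w} [CommRing k] {A : Type u} {C : Type u'}
  [DGCategory.{w, v} k A] [DGCategory.{w, v} k C]

/-- Restriction of a DG module along a DG functor. -/
def DGMod.res (F : DGFunctor k A C) (M : DGMod.{w, v, u', t} k C) : DGMod.{w, v, u, t} k A where
  obj X n := M.obj (F.obj X) n
  d n m h := M.d n m h
  act p q n h := M.act p q n h ∘ₗ F.map p
  d_d := M.d_d
  id_act n x := (congrArg (fun f => M.act 0 n n _ f x) (F.map_id _)).trans (M.id_act n x)
  comp_act p q r a b n h₁ h₂ h₃ h₄ f g x :=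
    (congrArg (fun e => M.act a r n _ e x) (F.map_comp p q a h₁ f g)).trans
      (M.comp_act p q r a b n h₁ h₂ h₃ h₄ (F.map p f) (F.map q g) x)
  leibniz p q n p' q' n' h hp hq hn h₁ h₂ f x :=
    (M.leibniz p q n p' q' n' h hp hq hn h₁ h₂ (F.map p f) x).trans
      (congrArg (fun e => M.act p' q n' _ e x + _) (F.map_d p p' hp f).symm)

/-- Restriction along a DG functor `A → C`, as a DG functor between the DG categories of DG
modules over `C` and over `A`. -/
def DGFunctor.res (F : DGFunctor k A C) :
    DGFunctor k (DGMod.{w, v, u', max u u' t} k C) (DGMod.{w, v, u, max u u' t} k A) where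
  obj M := M.res F
  map _ :=
    { toFun := fun φ => ⟨fun X p => φ.1 (F.obj X) p,
        fun X Y a p p' q q' h hq hq' h' f x =>
          φ.2 (F.obj X) (F.obj Y) a p p' q q' h hq hq' h' (F.map a f) x⟩
      map_add' := fun _ _ => rfl
      map_smul' := fun _ _ => rfl }
  map_d _ _ _ _ := rfl
  map_id _ := rfl
  map_comp _ _ _ _ _ _ := rfl

/-- The class of morphisms of the homotopy category of DG modules whose cone is acyclic. -/
def acyclicConeClass (k : Type w) [CommRing k] (A : Type u) [DGCategory.{w, v} k A] :
    MorphismProperty (Ho k (DGMod.{w, v, u, t} k A)) := fun M N f =>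
  ∃ g : closed k M.of N.of, f = Ho.homMk g ∧ (DGMod.cone g).Acyclic

/-- The derived category of left DG modules over a (small) DG category: the Verdier quotient of
the homotopy category of DG modules by the acyclic ones. The derived category `D(A)` of right DG
`A`-modules is `DerMod k Aᵒᵖ`, and `D(A°)` is `DerMod k A`. -/
abbrev DerMod (k : Type w) [CommRing k] (A : Type u) [DGCategory.{w, u} k A] :=
  (acyclicConeClass.{w, u, u, u} k A).Localization

/-- A DG module as an object of the derived category. -/
def toDer {A : Type u} [DGCategory.{w, u} k A] (M : DGMod.{w, u, u, u} k A) : DerMod k A :=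
  (acyclicConeClass.{w, u, u, u} k A).Q.obj ⟨M⟩

section

variable {A C : Type u} [DGCategory.{w, u} k A] [DGCategory.{w, u} k C]

theorem res_inverts (F : DGFunctor k A C) :
    (acyclicConeClass.{w, u, u, u} k C).IsInvertedBy
      (F.res.ho ⋙ (acyclicConeClass.{w, u, u, u} k A).Q) := by
  rintro M N f ⟨g, rfl, hg⟩
  exact MorphismProperty.Q_inverts _ _
    ⟨F.res.mapClosed _ _ g, rfl, fun X l m n h h' x hx => hg (F.obj X) l m n h h' x hx⟩

/-- Restriction between derived categories of DG modules. -/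
noncomputable def derRes (F : DGFunctor k A C) : DerMod k C ⥤ DerMod k A :=
  Localization.Construction.lift (F.res.ho ⋙ (acyclicConeClass.{w, u, u, u} k A).Q)
    (res_inverts F)

/-- Derived induction along a DG functor: the left adjoint of the restriction functor between
derived categories. It is given here as the left adjoint on the full subcategory of all objects
at which the left adjoint is defined; this is the whole derived category, because all
DG modules have semi-free resolutions. -/
noncomputable def LInd (F : DGFunctor k A C) :
    (derRes F).PartialLeftAdjointSource ⥤ DerMod k C :=
  (derRes F).partialLeftAdjoint

/-- The essential image of `LInd F` is that of any globally defined left adjoint of restriction. -/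
theorem LInd_essImage_iff (F : DGFunctor k A C) (L : DerMod k A ⥤ DerMod k C)
    (adj : L ⊣ derRes F) (M : DerMod k C) : (LInd F).essImage M ↔ L.essImage M := by
  constructor
  · rintro ⟨N, ⟨e⟩⟩
    exact ⟨N.obj, ⟨(adj.corepresentableBy N.obj).uniqueUpToIso
      (Functor.corepresentableBy _) ≪≫ e⟩⟩
  · rintro ⟨N, ⟨e⟩⟩
    have := (adj.corepresentableBy N).isCorepresentable
    exact ⟨⟨N, (derRes F).leftAdjointObjIsDefined_of_adjunction adj N⟩,
      ⟨(Functor.corepresentableBy _).uniqueUpToIso (adj.corepresentableBy N) ≪≫ e⟩⟩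

end

/-- The family of maps `Hom(X, Y) → Hom(ξ X, ξ Y)` given by a DG functor `ξ`. -/
def repFam (ξ : DGFunctor k A C) (X : A) :
    DGMod.Fam (DGMod.rep (k := k) X) ((DGMod.rep (k := k) (ξ.obj X)).res ξ) 0 :=
  fun Y p => DGMod.objCast ((DGMod.rep (k := k) (ξ.obj X)).res ξ) Y (add_zero p).symm ∘ₗ ξ.map p

theorem repFam_app (ξ : DGFunctor k A C) (X Y : A) (p : ℤ) (h : p + 0 = p) (f : Hom k X Y p) :
    DGMod.Fam.app (repFam ξ X) Y p p h f = ξ.map p f :=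
  DGMod.objCast_objCast _ Y _ _ _

theorem repFam_mem (ξ : DGFunctor k A C) (X : A) : repFam ξ X ∈ DGMod.homs _ _ 0 := by
  intro Y Z a p p' q q' h hq hq' h' f x
  obtain rfl : p = q := by omega
  obtain rfl : p' = q' := by omega
  rw [zero_mul, sgn_zero, one_smul]
  refine (repFam_app ξ X Z p' hq' _).trans ?_
  refine (ξ.map_comp p a p' (by omega) x f).trans ?_
  exact (congrArg (fun e => comp p a p' (by omega) e (ξ.map a f)) (repFam_app ξ X Y p hq x)).symm

theorem repFam_closed (ξ : DGFunctor k A C) (X : A) :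
    DGMod.famD 0 1 (zero_add 1) (repFam ξ X) = 0 := by
  refine DGMod.Fam.ext_app fun Y p q h x => ?_
  rw [DGMod.famD_apply 0 1 _ _ Y p p q q (add_zero p) h h (add_zero q), DGMod.Fam.zero_app,
    sgn_zero, one_smul, sub_eq_zero]
  refine Eq.trans ?_ (repFam_app ξ X Y q _ _).symm
  refine Eq.trans ?_ (ξ.map_d p q h x).symm
  exact congrArg (fun e => d p q h e) (repFam_app ξ X Y p _ x)

/-- The closed morphism `Hom(X, ?) → Hom(ξ X, ξ ?)` of DG `A`-modules given by a DG functor `ξ`. -/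
def repMap (ξ : DGFunctor k A C) (X : A) :
    closed k (DGMod.rep (k := k) X) ((DGMod.rep (k := k) (ξ.obj X)).res ξ) :=
  ⟨(⟨repFam ξ X, repFam_mem ξ X⟩ : DGMod.homs _ _ 0), Subtype.ext (repFam_closed ξ X)⟩

/-- The left DG `A`-module `Y ↦ Cone(Hom_A(X, Y) → Hom_C(ξ X, ξ Y))`. Applied to the dual DG functor
`ξ.op` it yields the right DG `A`-module `X ↦ Cone(Hom_A(X, Y) → Hom_C(ξ X, ξ Y))`. -/
def coneModule (ξ : DGFunctor k A C) (X : A) : DGMod.{w, v, u, v} k A :=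
  DGMod.cone (repMap ξ X)

end Derived

end DG

-- All three conditions are equivalent to one elementary statement about `E = A^pretr`, the DG
-- functor `Ξ = ξ^pretr : E → C^pretr` and the class `P` of twisted complexes over `B`. A tower
-- (`Tower`) is a finite composite `Y → K` of inclusions into cones of morphisms with source in `P`.
-- An object `X` is killable (`Killable`) if every cocycle of `Cone(Hom(X, Y) → Hom(Ξ X, Ξ Y))`
-- becomes a coboundary after composition with some tower `Y → K`. Heuristically, the colimit of
-- `Hom(X, K)` over towers computes morphisms in `A^tr / B^tr`, and killability says that `Ξ`
-- identifies it with `Hom(Ξ X, Ξ Y)`. Killability passes to shifts and cones in `X`, so it suffices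
-- to test it on objects of `A`.
--
-- Condition (i) (`isDGQuotient_iff`). Towers satisfy a left calculus of fractions in `Ho(E)`, and
-- they are inverted by the same functors as the morphisms with cone in `B^tr`. Killability of
-- cocycles of degree `0` lifts morphisms `Ξ X → Ξ Y` to fractions, which is fullness of the functor
-- induced on the localization; in degree `-1` it gives faithfulness; shifts reduce every degree to
-- these two. Essential surjectivity on `C^tr` follows from that on `Ho(C)`, because a morphism
-- between objects in the image lifts to a fraction, so that its cone is again in the image.
--
-- Condition (ii°) (`essImage_coneModule_iff`). The module `N = Cone(Hom(X, ?) → Hom(Ξ X, Ξ ?))` is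
-- defined on all of `E`. Attach free cells at the objects of `B` for every possible boundary and
-- image: the result is a semi-free module with an augmentation to `N` which is a quasi-isomorphism
-- on `B`. Over `A` this module is K-projective and lies in the image of `LInd`, so `N` restricted
-- to `A` lies in that image if and only if the augmentation is a quasi-isomorphism on all of `A`
-- (`LInd_essImage_res_iff`). Finitely many cells closed under boundaries generate a submodule
-- corepresented by an object of `P`. Hence every cocycle of the semi-free module at `Y` comes from
-- a closed morphism `Z → Y` with `Z` in `P`, and it dies in the cone of that morphism. This
-- translates acyclicity of the cone of the augmentation into killability and back
-- (`killable_of_acyclic`, `acyclic_of_killable`).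
--
-- Condition (ii). The same argument applies to the dual DG categories, and killability of all
-- objects is self-dual (`forall_killable_op_iff`): a tower out of `Y` that kills a cocycle is
-- replaced, one cone at a time, by a cotower into `X` that kills it. Contractibility of `Ξ Z` for
-- `Z` in `P` enters here.
--
-- Computations take place in the total category `Tot`, where degrees disappear from the types, with
-- cones and shifts described by equations (`ConeData`, `ShiftData`). Such data are preserved by
-- every DG functor, and several objects of different shapes can be cones of the same morphism.

universe t

namespace DG

/-! ### The total category of a DG category -/

section Tot

/-- The category with the objects of the DG category `E` in which the morphisms are finite sums of
homogeneous morphisms. -/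
structure Tot (k : Type w) (E : Type u) where
  of : E

variable {k : Type w} [CommRing k] {E : Type u} [DGCategory.{w, v} k E]

namespace Tot

/-- Composition of inhomogeneous morphisms. -/
noncomputable def compHom (X Y Z : E) :
    (DirectSum ℤ fun n => Hom k X Y n) →+ (DirectSum ℤ fun n => Hom k Y Z n) →+
      (DirectSum ℤ fun n => Hom k X Z n) :=
  DirectSum.toAddMonoid fun p => AddMonoidHom.flip <| DirectSum.toAddMonoid fun q =>
    AddMonoidHom.flip <|
      { toFun := fun f => (DirectSum.of (fun n => Hom k X Z n) (p + q)).comp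
          (comp p q (p + q) rfl f).toAddMonoidHom
        map_zero' := by ext; simp
        map_add' := fun f g => by ext; simp }

theorem compHom_of {X Y Z : E} (p q n : ℤ) (h : p + q = n) (f : Hom k X Y p) (g : Hom k Y Z q) :
    compHom X Y Z (DirectSum.of _ p f) (DirectSum.of _ q g) =
      DirectSum.of (fun n => Hom k X Z n) n (comp p q n h f g) := by
  subst h
  simp [compHom]

noncomputable instance : Category.{v} (Tot k E) where
  Hom X Y := DirectSum ℤ fun n => Hom k X.of Y.of n
  id X := DirectSum.of (fun n => Hom k X.of X.of n) 0 (DGCategory.id X.of)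
  comp {X Y Z} f g := compHom X.of Y.of Z.of f g
  id_comp {X Y} f := by
    induction f using DirectSum.induction_on with
    | zero => exact map_zero _
    | of n f => rw [compHom_of 0 n n (zero_add n), DGCategory.id_comp]
    | add f g hf hg => rw [map_add, hf, hg]
  comp_id {X Y} f := by
    induction f using DirectSum.induction_on with
    | zero => simp
    | of n f => rw [compHom_of n 0 n (add_zero n), DGCategory.comp_id]
    | add f g hf hg => rw [map_add, AddMonoidHom.add_apply, hf, hg]
  assoc {X Y Z T} f g h := by
    induction f using DirectSum.induction_on with
    | zero => simp
    | add f f' hf hf' => simp only [map_add, AddMonoidHom.add_apply, hf, hf']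
    | of p f =>
      induction g using DirectSum.induction_on with
      | zero => simp
      | add f f' hf hf' => simp only [map_add, AddMonoidHom.add_apply, hf, hf']
      | of q g =>
        induction h using DirectSum.induction_on with
        | zero => simp
        | add f f' hf hf' => simp only [map_add, hf, hf']
        | of r h =>
          rw [compHom_of p q _ rfl, compHom_of q r _ rfl, compHom_of (p + q) r _ rfl,
            compHom_of p (q + r) (p + q + r) (by omega),
            DGCategory.assoc p q r (p + q) (q + r) (p + q + r)]

noncomputable instance homAddCommGroup (X Y : Tot k E) : AddCommGroup (X ⟶ Y) :=
  inferInstanceAs (AddCommGroup (DirectSum ℤ fun n => Hom k X.of Y.of n))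

noncomputable instance : Preadditive (Tot k E) where
  homGroup := homAddCommGroup
  add_comp X Y Z f f' g :=
    (DFunLike.congr_fun (map_add (compHom X.of Y.of Z.of) f f') g).trans (AddMonoidHom.add_apply ..)
  comp_add X Y Z f := map_add (compHom X.of Y.of Z.of f)

/-- A homogeneous morphism as a morphism of the total category. -/
noncomputable def ι {X Y : E} {n : ℤ} : Hom k X Y n →+ ((⟨X⟩ : Tot k E) ⟶ ⟨Y⟩) :=
  DirectSum.of (fun n => Hom k X Y n) n

theorem ι_injective {X Y : E} {n : ℤ} : Function.Injective (ι : Hom k X Y n →+ _) :=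
  DirectSum.of_injective n

theorem ι_inj {X Y : E} {n : ℤ} {f g : Hom k X Y n} : ι f = ι g ↔ f = g := ι_injective.eq_iff

theorem ι_eq_zero {X Y : E} {n : ℤ} {f : Hom k X Y n} : ι f = 0 ↔ f = 0 :=
  ⟨fun h => ι_injective (h.trans (map_zero ι).symm), fun h => by rw [h, map_zero]⟩

@[elab_as_elim]
theorem induction {X Y : Tot k E} {P : (X ⟶ Y) → Prop} (f : X ⟶ Y)
    (zero : P 0) (homog : ∀ (n : ℤ) (f : Hom k X.of Y.of n), P (ι f))
    (add : ∀ f g, P f → P g → P (f + g)) : P f :=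
  DirectSum.induction_on (β := fun n => Hom k X.of Y.of n) f zero homog add

/-- Extend additive maps defined on homogeneous morphisms. -/
noncomputable def lift {X Y : Tot k E} {M : Type*} [AddCommMonoid M]
    (φ : ∀ n : ℤ, Hom k X.of Y.of n →+ M) : (X ⟶ Y) →+ M :=
  DirectSum.toAddMonoid (β := fun n => Hom k X.of Y.of n) φ

theorem lift_ι {X Y : Tot k E} {M : Type*} [AddCommMonoid M]
    (φ : ∀ n : ℤ, Hom k X.of Y.of n →+ M) {n : ℤ} (f : Hom k X.of Y.of n) :
    lift φ (ι f) = φ n f :=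
  DirectSum.toAddMonoid_of (β := fun n => Hom k X.of Y.of n) φ n f

/-- The differential of the total category. -/
noncomputable def D {X Y : Tot k E} : (X ⟶ Y) →+ (X ⟶ Y) :=
  lift fun n => ι.comp (d n (n + 1) rfl).toAddMonoidHom

/-- The sign involution of the total category. -/
noncomputable def sg {X Y : Tot k E} : (X ⟶ Y) →+ (X ⟶ Y) := lift fun n => sgn n • ι

theorem D_ι {X Y : E} (n m : ℤ) (h : n + 1 = m) (f : Hom k X Y n) : D (ι f) = ι (d n m h f) := by
  subst h
  exact lift_ι _ f

theorem ι_d {X Y : E} (n m : ℤ) (h : n + 1 = m) (f : Hom k X Y n) : ι (d n m h f) = D (ι f) :=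
  (D_ι n m h f).symm

theorem sg_ι {X Y : E} {n : ℤ} (f : Hom k X Y n) : sg (ι f) = sgn n • ι f := lift_ι _ f

theorem ι_comp {X Y Z : E} (p q n : ℤ) (h : p + q = n) (f : Hom k X Y p) (g : Hom k Y Z q) :
    ι (comp p q n h f g) = ι f ≫ ι g := (compHom_of p q n h f g).symm

theorem ι_id (X : E) : ι (DGCategory.id X : Hom k X X 0) = 𝟙 (⟨X⟩ : Tot k E) := rfl

/-- Transports between equal degrees become invisible after `ι`. Since `ι` is injective, identities
between homogeneous morphisms can be checked in `Tot` without any bookkeeping of degrees. -/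
theorem ι_degCast {X Y : E} {n m : ℤ} (h : n = m) (f : Hom k X Y n) : ι (degCast h f) = ι f := by
  subst h
  rfl

theorem ι_idOfEq {X : E} {n : ℤ} (hn : n = 0) :
    ι (idOfEq rfl hn : Hom k X X n) = 𝟙 (⟨X⟩ : Tot k E) := by
  subst hn
  rfl

@[simp]
theorem D_D {X Y : Tot k E} (f : X ⟶ Y) : D (D f) = 0 := by
  induction f using induction with
  | zero => simp
  | homog n f =>
    rw [D_ι n _ rfl, D_ι (n + 1) _ rfl]
    exact (congrArg ι (DGCategory.d_d n _ _ rfl rfl f)).trans (map_zero _)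
  | add f g hf hg => rw [map_add, map_add, hf, hg, add_zero]

/-- `f ≫ g` is `g ∘ f`, so the differential passes the factor `g` before it reaches `f`. The sign
involution `sg` records this sign also for sums of different degrees. -/
theorem D_comp {X Y Z : Tot k E} (f : X ⟶ Y) (g : Y ⟶ Z) :
    D (f ≫ g) = f ≫ D g + D f ≫ sg g := by
  induction f using induction with
  | zero => simp
  | add f f' hf hf' => simp only [map_add, Preadditive.add_comp, hf, hf']; abel
  | homog p f =>
    induction g using induction with
    | zero => simp
    | add g g' hg hg' => simp only [map_add, Preadditive.comp_add, hg, hg']; abel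
    | homog q g =>
      rw [← ι_comp p q _ rfl f g, D_ι (p + q) _ rfl,
        DGCategory.leibniz p q (p + q) (p + 1) (q + 1) (p + q + 1) rfl rfl rfl rfl (by omega)
          (by omega), map_add, map_zsmul, sg_ι, D_ι q _ rfl, D_ι p _ rfl, Preadditive.comp_zsmul]
      exact congrArg₂ (· + ·) (ι_comp ..) (congrArg _ (ι_comp ..))

theorem sg_comp {X Y Z : Tot k E} (f : X ⟶ Y) (g : Y ⟶ Z) : sg (f ≫ g) = sg f ≫ sg g := by
  induction f using induction with
  | zero => simp
  | add f f' hf hf' => simp only [map_add, Preadditive.add_comp, hf, hf']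
  | homog p f =>
    induction g using induction with
    | zero => simp
    | add g g' hg hg' => simp only [map_add, Preadditive.comp_add, hg, hg']
    | homog q g =>
      rw [← ι_comp p q _ rfl f g, sg_ι, sg_ι, sg_ι, ι_comp, sgn_add, Preadditive.comp_zsmul,
        Preadditive.zsmul_comp, smul_smul, mul_comm]

@[simp]
theorem D_id (X : Tot k E) : D (𝟙 X) = 0 := by
  rw [← ι_id, D_ι 0 1 (zero_add 1), d_id, map_zero]

theorem sgn_neg_one : sgn (-1) = -1 := by simp [sgn]

@[simp]
theorem sg_ι_zero {X Y : E} (f : Hom k X Y 0) : sg (ι f) = ι f := by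
  rw [sg_ι, sgn_zero, one_smul]

@[simp]
theorem sg_ι_one {X Y : E} (f : Hom k X Y 1) : sg (ι f) = -ι f := by
  rw [sg_ι, sgn_one, neg_one_smul]

@[simp]
theorem sg_ι_neg_one {X Y : E} (f : Hom k X Y (-1)) : sg (ι f) = -ι f := by
  rw [sg_ι, sgn_neg_one, neg_one_smul]

theorem mem_closed_iff {X Y : E} {f : Hom k X Y 0} : f ∈ closed k X Y ↔ D (ι f) = 0 := by
  rw [D_ι 0 1 (zero_add 1), ι_eq_zero]
  rfl

theorem mem_exact_iff {X Y : E} {f : closed k X Y} :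
    f ∈ exact k X Y ↔ ∃ h : Hom k X Y (-1), D (ι h) = ι f.1 := by
  refine exists_congr fun h => ?_
  rw [D_ι (-1) 0 (by simp), ι_inj]
  rfl

end Tot

end Tot

/-! ### DG functors on inhomogeneous morphisms -/

section TotFunctor

variable {k : Type w} [CommRing k] {E : Type u} {E' : Type u'}
  [DGCategory.{w, v} k E] [DGCategory.{w, v} k E']

/-- The action of a DG functor on inhomogeneous morphisms. -/
noncomputable def DGFunctor.tot (F : DGFunctor k E E') {X Y : E} :
    ((⟨X⟩ : Tot k E) ⟶ ⟨Y⟩) →+ ((⟨F.obj X⟩ : Tot k E') ⟶ ⟨F.obj Y⟩) :=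
  Tot.lift fun n => Tot.ι.comp (F.map n).toAddMonoidHom

namespace DGFunctor

variable (F : DGFunctor k E E')

open Tot

theorem tot_ι {X Y : E} {n : ℤ} (f : Hom k X Y n) : F.tot (ι f) = ι (F.map n f) :=
  Tot.lift_ι (X := ⟨X⟩) (Y := ⟨Y⟩) _ f

theorem ι_map {X Y : E} {n : ℤ} (f : Hom k X Y n) : ι (F.map n f) = F.tot (ι f) :=
  (F.tot_ι f).symm

@[simp]
theorem tot_id (X : E) : F.tot (𝟙 (⟨X⟩ : Tot k E)) = 𝟙 _ := by
  rw [← ι_id, tot_ι, F.map_id, ι_id]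

@[simp]
theorem tot_comp {X Y Z : E} (f : (⟨X⟩ : Tot k E) ⟶ ⟨Y⟩) (g : (⟨Y⟩ : Tot k E) ⟶ ⟨Z⟩) :
    F.tot (f ≫ g) = F.tot f ≫ F.tot g := by
  induction f using Tot.induction with
  | zero => simp
  | add f f' hf hf' => simp only [map_add, Preadditive.add_comp, hf, hf']
  | homog p f =>
    induction g using Tot.induction with
    | zero => simp
    | add g g' hg hg' => simp only [map_add, Preadditive.comp_add, hg, hg']
    | homog q g =>
      rw [← ι_comp p q _ rfl f g, tot_ι, tot_ι, tot_ι, F.map_comp, ι_comp]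

theorem tot_D {X Y : E} (f : (⟨X⟩ : Tot k E) ⟶ ⟨Y⟩) : F.tot (D f) = D (F.tot f) := by
  induction f using Tot.induction with
  | zero => simp
  | add f f' hf hf' => simp only [map_add, hf, hf']
  | homog p f => rw [D_ι p _ rfl, tot_ι, tot_ι, F.map_d, D_ι p _ rfl]

theorem D_tot {X Y : E} (f : (⟨X⟩ : Tot k E) ⟶ ⟨Y⟩) : D (F.tot f) = F.tot (D f) := (F.tot_D f).symm

theorem tot_sg {X Y : E} (f : (⟨X⟩ : Tot k E) ⟶ ⟨Y⟩) : F.tot (sg f) = sg (F.tot f) := by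
  induction f using Tot.induction with
  | zero => simp
  | add f f' hf hf' => simp only [map_add, hf, hf']
  | homog p f => rw [sg_ι, map_zsmul, tot_ι, sg_ι]

end DGFunctor

end TotFunctor


/-! ### Inhomogeneous elements of DG modules -/

section TotMod

variable {k : Type w} [CommRing k] {E : Type u} [DGCategory.{w, v} k E]

namespace DGMod

/-- Inhomogeneous elements of a DG module. -/
abbrev El (N : DGMod.{w, v, u, t} k E) (X : Tot k E) : Type t := DirectSum ℤ (N.obj X.of)

variable (N : DGMod.{w, v, u, t} k E)

/-- A homogeneous element as an inhomogeneous one. -/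
noncomputable def el {X : E} {n : ℤ} : N.obj X n →+ N.El ⟨X⟩ := DirectSum.of (N.obj X) n

theorem el_injective {X : E} {n : ℤ} : Function.Injective (N.el (X := X) (n := n)) :=
  DirectSum.of_injective n

theorem el_inj {X : E} {n : ℤ} {x y : N.obj X n} : N.el x = N.el y ↔ x = y :=
  N.el_injective.eq_iff

theorem el_eq_zero {X : E} {n : ℤ} {x : N.obj X n} : N.el x = 0 ↔ x = 0 :=
  ⟨fun h => N.el_injective (h.trans (map_zero N.el).symm), fun h => by rw [h, map_zero]⟩

theorem el_induction {X : Tot k E} {P : N.El X → Prop} (x : N.El X)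
    (zero : P 0) (homog : ∀ (n : ℤ) (x : N.obj X.of n), P (N.el x))
    (add : ∀ x y, P x → P y → P (x + y)) : P x :=
  DirectSum.induction_on x zero homog add

/-- Extend additive maps defined on homogeneous elements. -/
noncomputable def elLift {X : Tot k E} {M : Type*} [AddCommMonoid M]
    (φ : ∀ n : ℤ, N.obj X.of n →+ M) : N.El X →+ M :=
  DirectSum.toAddMonoid φ

theorem elLift_el {X : Tot k E} {M : Type*} [AddCommMonoid M]
    (φ : ∀ n : ℤ, N.obj X.of n →+ M) {n : ℤ} (x : N.obj X.of n) : N.elLift φ (N.el x) = φ n x :=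
  DirectSum.toAddMonoid_of φ n x

/-- The action of inhomogeneous morphisms on inhomogeneous elements. -/
noncomputable def tact {X Y : Tot k E} : (X ⟶ Y) →+ N.El X →+ N.El Y :=
  Tot.lift fun p => AddMonoidHom.flip <| N.elLift fun q => AddMonoidHom.flip <|
      { toFun := fun f => N.el.comp (N.act p q (p + q) rfl f).toAddMonoidHom
        map_zero' := by ext; simp
        map_add' := fun f g => by ext; simp }

theorem tact_ι_el {X Y : E} (p q n : ℤ) (h : p + q = n) (f : Hom k X Y p) (x : N.obj X q) :
    N.tact (Tot.ι f) (N.el x) = N.el (N.act p q n h f x) := by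
  subst h
  rw [tact, Tot.lift_ι, AddMonoidHom.flip_apply]
  exact DFunLike.congr_fun (N.elLift_el (X := ⟨X⟩) _ x) f

theorem el_act {X Y : E} (p q n : ℤ) (h : p + q = n) (f : Hom k X Y p) (x : N.obj X q) :
    N.el (N.act p q n h f x) = N.tact (Tot.ι f) (N.el x) := (N.tact_ι_el p q n h f x).symm

/-- The differential on inhomogeneous elements. -/
noncomputable def tD {X : Tot k E} : N.El X →+ N.El X :=
  N.elLift fun n => N.el.comp (N.d n (n + 1) rfl).toAddMonoidHom

theorem tD_el {X : E} (n m : ℤ) (h : n + 1 = m) (x : N.obj X n) :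
    N.tD (N.el x) = N.el (N.d n m h x) := by
  subst h
  exact N.elLift_el (X := ⟨X⟩) _ x

theorem el_d {X : E} (n m : ℤ) (h : n + 1 = m) (x : N.obj X n) :
    N.el (N.d n m h x) = N.tD (N.el x) := (N.tD_el n m h x).symm

theorem tD_el_eq_zero {X : E} (n m : ℤ) (h : n + 1 = m) (x : N.obj X n) :
    N.tD (N.el x) = 0 ↔ N.d n m h x = 0 := by
  rw [N.tD_el n m h, el_eq_zero]

@[simp]
theorem tact_id {X : Tot k E} (x : N.El X) : N.tact (𝟙 X) x = x := by
  induction x using N.el_induction with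
  | zero => simp
  | add x y hx hy => rw [map_add, hx, hy]
  | homog n x => rw [← Tot.ι_id, N.tact_ι_el 0 n n (zero_add n), N.id_act]

theorem tact_comp {X Y Z : Tot k E} (f : X ⟶ Y) (g : Y ⟶ Z) (x : N.El X) :
    N.tact (f ≫ g) x = N.tact g (N.tact f x) := by
  induction f using Tot.induction with
  | zero => simp
  | add f f' hf hf' => simp only [Preadditive.add_comp, map_add, AddMonoidHom.add_apply, hf, hf']
  | homog p f =>
    induction g using Tot.induction with
    | zero => simp
    | add f f' hf hf' => simp only [Preadditive.comp_add, map_add, AddMonoidHom.add_apply, hf, hf']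
    | homog q g =>
      induction x using N.el_induction with
      | zero => simp
      | add x y hx hy => simp only [map_add, hx, hy]
      | homog n x =>
        rw [← Tot.ι_comp p q _ rfl f g, N.tact_ι_el p n _ rfl, N.tact_ι_el q (p + n) _ rfl,
          N.tact_ι_el (p + q) n (q + (p + n)) (by omega),
          N.comp_act p q n (p + q) (p + n) (q + (p + n)) rfl (by omega) rfl rfl]

@[simp]
theorem tD_tD {X : Tot k E} (x : N.El X) : N.tD (N.tD x) = 0 := by
  induction x using N.el_induction with
  | zero => simp
  | add x y hx hy => simp only [map_add, hx, hy, add_zero]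
  | homog n x => rw [N.tD_el n _ rfl, N.tD_el (n + 1) _ rfl, N.d_d, map_zero]

/-- The acting morphism stands to the left of the element, so the Koszul sign falls on `f`. -/
theorem tD_tact {X Y : Tot k E} (f : X ⟶ Y) (x : N.El X) :
    N.tD (N.tact f x) = N.tact (Tot.D f) x + N.tact (Tot.sg f) (N.tD x) := by
  induction f using Tot.induction with
  | zero => simp
  | add f f' hf hf' => simp only [map_add, AddMonoidHom.add_apply, hf, hf']; abel
  | homog p f =>
    induction x using N.el_induction with
    | zero => simp
    | add x y hx hy => simp only [map_add, hx, hy]; abel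
    | homog n x =>
      rw [N.tact_ι_el p n _ rfl, N.tD_el (p + n) _ rfl,
        N.leibniz p n (p + n) (p + 1) (n + 1) (p + n + 1) rfl rfl rfl rfl (by omega) (by omega),
        map_add, map_zsmul, N.el_act, N.el_act, Tot.ι_d, N.el_d, Tot.sg_ι, map_zsmul]
      rfl

/-- The additive map underlying a closed morphism of degree zero. -/
noncomputable def tmap {M N : DGMod.{w, v, u, t} k E} (φ : closed k M N) {X : Tot k E} :
    M.El X →+ N.El X :=
  M.elLift fun n => N.el.comp (Fam.app (degZero φ) X.of n n (add_zero n)).toAddMonoidHom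

section

variable {M N : DGMod.{w, v, u, t} k E} (φ : closed k M N)

/-- The component of a closed morphism of degree zero. -/
abbrev app (X : E) (n : ℤ) : M.obj X n →ₗ[k] N.obj X n :=
  Fam.app (degZero φ) X n n (add_zero n)

theorem tmap_el {X : E} {n : ℤ} (x : M.obj X n) : tmap φ (M.el x) = N.el (app φ X n x) :=
  M.elLift_el (X := ⟨X⟩) _ x

theorem app_act {X Y : E} (p q n : ℤ) (h : p + q = n) (f : Hom k X Y p) (x : M.obj X q) :
    app φ Y n (M.act p q n h f x) = N.act p q n h f (app φ X q x) := by
  refine (degZero_mem φ X Y p q n q n h (add_zero q) (add_zero n) h f x).trans ?_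
  rw [zero_mul, sgn_zero, one_smul]

theorem app_d {X : E} (n m : ℤ) (h : n + 1 = m) (x : M.obj X n) :
    app φ X m (M.d n m h x) = N.d n m h (app φ X n x) := by
  have H := congrArg (fun ψ => Fam.app ψ X n m h x) (famD_degZero φ)
  rw [famD_apply 0 1 (zero_add 1) _ X n n m m (add_zero n) h h (add_zero m), Fam.zero_app,
    sgn_zero, one_smul, sub_eq_zero] at H
  exact H.symm

theorem tmap_tact {X Y : Tot k E} (f : X ⟶ Y) (x : M.El X) :
    tmap φ (M.tact f x) = N.tact f (tmap φ x) := by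
  induction f using Tot.induction with
  | zero => simp
  | add f f' hf hf' => simp only [map_add, AddMonoidHom.add_apply, hf, hf']
  | homog p f =>
    induction x using M.el_induction with
    | zero => simp
    | add x y hx hy => simp only [map_add, hx, hy]
    | homog n x =>
      rw [M.tact_ι_el p n _ rfl, tmap_el, tmap_el, N.tact_ι_el p n _ rfl, app_act]

theorem tmap_tD {X : Tot k E} (x : M.El X) : tmap φ (M.tD x) = N.tD (tmap φ x) := by
  induction x using M.el_induction with
  | zero => simp
  | add x y hx hy => simp only [map_add, hx, hy]
  | homog n x => rw [M.tD_el n _ rfl, tmap_el, tmap_el, N.tD_el n _ rfl, app_d]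

end

/-- A DG module is acyclic at `X` if the complex `N(X)` is acyclic. -/
def AcyclicAt (X : E) : Prop :=
  ∀ (l m n : ℤ) (h : l + 1 = m) (h' : m + 1 = n) (x : N.obj X m),
    N.d m n h' x = 0 → ∃ y : N.obj X l, N.d l m h y = x

theorem AcyclicAt.exists_eq {N : DGMod.{w, v, u, t} k E} {X : E} (hX : N.AcyclicAt X) {m : ℤ}
    (l : ℤ) (h : l + 1 = m) {x : N.obj X m} (hx : N.tD (N.el x) = 0) :
    ∃ y : N.obj X l, N.tD (N.el y) = N.el x := by
  obtain ⟨y, hy⟩ := hX l m (m + 1) h rfl x ((N.tD_el_eq_zero _ _ rfl x).mp hx)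
  exact ⟨y, by rw [N.tD_el _ _ h, hy]⟩

theorem AcyclicAt.of_exists {N : DGMod.{w, v, u, t} k E} {X : E}
    (H : ∀ (l m : ℤ) (_ : l + 1 = m) (x : N.obj X m), N.tD (N.el x) = 0 →
      ∃ y : N.obj X l, N.tD (N.el y) = N.el x) : N.AcyclicAt X := by
  intro l m n h h' x hx
  obtain ⟨y, hy⟩ := H l m h x ((N.tD_el_eq_zero _ _ h' x).mpr hx)
  exact ⟨y, by rwa [N.tD_el _ _ h, el_inj] at hy⟩

end DGMod

end TotMod

/-! ### Cones and shifts in DG categories -/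

section Cones

open Tot

variable {k : Type w} [CommRing k] {E : Type u} [DGCategory.{w, v} k E]

/-- The structure of a cone `Y ⊕ X[1]` of a closed morphism `f : X → Y` of degree zero. -/
structure ConeData {X Y : E} (f : Hom k X Y 0) (K : E) where
  i : Hom k Y K 0
  j : Hom k X K (-1)
  p : Hom k K X 1
  s : Hom k K Y 0
  i_s : ι i ≫ ι s = 𝟙 _
  j_p : ι j ≫ ι p = 𝟙 _
  i_p : ι i ≫ ι p = 0
  j_s : ι j ≫ ι s = 0
  total : ι s ≫ ι i + ι p ≫ ι j = 𝟙 _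
  D_i : D (ι i) = 0
  D_p : D (ι p) = 0
  D_j : D (ι j) = ι f ≫ ι i
  D_s : D (ι s) = -(ι p ≫ ι f)

/-- The structure of a shift of an object. -/
structure ShiftData (k : Type w) [CommRing k] {E : Type u} [DGCategory.{w, v} k E]
    (X X' : E) (n m : ℤ) where
  σ : Hom k X X' n
  τ : Hom k X' X m
  σ_τ : ι σ ≫ ι τ = 𝟙 _
  τ_σ : ι τ ≫ ι σ = 𝟙 _
  D_σ : D (ι σ) = 0
  D_τ : D (ι τ) = 0

attribute [simp] ConeData.i_s ConeData.j_p ConeData.i_p ConeData.j_s ConeData.D_i ConeData.D_p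
  ConeData.D_j ConeData.D_s ShiftData.σ_τ ShiftData.τ_σ ShiftData.D_σ ShiftData.D_τ

namespace ConeData

variable {X Y : E} {f : Hom k X Y 0} {K : E} (c : ConeData f K)

@[simp]
theorem i_s_assoc {Z : Tot k E} (h : _ ⟶ Z) : ι c.i ≫ ι c.s ≫ h = h := by
  rw [← Category.assoc, i_s, Category.id_comp]

@[simp]
theorem j_p_assoc {Z : Tot k E} (h : _ ⟶ Z) : ι c.j ≫ ι c.p ≫ h = h := by
  rw [← Category.assoc, j_p, Category.id_comp]

@[simp]
theorem i_p_assoc {Z : Tot k E} (h : _ ⟶ Z) : ι c.i ≫ ι c.p ≫ h = 0 := by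
  rw [← Category.assoc, i_p, Limits.zero_comp]

@[simp]
theorem j_s_assoc {Z : Tot k E} (h : _ ⟶ Z) : ι c.j ≫ ι c.s ≫ h = 0 := by
  rw [← Category.assoc, j_s, Limits.zero_comp]

theorem closed_i : c.i ∈ closed k Y K := mem_closed_iff.mpr c.D_i

-- Closedness of `f` is a consequence of the cone equations: `0 = D (D j) = D f ≫ i`, and `i` is
-- split by `s`.
include c in
theorem D_base : D (ι f) = 0 := by
  have h : D (D (ι c.j)) = 0 := D_D _
  rw [c.D_j, D_comp, c.D_i, Limits.comp_zero, zero_add, sg_ι_zero] at h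
  have h' := congrArg (· ≫ ι c.s) h
  simpa using h'

/-- Morphisms out of a cone are determined by the restrictions to the two summands. -/
theorem hom_ext {T : Tot k E} {a b : (⟨K⟩ : Tot k E) ⟶ T} (hi : ι c.i ≫ a = ι c.i ≫ b)
    (hj : ι c.j ≫ a = ι c.j ≫ b) : a = b := by
  rw [← Category.id_comp a, ← Category.id_comp b, ← c.total]
  simp only [Preadditive.add_comp, Category.assoc, hi, hj]

end ConeData

namespace ShiftData

variable {X X' : E} {n m : ℤ} (c : ShiftData k X X' n m)

@[simp]
theorem σ_τ_assoc {Z : Tot k E} (h : _ ⟶ Z) : ι c.σ ≫ ι c.τ ≫ h = h := by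
  rw [← Category.assoc, σ_τ, Category.id_comp]

@[simp]
theorem τ_σ_assoc {Z : Tot k E} (h : _ ⟶ Z) : ι c.τ ≫ ι c.σ ≫ h = h := by
  rw [← Category.assoc, τ_σ, Category.id_comp]

/-- The inverse of a shift. -/
def symm : ShiftData k X' X m n := ⟨c.τ, c.σ, c.τ_σ, c.σ_τ, c.D_τ, c.D_σ⟩

end ShiftData

namespace DGFunctor

variable {E' : Type u'} [DGCategory.{w, v} k E'] (F : DGFunctor k E E')

/-- DG functors preserve cones. -/
def mapCone {X Y : E} {f : Hom k X Y 0} {K : E} (c : ConeData f K) :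
    ConeData (F.map 0 f) (F.obj K) where
  i := F.map _ c.i
  j := F.map _ c.j
  p := F.map _ c.p
  s := F.map _ c.s
  i_s := by simp only [ι_map, ← tot_comp, c.i_s, tot_id]
  j_p := by simp only [ι_map, ← tot_comp, c.j_p, tot_id]
  i_p := by simp only [ι_map, ← tot_comp, c.i_p, map_zero]
  j_s := by simp only [ι_map, ← tot_comp, c.j_s, map_zero]
  total := by simp only [ι_map, ← tot_comp, ← map_add, c.total, tot_id]
  D_i := by simp only [ι_map, D_tot, c.D_i, map_zero]
  D_p := by simp only [ι_map, D_tot, c.D_p, map_zero]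
  D_j := by simp only [ι_map, D_tot, c.D_j, tot_comp]
  D_s := by simp only [ι_map, D_tot, c.D_s, map_neg, tot_comp]

/-- DG functors preserve shifts. -/
def mapShift {X X' : E} {n m : ℤ} (c : ShiftData k X X' n m) :
    ShiftData k (F.obj X) (F.obj X') n m where
  σ := F.map _ c.σ
  τ := F.map _ c.τ
  σ_τ := by simp only [ι_map, ← tot_comp, c.σ_τ, tot_id]
  τ_σ := by simp only [ι_map, ← tot_comp, c.τ_σ, tot_id]
  D_σ := by simp only [ι_map, D_tot, c.D_σ, map_zero]
  D_τ := by simp only [ι_map, D_tot, c.D_τ, map_zero]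

end DGFunctor

/-- The objects generated by the objects `j s` by means of shifts and cones. -/
inductive Generated (k : Type w) [CommRing k] {E : Type u} [DGCategory.{w, v} k E] {S : Type u'}
    (j : S → E) : E → Prop
  | zero (K : E) (h : 𝟙 (⟨K⟩ : Tot k E) = 0) : Generated k j K
  | base (s : S) : Generated k j (j s)
  | shift {X X' : E} {n m : ℤ} (hnm : n + m = 0) (c : ShiftData k X X' n m)
      (h : Generated k j X) : Generated k j X'
  | cone {X Y K : E} {f : Hom k X Y 0} (c : ConeData f K) (hX : Generated k j X)
      (hY : Generated k j Y) : Generated k j K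

/-- Cones and shifts are given by equations rather than by universal properties, so any DG functor
preserves them. -/
theorem Generated.map {E' : Type u''} [DGCategory.{w, v} k E'] (F : DGFunctor k E E')
    {S : Type u'} {j : S → E} {X : E} (h : Generated k j X) :
    Generated k (fun s => F.obj (j s)) (F.obj X) := by
  induction h with
  | zero K h => exact .zero _ (by simpa using congrArg F.tot h)
  | base s => exact .base s
  | shift hnm c _ h => exact .shift hnm (F.mapShift c) h
  | cone c _ _ hX hY => exact .cone (F.mapCone c) hX hY

/-- The objects satisfying `P` are generated by the objects `j s`, and they are closed under
shifts and cones. -/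
structure IsHull (k : Type w) [CommRing k] {E : Type u} [DGCategory.{w, v} k E] {S : Type u'}
    (j : S → E) (P : E → Prop) : Prop where
  gen : ∀ X, P X → Generated k j X
  base : ∀ s, P (j s)
  zero : ∃ X, P X ∧ 𝟙 (⟨X⟩ : Tot k E) = 0
  shift : ∀ X, P X → ∀ n m : ℤ, n + m = 0 → ∃ X', P X' ∧ Nonempty (ShiftData k X X' n m)
  cone : ∀ (X Y : E) (f : Hom k X Y 0), P X → P Y → D (ι f) = 0 →
    ∃ K, P K ∧ Nonempty (ConeData f K)

namespace DGMod

variable (N : DGMod.{w, v, u, t} k E)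

theorem AcyclicAt.of_id_eq_zero {K : E} (h : 𝟙 (⟨K⟩ : Tot k E) = 0) : N.AcyclicAt K := by
  refine .of_exists fun l m _ x _ => ⟨0, ?_⟩
  rw [← N.tact_id (N.el x), h]
  simp

theorem AcyclicAt.shift {X X' : E} {n m : ℤ} (hnm : n + m = 0) (c : ShiftData k X X' n m)
    (h : N.AcyclicAt X) : N.AcyclicAt X' := by
  refine .of_exists fun a b hab x hx => ?_
  obtain ⟨y, hy⟩ := h.exists_eq (m := m + b) (m + a) (by omega) (x := N.act m b _ rfl c.τ x)
    (by rw [N.el_act, tD_tact, c.D_τ, hx]; simp)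
  refine ⟨sgn n • N.act n (m + a) a (by omega) c.σ y, ?_⟩
  rw [map_zsmul, map_zsmul, N.el_act, tD_tact, c.D_σ, hy, N.el_act, sg_ι, map_zsmul, map_zero,
    AddMonoidHom.coe_smul, Pi.smul_apply, ← tact_comp, c.τ_σ, AddMonoidHom.zero_apply, zero_add,
    smul_smul, sgn_mul_self, one_smul, tact_id]

/-- The chase in the long exact sequence, made explicit: for a cocycle `z` write `p z = d x`; then
`s z + f x` is a cocycle of `N(Y)`, say `d y`, and `i y - j x` is a primitive of `z`. -/
theorem AcyclicAt.cone {X Y K : E} {f : Hom k X Y 0} (c : ConeData f K)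
    (hX : N.AcyclicAt X) (hY : N.AcyclicAt Y) : N.AcyclicAt K := by
  refine .of_exists fun l m hlm z hz => ?_
  obtain ⟨x, hx⟩ := hX.exists_eq m rfl (x := N.act 1 m (m + 1) (by omega) c.p z)
    (by rw [N.el_act, tD_tact, c.D_p, hz]; simp)
  obtain ⟨y, hy⟩ := hY.exists_eq l hlm
    (x := N.act 0 m m (by omega) c.s z + N.act 0 m m (by omega) f x)
    (by rw [map_add, map_add, N.el_act, N.el_act, tD_tact, tD_tact, c.D_s, hz, hx, c.D_base,
          N.el_act]
        simp [tact_comp])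
  refine ⟨N.act 0 l l (by omega) c.i y - N.act (-1) m l (by omega) c.j x, ?_⟩
  rw [map_sub, map_sub, N.el_act, N.el_act, tD_tact, tD_tact, c.D_i, c.D_j, hx, hy, map_add,
    N.el_act, N.el_act, N.el_act]
  have := congrArg (fun φ => N.tact φ (N.el z)) c.total
  simp only [map_add, AddMonoidHom.add_apply, tact_comp, tact_id] at this
  refine Eq.trans ?_ this
  simp [tact_comp]
  abel

theorem AcyclicAt.of_generated {S : Type u'} {j : S → E} (hN : ∀ s, N.AcyclicAt (j s)) {X : E}
    (hX : Generated k j X) : N.AcyclicAt X := by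
  induction hX with
  | zero K h => exact .of_id_eq_zero N h
  | base s => exact hN s
  | shift hnm c _ h => exact .shift N hnm c h
  | cone c _ _ hX hY => exact .cone N c hX hY

/-- Exactness of `N(X) → N(Y) → N(K)` for a cone `K` of `X → Y`. -/
theorem exists_lift_of_cone {X Y K : E} {f : Hom k X Y 0} (c : ConeData f K) {l n : ℤ}
    (h : l + 1 = n) {y : N.obj Y n} {e : N.obj K l}
    (he : N.tD (N.el e) = N.tact (ι c.i) (N.el y)) :
    ∃ x : N.obj X n, N.tD (N.el x) = 0 ∧
      ∃ y' : N.obj Y l, N.tD (N.el y') = N.el y - N.tact (ι f) (N.el x) := by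
  refine ⟨N.act 1 l n (by omega) c.p e, ?_, N.act 0 l l (by omega) c.s e, ?_⟩
  · rw [N.el_act, tD_tact, he]
    simp [← tact_comp]
  · rw [N.el_act, tD_tact, he, N.el_act]
    simp [← tact_comp, neg_add_eq_sub]

/-- If `N(X)` is acyclic, then `N(Y) → N(K)` is injective in cohomology, for a cone `K` of
`X → Y`. -/
theorem AcyclicAt.exists_cobound {X Y K : E} {f : Hom k X Y 0} (c : ConeData f K)
    (hX : N.AcyclicAt X) {l n : ℤ} (h : l + 1 = n) {y : N.obj Y n} {e : N.obj K l}
    (he : N.tD (N.el e) = N.tact (ι c.i) (N.el y)) :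
    ∃ y' : N.obj Y l, N.tD (N.el y') = N.el y := by
  obtain ⟨x, hx, y', hy'⟩ := N.exists_lift_of_cone c h he
  obtain ⟨x', hx'⟩ := hX.exists_eq l h hx
  refine ⟨y' + N.act 0 l l (by omega) f x', ?_⟩
  rw [map_add, map_add, hy', N.el_act, tD_tact, hx', c.D_base]
  simp

end DGMod

end Cones


/-! ### Duality for cones and shifts -/

section OpHull

open Tot Opposite

variable {k : Type w} [CommRing k] {E : Type u} [DGCategory.{w, v} k E]

/-- Inhomogeneous morphisms of the dual DG category, as morphisms of the original one. -/
noncomputable def Tot.unopHom {X Y : Eᵒᵖ} :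
    ((⟨X⟩ : Tot k Eᵒᵖ) ⟶ ⟨Y⟩) →+ ((⟨Y.unop⟩ : Tot k E) ⟶ ⟨X.unop⟩) :=
  AddMonoidHom.id (DirectSum ℤ fun n => Hom k Y.unop X.unop n)

theorem Tot.unopHom_injective {X Y : Eᵒᵖ} :
    Function.Injective (unopHom : ((⟨X⟩ : Tot k Eᵒᵖ) ⟶ ⟨Y⟩) →+ _) := fun _ _ h => h

/-- A homogeneous morphism as a morphism of the dual DG category. -/
def opHom {X Y : E} {n : ℤ} (f : Hom k X Y n) : Hom k (op Y) (op X) n := f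

theorem Tot.unopHom_id (X : Eᵒᵖ) : unopHom (𝟙 (⟨X⟩ : Tot k Eᵒᵖ)) = 𝟙 _ := rfl

theorem Tot.unopHom_D_opHom {X Y : E} {n : ℤ} (f : Hom k X Y n) :
    unopHom (D (ι (opHom f))) = D (ι f) := by
  rw [D_ι n _ rfl, D_ι n _ rfl]
  rfl

theorem Tot.unopHom_comp {X Y Z : E} {p q : ℤ} (f : Hom k X Y p) (g : Hom k Y Z q) :
    unopHom (ι (opHom g) ≫ ι (opHom f)) = sgn (q * p) • (ι f ≫ ι g) := by
  rw [← ι_comp q p (q + p) rfl, ← ι_comp p q (q + p) (by omega), ← map_zsmul]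
  rfl

namespace ShiftData

/-- A shift in the dual DG category. -/
def op {X X' : E} {n m : ℤ} (hnm : n + m = 0) (c : ShiftData k X X' n m) :
    ShiftData k (op X) (op X') m n where
  σ := opHom c.τ
  τ := sgn (m * n) • opHom c.σ
  σ_τ := unopHom_injective (by
    rw [map_zsmul, Preadditive.comp_zsmul, map_zsmul, unopHom_comp, c.σ_τ, smul_smul,
      sgn_mul_self, one_smul, unopHom_id])
  τ_σ := unopHom_injective (by
    rw [map_zsmul, Preadditive.zsmul_comp, map_zsmul, unopHom_comp, c.τ_σ, smul_smul,
      mul_comm n m, sgn_mul_self, one_smul, unopHom_id])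
  D_σ := unopHom_injective (by rw [unopHom_D_opHom, c.D_τ, map_zero])
  D_τ := unopHom_injective (by rw [map_zsmul, map_zsmul, map_zsmul, unopHom_D_opHom, c.D_σ,
    map_zero, smul_zero])

end ShiftData

/-- A cone of `f : X → Y` is a cone of a shift of `f` in the dual DG category. -/
def ConeData.op {X Y K X₁ Y₁ : E} {f : Hom k X Y 0} (c : ConeData f K)
    (a : ShiftData k X X₁ (-1) 1) (b : ShiftData k Y Y₁ (-1) 1) (g : Hom k X₁ Y₁ 0)
    (hg : ι g = ι a.τ ≫ ι f ≫ ι b.σ) : ConeData (opHom g) (op K) where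
  -- With `K = Y ⊕ X[1]`, dualizing makes `X[1]` the target summand and `Y` the shifted source
  -- summand, that is, the dual of `Y[1]` shifted by one. The four maps are those of `K` in
  -- exchanged roles, composed with the shifts.
  i := opHom (comp 1 (-1) 0 (by simp) c.p a.σ)
  p := opHom (-comp 1 0 1 (by simp) b.τ c.i)
  j := opHom (comp 0 (-1) (-1) (by simp) c.s b.σ)
  s := opHom (comp 1 (-1) 0 (by simp) a.τ c.j)
  i_s := unopHom_injective (by rw [unopHom_comp, unopHom_id]; simp [ι_comp, sgn_zero])
  j_p := unopHom_injective (by rw [unopHom_comp, unopHom_id]; simp [ι_comp, sgn_neg_one])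
  i_p := unopHom_injective (by rw [unopHom_comp, map_zero]; simp [ι_comp])
  j_s := unopHom_injective (by rw [unopHom_comp, map_zero]; simp [ι_comp])
  total := unopHom_injective (by
    rw [map_add, unopHom_comp, unopHom_comp, unopHom_id, ← c.total]
    simp [ι_comp, sgn_neg_one, sgn_zero, add_comm])
  D_i := unopHom_injective (by rw [unopHom_D_opHom, map_zero]; simp [ι_comp, D_comp])
  D_p := unopHom_injective (by rw [unopHom_D_opHom, map_zero]; simp [ι_comp, D_comp])
  D_j := unopHom_injective (by
    rw [unopHom_D_opHom, unopHom_comp]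
    simp [ι_comp, D_comp, sgn_zero, hg])
  D_s := unopHom_injective (by
    rw [unopHom_D_opHom, map_neg, unopHom_comp]
    simp [ι_comp, D_comp, sgn_zero, hg])

/-- A DG category in which all shifts exist. -/
def HasShifts (k : Type w) [CommRing k] (E : Type u) [DGCategory.{w, v} k E] : Prop :=
  ∀ (X : E) (n m : ℤ), n + m = 0 → ∃ X' : E, Nonempty (ShiftData k X X' n m)

/-- Only the cone case needs an argument: the dual of a cone of `f` is a cone of the dual of `f[1]`,
whose source and target are shifts of the duals of `Y` and `X`. -/
theorem Generated.op (hE : HasShifts k E) {S : Type u'} {j : S → E} {X : E}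
    (h : Generated k j X) : Generated k (fun s : Sᵒᵖ => op (j s.unop)) (op X) := by
  induction h with
  | zero K h => exact .zero _ (unopHom_injective (by rw [unopHom_id, h, map_zero]))
  | base s => exact .base (j := fun s : Sᵒᵖ => Opposite.op (j s.unop)) (Opposite.op s)
  | shift hnm c _ h => exact .shift (by omega) (c.op hnm) h
  | @cone X Y K f c _ _ hX hY =>
    obtain ⟨X₁, ⟨a⟩⟩ := hE X (-1) 1 (by simp)
    obtain ⟨Y₁, ⟨b⟩⟩ := hE Y (-1) 1 (by simp)
    refine .cone (c.op a b (comp 1 (-1) 0 (by simp) a.τ (comp 0 (-1) (-1) (by simp) f b.σ)) ?_)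
      (.shift (by simp) (b.op (by simp)) hY) (.shift (by simp) (a.op (by simp)) hX)
    rw [ι_comp, ι_comp]

theorem IsHull.op (hE : HasShifts k E) {S : Type u'} {j : S → E} {P : E → Prop}
    (h : IsHull k j P) :
    IsHull k (fun s : Sᵒᵖ => op (j s.unop)) (fun X : Eᵒᵖ => P X.unop) where
  gen X hX := (h.gen X.unop hX).op hE
  base s := h.base s.unop
  zero := by
    obtain ⟨X, hX, h0⟩ := h.zero
    exact ⟨Opposite.op X, hX, unopHom_injective (by rw [unopHom_id, h0, map_zero])⟩
  shift X hX n m hnm := by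
    obtain ⟨X', hX', ⟨c⟩⟩ := h.shift X.unop hX m n (by omega)
    exact ⟨Opposite.op X', hX', ⟨c.op (by omega)⟩⟩
  cone X Y f hX hY hf := by
    obtain ⟨X₁, hX₁, ⟨a⟩⟩ := h.shift X.unop hX 1 (-1) (by simp)
    obtain ⟨Y₁, hY₁, ⟨b⟩⟩ := h.shift Y.unop hY 1 (-1) (by simp)
    let f' : Hom k Y.unop X.unop 0 := f
    have hf' : D (ι f') = 0 := hf
    -- `ConeData.op` shifts the morphism by one, so the cone is taken of the desuspension of `f'`,
    -- and its dual is a cone of `f` itself.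
    obtain ⟨K, hK, ⟨c⟩⟩ := h.cone Y₁ X₁
      (comp (-1) 1 0 (by simp) b.τ (comp 0 1 1 (by simp) f' a.σ)) hY₁ hX₁
      (by simp [ι_comp, D_comp, hf'])
    exact ⟨Opposite.op K, hK, ⟨c.op b.symm a.symm f' (by simp [ι_comp, ShiftData.symm])⟩⟩

theorem HasShifts.op (hE : HasShifts k E) : HasShifts k Eᵒᵖ := by
  intro X n m hnm
  obtain ⟨X', ⟨c⟩⟩ := hE X.unop m n (by omega)
  exact ⟨Opposite.op X', ⟨c.op (by omega)⟩⟩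

end OpHull


/-! ### The hull of one-sided twisted complexes -/

section PreTrHull

open Tot

variable {k : Type w} [CommRing k] {A : Type u} [DGCategory.{w, v} k A]

namespace PreTr

theorem ι_add_ι_neg {X Y : A} {n : ℤ} (x : Hom k X Y n) : ι x + ι (-x) = 0 := by
  rw [map_neg, add_neg_cancel]

theorem mat_ext {X Y : PreTr k A} {n : ℤ} {f g : Hom k X Y n}
    (h : ∀ i j, ι (k := k) (f i j) = ι (g i j)) : ι f = ι g :=
  congrArg ι (funext fun i => funext fun j => ι_injective (h i j))

theorem ι_comp_apply {X Y Z : PreTr k A} (p q n : ℤ) (h : p + q = n) (f : Hom k X Y p)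
    (g : Hom k Y Z q) (i : Fin Z.n) (j : Fin X.n) :
    ι (k := k) (comp p q n h f g i j) = ∑ a, ι (f a j) ≫ ι (g i a) := by
  change ι (k := k) (matComp p q n h f g i j) = _
  rw [matComp_apply, map_sum]
  exact Finset.sum_congr rfl fun a _ => ι_comp ..

theorem ι_d_apply {X Y : PreTr k A} (l m : ℤ) (h : l + 1 = m) (f : Hom k X Y l) (i : Fin Y.n)
    (j : Fin X.n) :
    ι (k := k) (d l m h f i j) = sgn (Y.r i) • D (ι (f i j)) + ∑ a, ι (f a j) ≫ ι (Y.q i a) -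
      sgn l • ∑ a, ι (X.q a j) ≫ ι (f i a) := by
  change ι (k := k) (diff l m h f i j) = _
  rw [diff_apply, Pi.sub_apply, Pi.sub_apply, Pi.add_apply, Pi.add_apply, Pi.smul_apply,
    Pi.smul_apply, map_sub, map_add, map_zsmul, naive_apply, map_zsmul, ι_d]
  exact congrArg₂ (· - ·) (congrArg (_ + ·) (ι_comp_apply l 1 m h f Y.q i j))
    (congrArg (sgn l • ·) (ι_comp_apply 1 l m (by omega) X.q f i j))

theorem ι_one_self (X : PreTr k A) (i : Fin X.n) : ι (k := k) (one X i i) = 𝟙 _ := by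
  rw [one, dif_pos rfl]
  exact ι_idOfEq _

theorem ι_one_ne (X : PreTr k A) {i j : Fin X.n} (h : j ≠ i) : ι (k := k) (one X i j) = 0 := by
  rw [one, dif_neg h, map_zero]

theorem D_ι_one (X : PreTr k A) (i j : Fin X.n) : D (ι (k := k) (one X i j)) = 0 := by
  by_cases h : j = i
  · subst h
    rw [ι_one_self, D_id]
  · rw [ι_one_ne X h, map_zero]

theorem sum_one_comp (X : PreTr k A) {T : Tot k A} (G : ∀ a, (⟨X.obj a⟩ : Tot k A) ⟶ T)
    (j : Fin X.n) : ∑ a, ι (k := k) (one X a j) ≫ G a = G j := by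
  rw [Finset.sum_eq_single j, ι_one_self, Category.id_comp]
  · intro a _ ha
    rw [ι_one_ne X ha.symm, Limits.zero_comp]
  · simp

theorem sum_comp_one (X : PreTr k A) {T : Tot k A} (G : ∀ a, T ⟶ (⟨X.obj a⟩ : Tot k A))
    (i : Fin X.n) : ∑ a, G a ≫ ι (k := k) (one X i a) = G i := by
  rw [Finset.sum_eq_single i, ι_one_self, Category.comp_id]
  · intro a _ ha
    rw [ι_one_ne X ha, Limits.comp_zero]
  · simp

theorem ι_mc (X : PreTr k A) (i j : Fin X.n) :
    sgn (X.r i) • D (ι (k := k) (X.q i j)) + ∑ a, ι (X.q a j) ≫ ι (X.q i a) = 0 := by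
  have h := congrArg (ι (k := k)) (X.maurerCartan i j)
  rw [map_add, map_zsmul, ι_d, map_zero, map_sum] at h
  rw [← h]
  exact congrArg _ (Finset.sum_congr rfl fun a _ => (ι_comp ..).symm)

theorem id_eq_one (X : PreTr k A) : (DGCategory.id X : Hom k X X 0) = one X := rfl

/-- The shift of a twisted complex. -/
abbrev shift (X : PreTr k A) (t : ℤ) : PreTr k A where
  n := X.n
  obj := X.obj
  r i := X.r i + t
  -- The naive differential carries the sign `(-1)^(r i)`, which changes by `(-1)^t`. The same sign
  -- on `q` compensates for it in the term `dq` and cancels in `q²`.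
  q i j := sgn t • degCast (by omega) (X.q i j)
  upper i j h := by rw [X.upper i j h, map_zero, smul_zero]
  maurerCartan i j := by
    refine ι_injective ?_
    simp only [map_add, map_zsmul, map_sum, ι_d, ι_comp, ι_degCast, LinearMap.smul_apply,
      Preadditive.zsmul_comp, Preadditive.comp_zsmul, smul_smul, sgn_mul_self, one_smul, map_zero,
      sgn_add, mul_assoc, mul_one]
    exact X.ι_mc i j

/-- The structure of a shift on `shift X m`. -/
def shiftData (X : PreTr k A) (n m : ℤ) (h : n + m = 0) : ShiftData k X (X.shift m) n m where
  σ := fun i j => degCast (by simp only [shift]; omega) (one X i j)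
  τ := fun i j => degCast (by simp only [shift]; omega) (one X i j)
  σ_τ := by
    rw [← ι_comp n m 0 h, ← ι_id]
    refine mat_ext fun i j => ?_
    rw [ι_comp_apply, id_eq_one]
    simp only [ι_degCast]
    exact sum_one_comp X (fun a => ι (one X i a)) j
  τ_σ := by
    rw [← ι_comp m n 0 (by omega), ← ι_id]
    refine mat_ext fun i j => ?_
    rw [ι_comp_apply, id_eq_one]
    simp only [ι_degCast]
    refine (sum_one_comp X (fun a => ι (one X i a)) j).trans ?_
    by_cases h : j = i
    · subst h
      exact (ι_one_self X j).trans (ι_one_self (X.shift m) j).symm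
    · exact (ι_one_ne X h).trans (ι_one_ne (X.shift m) h).symm
  D_σ := by
    rw [D_ι n _ rfl, ι_eq_zero, ← ι_eq_zero, ← map_zero ι]
    refine mat_ext fun i j => ?_
    rw [ι_d_apply]
    have h1 : ∑ a, ι (k := k) (one X a j) ≫ ι ((X.shift m).q i a) = ι ((X.shift m).q i j) :=
      sum_one_comp X (fun a => ι ((X.shift m).q i a)) j
    have h2 : ∑ a, ι (k := k) (X.q a j) ≫ ι (one X i a) = ι (X.q i j) :=
      sum_comp_one X (fun a => ι (X.q a j)) i
    simp only [ι_degCast]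
    rw [D_ι_one, h2]
    refine (congrArg (fun e => _ + e - _) h1).trans ?_
    have h3 : ι (k := k) ((X.shift m).q i j) = sgn m • ι (X.q i j) := by
      simp only [shift, map_zsmul, ι_degCast]
    have h4 : sgn n = sgn m := by
      rw [show n = -m by omega]
      simp [sgn]
    rw [h3, h4, smul_zero, zero_add, sub_self]
    exact (map_zero _).symm
  D_τ := by
    rw [D_ι m _ rfl, ι_eq_zero, ← ι_eq_zero, ← map_zero ι]
    refine mat_ext fun i j => ?_
    rw [ι_d_apply]
    have h1 : ∑ a, ι (k := k) (one X a j) ≫ ι (X.q i a) = ι (X.q i j) :=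
      sum_one_comp X (fun a => ι (X.q i a)) j
    have h2 : ∑ a, ι (k := k) ((X.shift m).q a j) ≫ ι (one X i a) = ι ((X.shift m).q i j) :=
      sum_comp_one X (fun a => ι ((X.shift m).q a j)) i
    simp only [ι_degCast]
    rw [D_ι_one]
    refine (congrArg₂ (fun e e' => _ + e - _ • e') h1 h2).trans ?_
    have h3 : ι (k := k) ((X.shift m).q i j) = sgn m • ι (X.q i j) := by
      simp only [shift, map_zsmul, ι_degCast]
    rw [h3, smul_smul, sgn_mul_self, one_smul, smul_zero, zero_add, sub_self]
    exact (map_zero _).symm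

theorem hasShifts : HasShifts k (PreTr k A) := fun X n m h => ⟨X.shift m, ⟨X.shiftData n m h⟩⟩

/-- The twisted complex with one component `a[r]`. -/
abbrev single (a : A) (r : ℤ) : PreTr k A where
  n := 1
  obj _ := a
  r _ := r
  q _ _ := 0
  upper _ _ _ := rfl
  maurerCartan _ _ := by simp

/-- The empty twisted complex. -/
def empty : PreTr k A where
  n := 0
  obj := Fin.elim0
  r := Fin.elim0
  q i := i.elim0
  upper i := i.elim0
  maurerCartan i := i.elim0

theorem id_eq_zero_of_n_eq_zero (X : PreTr k A) (h : X.n = 0) : 𝟙 (⟨X⟩ : Tot k (PreTr k A)) = 0 := by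
  rw [← ι_id, ← map_zero ι]
  exact mat_ext fun i => (Fin.cast h i).elim0

variable (k) in
/-- The inclusion of a DG category into the DG category of its twisted complexes. -/
abbrev singleFunctor (A : Type u) [DGCategory.{w, v} k A] : DGFunctor k A (PreTr k A) where
  obj a := single a 0
  map {X Y} n :=
    { toFun := fun f _ _ => degCast (by simp only [single]; omega) f
      map_add' := fun f g => by funext i j; exact map_add _ _ _
      map_smul' := fun c f => by funext i j; exact map_smul _ _ _ }
  map_d {X Y} n m h f := by
    refine ι_injective (mat_ext fun i j => ?_)
    rw [ι_d_apply]
    simp [ι_degCast, ι_d, sgn_zero]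
  map_id X := by
    refine ι_injective (mat_ext fun i j => ?_)
    obtain rfl : j = i := Fin.ext (by have h1 := i.2; have h2 := j.2; simp only [single] at h1 h2; omega)
    exact (ι_degCast (by simp [single]) (DGCategory.id X)).trans
      (ι_one_self (single (k := k) X 0) j).symm
  map_comp {X Y Z} p q n h f g := by
    refine ι_injective (mat_ext fun i j => ?_)
    rw [ι_comp_apply]
    simp [ι_degCast, ι_comp]

theorem singleFunctor_bijective {X Y : A} (n : ℤ) :
    Function.Bijective ((singleFunctor k A).map (X := X) (Y := Y) n) := by
  constructor
  · intro f g h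
    have := congrArg (ι (k := k)) (congrFun (congrFun h (0 : Fin 1)) (0 : Fin 1))
    exact ι_injective ((ι_degCast _ f).symm.trans (this.trans (ι_degCast _ g)))
  · intro f
    refine ⟨degCast (by simp only [singleFunctor, single]; omega) (f (0 : Fin 1) (0 : Fin 1)), ?_⟩
    refine ι_injective (mat_ext fun i j => ?_)
    obtain rfl : i = (0 : Fin 1) := Subsingleton.elim (α := Fin 1) _ _
    obtain rfl : j = (0 : Fin 1) := Subsingleton.elim (α := Fin 1) _ _
    exact (ι_degCast _ _).trans (ι_degCast _ _)

/-! The cone of a closed morphism of twisted complexes. -/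

theorem sum_cone {X Y : PreTr k A} {M : Type*} [AddCommMonoid M]
    (F : Fin Y.n ⊕ Fin X.n → M) :
    ∑ a : Fin (Y.n + X.n), F (finSumFinEquiv.symm a) = ∑ b, F (.inl b) + ∑ b, F (.inr b) := by
  rw [Equiv.sum_comp finSumFinEquiv.symm F, Fintype.sum_sum_type]

section

variable {X Y : PreTr k A}

/-- The entries of the inclusion `Y → Y ⊕ X[1]`. -/
def coneI (X Y : PreTr k A) : ∀ (s : Fin Y.n ⊕ Fin X.n) (b : Fin Y.n),
    Hom k (Y.obj b) (coneObj X Y s) (0 + coneShift X Y s - Y.r b)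
  | .inl c, b => one Y c b
  | .inr _, _ => 0

/-- The entries of the inclusion `X[1] → Y ⊕ X[1]`. -/
def coneJ (X Y : PreTr k A) : ∀ (s : Fin Y.n ⊕ Fin X.n) (b : Fin X.n),
    Hom k (X.obj b) (coneObj X Y s) (-1 + coneShift X Y s - X.r b)
  | .inl _, _ => 0
  | .inr c, b => degCast (by simp only [coneShift]; omega) (one X c b)

/-- The entries of the projection `Y ⊕ X[1] → X[1]`. -/
def coneP (X Y : PreTr k A) : ∀ (c : Fin X.n) (s : Fin Y.n ⊕ Fin X.n),
    Hom k (coneObj X Y s) (X.obj c) (1 + X.r c - coneShift X Y s)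
  | _, .inl _ => 0
  | c, .inr b => degCast (by simp only [coneShift]; omega) (one X c b)

/-- The entries of the projection `Y ⊕ X[1] → Y`. -/
def coneS (X Y : PreTr k A) : ∀ (c : Fin Y.n) (s : Fin Y.n ⊕ Fin X.n),
    Hom k (coneObj X Y s) (Y.obj c) (0 + Y.r c - coneShift X Y s)
  | c, .inl b => one Y c b
  | _, .inr _ => 0

end

section

variable {X Y : PreTr k A} (f : closed k X Y)

theorem sum_coneI_comp {T : Tot k A} (G : ∀ s, (⟨coneObj X Y s⟩ : Tot k A) ⟶ T) (b : Fin Y.n) :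
    ∑ a : Fin (Y.n + X.n), ι (k := k) (coneI X Y (finSumFinEquiv.symm a) b) ≫
      G (finSumFinEquiv.symm a) = G (.inl b) := by
  rw [sum_cone (fun s => ι (k := k) (coneI X Y s b) ≫ G s)]
  simp only [coneI, map_zero, Limits.zero_comp, Finset.sum_const_zero, add_zero]
  exact sum_one_comp Y (fun a => G (.inl a)) b

theorem sum_coneJ_comp {T : Tot k A} (G : ∀ s, (⟨coneObj X Y s⟩ : Tot k A) ⟶ T) (b : Fin X.n) :
    ∑ a : Fin (Y.n + X.n), ι (k := k) (coneJ X Y (finSumFinEquiv.symm a) b) ≫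
      G (finSumFinEquiv.symm a) = G (.inr b) := by
  rw [sum_cone (fun s => ι (k := k) (coneJ X Y s b) ≫ G s)]
  simp only [coneJ, map_zero, Limits.zero_comp, Finset.sum_const_zero, zero_add]
  exact (Finset.sum_congr rfl fun a _ => congrArg (· ≫ G (.inr a))
    (ι_degCast _ (one X a b))).trans (sum_one_comp X (fun a => G (.inr a)) b)

theorem sum_comp_coneP {T : Tot k A} (G : ∀ s, T ⟶ (⟨coneObj X Y s⟩ : Tot k A)) (c : Fin X.n) :
    ∑ a : Fin (Y.n + X.n), G (finSumFinEquiv.symm a) ≫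
      ι (k := k) (coneP X Y c (finSumFinEquiv.symm a)) = G (.inr c) := by
  rw [sum_cone (fun s => G s ≫ ι (k := k) (coneP X Y c s))]
  simp only [coneP, map_zero, Limits.comp_zero, Finset.sum_const_zero, zero_add]
  exact (Finset.sum_congr rfl fun a _ => congrArg (G (.inr a) ≫ ·)
    (ι_degCast _ (one X c a))).trans (sum_comp_one X (fun a => G (.inr a)) c)

theorem sum_comp_coneS {T : Tot k A} (G : ∀ s, T ⟶ (⟨coneObj X Y s⟩ : Tot k A)) (c : Fin Y.n) :
    ∑ a : Fin (Y.n + X.n), G (finSumFinEquiv.symm a) ≫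
      ι (k := k) (coneS X Y c (finSumFinEquiv.symm a)) = G (.inl c) := by
  rw [sum_cone (fun s => G s ≫ ι (k := k) (coneS X Y c s))]
  simp only [coneS, map_zero, Limits.comp_zero, Finset.sum_const_zero, add_zero]
  exact sum_comp_one Y (fun a => G (.inl a)) c

theorem D_coneJ (s : Fin Y.n ⊕ Fin X.n) (b : Fin X.n) : D (ι (k := k) (coneJ X Y s b)) = 0 := by
  rcases s with c | c
  · exact (congrArg D (map_zero ι)).trans (map_zero D)
  · exact (congrArg D (ι_degCast _ _)).trans (D_ι_one X c b)

theorem D_coneI (s : Fin Y.n ⊕ Fin X.n) (b : Fin Y.n) : D (ι (k := k) (coneI X Y s b)) = 0 := by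
  rcases s with c | c
  · exact D_ι_one Y c b
  · exact (congrArg D (map_zero ι)).trans (map_zero D)

theorem D_coneP (s : Fin Y.n ⊕ Fin X.n) (b : Fin X.n) : D (ι (k := k) (coneP X Y b s)) = 0 := by
  rcases s with c | c
  · exact (congrArg D (map_zero ι)).trans (map_zero D)
  · exact (congrArg D (ι_degCast _ _)).trans (D_ι_one X b c)

theorem D_coneS (s : Fin Y.n ⊕ Fin X.n) (b : Fin Y.n) : D (ι (k := k) (coneS X Y b s)) = 0 := by
  rcases s with c | c
  · exact D_ι_one Y b c
  · exact (congrArg D (map_zero ι)).trans (map_zero D)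

/-- The inclusion `Y → cone f`. -/
def coneIncl : Hom k Y (cone f) 0 := fun a b => coneI X Y (finSumFinEquiv.symm a) b

/-- The inclusion `X[1] → cone f`. -/
def coneIncl' : Hom k X (cone f) (-1) := fun a b => coneJ X Y (finSumFinEquiv.symm a) b

/-- The projection `cone f → X[1]`. -/
def conePr : Hom k (cone f) X 1 := fun a b => coneP X Y a (finSumFinEquiv.symm b)

/-- The projection `cone f → Y`. -/
def conePr' : Hom k (cone f) Y 0 := fun a b => coneS X Y a (finSumFinEquiv.symm b)

theorem D_coneIncl (i j) : D (ι (k := k) (coneIncl f i j)) = 0 := D_coneI _ _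

theorem D_coneIncl' (i j) : D (ι (k := k) (coneIncl' f i j)) = 0 := D_coneJ _ _

theorem D_conePr (i j) : D (ι (k := k) (conePr f i j)) = 0 := D_coneP _ _

theorem D_conePr' (i j) : D (ι (k := k) (conePr' f i j)) = 0 := D_coneS _ _

/-- The structure of a cone on `cone f`. -/
def coneData : ConeData f.1 (cone f) where
  i := coneIncl f
  j := coneIncl' f
  p := conePr f
  s := conePr' f
  i_s := by
    rw [← ι_comp 0 0 0 (by simp), ← ι_id]
    refine mat_ext fun i j => ?_
    rw [ι_comp_apply]
    exact (sum_coneI_comp (fun s => ι (coneS X Y i s)) j)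
  j_p := by
    rw [← ι_comp (-1) 1 0 (by simp), ← ι_id]
    refine mat_ext fun i j => ?_
    rw [ι_comp_apply]
    exact (sum_coneJ_comp (fun s => ι (coneP X Y i s)) j).trans (ι_degCast _ (one X i j))
  i_p := by
    rw [← ι_comp 0 1 1 (by simp), ← map_zero ι]
    refine mat_ext fun i j => ?_
    rw [ι_comp_apply]
    exact (sum_coneI_comp (fun s => ι (coneP X Y i s)) j).trans
      ((map_zero ι).trans (map_zero ι).symm)
  j_s := by
    rw [← ι_comp (-1) 0 (-1) (by simp), ← map_zero ι]
    refine mat_ext fun i j => ?_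
    rw [ι_comp_apply]
    exact (sum_coneJ_comp (fun s => ι (coneS X Y i s)) j).trans
      ((map_zero ι).trans (map_zero ι).symm)
  total := by
    rw [← ι_comp 0 0 0 (by simp), ← ι_comp 1 (-1) 0 (by simp), ← ι_id, ← map_add]
    refine mat_ext fun i j => ?_
    rw [Pi.add_apply, Pi.add_apply, map_add, ι_comp_apply, ι_comp_apply]
    have key : ∀ s t : Fin Y.n ⊕ Fin X.n, s ≠ t →
        ∑ c, ι (k := k) (coneS X Y c t) ≫ ι (coneI X Y s c) +
        ∑ c, ι (k := k) (coneP X Y c t) ≫ ι (coneJ X Y s c) = 0 := by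
      intro s t hst
      rcases s with c | c <;> rcases t with b | b
      · simp only [coneS, coneI, coneP, coneJ, map_zero, Limits.zero_comp, Limits.comp_zero,
          Finset.sum_const_zero, add_zero]
        exact (sum_one_comp Y (fun a => ι (one Y c a)) b).trans
          (ι_one_ne Y (fun h => hst (by rw [h])))
      · simp [coneS, coneI, coneP, coneJ]
      · simp [coneS, coneI, coneP, coneJ]
      · simp only [coneS, coneI, coneP, coneJ, map_zero, Limits.zero_comp, Limits.comp_zero,
          Finset.sum_const_zero, zero_add]
        exact (Finset.sum_congr rfl fun a _ => congrArg₂ (· ≫ ·) (ι_degCast _ (one X a b))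
          (ι_degCast _ (one X c a))).trans ((sum_one_comp X (fun a => ι (one X c a)) b).trans
          (ι_one_ne X (fun h => hst (by rw [h]))))
    have key' : ∀ s : Fin Y.n ⊕ Fin X.n,
        ∑ c, ι (k := k) (coneS X Y c s) ≫ ι (coneI X Y s c) +
        ∑ c, ι (k := k) (coneP X Y c s) ≫ ι (coneJ X Y s c) = 𝟙 _ := by
      intro s
      rcases s with c | c
      · simp only [coneS, coneI, coneP, coneJ, map_zero, Limits.zero_comp,
          Finset.sum_const_zero, add_zero]
        exact (sum_one_comp Y (fun a => ι (one Y c a)) c).trans (ι_one_self Y c)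
      · simp only [coneS, coneI, coneP, coneJ, map_zero, Limits.zero_comp,
          Finset.sum_const_zero, zero_add]
        exact (Finset.sum_congr rfl fun a _ => congrArg₂ (· ≫ ·) (ι_degCast _ (one X a c))
          (ι_degCast _ (one X c a))).trans ((sum_one_comp X (fun a => ι (one X c a)) c).trans
          (ι_one_self X c))
    by_cases h : j = i
    · subst h
      exact (key' _).trans (ι_one_self (cone f) j).symm
    · exact (key _ _ (fun e => h (finSumFinEquiv.symm.injective e).symm)).trans
        (ι_one_ne (cone f) h).symm
  D_i := by
    rw [D_ι 0 1 (by simp), ← map_zero ι]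
    refine mat_ext fun i j => ?_
    rw [ι_d_apply, D_coneIncl, smul_zero, zero_add, sgn_zero, one_smul]
    have key : ∀ s, ι (k := k) (X := Y.obj j) (Y := coneObj X Y s) (coneMat f s (.inl j)) -
        ∑ c, ι (Y.q c j) ≫ ι (coneI X Y s c) = 0 := by
      intro s
      rcases s with c | c
      · exact sub_eq_zero.mpr (sum_comp_one Y (fun a => ι (Y.q a j)) c).symm
      · simp only [coneMat, coneI, map_zero, Limits.comp_zero, Finset.sum_const_zero, sub_zero]
        exact map_zero ι
    refine Eq.trans ?_ ((key (finSumFinEquiv.symm i)).trans (map_zero ι).symm)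
    exact congrArg₂ (· - ·) (sum_coneI_comp (fun s => ι (coneMat f (finSumFinEquiv.symm i) s)) j)
      rfl
  D_p := by
    rw [D_ι 1 2 (by simp), ← map_zero ι]
    refine mat_ext fun i j => ?_
    rw [ι_d_apply, D_conePr, smul_zero, zero_add, sgn_one, neg_one_smul, sub_neg_eq_add]
    have key : ∀ s, ∑ c, ι (k := k) (coneP X Y c s) ≫ ι (X.q i c) +
        ι (X := coneObj X Y s) (Y := X.obj i) (coneMat f (.inr i) s) = 0 := by
      intro s
      rcases s with c | c
      · simp only [coneMat, coneP, map_zero, Limits.zero_comp, Finset.sum_const_zero, zero_add]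
        exact map_zero ι
      · exact (congrArg₂ (fun x y : (⟨X.obj c⟩ : Tot k A) ⟶ ⟨X.obj i⟩ => x + y)
          ((Finset.sum_congr rfl fun a _ => congrArg (· ≫ _)
          (ι_degCast _ (one X a c))).trans (sum_one_comp X (fun a => ι (X.q i a)) c))
          (ι_degCast _ (-X.q i c))).trans (ι_add_ι_neg _)
    refine Eq.trans ?_ ((key (finSumFinEquiv.symm j)).trans (map_zero ι).symm)
    exact congrArg₂ (· + ·) rfl
      (sum_comp_coneP (fun s => ι (coneMat f s (finSumFinEquiv.symm j))) i)
  D_j := by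
    rw [D_ι (-1) 0 (by simp), ← ι_comp 0 0 0 (by simp)]
    refine mat_ext fun i j => ?_
    rw [ι_d_apply, ι_comp_apply, D_coneIncl', smul_zero, zero_add, sgn_neg_one, neg_one_smul,
      sub_neg_eq_add]
    have key : ∀ s, ι (k := k) (X := X.obj j) (Y := coneObj X Y s) (coneMat f s (.inr j)) +
        ∑ c, ι (X.q c j) ≫ ι (coneJ X Y s c) =
        ∑ c, ι (f.1 c j) ≫ ι (coneI X Y s c) := by
      intro s
      rcases s with c | c
      · simp only [coneJ, coneI, map_zero, Limits.comp_zero, Finset.sum_const_zero, add_zero]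
        exact (ι_degCast _ (f.1 c j)).trans (sum_comp_one Y (fun a => ι (f.1 a j)) c).symm
      · simp only [coneI, map_zero, Limits.comp_zero, Finset.sum_const_zero]
        exact (congrArg₂ (fun x y : (⟨X.obj j⟩ : Tot k A) ⟶ ⟨X.obj c⟩ => x + y)
          (ι_degCast _ (-X.q c j)) ((Finset.sum_congr rfl fun a _ =>
          congrArg (_ ≫ ·) (ι_degCast _ (one X c a))).trans
            (sum_comp_one X (fun a => ι (X.q a j)) c))).trans ((add_comm _ _).trans (ι_add_ι_neg _))
    refine Eq.trans ?_ (key (finSumFinEquiv.symm i))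
    exact congrArg₂ (· + ·) (sum_coneJ_comp (fun s => ι (coneMat f (finSumFinEquiv.symm i) s)) j)
      rfl
  D_s := by
    rw [D_ι 0 1 (by simp), ← ι_comp 1 0 1 (by simp), ← map_neg]
    refine mat_ext fun i j => ?_
    rw [ι_d_apply, Pi.neg_apply, Pi.neg_apply, map_neg, ι_comp_apply, D_conePr', smul_zero, zero_add,
      sgn_zero, one_smul]
    have key : ∀ s, ∑ c, ι (k := k) (coneS X Y c s) ≫ ι (Y.q i c) -
        ι (X := coneObj X Y s) (Y := Y.obj i) (coneMat f (.inl i) s) =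
        -∑ c, ι (coneP X Y c s) ≫ ι (f.1 i c) := by
      intro s
      rcases s with c | c
      · simp only [coneP, map_zero, Limits.zero_comp, Finset.sum_const_zero, neg_zero]
        exact sub_eq_zero.mpr (sum_one_comp Y (fun a => ι (Y.q i a)) c)
      · simp only [coneS, map_zero, Limits.zero_comp, Finset.sum_const_zero, zero_sub]
        exact congrArg Neg.neg ((ι_degCast _ (f.1 i c)).trans ((Finset.sum_congr rfl fun a _ =>
          congrArg (· ≫ _) (ι_degCast _ (one X a c))).trans
            (sum_one_comp X (fun a => ι (f.1 i a)) c)).symm)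
    refine Eq.trans ?_ (key (finSumFinEquiv.symm j))
    exact congrArg₂ (· - ·) rfl
      (sum_comp_coneS (fun s => ι (coneMat f s (finSumFinEquiv.symm j))) i)

end

/-- A twisted complex with `m + 1` components is a cone of a morphism from a twisted complex with
one component to a twisted complex with `m` components. -/
theorem exists_coneData {m : ℕ} (K : PreTr k A) (h : K.n = m + 1) :
    ∃ (a : A) (r : ℤ) (Y : PreTr k A) (_ : Y.n = m) (f : Hom k (single a r) Y 0),
      Nonempty (ConeData f K) := by
  obtain ⟨n, obj, r, q, upper, mc⟩ := K
  obtain rfl : n = m + 1 := h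
  let K : PreTr k A := ⟨m + 1, obj, r, q, upper, mc⟩
  -- The last row of a strictly upper triangular matrix vanishes, so the first `m` components form a
  -- subcomplex and the last one is the quotient.
  have hlast : ∀ b, ι (k := k) (q (Fin.last m) b) = 0 := fun b => by
    rw [upper _ _ (Fin.le_last b), map_zero]
  let Y : PreTr k A :=
    { n := m
      obj := fun i => obj i.castSucc
      r := fun i => r i.castSucc
      q := fun i j => q i.castSucc j.castSucc
      upper := fun i j h => upper _ _ h
      maurerCartan := fun i j => by
        refine ι_injective ((Eq.trans ?_ (ι_mc K i.castSucc j.castSucc)).trans (map_zero ι).symm)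
        rw [map_add, map_zsmul, ι_d, map_sum]
        refine congrArg (_ + ·) ((Finset.sum_congr rfl fun a _ => ι_comp ..).trans
          (Eq.trans ?_ (Fin.sum_univ_castSucc fun a => ι (k := k) (q a j.castSucc) ≫
            ι (q i.castSucc a)).symm))
        rw [hlast, Limits.zero_comp, add_zero] }
  -- The source enters its cone shifted by one, hence `r - 1`. The morphism is the last column of
  -- `q`.
  refine ⟨obj (Fin.last m), r (Fin.last m) - 1, Y, rfl,
    fun i _ => degCast (by simp only [single, Y]; omega) (q i.castSucc (Fin.last m)), ⟨?_⟩⟩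
  have hone : ∀ a b, ι (k := k) (one Y a b) = ι (one K a.castSucc b.castSucc) := by
    intro a b
    by_cases h : b = a
    · subst h
      exact (ι_one_self Y b).trans (ι_one_self K _).symm
    · exact (ι_one_ne Y h).trans (ι_one_ne K (fun e => h (Fin.castSucc_injective m e))).symm
  have hsum : ∀ {T T' : Tot k A} (F : ∀ a : Fin (m + 1), T ⟶ T'),
      ∑ a : Fin m, F a.castSucc = ∑ a, F a - F (Fin.last m) := fun F => by
    rw [Fin.sum_univ_castSucc, add_sub_cancel_right]
  have hone1 : ∀ (e : Fin (m + 1)) (b : Fin m), ι (k := k) (one K (Fin.last m) b.castSucc) = 0 :=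
    fun _ b => ι_one_ne K (Fin.castSucc_ne_last b)
  have hone2 : ∀ (b : Fin m), ι (k := k) (one K b.castSucc (Fin.last m)) = 0 :=
    fun b => ι_one_ne K (Fin.castSucc_ne_last b).symm
  have hc0 : ∀ (e : Fin (m + 1)) (b : ℤ) (hb : 0 + r e - r (Fin.last m) = b),
    ι (k := k) (degCast hb (one K e (Fin.last m))) = ι (one K e (Fin.last m)) := fun _ _ _ => ι_degCast _ _
  have hc1 : ∀ (e : Fin (m + 1)) (b : ℤ) (hb : 0 + r (Fin.last m) - r e = b),
    ι (k := k) (degCast hb (one K (Fin.last m) e)) = ι (one K (Fin.last m) e) := fun _ _ _ => ι_degCast _ _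
  have hr : ∀ a, K.r a = r a := fun _ => rfl
  exact
    { i := fun a b => one K a b.castSucc
      j := fun a _ => degCast (by
        have h1 := hr a
        have h2 := hr (Fin.last m)
        simp only [single]
        omega) (one K a (Fin.last m))
      p := fun _ b => degCast (by
        have h1 := hr b
        have h2 := hr (Fin.last m)
        simp only [single]
        omega) (one K (Fin.last m) b)
      s := fun a b => one K a.castSucc b
      i_s := by
        rw [← ι_comp 0 0 0 (by simp), ← ι_id]
        refine mat_ext fun i j => ?_
        rw [ι_comp_apply]
        exact (sum_one_comp K (fun a => ι (one K i.castSucc a)) j.castSucc).trans (hone i j).symm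
      j_p := by
        rw [← ι_comp (-1) 1 0 (by simp), ← ι_id]
        refine mat_ext fun i j => ?_
        obtain rfl : i = (0 : Fin 1) := Subsingleton.elim (α := Fin 1) _ _
        obtain rfl : j = (0 : Fin 1) := Subsingleton.elim (α := Fin 1) _ _
        rw [ι_comp_apply]
        exact (Finset.sum_congr rfl fun a _ => congrArg₂ (· ≫ ·) (hc0 a _ _) (hc1 a _ _)).trans
          ((sum_one_comp K (fun a => ι (one K (Fin.last m) a)) (Fin.last m)).trans
          ((ι_one_self K _).trans (ι_one_self (single (k := k) (obj (Fin.last m)) (r (Fin.last m) - 1))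
            (0 : Fin 1)).symm))
      i_p := by
        rw [← ι_comp 0 1 1 (by simp), ← map_zero ι]
        refine mat_ext fun i j => ?_
        rw [ι_comp_apply]
        exact (sum_one_comp K (fun a => ι (degCast _ (one K (Fin.last m) a))) j.castSucc).trans
          ((hc1 _ _ _).trans ((hone1 j.castSucc j).trans (map_zero ι).symm))
      j_s := by
        rw [← ι_comp (-1) 0 (-1) (by simp), ← map_zero ι]
        refine mat_ext fun i j => ?_
        rw [ι_comp_apply]
        exact (Finset.sum_congr rfl fun a _ => congrArg (· ≫ _) (hc0 a _ _)).trans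
          ((sum_one_comp K (fun a => ι (one K i.castSucc a)) (Fin.last m)).trans
          ((hone2 i).trans (map_zero ι).symm))
      total := by
        rw [← ι_comp 0 0 0 (by simp), ← ι_comp 1 (-1) 0 (by simp), ← ι_id, ← map_add]
        refine mat_ext fun i j => ?_
        rw [Pi.add_apply, Pi.add_apply, map_add, ι_comp_apply, ι_comp_apply]
        refine (congrArg (_ + ·) ((Fin.sum_univ_one _).trans
          (congrArg₂ (· ≫ ·) (hc1 j _ _) (hc0 i _ _)))).trans ?_
        exact (Fin.sum_univ_castSucc fun a => ι (k := k) (one K a j) ≫ ι (one K i a)).symm.trans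
          (sum_one_comp K (fun a => ι (one K i a)) j)
      D_i := by
        rw [D_ι 0 1 (by simp), ← map_zero ι]
        refine mat_ext fun i j => ?_
        rw [ι_d_apply, sgn_zero, one_smul]
        refine (congrArg₂ (· - ·) (congrArg₂ (· + ·) ((congrArg (_ • ·) (D_ι_one K i j.castSucc)).trans
          (smul_zero _)) (sum_one_comp K (fun a => ι (q i a)) j.castSucc))
          (hsum fun a => ι (k := k) (q a j.castSucc) ≫ ι (one K i a))).trans ?_
        refine (congrArg (_ - ·) (congrArg₂ (· - ·) (sum_comp_one K (fun a => ι (q a j.castSucc)) i)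
          ((congrArg (· ≫ _) (hlast j.castSucc)).trans Limits.zero_comp))).trans ?_
        rw [zero_add, sub_zero]
        exact (sub_self _).trans (map_zero ι).symm
      D_p := by
        rw [D_ι 1 2 (by simp), ← map_zero ι]
        refine mat_ext fun i j => ?_
        rw [ι_d_apply, sgn_one, neg_one_smul, sub_neg_eq_add]
        refine (congrArg₂ (· + ·) (congrArg₂ (· + ·) ((congrArg (_ • ·) ((congrArg D
          (hc1 j _ _)).trans (D_ι_one K (Fin.last m) j))).trans (smul_zero _))
          (Finset.sum_eq_zero fun a _ => (congrArg (_ ≫ ·) (map_zero ι)).trans Limits.comp_zero))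
          ((Finset.sum_congr rfl fun a _ => congrArg (_ ≫ ·) (hc1 a _ _)).trans
          ((sum_comp_one K (fun a => ι (q a j)) (Fin.last m)).trans (hlast j)))).trans ?_
        rw [add_zero, add_zero]
        exact (map_zero ι).symm
      D_j := by
        rw [D_ι (-1) 0 (by simp), ← ι_comp 0 0 0 (by simp)]
        refine mat_ext fun i j => ?_
        rw [ι_d_apply, ι_comp_apply, sgn_neg_one, neg_one_smul, sub_neg_eq_add]
        refine (congrArg₂ (· + ·) (congrArg₂ (· + ·) ((congrArg (_ • ·) ((congrArg D
          (hc0 i _ _)).trans (D_ι_one K i (Fin.last m)))).trans (smul_zero _))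
          ((Finset.sum_congr rfl fun a _ => congrArg (· ≫ _) (hc0 a _ _)).trans
          (sum_one_comp K (fun a => ι (q i a)) (Fin.last m))))
          (Finset.sum_eq_zero fun a _ => (congrArg (· ≫ _) (map_zero ι)).trans
            Limits.zero_comp)).trans ?_
        refine Eq.trans ?_ ((Finset.sum_congr rfl fun a _ => congrArg (· ≫ _)
          (ι_degCast _ (q a.castSucc (Fin.last m)))).trans
          ((hsum fun a => ι (k := k) (q a (Fin.last m)) ≫ ι (one K i a)).trans
          (congrArg₂ (· - ·) (sum_comp_one K (fun a => ι (q a (Fin.last m))) i)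
            ((congrArg (· ≫ _) (hlast _)).trans Limits.zero_comp)))).symm
        rw [zero_add, add_zero]
        exact (sub_zero _).symm
      D_s := by
        rw [D_ι 0 1 (by simp), ← ι_comp 1 0 1 (by simp), ← map_neg]
        refine mat_ext fun i j => ?_
        rw [ι_d_apply, Pi.neg_apply, Pi.neg_apply, map_neg, ι_comp_apply, sgn_zero, one_smul]
        refine (congrArg₂ (· - ·) (congrArg₂ (· + ·) ((congrArg (_ • ·)
          (D_ι_one K i.castSucc j)).trans (smul_zero _))
          ((hsum fun a => ι (k := k) (one K a j) ≫ ι (q i.castSucc a)).trans (congrArg (· - _)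
            (sum_one_comp K (fun a => ι (q i.castSucc a)) j))))
          (sum_comp_one K (fun a => ι (q a j)) i.castSucc)).trans ?_
        refine Eq.trans ?_ (congrArg Neg.neg ((Fin.sum_univ_one _).trans
          (congrArg₂ (· ≫ ·) (hc1 j _ _) (ι_degCast _ (q i.castSucc (Fin.last m)))))).symm
        rw [zero_add, sub_sub_cancel_left] }

/-- `a[r]` is a shift of `a`. -/
def singleShift (a : A) (r : ℤ) : ShiftData k (single (k := k) a 0) (single (k := k) a r) (-r) r where
  σ := fun _ _ => idOfEq rfl (by simp [single])
  τ := fun _ _ => idOfEq rfl (by simp [single])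
  σ_τ := by
    rw [← ι_comp (-r) r 0 (by omega), ← ι_id]
    refine mat_ext fun i j => ?_
    obtain rfl : i = (0 : Fin 1) := Subsingleton.elim (α := Fin 1) _ _
    obtain rfl : j = (0 : Fin 1) := Subsingleton.elim (α := Fin 1) _ _
    rw [ι_comp_apply]
    exact (Fin.sum_univ_one _).trans (((congrArg₂ (· ≫ ·) (ι_idOfEq _) (ι_idOfEq _)).trans
      (Category.comp_id _)).trans (ι_one_self (single (k := k) a 0) (0 : Fin 1)).symm)
  τ_σ := by
    rw [← ι_comp r (-r) 0 (by omega), ← ι_id]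
    refine mat_ext fun i j => ?_
    obtain rfl : i = (0 : Fin 1) := Subsingleton.elim (α := Fin 1) _ _
    obtain rfl : j = (0 : Fin 1) := Subsingleton.elim (α := Fin 1) _ _
    rw [ι_comp_apply]
    exact (Fin.sum_univ_one _).trans (((congrArg₂ (· ≫ ·) (ι_idOfEq _) (ι_idOfEq _)).trans
      (Category.comp_id _)).trans (ι_one_self (single (k := k) a r) (0 : Fin 1)).symm)
  D_σ := by
    rw [D_ι _ _ rfl, ← map_zero ι]
    refine mat_ext fun i j => ?_
    rw [ι_d_apply]
    simp only [single, ι_idOfEq, D_id, map_zero, smul_zero, Limits.comp_zero, Limits.zero_comp,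
      Finset.sum_const_zero, add_zero, sub_zero]
    exact (map_zero ι).symm
  D_τ := by
    rw [D_ι _ _ rfl, ← map_zero ι]
    refine mat_ext fun i j => ?_
    rw [ι_d_apply]
    simp only [single, ι_idOfEq, D_id, map_zero, smul_zero, Limits.comp_zero, Limits.zero_comp,
      Finset.sum_const_zero, add_zero, sub_zero]
    exact (map_zero ι).symm

/-- Induction on the number of components, splitting off the last one as the shifted source of a
cone. -/
theorem generated (X : PreTr k A) : Generated k (fun a : A => single (k := k) a 0) X := by
  suffices ∀ (m : ℕ) (X : PreTr k A), X.n = m → Generated k (fun a : A => single (k := k) a 0) X from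
    this _ X rfl
  intro m
  induction m with
  | zero => exact fun X h => .zero X (id_eq_zero_of_n_eq_zero X h)
  | succ m ih =>
    intro X h
    obtain ⟨a, r, Y, hY, f, ⟨c⟩⟩ := exists_coneData X h
    exact .cone c (.shift (by omega) (singleShift a r) (.base (j := fun a : A => single (k := k) a 0) a))
      (ih Y hY)

theorem isHull : IsHull k (singleFunctor k A).obj (fun _ : PreTr k A => True) where
  gen X _ := generated X
  base _ := trivial
  zero := ⟨empty, trivial, id_eq_zero_of_n_eq_zero _ rfl⟩
  shift X _ n m h := ⟨_, trivial, ⟨X.shiftData n m h⟩⟩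
  cone X Y f _ _ hf := ⟨_, trivial, ⟨coneData ⟨f, mem_closed_iff.mpr hf⟩⟩⟩

/-- The twisted complexes over a full DG subcategory. -/
def IsOver (B : Set A) (X : PreTr k A) : Prop := ∃ Z : PreTr k B, (incl k B).pretr.obj Z = X

theorem isHull_isOver (B : Set A) :
    IsHull k (fun b : B => (singleFunctor k A).obj b.1) (IsOver (k := k) B) where
  gen X := by
    rintro ⟨Z, rfl⟩
    exact (generated Z).map (incl k B).pretr
  base b := ⟨single b 0, rfl⟩
  zero := ⟨_, ⟨empty, rfl⟩, id_eq_zero_of_n_eq_zero _ rfl⟩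
  shift X := by
    rintro ⟨Z, rfl⟩ n m h
    exact ⟨_, ⟨_, rfl⟩, ⟨(incl k B).pretr.mapShift (Z.shiftData n m h)⟩⟩
  cone X Y f := by
    rintro ⟨Z, rfl⟩ ⟨Z', rfl⟩ hf
    -- The subcategory is full, so `f` is itself a matrix over `B`, and its cone can be formed
    -- there.
    let f' : Hom k Z Z' 0 := f
    have hf' : f' ∈ closed k Z Z' := by
      have h0 : d 0 1 (zero_add 1) f = 0 := mem_closed_iff.mpr hf
      have h1 := (incl k B).pretr.map_d 0 1 (zero_add 1) f'
      exact h1.trans h0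
    exact ⟨_, ⟨_, rfl⟩, ⟨(incl k B).pretr.mapCone (coneData ⟨f', hf'⟩)⟩⟩

end PreTr

end PreTrHull


/-! ### Towers of cones -/

section Towers

open Tot

variable {k : Type w} [CommRing k] {E : Type u} [DGCategory.{w, v} k E]

/-- A DG category in which all closed morphisms of degree zero have cones. -/
def HasCones (k : Type w) [CommRing k] (E : Type u) [DGCategory.{w, v} k E] : Prop :=
  ∀ (X Y : E) (f : Hom k X Y 0), D (ι f) = 0 → ∃ K : E, Nonempty (ConeData f K)

/-- Finite compositions of the morphisms `Y → K`, where `K` is a cone of a morphism `Z → Y` such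
that `Z` satisfies `P`. -/
inductive Tower (k : Type w) [CommRing k] {E : Type u} [DGCategory.{w, v} k E] (P : E → Prop) :
    ∀ {Y K : E}, Hom k Y K 0 → Prop
  | id (Y : E) : Tower k P (DGCategory.id Y)
  | step {Z Y K K' : E} {f : Hom k Z Y 0} (hZ : P Z) (c : ConeData f K) {t : Hom k K K' 0}
      (ht : Tower k P t) : Tower k P (comp 0 0 0 (zero_add 0) c.i t)

namespace Tower

variable {P : E → Prop}

theorem D_eq_zero {Y K : E} {t : Hom k Y K 0} (h : Tower k P t) : D (ι t) = 0 := by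
  induction h with
  | id Y => rw [ι_id, D_id]
  | step hZ c ht ih => simp [ι_comp, D_comp, ih]

theorem trans {Y K K' : E} {s : Hom k Y K 0} {t : Hom k K K' 0} (hs : Tower k P s)
    (ht : Tower k P t) : Tower k P (comp 0 0 0 (zero_add 0) s t) := by
  induction hs with
  | id Y => rwa [comp, DGCategory.id_comp]
  | step hZ c hs ih =>
    rw [comp, DGCategory.assoc 0 0 0 0 0 0 (zero_add 0) (zero_add 0) (zero_add 0) (zero_add 0)]
    exact .step hZ c (ih ht)

theorem of_cone {Z Y K : E} {f : Hom k Z Y 0} (hZ : P Z) (c : ConeData f K) : Tower k P c.i := by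
  have := step hZ c (.id K)
  rwa [comp, DGCategory.comp_id] at this

theorem map {E' : Type u'} [DGCategory.{w, v} k E'] (F : DGFunctor k E E') {P' : E' → Prop}
    (hF : ∀ X, P X → P' (F.obj X)) {Y K : E} {t : Hom k Y K 0} (h : Tower k P t) :
    Tower k P' (F.map 0 t) := by
  induction h with
  | id Y => rw [F.map_id]; exact .id _
  | step hZ c ht ih => rw [F.map_comp 0 0 0]; exact .step (hF _ hZ) (F.mapCone c) ih

/-- The Ore condition, with a square that commutes strictly. For one step, `u` induces a morphism
from the cone of `f` to the cone of `f ≫ u`, compatible with the inclusions; the rest of the tower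
is then pushed out along this morphism. -/
theorem exists_pushout (hE : HasCones k E) {Y K Y' : E} {t : Hom k Y K 0} (ht : Tower k P t)
    (u : Hom k Y Y' 0) (hu : D (ι u) = 0) : ∃ (K' : E) (t' : Hom k Y' K' 0) (u' : Hom k K K' 0),
      Tower k P t' ∧ D (ι u') = 0 ∧ ι t ≫ ι u' = ι u ≫ ι t' := by
  induction ht generalizing Y' with
  | id Y => exact ⟨Y', DGCategory.id Y', u, .id Y', hu, by simp [ι_id]⟩
  | @step Z Y K K' f hZ c t ht ih =>
    obtain ⟨K₁, ⟨c'⟩⟩ := hE Z Y' (comp 0 0 0 (zero_add 0) f u) (by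
      simp [ι_comp, D_comp, hu, c.D_base])
    obtain ⟨K₂, t', u', ht', hu', h⟩ := ih (comp 0 0 0 (zero_add 0) c.s
      (comp 0 0 0 (zero_add 0) u c'.i) + comp 1 (-1) 0 (by simp) c.p c'.j)
      (by simp [ι_comp, D_comp, hu, sg_comp])
    refine ⟨K₂, comp 0 0 0 (zero_add 0) c'.i t', u', .step hZ c' ht', hu', ?_⟩
    rw [ι_comp, Category.assoc, h, ι_comp]
    simp [ι_comp]

/-- Each step of the tower is injective in cohomology, because its kernel comes from `N(Z)` with `Z`
in `P`, which is acyclic. -/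
theorem exists_cobound (N : DGMod.{w, v, u, t} k E) (hN : ∀ Z, P Z → N.AcyclicAt Z)
    {Y K : E} {t : Hom k Y K 0} (ht : Tower k P t) {l n : ℤ} (h : l + 1 = n) {y : N.obj Y n}
    {e : N.obj K l} (he : N.tD (N.el e) = N.tact (ι t) (N.el y)) :
    ∃ y' : N.obj Y l, N.tD (N.el y') = N.el y := by
  induction ht with
  | id Y => exact ⟨e, by rw [he, ι_id, N.tact_id]⟩
  | step hZ c ht ih =>
    obtain ⟨e', he'⟩ := ih (y := N.act 0 n n (zero_add n) c.i y) (e := e)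
      (by rw [he, N.el_act, ← N.tact_comp, ι_comp])
    exact (hN _ hZ).exists_cobound N c h (by rw [he', N.el_act])

end Tower

variable {E' : Type u'} [DGCategory.{w, v} k E']

/-- The cocycles of the complexes `Cone(Hom(X, Y) → Hom(Ξ X, Ξ Y))` become coboundaries
along towers `Y → K`. -/
def Killable (Ξ : DGFunctor k E E') (P : E → Prop) (X : E) : Prop :=
  ∀ (Y : E) (m l n : ℤ), m + 1 = l → l + 1 = n → ∀ (a : Hom k X Y n)
    (c : Hom k (Ξ.obj X) (Ξ.obj Y) l), D (ι a) = 0 → D (ι c) + Ξ.tot (ι a) = 0 →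
    ∃ (K : E) (t : Hom k Y K 0) (b : Hom k X K l) (e : Hom k (Ξ.obj X) (Ξ.obj K) m),
      Tower k P t ∧ ι a ≫ ι t = -D (ι b) ∧ ι c ≫ Ξ.tot (ι t) = D (ι e) + Ξ.tot (ι b)

namespace Killable

variable {Ξ : DGFunctor k E E'} {P : E → Prop}

theorem of_id_eq_zero {X : E} (h : 𝟙 (⟨X⟩ : Tot k E) = 0) : Killable Ξ P X := by
  intro Y m l n hm hl a c _ _
  have h' := congrArg Ξ.tot h
  rw [Ξ.tot_id, map_zero] at h'
  refine ⟨Y, DGCategory.id Y, 0, 0, .id Y, ?_, ?_⟩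
  · rw [← Category.id_comp (ι a), h]
    simp
  · rw [← Category.id_comp (ι c), h']
    simp

theorem shift {X X' : E} {n m : ℤ} (hnm : n + m = 0) (s : ShiftData k X X' n m)
    (h : Killable Ξ P X) : Killable Ξ P X' := by
  intro Y p q r hp hq a c ha hc
  obtain ⟨K, t, b, e, ht, hb, he⟩ := h Y (n + p) (n + q) (n + r) (by omega) (by omega)
    (comp n r _ rfl s.σ a) (comp n q _ rfl (Ξ.map n s.σ) c)
    (by simp [ι_comp, D_comp, ha])
    (by
      rw [ι_comp, ι_comp, D_comp, Ξ.ι_map, Ξ.D_tot, s.D_σ, Ξ.tot_comp, map_zero, Limits.zero_comp,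
        add_zero, ← Preadditive.comp_add, hc, Limits.comp_zero])
  refine ⟨K, t, comp m (n + q) q (by omega) s.τ b, comp m (n + p) p (by omega) (Ξ.map m s.τ) e, ht,
    ?_, ?_⟩
  · rw [ι_comp, Category.assoc] at hb
    rw [ι_comp, D_comp, s.D_τ, Limits.zero_comp, add_zero, ← Preadditive.comp_neg, ← hb,
      s.τ_σ_assoc]
  · rw [ι_comp, Category.assoc] at he
    rw [ι_comp, ι_comp, D_comp, Ξ.ι_map, Ξ.D_tot, s.D_τ, map_zero, Limits.zero_comp, add_zero,
      Ξ.tot_comp, ← Preadditive.comp_add, ← he, Ξ.ι_map, ← Category.assoc, ← Ξ.tot_comp, s.τ_σ,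
      Ξ.tot_id, Category.id_comp]

/-- Dévissage in the first variable. First kill the restriction of the cocycle to `X₂`; after
subtraction of a coboundary it vanishes there and hence factors through the projection to `X₁[1]`.
It can then be killed using `X₁`, with all degrees lowered by one. The two towers are composed. -/
theorem cone {X₁ X₂ X : E} {f : Hom k X₁ X₂ 0} (κ : ConeData f X) (h₁ : Killable Ξ P X₁)
    (h₂ : Killable Ξ P X₂) : Killable Ξ P X := by
  intro Y m l n hm hl a c ha hc
  let κ' := Ξ.mapCone κ
  have hi : Ξ.tot (ι κ.i) = ι κ'.i := Ξ.tot_ι _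
  have hp : Ξ.tot (ι κ.p) = ι κ'.p := Ξ.tot_ι _
  have hs : Ξ.tot (ι κ.s) = ι κ'.s := Ξ.tot_ι _
  have hj : Ξ.tot (ι κ.j) = ι κ'.j := Ξ.tot_ι _
  obtain ⟨K, t, b, e, ht, hb, he⟩ := h₂ Y m l n hm hl (comp 0 n n (zero_add n) κ.i a)
    (comp 0 l l (zero_add l) κ'.i c) (by simp [ι_comp, D_comp, ha])
    (by
      rw [ι_comp, ι_comp, D_comp, κ'.D_i, Ξ.tot_comp, Limits.zero_comp, add_zero, hi,
        ← Preadditive.comp_add, hc, Limits.comp_zero])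
  have hDt := ht.D_eq_zero
  -- The primitive `(e, b)` over `X₂` is extended to `X` by means of the splitting `s`, and its
  -- coboundary is subtracted from the cocycle `(c, a)` pushed along `t`.
  let a₁ : Hom k X K n := comp n 0 n (add_zero n) a t + d l n hl (comp 0 l l (zero_add l) κ.s b)
  let c₁ : Hom k (Ξ.obj X) (Ξ.obj K) l := comp l 0 l (add_zero l) c (Ξ.map 0 t) -
    d m l hm (comp 0 m m (zero_add m) κ'.s e) - Ξ.map l (comp 0 l l (zero_add l) κ.s b)
  have ha₁ : ι a₁ = ι a ≫ ι t + D (ι κ.s ≫ ι b) := by simp [a₁, ι_comp, ι_d]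
  have hc₁ : ι c₁ = ι c ≫ Ξ.tot (ι t) - D (ι κ'.s ≫ ι e) - ι κ'.s ≫ Ξ.tot (ι b) := by
    simp [c₁, ι_comp, ι_d, Ξ.ι_map, hs]
  have hDa₁ : D (ι a₁) = 0 := by
    rw [ha₁, map_add, D_D, D_comp, hDt, ha]
    simp
  have hDc₁ : D (ι c₁) + Ξ.tot (ι a₁) = 0 := by
    have h' := congrArg (· ≫ Ξ.tot (ι t)) hc
    simp only [Preadditive.add_comp, Limits.zero_comp] at h'
    rw [hc₁, ha₁, map_sub, map_sub, D_D, D_comp, Ξ.D_tot, hDt, map_zero, Limits.comp_zero,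
      ← Ξ.tot_sg, sg_ι_zero, map_add, Ξ.tot_comp, Ξ.tot_D, Ξ.tot_comp, hs]
    rw [← h']
    abel
  have hia : ι κ.i ≫ ι a₁ = 0 := by
    rw [ι_comp, Category.assoc] at hb
    rw [ha₁, Preadditive.comp_add, hb, D_comp]
    simp
  have hic : ι κ'.i ≫ ι c₁ = 0 := by
    rw [ι_comp, Category.assoc] at he
    rw [hc₁, Preadditive.comp_sub, Preadditive.comp_sub, he, D_comp]
    simp
  -- A morphism out of a cone which vanishes on the summand `X₂` is determined by its restriction
  -- along `j`.
  have hpa : ι a₁ = ι κ.p ≫ ι κ.j ≫ ι a₁ := by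
    conv_lhs => rw [← Category.id_comp (ι a₁), ← κ.total]
    simp [hia]
  have hpc : ι c₁ = ι κ'.p ≫ ι κ'.j ≫ ι c₁ := by
    conv_lhs => rw [← Category.id_comp (ι c₁), ← κ'.total]
    simp [hic]
  obtain ⟨K₂, t₂, b₂, e₂, ht₂, hb₂, he₂⟩ := h₁ K (m - 1) (l - 1) (n - 1) (by omega) (by omega)
    (comp (-1) n _ (by omega) κ.j a₁) (comp (-1) l _ (by omega) κ'.j c₁)
    (by simp [ι_comp, D_comp, hDa₁, sg_ι, hia])
    (by
      rw [ι_comp, ι_comp, D_comp, κ'.D_j, Ξ.tot_comp, hj, sg_ι, Preadditive.comp_zsmul,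
        Category.assoc, hic, Limits.comp_zero, smul_zero, add_zero, ← Preadditive.comp_add, hDc₁,
        Limits.comp_zero])
  have hDt₂ := ht₂.D_eq_zero
  rw [ι_comp, Category.assoc] at hb₂ he₂
  refine ⟨K₂, comp 0 0 0 (zero_add 0) t t₂,
    comp 1 (l - 1) l (by omega) κ.p b₂ + comp 0 l l (zero_add l) κ.s (comp l 0 l (add_zero l) b t₂),
    comp 1 (m - 1) m (by omega) κ'.p e₂ +
      comp 0 m m (zero_add m) κ'.s (comp m 0 m (add_zero m) e (Ξ.map 0 t₂)), ht.trans ht₂, ?_, ?_⟩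
  · have h' : ι a ≫ ι t = ι a₁ - D (ι κ.s ≫ ι b) := by rw [ha₁, add_sub_cancel_right]
    have hX : D (ι κ.s ≫ ι b ≫ ι t₂) = D (ι κ.s ≫ ι b) ≫ ι t₂ := by
      rw [← Category.assoc, D_comp (ι κ.s ≫ ι b)]
      simp [hDt₂]
    rw [ι_comp, ← Category.assoc, h', Preadditive.sub_comp, hpa, Category.assoc, Category.assoc,
      hb₂, map_add, map_add, ι_comp, D_comp (ι κ.p), ι_comp, ι_comp, hX, κ.D_p]
    simp
    abel
  · have h' : ι c ≫ Ξ.tot (ι t) = ι c₁ + D (ι κ'.s ≫ ι e) + ι κ'.s ≫ Ξ.tot (ι b) := by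
      rw [hc₁]; abel
    have hX : D (ι κ'.s ≫ ι e ≫ Ξ.tot (ι t₂)) = D (ι κ'.s ≫ ι e) ≫ Ξ.tot (ι t₂) := by
      rw [← Category.assoc, D_comp (ι κ'.s ≫ ι e), Ξ.D_tot, hDt₂, ← Ξ.tot_sg]
      simp
    rw [ι_comp, Ξ.tot_comp, ← Category.assoc, h', Preadditive.add_comp, Preadditive.add_comp, hpc,
      Category.assoc, Category.assoc, he₂, map_add, map_add, ι_comp, D_comp (ι κ'.p), ι_comp,
      ι_comp, Ξ.ι_map, hX, κ'.D_p, map_add, map_add, ι_comp, ι_comp, ι_comp]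
    simp [hp, hs]
    abel

theorem of_generated {S : Type u''} {j : S → E} (h : ∀ s, Killable Ξ P (j s)) {X : E}
    (hX : Generated k j X) : Killable Ξ P X := by
  induction hX with
  | zero K h => exact of_id_eq_zero h
  | base s => exact h s
  | shift hnm c _ h => exact shift hnm c h
  | cone c _ _ hX hY => exact cone c hX hY

end Killable

end Towers


/-! ### Duality for towers -/

section TowerDuality

open Tot Opposite

variable {k : Type w} [CommRing k] {E : Type u} [DGCategory.{w, v} k E] {E' : Type u'}
  [DGCategory.{w, v} k E']

theorem opHom_comp_zero {X Y Z : E} (f : Hom k X Y 0) (g : Hom k Y Z 0) :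
    comp 0 0 0 (zero_add 0) (opHom g) (opHom f) = opHom (comp 0 0 0 (zero_add 0) f g) := by
  change sgn (0 * 0) • comp 0 0 0 (zero_add 0) f g = _
  rw [mul_zero, sgn_zero, one_smul]
  rfl

theorem Tot.unopHom_tot_opHom (Ξ : DGFunctor k E E') {X Y : E} {n : ℤ} (f : Hom k X Y n) :
    unopHom (Ξ.op.tot (ι (opHom f))) = Ξ.tot (ι f) := by
  rw [DGFunctor.tot_ι, DGFunctor.tot_ι]
  rfl

/-- Morphisms into a contractible object which are closed are coboundaries. -/
theorem IsContractible.exists_eq {X Z : E} (hZ : IsContractible k Z) {m l : ℤ} (h : m + 1 = l)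
    {c : Hom k X Z l} (hc : D (ι c) = 0) : ∃ e : Hom k X Z m, D (ι e) = ι c := by
  obtain ⟨s, hs⟩ := hZ
  have hs' : D (ι s) = 𝟙 (⟨Z⟩ : Tot k E) := by rw [D_ι (-1) 0 (by simp), hs, ι_id]
  refine ⟨comp l (-1) m (by omega) c s, ?_⟩
  rw [ι_comp, D_comp, hc, hs']
  simp

variable {Ξ : DGFunctor k E E'} {P : E → Prop}

/-- A tower out of the target is traded for a cotower into the source, by induction on the tower.
Once `r : X₁ → X` solves the problem with values in the cone `K₁` of `f : Z → Y`, what remains over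
`Y` is, up to a coboundary, the image under `f` of a cocycle `(c₀, a₀)` with values in `Z`. Passing
to the fibre of `a₀ : X₁ → Z[n]` makes `a₀` a coboundary; the rest is a closed morphism into the
contractible object `Ξ Z`, hence a coboundary. -/
theorem Tower.exists_cotower
    (hP : ∀ X, P X → ∀ n m : ℤ, n + m = 0 → ∃ X', P X' ∧ Nonempty (ShiftData k X X' n m))
    (hE : HasCones k Eᵒᵖ) (hΞ : ∀ Z, P Z → IsContractible k (Ξ.obj Z)) {Y K : E}
    {t : Hom k Y K 0} (ht : Tower k P t) {X : E} {m l n : ℤ} (hm : m + 1 = l) (hl : l + 1 = n)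
    (a : Hom k X Y n) (c : Hom k (Ξ.obj X) (Ξ.obj Y) l) (ha : D (ι a) = 0)
    (hc : D (ι c) + Ξ.tot (ι a) = 0) (b : Hom k X K l) (e : Hom k (Ξ.obj X) (Ξ.obj K) m)
    (hb : ι a ≫ ι t = -D (ι b)) (he : ι c ≫ Ξ.tot (ι t) = D (ι e) + Ξ.tot (ι b)) :
    ∃ (X' : E) (r : Hom k X' X 0) (b' : Hom k X' Y l) (e' : Hom k (Ξ.obj X') (Ξ.obj Y) m),
      Tower k (fun X : Eᵒᵖ => P X.unop) (opHom r) ∧ ι r ≫ ι a = -D (ι b') ∧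
        Ξ.tot (ι r) ≫ ι c = D (ι e') + Ξ.tot (ι b') := by
  induction ht with
  | id Y =>
    refine ⟨X, DGCategory.id X, b, e, .id (op X), ?_, ?_⟩
    · rw [← hb]
      simp [ι_id]
    · rw [← he]
      simp [ι_id]
  | @step Z Y K₁ K f hZ κ t ht ih =>
    let κ' := Ξ.mapCone κ
    have hi : Ξ.tot (ι κ.i) = ι κ'.i := Ξ.tot_ι _
    have hp : Ξ.tot (ι κ.p) = ι κ'.p := Ξ.tot_ι _
    have hs : Ξ.tot (ι κ.s) = ι κ'.s := Ξ.tot_ι _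
    rw [ι_comp] at hb he
    obtain ⟨X₁, r, b₁, e₁, hr, hb₁, he₁⟩ := ih (comp n 0 n (add_zero n) a κ.i)
      (comp l 0 l (add_zero l) c κ'.i) (by simp [ι_comp, D_comp, ha])
      (by
        have h' := congrArg (· ≫ ι κ'.i) hc
        simp only [Preadditive.add_comp, Limits.zero_comp] at h'
        rw [ι_comp, ι_comp, D_comp, κ'.D_i, Ξ.tot_comp, Limits.comp_zero, zero_add, hi, sg_ι_zero,
          h']) b e
      (by rw [ι_comp, Category.assoc, hb])
      (by rw [ι_comp, Category.assoc, ← hi, ← Ξ.tot_comp, he])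
    have hDr : D (ι r) = 0 := by
      have := congrArg unopHom hr.D_eq_zero
      rwa [unopHom_D_opHom, map_zero] at this
    rw [ι_comp] at hb₁ he₁
    -- Up to sign, these are the components of the primitive `(e₁, b₁)` in the summand `Z[1]` of the
    -- cone: the obstruction to using its components in `Y` as a primitive.
    let a₀ : Hom k X₁ Z n := -comp l 1 n hl b₁ κ.p
    let c₀ : Hom k (Ξ.obj X₁) (Ξ.obj Z) l := comp m 1 l hm e₁ κ'.p
    have ha₀ : ι a₀ = -(ι b₁ ≫ ι κ.p) := by simp [a₀, ι_comp]
    have hc₀ : ι c₀ = ι e₁ ≫ ι κ'.p := by simp [c₀, ι_comp]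
    clear_value a₀ c₀
    have hDb₁ : D (ι b₁) = -(ι r ≫ ι a ≫ ι κ.i) := by rw [hb₁, neg_neg]
    have hDe₁ : D (ι e₁) = Ξ.tot (ι r) ≫ ι c ≫ ι κ'.i - Ξ.tot (ι b₁) := by
      rw [he₁, add_sub_cancel_right]
    have hDa₀ : D (ι a₀) = 0 := by
      rw [ha₀, map_neg, D_comp, hDb₁]
      simp
    have hDc₀ : D (ι c₀) + Ξ.tot (ι a₀) = 0 := by
      rw [hc₀, ha₀, D_comp, hDe₁]
      simp [hp, Preadditive.sub_comp]
    have ha₁ : ι r ≫ ι a = ι a₀ ≫ ι f - D (ι b₁ ≫ ι κ.s) := by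
      rw [ha₀, D_comp, hDb₁]
      simp
    have hc₁ : Ξ.tot (ι r) ≫ ι c = ι c₀ ≫ Ξ.tot (ι f) + D (ι e₁ ≫ ι κ'.s) +
        Ξ.tot (ι b₁ ≫ ι κ.s) := by
      rw [hc₀, D_comp, hDe₁]
      simp [hs, Preadditive.sub_comp, Ξ.ι_map]
    -- `Z'` is `Z[n]`, so that `a₀` becomes a morphism of degree zero. Its fibre is obtained as a
    -- cone in the dual category, which is a single step of a tower there.
    obtain ⟨Z', hZ', ⟨z⟩⟩ := hP Z hZ (-n) n (by omega)
    obtain ⟨W, ⟨w⟩⟩ := hE (op Z') (op X₁) (opHom (comp n (-n) 0 (by omega) a₀ z.σ))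
      (unopHom_injective (by rw [unopHom_D_opHom, map_zero]; simp [ι_comp, D_comp, hDa₀]))
    let q : Hom k W.unop X₁ 0 := w.i
    let j : Hom k W.unop Z' (-1) := w.j
    have hq : D (ι q) = 0 := by
      have := congrArg unopHom w.D_i
      exact (unopHom_D_opHom q).symm.trans (this.trans (map_zero _))
    have hj : D (ι j) = ι q ≫ ι a₀ ≫ ι z.σ := by
      have h1 := congrArg unopHom w.D_j
      have h2 := (unopHom_D_opHom j).symm.trans (h1.trans
        (unopHom_comp (X := W.unop) q (comp n (-n) 0 (by omega) a₀ z.σ)))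
      rw [h2, mul_zero, sgn_zero, one_smul, ι_comp]
    have hqa : ι q ≫ ι a₀ = sgn n • D (ι j ≫ ι z.τ) := by
      rw [D_comp, hj, z.D_τ, sg_ι, Limits.comp_zero, zero_add, Preadditive.comp_zsmul, smul_smul,
        sgn_mul_self, one_smul, Category.assoc, Category.assoc, z.σ_τ, Category.comp_id]
    -- On the fibre, `a₀` has the primitive `sgn n • j ≫ z.τ`. Adding its image under `Ξ` to `c₀`
    -- gives a closed morphism into `Ξ Z`.
    obtain ⟨e₂, he₂⟩ := (hΞ Z hZ).exists_eq hm
      (c := comp 0 l l (zero_add l) (Ξ.map 0 q) c₀ +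
        Ξ.map l (sgn n • comp (-1) n l (by omega) j z.τ)) (by
      rw [map_add, map_add, ι_comp, D_comp, Ξ.ι_map, Ξ.ι_map, Ξ.D_tot, Ξ.D_tot, hq, map_zero,
        Limits.zero_comp, add_zero, map_zsmul, map_zsmul, ι_comp, ← hqa, Ξ.tot_comp,
        ← Preadditive.comp_add, hDc₀, Limits.comp_zero])
    rw [map_add, ι_comp, Ξ.ι_map, Ξ.ι_map, map_zsmul, map_zsmul, ι_comp] at he₂
    refine ⟨W.unop, comp 0 0 0 (zero_add 0) q r,
      comp 0 l l (zero_add l) q (comp l 0 l (add_zero l) b₁ κ.s) -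
        sgn n • comp l 0 l (add_zero l) (comp (-1) n l (by omega) j z.τ) f,
      comp 0 m m (zero_add m) (Ξ.map 0 q) (comp m 0 m (add_zero m) e₁ κ'.s) +
        comp m 0 m (add_zero m) e₂ (Ξ.map 0 f), ?_, ?_, ?_⟩
    · rw [← opHom_comp_zero]
      exact hr.trans (.of_cone (P := fun X : Eᵒᵖ => P X.unop) hZ' w)
    · have h3 : D ((ι j ≫ ι z.τ) ≫ ι f) = D (ι j ≫ ι z.τ) ≫ ι f := by
        rw [D_comp (ι j ≫ ι z.τ), κ.D_base]
        simp
      rw [ι_comp, Category.assoc, ha₁, Preadditive.comp_sub, ← Category.assoc, hqa]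
      simp only [map_sub, map_zsmul, ι_comp, h3, D_comp (ι q), hq, Preadditive.zsmul_comp]
      simp
    · have h3 : D (ι e₂ ≫ Ξ.tot (ι f)) = D (ι e₂) ≫ Ξ.tot (ι f) := by
        rw [D_comp, Ξ.D_tot, κ.D_base, ← Ξ.tot_sg]
        simp
      rw [ι_comp, Ξ.tot_comp, Category.assoc, hc₁]
      simp only [map_add, map_sub, map_zsmul, ι_comp, Ξ.ι_map, h3, D_comp (Ξ.tot (ι q)), Ξ.D_tot, hq,
        he₂, Ξ.tot_comp, Preadditive.comp_add, Preadditive.add_comp, Preadditive.zsmul_comp]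
      simp
      abel

/-- A cocycle from `X` to `Y` in the dual category is a cocycle from `Y` to `X` in `E`. Killability
of `Y` provides a tower out of `X`, and `Tower.exists_cotower` converts it into a cotower into `Y`,
which is a tower out of `Y` in the dual. -/
theorem Killable.op
    (hP : ∀ X, P X → ∀ n m : ℤ, n + m = 0 → ∃ X', P X' ∧ Nonempty (ShiftData k X X' n m))
    (hE : HasCones k Eᵒᵖ) (hΞ : ∀ Z, P Z → IsContractible k (Ξ.obj Z))
    (h : ∀ X, Killable Ξ P X) (X : Eᵒᵖ) : Killable Ξ.op (fun X => P X.unop) X := by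
  intro Y m l n hm hl a c ha hc
  let a' : Hom k Y.unop X.unop n := a
  let c' : Hom k (Ξ.obj Y.unop) (Ξ.obj X.unop) l := c
  have ha' : D (ι a') = 0 := (unopHom_D_opHom a').symm.trans ((congrArg unopHom ha).trans
    (map_zero _))
  have hc' : D (ι c') + Ξ.tot (ι a') = 0 := by
    have := congrArg unopHom hc
    rw [map_add, map_zero] at this
    refine Eq.trans ?_ this
    exact congrArg₂ (· + ·) (unopHom_D_opHom c').symm (unopHom_tot_opHom Ξ a').symm
  obtain ⟨K, t, b, e, ht, hb, he⟩ := h Y.unop X.unop m l n hm hl a' c' ha' hc'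
  obtain ⟨X', r, b', e', hr, hb', he'⟩ :=
    ht.exists_cotower hP hE hΞ hm hl a' c' ha' hc' b e hb he
  refine ⟨Opposite.op X', opHom r, opHom b', opHom e', hr, unopHom_injective ?_,
    unopHom_injective ?_⟩
  · refine (unopHom_comp r a').trans ?_
    rw [map_neg, unopHom_D_opHom, mul_zero, sgn_zero, one_smul, hb']
  · rw [map_add]
    refine Eq.trans ?_ (he'.trans (congrArg₂ (· + ·) (unopHom_D_opHom e').symm
      (unopHom_tot_opHom Ξ b').symm))
    rw [DGFunctor.tot_ι, DGFunctor.tot_ι]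
    refine (unopHom_comp (Ξ.map 0 r) c').trans ?_
    rw [mul_zero, sgn_zero, one_smul]

/-- The canonical DG functor from the double dual. -/
def unopUnop (k : Type w) [CommRing k] (E : Type u) [DGCategory.{w, v} k E] :
    DGFunctor k Eᵒᵖᵒᵖ E where
  obj X := X.unop.unop
  map n := LinearMap.id
  map_d _ _ _ _ := rfl
  map_id _ := rfl
  map_comp {X Y Z} p q n h f g := by
    change sgn (p * q) • sgn (q * p) • comp p q n h (X := X.unop.unop) (Y := Y.unop.unop)
      (Z := Z.unop.unop) f g = comp p q n h (X := X.unop.unop) (Y := Y.unop.unop)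
      (Z := Z.unop.unop) f g
    rw [smul_smul, mul_comm q p, sgn_mul_self, one_smul]

/-- Allows the passage to the dual to be applied twice, for the converse. The double dual has the
same Hom complexes, with the sign of its composition squared away; `unopUnop` carries the tower
back. -/
theorem Killable.of_op_op {X : E} (h : Killable Ξ.op.op (fun X : Eᵒᵖᵒᵖ => P X.unop.unop)
    (Opposite.op (Opposite.op X))) : Killable Ξ P X := by
  have hinj : ∀ {Y Z : Eᵒᵖᵒᵖ} {n : ℤ} (f : Hom k Y Z n), (unopUnop k E).tot (ι f) =
      ι (X := Y.unop.unop) (Y := Z.unop.unop) f := fun f => (unopUnop k E).tot_ι f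
  have hinj' : ∀ {Y Z : E'ᵒᵖᵒᵖ} {n : ℤ} (f : Hom k Y Z n), (unopUnop k E').tot (ι f) =
      ι (X := Y.unop.unop) (Y := Z.unop.unop) f := fun f => (unopUnop k E').tot_ι f
  have hΞ : ∀ {Y Z : Eᵒᵖᵒᵖ} {n : ℤ} (f : Hom k Y Z n), (unopUnop k E').tot (Ξ.op.op.tot (ι f)) =
      Ξ.tot (ι (X := Y.unop.unop) (Y := Z.unop.unop) f) := fun f => by
    rw [DGFunctor.tot_ι, DGFunctor.tot_ι, DGFunctor.tot_ι]
    rfl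
  intro Y m l n hm hl a c ha hc
  obtain ⟨K, t, b, e, ht, hb, he⟩ := h (Opposite.op (Opposite.op Y)) m l n hm hl a c
    (unopHom_injective (unopHom_injective (by
      refine (congrArg unopHom (unopHom_D_opHom (opHom a))).trans ?_
      exact (unopHom_D_opHom a).trans (ha.trans (map_zero _).symm))))
    (by
      refine unopHom_injective (unopHom_injective ?_)
      rw [map_add, map_add]
      refine Eq.trans ?_ (hc.trans (map_zero _).symm)
      exact congrArg₂ (· + ·) ((congrArg unopHom (unopHom_D_opHom (opHom c))).trans
        (unopHom_D_opHom c)) ((congrArg unopHom (unopHom_tot_opHom Ξ.op (opHom a))).trans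
        (unopHom_tot_opHom Ξ a)))
  refine ⟨K.unop.unop, t, b, e, ht.map (unopUnop k E) (fun X hX => hX), ?_, ?_⟩
  · have := congrArg (unopUnop k E).tot hb
    rw [DGFunctor.tot_comp, map_neg, DGFunctor.tot_D, hinj, hinj, hinj] at this
    exact this
  · have := congrArg (unopUnop k E').tot he
    rw [DGFunctor.tot_comp, map_add, DGFunctor.tot_D] at this
    refine Eq.trans ?_ (this.trans ?_)
    · exact congrArg₂ (· ≫ ·) (hinj' (Y := Opposite.op (Opposite.op (Ξ.obj X)))
        (Z := Opposite.op (Opposite.op (Ξ.obj Y))) c).symm (hΞ t).symm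
    · exact congrArg₂ (· + ·) (congrArg D (hinj' e)) (hΞ b)

end TowerDuality


/-! ### Semi-free modules -/

section Semifree

open Tot

variable {k : Type w} [CommRing k] {E : Type u} [DGCategory.{w, u} k E] {S : Type u} (j : S → E)
  (N : DGMod.{w, u, u, u} k E)

/-- Cells of a semi-free module over `N`. A cell of degree `r` at `b` records a linear combination
of cells, intended as its boundary, and an element of `N`, intended as its image. -/
inductive Cell : S → ℤ → Type u
  | mk (b : S) (r : ℤ) (n : ℕ) (c : Fin n → S) (s : Fin n → ℤ) (sub : ∀ i, Cell (c i) (s i))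
      (coef : ∀ i, Hom k (j (c i)) (j b) (r + 1 - s i)) (x : N.obj (j b) r) : Cell b r

/-- The set of all cells. -/
abbrev Cells : Type u := Σ b : S, Σ r : ℤ, Cell j N b r

noncomputable instance : DecidableEq (Cells j N) := Classical.decEq _

/-- The linear combinations of cells. -/
abbrev CellObj (Y : E) (n : ℤ) : Type u :=
  DirectSum (Cells j N) fun g => Hom k (j g.1) Y (n - g.2.1)

variable {j N}

/-- The multiples of a cell. -/
noncomputable def cel {Y : E} {n : ℤ} (g : Cells j N) :
    Hom k (j g.1) Y (n - g.2.1) →ₗ[k] CellObj j N Y n :=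
  DirectSum.lof k _ (fun g : Cells j N => Hom k (j g.1) Y (n - g.2.1)) g

theorem cell_induction {Y : E} {n : ℤ} {p : CellObj j N Y n → Prop} (x : CellObj j N Y n)
    (zero : p 0) (homog : ∀ g e, p (cel g e)) (add : ∀ x y, p x → p y → p (x + y)) : p x :=
  DirectSum.induction_on x zero homog add

theorem exists_eq_sum_cel {Y : E} {n : ℤ} (x : CellObj j N Y n) :
    ∃ (m : ℕ) (g : Fin m → Cells j N) (e : ∀ i, Hom k (j (g i).1) Y (n - (g i).2.1)),
      (∀ i, x (g i) ≠ 0) ∧ x = ∑ i, cel (g i) (e i) := by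
  classical
  refine ⟨_, fun i => ((DFinsupp.support x).equivFin.symm i).1, fun i => x _,
    fun i => DFinsupp.mem_support_iff.mp ((DFinsupp.support x).equivFin.symm i).2, ?_⟩
  rw [Equiv.sum_comp (DFinsupp.support x).equivFin.symm (fun g => cel g.1 (x g.1)),
    Finset.sum_coe_sort (DFinsupp.support x) (fun g => cel g (x g))]
  exact (DirectSum.sum_support_of x).symm

variable (j N) in
/-- The action on linear combinations of cells. -/
noncomputable def cellAct {Y Z : E} (p q n : ℤ) (h : p + q = n) :
    Hom k Y Z p →ₗ[k] CellObj j N Y q →ₗ[k] CellObj j N Z n :=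
  (DirectSum.toModule k (Cells j N) _ fun g =>
    (comp (q - g.2.1) p (n - g.2.1) (by omega)).compr₂ (cel g)).flip

theorem cellAct_cel {Y Z : E} (p q n : ℤ) (h : p + q = n) (f : Hom k Y Z p) (g : Cells j N)
    (e : Hom k (j g.1) Y (q - g.2.1)) :
    cellAct j N p q n h f (cel g e) = cel g (comp (q - g.2.1) p (n - g.2.1) (by omega) e f) := by
  rw [cellAct, LinearMap.flip_apply, cel, DirectSum.toModule_lof]
  rfl

theorem cel_apply_self {Y : E} {n : ℤ} (g : Cells j N) (e : Hom k (j g.1) Y (n - g.2.1)) :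
    cel g e g = e := DirectSum.of_eq_same (β := fun g : Cells j N => Hom k (j g.1) Y (n - g.2.1)) g e

theorem cel_apply_ne {Y : E} {n : ℤ} {g g' : Cells j N} (hg : g ≠ g')
    (e : Hom k (j g.1) Y (n - g.2.1)) : cel g e g' = 0 := 
  DirectSum.of_eq_of_ne (β := fun g : Cells j N => Hom k (j g.1) Y (n - g.2.1)) g g' e hg.symm

theorem cellAct_apply {Y Z : E} (p q n : ℤ) (h : p + q = n) (f : Hom k Y Z p)
    (x : CellObj j N Y q) (g : Cells j N) :
    cellAct j N p q n h f x g = comp (q - g.2.1) p (n - g.2.1) (by omega) (x g) f := by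
  induction x using cell_induction with
  | zero => simp
  | add x y hx hy => rw [map_add, DirectSum.add_apply, hx, hy, DirectSum.add_apply]; simp
  | homog g' e =>
    rw [cellAct_cel]
    by_cases hg : g' = g
    · subst hg
      rw [cel_apply_self, cel_apply_self]
    · rw [cel_apply_ne hg, cel_apply_ne hg]
      simp

theorem cellAct_comp {X Y Z : E} (p q r a b n : ℤ) (h₁ : p + q = a) (h₂ : a + r = n)
    (h₃ : p + r = b) (h₄ : q + b = n) (f : Hom k X Y p) (g : Hom k Y Z q) (x : CellObj j N X r) :
    cellAct j N a r n h₂ (comp p q a h₁ f g) x =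
      cellAct j N q b n h₄ g (cellAct j N p r b h₃ f x) := by
  induction x using cell_induction with
  | zero => simp
  | add x y hx hy => simp only [map_add, hx, hy]
  | homog c e =>
    rw [cellAct_cel, cellAct_cel, cellAct_cel]
    exact congrArg (cel c) (DGCategory.assoc (r - c.2.1) p q (b - c.2.1) a (n - c.2.1) (by omega)
      (by omega) h₁ (by omega) e f g).symm

open Classical in
/-- The boundary and the image of a cell. They are zero if the data recorded by the cell are
inconsistent. -/
noncomputable def Cell.val : ∀ {b : S} {r : ℤ}, Cell j N b r →
    CellObj j N (j b) (r + 1) × N.obj (j b) r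
  | _, _, .mk _ r _ c s sub coef x =>
    -- Consistency means that the recorded boundary is a cocycle and that its image is the
    -- differential of `x`. Both are written out on the sub-cells, since `cellD` and `cellAug` are
    -- defined from `val`.
    if ∑ i, (cel ⟨c i, s i, sub i⟩ (DG.d (r + 1 - s i) (r + 1 + 1 - s i) (by omega) (coef i)) +
          sgn (r + 1 - s i) • cellAct j N (r + 1 - s i) (s i + 1) (r + 1 + 1) (by omega) (coef i)
            (val (sub i)).1) = 0 ∧
        N.d r (r + 1) rfl x = ∑ i, N.act (r + 1 - s i) (s i) (r + 1) (by omega) (coef i)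
          (val (sub i)).2 then
      (∑ i, cel ⟨c i, s i, sub i⟩ (coef i), x)
    -- An inconsistent cell becomes a free generator with zero boundary and zero image, which does
    -- no harm.
    else 0

/-- The differential on linear combinations of cells. -/
noncomputable def cellD {Y : E} (n m : ℤ) (h : n + 1 = m) : CellObj j N Y n →ₗ[k] CellObj j N Y m :=
  DirectSum.toModule k (Cells j N) _ fun g =>
    cel g ∘ₗ DG.d (n - g.2.1) (m - g.2.1) (by omega) +
      sgn (n - g.2.1) • (cellAct j N (n - g.2.1) (g.2.1 + 1) m (by omega)).flip g.2.2.val.1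

theorem cellD_cel {Y : E} (n m : ℤ) (h : n + 1 = m) (g : Cells j N)
    (e : Hom k (j g.1) Y (n - g.2.1)) : cellD n m h (cel g e) =
      cel g (DG.d (n - g.2.1) (m - g.2.1) (by omega) e) +
        sgn (n - g.2.1) • cellAct j N (n - g.2.1) (g.2.1 + 1) m (by omega) e g.2.2.val.1 := by
  rw [cellD, cel, DirectSum.toModule_lof]
  rfl

/-- The augmentation on linear combinations of cells. -/
noncomputable def cellAug {Y : E} (n : ℤ) : CellObj j N Y n →ₗ[k] N.obj Y n :=
  DirectSum.toModule k (Cells j N) _ fun g =>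
    (N.act (n - g.2.1) g.2.1 n (by omega)).flip g.2.2.val.2

theorem cellAug_cel {Y : E} (n : ℤ) (g : Cells j N) (e : Hom k (j g.1) Y (n - g.2.1)) :
    cellAug n (cel g e) = N.act (n - g.2.1) g.2.1 n (by omega) e g.2.2.val.2 := by
  rw [cellAug, cel, DirectSum.toModule_lof]
  rfl

theorem cellAug_act {Y Z : E} (p q n : ℤ) (h : p + q = n) (f : Hom k Y Z p)
    (x : CellObj j N Y q) : cellAug n (cellAct j N p q n h f x) = N.act p q n h f (cellAug q x) := by
  induction x using cell_induction with
  | zero => simp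
  | add x y hx hy => simp only [map_add, hx, hy]
  | homog g e =>
    rw [cellAct_cel, cellAug_cel, cellAug_cel]
    exact N.comp_act (q - g.2.1) p g.2.1 (n - g.2.1) q n (by omega) (by omega) (by omega) h e f _

/-- True by the test for consistent cells and trivially for the others. The first half yields `d² =
0` on the semi-free module, the second that the augmentation is closed. -/
theorem Cell.val_spec {b : S} {r : ℤ} (g : Cell j N b r) :
    cellD (r + 1) (r + 1 + 1) rfl g.val.1 = 0 ∧ N.d r (r + 1) rfl g.val.2 = cellAug (r + 1) g.val.1 := by
  obtain ⟨_, r, n, c, s, sub, coef, x⟩ := g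
  rw [Cell.val]
  split_ifs with h
  · refine ⟨?_, ?_⟩
    · rw [map_sum, ← h.1]
      exact Finset.sum_congr rfl fun i _ => cellD_cel _ _ _ _ _
    · rw [map_sum, h.2]
      exact Finset.sum_congr rfl fun i _ => (cellAug_cel _ ⟨c i, s i, sub i⟩ _).symm
  · simp

/-- A linear combination of cells together with an element of `N` is exactly the data of a cell.
Because of this self-reference no iterated attaching of cells is needed: every cocycle that should
be killed already has its cell. -/
theorem exists_cell {b : S} {r : ℤ} (y : CellObj j N (j b) (r + 1)) (x : N.obj (j b) r)
    (hy : cellD (r + 1) (r + 1 + 1) rfl y = 0) (hx : N.d r (r + 1) rfl x = cellAug (r + 1) y) :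
    ∃ g : Cell j N b r, g.val = (y, x) := by
  obtain ⟨n, c, coef, _, rfl⟩ := exists_eq_sum_cel y
  refine ⟨.mk b r n (fun i => (c i).1) (fun i => (c i).2.1) (fun i => (c i).2.2) coef x, ?_⟩
  rw [Cell.val, if_pos]
  refine ⟨?_, ?_⟩
  · rw [← hy, map_sum]
    exact Finset.sum_congr rfl fun i _ => (cellD_cel _ _ _ _ _).symm
  · rw [hx, map_sum]
    exact Finset.sum_congr rfl fun i _ => cellAug_cel _ (c i) _

theorem cellD_act {Y Z : E} (p q n p' q' n' : ℤ) (h : p + q = n) (hp : p + 1 = p')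
    (hq : q + 1 = q') (hn : n + 1 = n') (h₁ : p' + q = n') (h₂ : p + q' = n') (f : Hom k Y Z p)
    (x : CellObj j N Y q) : cellD n n' hn (cellAct j N p q n h f x) =
      cellAct j N p' q n' h₁ (DG.d p p' hp f) x +
        sgn p • cellAct j N p q' n' h₂ f (cellD q q' hq x) := by
  induction x using cell_induction with
  | zero => simp
  | add x y hx hy => simp only [map_add, hx, hy, smul_add]; abel
  | homog g e =>
    have hs : sgn (n - g.2.1) = sgn p * sgn (q - g.2.1) := by
      rw [← sgn_add]
      congr 1
      omega
    rw [cellAct_cel, cellD_cel, cellD_cel, cellAct_cel, map_add, cellAct_cel, map_zsmul,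
      ← cellAct_comp (q - g.2.1) p (g.2.1 + 1) (n - g.2.1) q' n' (by omega) (by omega) (by omega)
        (by omega),
      DGCategory.leibniz (q - g.2.1) p (n - g.2.1) (q' - g.2.1) p' (n' - g.2.1) (by omega)
        (by omega) hp (by omega) (by omega) (by omega), map_add, map_zsmul, smul_add, smul_smul, hs]
    abel

variable (j N)

/-- The semi-free module generated by all cells. -/
noncomputable abbrev semifree : DGMod.{w, u, u, u} k E where
  obj Y n := CellObj j N Y n
  d n m h := cellD n m h
  act p q n h := cellAct j N p q n h
  d_d {X} l m n h h' x := by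
    induction x using cell_induction with
    | zero => simp
    | add x y hx hy => rw [map_add, map_add, hx, hy, add_zero]
    | homog g e =>
      have h1 : cellD (g.2.1 + 1) (g.2.1 + 1 + 1) rfl g.2.2.val.1 = 0 := g.2.2.val_spec.1
      have hs : sgn (m - g.2.1) = -sgn (l - g.2.1) := by
        rw [show m - g.2.1 = (l - g.2.1) + 1 by omega, sgn_add, sgn_one, mul_neg_one]
      rw [cellD_cel, map_add, map_zsmul, cellD_cel,
        cellD_act (l - g.2.1) (g.2.1 + 1) m (m - g.2.1) (g.2.1 + 1 + 1) n (by omega) (by omega) rfl h'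
          (by omega) (by omega), h1, DGCategory.d_d, map_zero, map_zero, zero_add, smul_zero,
        add_zero, hs, neg_smul, neg_add_cancel]
  id_act {X} n x := by
    induction x using cell_induction with
    | zero => simp
    | add x y hx hy => rw [map_add, hx, hy]
    | homog g e => rw [cellAct_cel]; exact congrArg (cel g) (DGCategory.comp_id _ e)
  comp_act := cellAct_comp
  leibniz := cellD_act

/-- The augmentation, as a family of linear maps. -/
noncomputable def cellAugFam : DGMod.Fam (semifree j N) N 0 :=
  fun X n => N.objCast X (add_zero n).symm ∘ₗ cellAug n

theorem cellAugFam_app {X : E} (n : ℤ) (h : n + 0 = n) (x : CellObj j N X n) :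
    DGMod.Fam.app (cellAugFam j N) X n n h x = cellAug n x :=
  DGMod.objCast_objCast N X _ _ _

theorem cellAugFam_mem : cellAugFam j N ∈ DGMod.homs (semifree j N) N 0 := by
  intro X Y a p p' q q' h hq hq' h' f x
  obtain rfl : p = q := by omega
  obtain rfl : p' = q' := by omega
  rw [zero_mul, sgn_zero, one_smul]
  refine (cellAugFam_app j N p' hq' _).trans ((cellAug_act a p p' h f x).trans ?_)
  exact congrArg (N.act a p p' h' f) (cellAugFam_app j N p hq x).symm

theorem cellAugFam_closed : DGMod.famD 0 1 (zero_add 1) (cellAugFam j N) = 0 := by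
  refine DGMod.Fam.ext_app fun X p q h x => ?_
  rw [DGMod.famD_apply 0 1 _ _ X p p q q (add_zero p) h h (add_zero q), DGMod.Fam.zero_app,
    sgn_zero, one_smul, sub_eq_zero]
  refine (congrArg (N.d p q h) (cellAugFam_app j N p _ x)).trans
    (Eq.trans ?_ (cellAugFam_app j N q _ (cellD p q h x)).symm)
  induction x using cell_induction with
  | zero => simp
  | add x y hx hy => simp only [map_add, hx, hy]
  | homog g e =>
    have h1 : N.d g.2.1 (g.2.1 + 1) rfl g.2.2.val.2 = cellAug (g.2.1 + 1) g.2.2.val.1 :=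
      g.2.2.val_spec.2
    rw [cellAug_cel, cellD_cel, map_add, map_zsmul, cellAug_cel, cellAug_act, ← h1]
    exact N.leibniz (p - g.2.1) g.2.1 p (q - g.2.1) (g.2.1 + 1) q (by omega) (by omega) rfl h
      (by omega) (by omega) e _

/-- The augmentation of the semi-free module generated by all cells. -/
noncomputable def semifreeAug : closed k (semifree j N) N :=
  ⟨(⟨cellAugFam j N, cellAugFam_mem j N⟩ : DGMod.homs _ _ 0), Subtype.ext (cellAugFam_closed j N)⟩

/-- The cell `g`, as an element of the semi-free module. -/
noncomputable def cellGen (g : Cells j N) : CellObj j N (j g.1) g.2.1 :=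
  cel g (idOfEq rfl (sub_self _))

theorem cellAct_gen (g : Cells j N) {Y : E} (p n : ℤ) (h : p + g.2.1 = n)
    (e : Hom k (j g.1) Y (n - g.2.1)) :
    cellAct j N p g.2.1 n h (degCast (by omega) e) (cellGen j N g) = cel g e := by
  obtain rfl : p = n - g.2.1 := by omega
  rw [cellGen, cellAct_cel]
  refine congrArg (cel g) (ι_injective ?_)
  rw [ι_comp, ι_idOfEq, Category.id_comp, ι_degCast]

theorem cellAug_gen (g : Cells j N) : cellAug g.2.1 (cellGen j N g) = g.2.2.val.2 := by
  rw [cellGen, cellAug_cel]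
  have : ∀ (a : ℤ) (h0 : a = 0) (h : a + g.2.1 = g.2.1),
      N.act a g.2.1 g.2.1 h (idOfEq rfl h0) g.2.2.val.2 = g.2.2.val.2 := by
    rintro a rfl h
    exact N.id_act _ _
  exact this _ _ _

theorem cellD_gen (g : Cells j N) :
    cellD g.2.1 (g.2.1 + 1) rfl (cellGen j N g) = g.2.2.val.1 := by
  rw [cellGen, cellD_cel, d_idOfEq, map_zero, zero_add]
  have : ∀ (a : ℤ) (h0 : a = 0) (h : a + (g.2.1 + 1) = g.2.1 + 1),
      sgn a • cellAct j N a (g.2.1 + 1) (g.2.1 + 1) h (idOfEq rfl h0) g.2.2.val.1 =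
        g.2.2.val.1 := by
    rintro a rfl h
    rw [sgn_zero, one_smul]
    exact (semifree j N).id_act _ _
  exact this _ _ _

/-- The cone of the augmentation is acyclic at the objects at which cells are attached. -/
theorem semifreeAug_acyclicAt (b : S) : (DGMod.cone (semifreeAug j N)).AcyclicAt (j b) := by
  rintro r m n rfl rfl ⟨x, y⟩ hx
  have h1 : N.d (r + 1) (r + 1 + 1) rfl x + cellAug (r + 1 + 1) y = 0 :=
    (congrArg (_ + ·) (cellAugFam_app j N _ _ y).symm).trans (congrArg Prod.fst hx)
  have h2 : -cellD (r + 1 + 1) (r + 1 + 1 + 1) rfl y = 0 := congrArg Prod.snd hx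
  -- That `(x, y)` is a cocycle of the cone says that `-y` is a cocycle whose image is `d x`. The
  -- generator of the corresponding cell bounds `(x, y)`; the sign comes from the differential `-d`
  -- on the source summand of the cone.
  obtain ⟨g, hg⟩ := exists_cell (-y) x ((map_neg _ _).trans h2)
    ((add_eq_zero_iff_eq_neg.mp h1).trans (map_neg _ _).symm)
  refine ⟨(0, cellGen j N ⟨b, r + 1, g⟩), Prod.ext ?_ ?_⟩
  · refine (congrArg (_ + ·) (cellAugFam_app j N _ _ _)).trans ?_
    refine (congrArg₂ (· + ·) (map_zero _) (cellAug_gen j N ⟨b, r + 1, g⟩)).trans ?_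
    rw [zero_add, hg]
  · refine (congrArg Neg.neg ((cellD_gen j N ⟨b, r + 1, g⟩).trans (congrArg Prod.fst hg))).trans ?_
    exact neg_neg _

end Semifree


/-! ### Elements of semi-free modules come from finite cell modules -/

section Cellular

open Tot

variable {k : Type w} [CommRing k] {E : Type u} [DGCategory.{w, u} k E] {S : Type u} {j : S → E}
  {N : DGMod.{w, u, u, u} k E}

theorem Cell.val_apply {b : S} {r : ℤ} (n : ℕ) (c : Fin n → S) (s : Fin n → ℤ)
    (sub : ∀ i, Cell j N (c i) (s i)) (coef : ∀ i, Hom k (j (c i)) (j b) (r + 1 - s i))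
    (x : N.obj (j b) r) : (Cell.mk b r n c s sub coef x).val.1 = 0 ∨
      (Cell.mk b r n c s sub coef x).val.1 = ∑ i, cel ⟨c i, s i, sub i⟩ (coef i) := by
  rw [Cell.val]
  split_ifs
  · exact .inr rfl
  · exact .inl rfl

variable (j N) in
/-- The set `T` of cells generates a submodule of the semi-free module which is represented by an
object satisfying `P`. -/
def IsCellular (P : E → Prop) (T : Set (Cells j N)) : Prop :=
  ∃ (Z : E) (z : (semifree j N).obj Z 0), P Z ∧ (semifree j N).tD ((semifree j N).el z) = 0 ∧
    (∀ (Y : E) (n : ℤ) (f : Hom k Z Y n),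
      (semifree j N).tact (ι f) ((semifree j N).el z) = 0 → f = 0) ∧
    (∀ g ∉ T, DFunLike.coe (F := CellObj j N Z 0) z g = 0) ∧
    ∀ g ∈ T, ∃ e : Hom k Z (j g.1) g.2.1,
      (semifree j N).tact (ι e) ((semifree j N).el z) = (semifree j N).el (cellGen j N g)

/-- Every generator in `T` is a multiple of `z`, hence so is every finite combination of them.
Together with injectivity of `f ↦ f z` this makes `z` a universal element. -/
theorem exists_tact_eq {T : Set (Cells j N)} {Z : E} {z : (semifree j N).obj Z 0}
    (hz : ∀ g ∈ T, ∃ e : Hom k Z (j g.1) g.2.1,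
      (semifree j N).tact (ι e) ((semifree j N).el z) = (semifree j N).el (cellGen j N g))
    {Y : E} {n : ℤ} (x : CellObj j N Y n) (hx : ∀ g ∉ T, x g = 0) : ∃ f : Hom k Z Y n,
      (semifree j N).tact (ι f) ((semifree j N).el z) =
        (semifree j N).el (X := Y) (n := n) x := by
  obtain ⟨m, g, e, hg, rfl⟩ := exists_eq_sum_cel x
  have hT : ∀ i, g i ∈ T := fun i => by_contra fun h => hg i (hx _ h)
  choose e' he' using fun i => hz (g i) (hT i)
  refine ⟨∑ i, comp (g i).2.1 (n - (g i).2.1) n (by omega) (e' i) (e i), ?_⟩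
  rw [map_sum, map_sum, AddMonoidHom.finsetSum_apply]
  refine Eq.trans ?_ (map_sum (semifree j N).el (fun i => cel (g i) (e i)) _).symm
  refine Finset.sum_congr rfl fun i _ => ?_
  rw [ι_comp, DGMod.tact_comp, he', (semifree j N).tact_ι_el _ _ n (by omega)]
  exact congrArg (semifree j N).el (cellAct_gen j N (g i) (n - (g i).2.1) n (by omega) (e i))

variable {P : E → Prop}

theorem IsCellular.empty (hP : IsHull k j P) : IsCellular j N P ∅ := by
  obtain ⟨Z, hZ, h0⟩ := hP.zero
  refine ⟨Z, 0, hZ, by simp, fun Y n f _ => ι_injective ?_, fun _ _ => rfl, fun _ h => h.elim⟩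
  rw [← Category.id_comp (ι f), h0]
  simp

/-- If `z` in `Z` is universal for `T`, the boundary of `g` is `u z` for a closed `u : Z → b` of
degree `r + 1`, where `b` is the object and `r` the degree of `g`. The cone `b[r] ⊕ Z` of the
induced morphism `Z[-1] → b[r]` corepresents the submodule enlarged by `g`. -/
theorem IsCellular.insert (hP : IsHull k j P) {T : Set (Cells j N)} (hT : IsCellular j N P T)
    (g : Cells j N) (hg : g ∉ T) (hval : ∀ h ∉ T, g.2.2.val.1 h = 0) :
    IsCellular j N P (insert g T) := by
  obtain ⟨Z, z, hZ, hDz, hinj, hsupp, hgen⟩ := hT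
  let M := semifree j N
  let γ : M.obj (j g.1) g.2.1 := cellGen j N g
  obtain ⟨u, hu⟩ := exists_tact_eq hgen g.2.2.val.1 hval
  have hγ : M.tD (M.el γ) = M.tact (ι u) (M.el z) := by
    rw [hu, M.tD_el _ _ rfl]
    exact congrArg M.el (cellD_gen j N g)
  have hDu : D (ι u) = 0 := by
    rw [D_ι _ _ rfl, ι_eq_zero]
    refine hinj _ _ _ ?_
    have h1 : M.tD (M.tD (M.el γ)) = 0 := M.tD_tD _
    rwa [hγ, M.tD_tact, hDz, map_zero, add_zero, D_ι _ _ rfl] at h1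
  obtain ⟨Z', hZ', ⟨ζ⟩⟩ := hP.shift Z hZ 1 (-1) (by simp)
  obtain ⟨b', hb', ⟨β⟩⟩ := hP.shift _ (hP.base g.1) (-g.2.1) g.2.1 (by simp)
  obtain ⟨K, hK, ⟨κ⟩⟩ := hP.cone Z' b'
    (comp (-1) 1 0 (by simp) ζ.τ (comp (g.2.1 + 1) (-g.2.1) 1 (by omega) u β.σ)) hZ' hb'
    (by simp [ι_comp, D_comp, hDu])
  -- The new universal element combines `z` and the generator of `g`, moved to degree zero. The sign
  -- makes it a cocycle: the boundary of the generator cancels against `D j`.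
  let z' : M.obj K 0 := M.act 0 0 0 (zero_add 0) (comp 1 (-1) 0 (by simp) ζ.σ κ.j) z -
    sgn g.2.1 • M.act (-g.2.1) g.2.1 0 (by simp) (comp (-g.2.1) 0 (-g.2.1) (by simp) β.σ κ.i) γ
  have hz' : M.el z' = M.tact (ι ζ.σ ≫ ι κ.j) (M.el z) -
      sgn g.2.1 • M.tact (ι β.σ ≫ ι κ.i) (M.el γ) := by
    simp only [z', map_sub, map_zsmul, M.el_act, ι_comp]
  refine ⟨K, z', hK, ?_, ?_, ?_, ?_⟩
  · have h1 : sgn (-g.2.1) = sgn g.2.1 := by simp [sgn]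
    rw [hz', map_sub, map_zsmul, M.tD_tact, M.tD_tact, hDz, hγ, sg_comp, sg_comp, sg_ι β.σ, h1]
    simp [D_comp, ι_comp, smul_smul, sgn_mul_self, M.tact_comp]
  · intro Y n f hf
    have h0 : M.tact (ι (comp 0 n n (zero_add n) (comp 1 (-1) 0 (by simp) ζ.σ κ.j) f)) (M.el z) =
        sgn g.2.1 • M.tact (ι (comp (-g.2.1) n (n - g.2.1) (by omega) β.σ
          (comp 0 n n (zero_add n) κ.i f))) (M.el γ) := by
      rw [hz', map_sub, map_zsmul, sub_eq_zero] at hf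
      simpa [ι_comp, M.tact_comp] using hf
    -- Compare coefficients at `g`: since `g` is not in `T`, multiples of `z` have none, so the
    -- coefficient coming from the generator must vanish by itself.
    have h1 : comp (-g.2.1) n (n - g.2.1) (by omega) β.σ (comp 0 n n (zero_add n) κ.i f) = 0 := by
      have h2 := h0
      rw [M.tact_ι_el _ _ n (add_zero n), M.tact_ι_el (n - g.2.1) _ n (by omega), ← map_zsmul,
        M.el_inj] at h2
      have h3 := congrArg (fun x : CellObj j N Y n => x g) h2
      have h4 := cellAct_apply n 0 n (add_zero n)
        (comp 0 n n (zero_add n) (comp 1 (-1) 0 (by simp) ζ.σ κ.j) f) z g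
      have h5 : DFunLike.coe (F := CellObj j N Z 0) z g = 0 := hsupp g hg
      rw [h5, map_zero, LinearMap.zero_apply] at h4
      have h6 := cellAct_gen j N g (n - g.2.1) n (by omega)
        (comp (-g.2.1) n (n - g.2.1) (by omega) β.σ (comp 0 n n (zero_add n) κ.i f))
      have h7 : sgn g.2.1 • comp (-g.2.1) n (n - g.2.1) (by omega) β.σ
          (comp 0 n n (zero_add n) κ.i f) = 0 := by
        refine Eq.trans ?_ (h3.symm.trans h4)
        refine Eq.trans ?_ (congrArg (fun x : CellObj j N Y n => (sgn g.2.1 • x) g) h6.symm)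
        exact congrArg (sgn g.2.1 • ·) (cel_apply_self g _).symm
      have h8 := congrArg (sgn g.2.1 • ·) h7
      simpa [smul_smul, sgn_mul_self] using h8
    have h2 : comp 0 n n (zero_add n) (comp 1 (-1) 0 (by simp) ζ.σ κ.j) f = 0 :=
      hinj _ _ _ (by rw [h0, h1]; simp)
    have h1' : ι κ.i ≫ ι f = 0 := by
      have := congrArg (fun x => ι β.τ ≫ ι x) h1
      simpa [ι_comp] using this
    have h2' : ι κ.j ≫ ι f = 0 := by
      have := congrArg (fun x => ι ζ.τ ≫ ι x) h2
      simpa [ι_comp] using this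
    refine ι_injective (κ.hom_ext ?_ ?_)
    · rw [h1', map_zero, Limits.comp_zero]
    · rw [h2', map_zero, Limits.comp_zero]
  · intro h hh
    rw [Set.mem_insert_iff, not_or] at hh
    have h1 := cellAct_apply 0 0 0 (zero_add 0) (comp 1 (-1) 0 (by simp) ζ.σ κ.j) z h
    rw [show DFunLike.coe (F := CellObj j N Z 0) z h = 0 from hsupp h hh.2, map_zero,
      LinearMap.zero_apply] at h1
    have h2 := cellAct_apply (-g.2.1) g.2.1 0 (by simp)
      (comp (-g.2.1) 0 (-g.2.1) (by simp) β.σ κ.i) γ h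
    rw [show DFunLike.coe (F := CellObj j N _ _) γ h = 0 from cel_apply_ne (Ne.symm hh.1) _, map_zero,
      LinearMap.zero_apply] at h2
    refine (congrArg₂ (fun x y => x - sgn g.2.1 • y) h1 h2).trans ?_
    rw [smul_zero, sub_zero]
  · have hpz : M.tact (ι κ.p ≫ ι ζ.τ) (M.el z') = M.el z := by
      rw [hz', map_sub, map_zsmul, ← M.tact_comp, ← M.tact_comp]
      simp
    rintro h (rfl | hh)
    · refine ⟨-sgn h.2.1 • comp 0 h.2.1 h.2.1 (zero_add _) κ.s β.τ, ?_⟩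
      rw [neg_smul, map_neg, map_neg, map_zsmul, map_zsmul, ι_comp, hz']
      change -(sgn h.2.1 • M.tact (ι κ.s ≫ ι β.τ) _) = M.el γ
      rw [map_sub, map_zsmul, ← M.tact_comp, ← M.tact_comp]
      simp [smul_sub, smul_smul, sgn_mul_self]
    · obtain ⟨e, he⟩ := hgen h hh
      refine ⟨comp 0 h.2.1 h.2.1 (zero_add _) (comp 1 (-1) 0 (by simp) κ.p ζ.τ) e, ?_⟩
      rw [ι_comp, ι_comp, M.tact_comp, hpz, he]

/-- Induction on the cell: insert the finitely many sub-cells recorded in its boundary one after the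
other, then the cell itself, whose boundary now lies in the span. -/
theorem IsCellular.exists_insert (hP : IsHull k j P) {b : S} {r : ℤ} (g : Cell j N b r) :
    ∀ {T : Set (Cells j N)}, IsCellular j N P T →
      ∃ T', IsCellular j N P T' ∧ T ⊆ T' ∧ (⟨b, r, g⟩ : Cells j N) ∈ T' := by
  induction g with
  | mk b r n c s sub coef x ih =>
    intro T hT
    have hfin : ∀ m ≤ n, ∃ T', IsCellular j N P T' ∧ T ⊆ T' ∧
        ∀ i : Fin n, (i : ℕ) < m → (⟨c i, s i, sub i⟩ : Cells j N) ∈ T' := by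
      intro m
      induction m with
      | zero => exact fun _ => ⟨T, hT, subset_rfl, fun i hi => (Nat.not_lt_zero _ hi).elim⟩
      | succ m ihm =>
        intro hm
        obtain ⟨T₁, hT₁, h₁, h₁'⟩ := ihm (by omega)
        obtain ⟨T₂, hT₂, h₂, h₂'⟩ := ih ⟨m, hm⟩ hT₁
        refine ⟨T₂, hT₂, h₁.trans h₂, fun i hi => ?_⟩
        rcases Nat.lt_succ_iff_lt_or_eq.mp hi with h | h
        · exact h₂ (h₁' i h)
        · obtain rfl : i = ⟨m, hm⟩ := Fin.ext h
          exact h₂'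
    obtain ⟨T₁, hT₁, h₁, h₁'⟩ := hfin n le_rfl
    by_cases hg : (⟨b, r, .mk b r n c s sub coef x⟩ : Cells j N) ∈ T₁
    · exact ⟨T₁, hT₁, h₁, hg⟩
    · refine ⟨_, hT₁.insert hP _ hg fun h hh => ?_, h₁.trans (Set.subset_insert _ _),
        Set.mem_insert _ _⟩
      rcases Cell.val_apply n c s sub coef x with h0 | h0
      · exact (congrArg (fun x : CellObj j N (j b) (r + 1) => x h) h0).trans rfl
      · refine (congrArg (fun x : CellObj j N (j b) (r + 1) => x h) h0).trans ?_
        rw [DFinsupp.finsetSum_apply]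
        refine Finset.sum_eq_zero fun i _ => cel_apply_ne (fun e => hh ?_) _
        rw [← e]
        exact h₁' i i.2

/-- A cocycle of the semi-free module generated by all cells comes from an object of the hull. -/
theorem exists_eq_tact_of_closed (hP : IsHull k j P) {Y : E} {n : ℤ} (p : (semifree j N).obj Y n)
    (hp : (semifree j N).tD ((semifree j N).el p) = 0) :
    ∃ (Z : E) (f : Hom k Z Y 0) (z : (semifree j N).obj Z n), P Z ∧ D (ι f) = 0 ∧
      (semifree j N).tD ((semifree j N).el z) = 0 ∧
      (semifree j N).tact (ι f) ((semifree j N).el z) = (semifree j N).el p := by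
  let M := semifree j N
  obtain ⟨m, g, e, hg, hpe⟩ := exists_eq_sum_cel (Y := Y) (n := n) p
  have hfin : ∀ m' ≤ m, ∃ T', IsCellular j N P T' ∧ ∀ i : Fin m, (i : ℕ) < m' → g i ∈ T' := by
    intro m'
    induction m' with
    | zero => exact fun _ => ⟨∅, .empty hP, fun i hi => (Nat.not_lt_zero _ hi).elim⟩
    | succ m' ihm =>
      intro hm
      obtain ⟨T₁, hT₁, h₁⟩ := ihm (by omega)
      obtain ⟨T₂, hT₂, h₂, h₂'⟩ := IsCellular.exists_insert hP (g ⟨m', hm⟩).2.2 hT₁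
      refine ⟨T₂, hT₂, fun i hi => ?_⟩
      rcases Nat.lt_succ_iff_lt_or_eq.mp hi with h | h
      · exact h₂ (h₁ i h)
      · obtain rfl : i = ⟨m', hm⟩ := Fin.ext h
        exact h₂'
  obtain ⟨T, ⟨Z, z, hZ, hDz, hinj, hsupp, hgen⟩, hT⟩ := hfin m le_rfl
  obtain ⟨f, hf⟩ := exists_tact_eq hgen (Y := Y) (n := n) p (fun h hh => by
    rw [hpe, DFinsupp.finsetSum_apply]
    exact Finset.sum_eq_zero fun i _ => cel_apply_ne (fun e => hh (by
      have h1 := hT i i.2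
      rwa [e] at h1)) _)
  -- Both `p` and `z` are cocycles, so `D f` annihilates `z`; the action on `z` is injective.
  have hDf : D (ι f) = 0 := by
    rw [D_ι _ _ rfl, ι_eq_zero]
    refine hinj _ _ _ ?_
    have h1 := congrArg M.tD hf
    rw [M.tD_tact, hDz, map_zero, add_zero, D_ι _ _ rfl] at h1
    exact h1.trans hp
  -- So far `f` has degree `n` and `z` degree `0`; the shift moves the degree from the morphism to
  -- the element.
  obtain ⟨Z', hZ', ⟨ζ⟩⟩ := hP.shift Z hZ n (-n) (by simp)
  refine ⟨Z', comp (-n) n 0 (by simp) ζ.τ f, M.act n 0 n (add_zero n) ζ.σ z, hZ', ?_, ?_, ?_⟩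
  · simp [ι_comp, D_comp, hDf]
  · rw [M.el_act, M.tD_tact, hDz]
    simp
  · rw [M.el_act, ← M.tact_comp, ι_comp]
    simpa using hf

end Cellular


/-! ### Cones of DG modules -/

section ModCone

open Tot

variable {k : Type w} [CommRing k] {A : Type u} [DGCategory.{w, v} k A]

namespace DGMod

variable {M N L : DGMod.{w, v, u, t} k A}

/-- The component `M(X)^p → N(X)^q` of a homogeneous morphism of DG modules of degree `n`, where
`p + n = q`. -/
abbrev happ {n : ℤ} (φ : Hom k M N n) (X : A) (p q : ℤ) (h : p + n = q) :
    M.obj X p →ₗ[k] N.obj X q := Fam.app (show homs M N n from φ).1 X p q h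

theorem hom_ext' {n : ℤ} {φ ψ : Hom k M N n}
    (h : ∀ (X : A) (p q : ℤ) (h : p + n = q) (x : M.obj X p),
      happ φ X p q h x = happ ψ X p q h x) : φ = ψ :=
  Subtype.ext (Fam.ext_app h)

theorem happ_comp (p q n : ℤ) (h : p + q = n) (φ : Hom k M N p) (ψ : Hom k N L q) (X : A)
    (a b c : ℤ) (hb : a + p = b) (hc : b + q = c) (hac : a + n = c) (x : M.obj X a) :
    happ (comp p q n h φ ψ) X a c hac x = happ ψ X b c hc (happ φ X a b hb x) :=
  famComp_apply p q n h _ _ X a b c hb hc hac x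

theorem happ_d (n m : ℤ) (h : n + 1 = m) (φ : Hom k M N n) (X : A)
    (a b c a' : ℤ) (hb : a + n = b) (hc : b + 1 = c) (ha' : a + 1 = a') (h' : a' + n = c)
    (hac : a + m = c) (x : M.obj X a) :
    happ (DG.d n m h φ) X a c hac x = N.d b c hc (happ φ X a b hb x) -
      sgn n • happ φ X a' c h' (M.d a a' ha' x) :=
  famD_apply n m h _ X a b c a' hb hc ha' h' hac x

theorem happ_id (X : A) (p q : ℤ) (h : p + 0 = q) (x : M.obj X p) :
    happ (DGCategory.id M : Hom k M M 0) X p q h x = M.objCast X (by omega) x := by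
  obtain rfl : p = q := by omega
  exact famId_apply M X p h x

theorem happ_add {n : ℤ} (φ ψ : Hom k M N n) (X : A) (p q : ℤ) (h : p + n = q) (x : M.obj X p) :
    happ (φ + ψ) X p q h x = happ φ X p q h x + happ ψ X p q h x := Fam.add_app ..

theorem happ_zero {n : ℤ} (X : A) (p q : ℤ) (h : p + n = q) (x : M.obj X p) :
    happ (0 : Hom k M N n) X p q h x = 0 := Fam.zero_app ..

theorem happ_neg {n : ℤ} (φ : Hom k M N n) (X : A) (p q : ℤ) (h : p + n = q) (x : M.obj X p) :
    happ (-φ) X p q h x = -happ φ X p q h x := by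
  rw [eq_neg_iff_add_eq_zero, ← happ_add, neg_add_cancel, happ_zero]

/-- A homogeneous morphism of DG modules given by its components. -/
def homOfApp {n : ℤ} (F : ∀ (X : A) (p q : ℤ), p + n = q → (M.obj X p →ₗ[k] N.obj X q))
    (hF : ∀ (X Y : A) (a p p' q q' : ℤ) (h : a + p = p') (hq : p + n = q)
      (hq' : p' + n = q') (h' : a + q = q') (f : Hom k X Y a) (x : M.obj X p),
      F Y p' q' hq' (M.act a p p' h f x) = sgn (n * a) • N.act a q q' h' f (F X p q hq x)) :
    Hom k M N n :=
  (⟨fun X p => F X p (p + n) rfl, fun X Y a p p' q q' h hq hq' h' f x => by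
    subst hq hq'
    exact hF X Y a p p' _ _ h rfl rfl h' f x⟩ : homs M N n)

theorem happ_homOfApp {n : ℤ} (F : ∀ (X : A) (p q : ℤ), p + n = q → (M.obj X p →ₗ[k] N.obj X q))
    (hF) (X : A) (p q : ℤ) (h : p + n = q) (x : M.obj X p) :
    happ (homOfApp F hF) X p q h x = F X p q h x := by
  subst h
  rfl

variable (φ : closed k M N)

/-- The element `(y, x)` of the cone. -/
def coneMk (X : A) (p : ℤ) (y : N.obj X p) (x : M.obj X (p + 1)) : (cone φ).obj X p := (y, x)

/-- The component of an element of the cone in the target. -/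
def coneFst (X : A) (p : ℤ) : (cone φ).obj X p →ₗ[k] N.obj X p := LinearMap.fst k _ _

/-- The component of an element of the cone in the source. -/
def coneSnd (X : A) (p : ℤ) : (cone φ).obj X p →ₗ[k] M.obj X (p + 1) := LinearMap.snd k _ _

@[simp] theorem coneFst_mk (X : A) (p : ℤ) (y : N.obj X p) (x : M.obj X (p + 1)) :
    coneFst φ X p (coneMk φ X p y x) = y := rfl

@[simp] theorem coneSnd_mk (X : A) (p : ℤ) (y : N.obj X p) (x : M.obj X (p + 1)) :
    coneSnd φ X p (coneMk φ X p y x) = x := rfl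

theorem cone_obj_ext {X : A} {p : ℤ} {y z : (cone φ).obj X p}
    (h : coneFst φ X p y = coneFst φ X p z) (h' : coneSnd φ X p y = coneSnd φ X p z) : y = z :=
  Prod.ext h h'

theorem coneFst_d (X : A) (p q : ℤ) (h : p + 1 = q) (y : (cone φ).obj X p) :
    coneFst φ X q ((cone φ).d p q h y) = N.d p q h (coneFst φ X p y) +
      happ φ.1 X (p + 1) q (by omega) (coneSnd φ X p y) := rfl

theorem coneSnd_d (X : A) (p q : ℤ) (h : p + 1 = q) (y : (cone φ).obj X p) :
    coneSnd φ X q ((cone φ).d p q h y) = -M.d (p + 1) (q + 1) (by omega) (coneSnd φ X p y) := rfl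

/-- The inclusion `N → Cone(φ)`. -/
def coneI : Hom k N (cone φ) 0 :=
  homOfApp (fun X p q h => LinearMap.inl k (N.obj X q) (M.obj X (q + 1)) ∘ₗ
    N.objCast X (by omega)) fun X Y a p p' q q' h hq hq' h' f x => by
      obtain rfl : p = q := by omega
      obtain rfl : p' = q' := by omega
      rw [zero_mul, sgn_zero, one_smul]
      refine Prod.ext rfl ?_
      change (0 : M.obj Y (p' + 1)) = sgn a • M.act a (p + 1) (p' + 1) _ f 0
      rw [map_zero, smul_zero]

/-- The inclusion `M[1] → Cone(φ)`. -/
def coneJ : Hom k M (cone φ) (-1) :=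
  homOfApp (fun X p q h => LinearMap.inr k (N.obj X q) (M.obj X (q + 1)) ∘ₗ
    M.objCast X (by omega)) fun X Y a p p' q q' h hq hq' h' f x => by
      obtain rfl : p = q + 1 := by omega
      obtain rfl : p' = q' + 1 := by omega
      have hs : sgn (-1 * a) = sgn a := by
        rw [show -1 * a = -a by omega]
        simp [sgn]
      rw [hs]
      refine Prod.ext ?_ ?_
      · change (0 : N.obj Y q') = sgn a • N.act a q q' _ f 0
        rw [map_zero, smul_zero]
      · change M.act a (q + 1) (q' + 1) h f x =
          sgn a • sgn a • M.act a (q + 1) (q' + 1) _ f x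
        rw [smul_smul, sgn_mul_self, one_smul]

/-- The projection `Cone(φ) → M[1]`. -/
def coneP : Hom k (cone φ) M 1 :=
  homOfApp (fun X p q h => M.objCast X h ∘ₗ LinearMap.snd k (N.obj X p) (M.obj X (p + 1)))
    fun X Y a p p' q q' h hq hq' h' f x => by
      subst hq hq'
      rw [one_mul]
      rfl

/-- The projection `Cone(φ) → N`. -/
def coneS : Hom k (cone φ) N 0 :=
  homOfApp (fun X p q h => N.objCast X (by omega) ∘ₗ
    LinearMap.fst k (N.obj X p) (M.obj X (p + 1)))
    fun X Y a p p' q q' h hq hq' h' f x => by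
      obtain rfl : p = q := by omega
      obtain rfl : p' = q' := by omega
      rw [zero_mul, sgn_zero, one_smul]
      rfl

theorem coneI_apply (X : A) (p : ℤ) (h : p + 0 = p) (x : N.obj X p) :
    happ (coneI φ) X p p h x = coneMk φ X p x 0 := by
  rw [coneI, happ_homOfApp]
  rfl

theorem coneJ_apply (X : A) (p : ℤ) (h : p + 1 + -1 = p) (x : M.obj X (p + 1)) :
    happ (coneJ φ) X (p + 1) p h x = coneMk φ X p 0 x := by
  rw [coneJ, happ_homOfApp]
  rfl

theorem coneP_apply (X : A) (p : ℤ) (h : p + 1 = p + 1) (x : (cone φ).obj X p) :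
    happ (coneP φ) X p (p + 1) h x = coneSnd φ X p x := by
  rw [coneP, happ_homOfApp]
  rfl

theorem coneS_apply (X : A) (p : ℤ) (h : p + 0 = p) (x : (cone φ).obj X p) :
    happ (coneS φ) X p p h x = coneFst φ X p x := by
  rw [coneS, happ_homOfApp]
  rfl

/-- The structure of a cone on `Cone(φ)`. -/
def coneData : ConeData φ.1 (cone φ) where
  i := coneI φ
  j := coneJ φ
  p := coneP φ
  s := coneS φ
  i_s := by
    rw [← ι_comp 0 0 0 (by simp), ← ι_id]
    refine congrArg ι (hom_ext' fun X p q h x => ?_)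
    obtain rfl : p = q := by omega
    rw [happ_comp 0 0 0 _ _ _ X p p p h h, happ_id, coneI_apply, coneS_apply]
    rfl
  j_p := by
    rw [← ι_comp (-1) 1 0 (by simp), ← ι_id]
    refine congrArg ι (hom_ext' fun X p q h x => ?_)
    obtain ⟨p, rfl⟩ : ∃ p', p = p' + 1 := ⟨p - 1, by omega⟩
    obtain rfl : p + 1 = q := by omega
    rw [happ_comp (-1) 1 0 _ _ _ X (p + 1) p (p + 1) (by omega) rfl, happ_id, coneJ_apply,
      coneP_apply]
    rfl
  i_p := by
    rw [← ι_comp 0 1 1 (by simp), ← map_zero ι]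
    refine congrArg ι (hom_ext' fun X p q h x => ?_)
    obtain rfl : p + 1 = q := by omega
    rw [happ_comp 0 1 1 _ _ _ X p p (p + 1) (by omega) rfl, happ_zero, coneI_apply, coneP_apply,
      coneSnd_mk]
  j_s := by
    rw [← ι_comp (-1) 0 (-1) (by simp), ← map_zero ι]
    refine congrArg ι (hom_ext' fun X p q h x => ?_)
    obtain rfl : p = q + 1 := by omega
    rw [happ_comp (-1) 0 (-1) _ _ _ X (q + 1) q q (by omega) (by omega), happ_zero, coneJ_apply,
      coneS_apply, coneFst_mk]
  total := by
    rw [← ι_comp 0 0 0 (by simp), ← ι_comp 1 (-1) 0 (by simp), ← ι_id, ← map_add]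
    refine congrArg ι (hom_ext' fun X p q h x => ?_)
    obtain rfl : p = q := by omega
    rw [happ_add, happ_comp 0 0 0 _ _ _ X p p p h h,
      happ_comp 1 (-1) 0 _ _ _ X p (p + 1) p rfl (by omega), coneS_apply, coneI_apply, coneP_apply,
      coneJ_apply, happ_id]
    exact Prod.ext (add_zero _) (zero_add _)
  D_i := by
    rw [D_ι 0 1 (by simp), ← map_zero ι]
    refine congrArg ι (hom_ext' fun X p q h x => ?_)
    rw [happ_d 0 1 _ _ X p p q q (by omega) h h (by omega), coneI_apply, coneI_apply, sgn_zero,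
      one_smul, happ_zero, sub_eq_zero]
    refine cone_obj_ext φ ?_ ?_
    · rw [coneFst_d, coneFst_mk, coneFst_mk, coneSnd_mk, map_zero, add_zero]
    · rw [coneSnd_d, coneSnd_mk, coneSnd_mk, map_zero, neg_zero]
  D_p := by
    rw [D_ι 1 2 (by simp), ← map_zero ι]
    refine congrArg ι (hom_ext' fun X p q h x => ?_)
    obtain rfl : p + 1 + 1 = q := by omega
    rw [happ_d 1 2 _ _ X p (p + 1) (p + 1 + 1) (p + 1) (by omega) rfl rfl rfl, coneP_apply,
      coneP_apply, sgn_one, neg_one_smul, sub_neg_eq_add, happ_zero, coneSnd_d]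
    exact add_neg_cancel _
  D_j := by
    rw [D_ι (-1) 0 (by simp), ← ι_comp 0 0 0 (by simp)]
    refine congrArg ι (hom_ext' fun X p q h x => ?_)
    obtain ⟨p, rfl⟩ : ∃ p', p = p' + 1 := ⟨p - 1, by omega⟩
    obtain rfl : p + 1 = q := by omega
    rw [happ_d (-1) 0 _ _ X (p + 1) p (p + 1) (p + 1 + 1) (by omega) rfl rfl (by omega),
      happ_comp 0 0 0 _ _ _ X (p + 1) (p + 1) (p + 1) (by omega) (by omega), coneJ_apply,
      coneJ_apply, coneI_apply, sgn_neg_one, neg_one_smul, sub_neg_eq_add]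
    refine cone_obj_ext φ ?_ ?_
    · rw [map_add, coneFst_d, coneFst_mk, coneFst_mk, coneFst_mk, coneSnd_mk, map_zero, zero_add,
        add_zero]
    · rw [map_add, coneSnd_d, coneSnd_mk, coneSnd_mk, coneSnd_mk, neg_add_cancel]
  D_s := by
    rw [D_ι 0 1 (by simp), ← ι_comp 1 0 1 (by simp), ← map_neg]
    refine congrArg ι (hom_ext' fun X p q h x => ?_)
    subst h
    rw [happ_d 0 1 _ _ X p p (p + 1) (p + 1) (by omega) rfl rfl (by omega), happ_neg,
      happ_comp 1 0 1 _ _ _ X p (p + 1) (p + 1) (by omega) (by omega), coneS_apply,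
      coneS_apply, coneP_apply, sgn_zero, one_smul, coneFst_d]
    exact sub_add_cancel_left _ _

end DGMod

end ModCone

/-! ### Morphisms out of semi-free modules -/

section FreeHom

open Tot

variable {k : Type w} [CommRing k] {A : Type u} {E : Type u} [DGCategory.{w, u} k A]
  [DGCategory.{w, u} k E] {S : Type u}

/-- A DG functor is fully faithful if it is bijective on morphisms. -/
def DGFunctor.FullyFaithful {k : Type w} [CommRing k] {A : Type u} {E : Type u'}
    [DGCategory.{w, v} k A] [DGCategory.{w, v} k E] (G : DGFunctor k A E) : Prop :=
  ∀ (X Y : A) (n : ℤ), Function.Bijective (G.map n : Hom k X Y n → _)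

/-- The inverse of a fully faithful DG functor on morphisms. -/
noncomputable def DGFunctor.FullyFaithful.pre {G : DGFunctor k A E} (hG : G.FullyFaithful)
    {X Y : A} {n : ℤ} : Hom k (G.obj X) (G.obj Y) n →ₗ[k] Hom k X Y n :=
  (LinearEquiv.ofBijective (G.map n) (hG X Y n)).symm.toLinearMap

namespace DGFunctor.FullyFaithful

variable {G : DGFunctor k A E} (hG : G.FullyFaithful)

theorem map_pre {X Y : A} {n : ℤ} (f : Hom k (G.obj X) (G.obj Y) n) : G.map n (hG.pre f) = f :=
  (LinearEquiv.ofBijective (G.map n) (hG X Y n)).apply_symm_apply f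

theorem pre_eq {X Y : A} {n : ℤ} {f : Hom k (G.obj X) (G.obj Y) n} {g : Hom k X Y n}
    (h : f = G.map n g) : hG.pre f = g :=
  (hG X Y n).1 ((hG.map_pre f).trans h)

theorem pre_comp {X Y Z : A} (p q n : ℤ) (h : p + q = n) (f : Hom k (G.obj X) (G.obj Y) p)
    (g : Hom k Y Z q) : hG.pre (comp p q n h f (G.map q g)) = comp p q n h (hG.pre f) g :=
  hG.pre_eq (by rw [G.map_comp, hG.map_pre])

theorem pre_idOfEq {X : A} {n : ℤ} (hn : n = 0) :
    hG.pre (idOfEq rfl hn : Hom k (G.obj X) (G.obj X) n) = idOfEq rfl hn := by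
  subst hn
  exact hG.pre_eq (G.map_id X).symm

end DGFunctor.FullyFaithful

variable {G : DGFunctor k A E} (hG : G.FullyFaithful) {l : S → A} {N : DGMod.{w, u, u, u} k E}
  {T : DGMod.{w, u, u, u} k A}

/-- The components of the morphism out of a semi-free module with given values at the cells. -/
noncomputable def freeLin (m : ℤ)
    (x : ∀ g : Cells (fun s => G.obj (l s)) N, T.obj (l g.1) (g.2.1 + m)) (Y : A) (n n' : ℤ)
    (h : n + m = n') : CellObj (fun s => G.obj (l s)) N (G.obj Y) n →ₗ[k] T.obj Y n' :=
  DirectSum.toModule k _ _ fun g =>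
    -- The Koszul sign for moving a morphism of degree `m` past a coefficient of degree `n - r`,
    -- where `r` is the degree of the cell.
    sgn (m * (n - g.2.1)) • (T.act (n - g.2.1) (g.2.1 + m) n' (by omega)).flip (x g) ∘ₗ hG.pre

theorem freeLin_cel (m : ℤ)
    (x : ∀ g : Cells (fun s => G.obj (l s)) N, T.obj (l g.1) (g.2.1 + m)) (Y : A) (n n' : ℤ)
    (h : n + m = n') (g : Cells (fun s => G.obj (l s)) N) (e : Hom k (G.obj (l g.1)) (G.obj Y) _) :
    freeLin hG m x Y n n' h (cel g e) =
      sgn (m * (n - g.2.1)) • T.act (n - g.2.1) (g.2.1 + m) n' (by omega) (hG.pre e) (x g) := by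
  rw [freeLin, cel, DirectSum.toModule_lof]
  rfl

theorem freeLin_act (m : ℤ)
    (x : ∀ g : Cells (fun s => G.obj (l s)) N, T.obj (l g.1) (g.2.1 + m)) {X Y : A}
    (a p p' q q' : ℤ) (h : a + p = p') (hq : p + m = q) (hq' : p' + m = q') (h' : a + q = q')
    (f : Hom k X Y a) (y : CellObj (fun s => G.obj (l s)) N (G.obj X) p) :
    freeLin hG m x Y p' q' hq' (cellAct _ N a p p' h (G.map a f) y) =
      sgn (m * a) • T.act a q q' h' f (freeLin hG m x X p q hq y) := by
  induction y using cell_induction with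
  | zero => simp only [map_zero, smul_zero]
  | add y z hy hz => rw [map_add, map_add, hy, hz, map_add, map_add, smul_add]
  | homog g e =>
    rw [cellAct_cel, freeLin_cel, freeLin_cel]
    have hs : sgn (m * (p' - g.2.1)) = sgn (m * a) * sgn (m * (p - g.2.1)) := by
      rw [← sgn_add, ← mul_add]
      congr 2
      omega
    rw [hG.pre_comp, hs, T.comp_act (p - g.2.1) a (g.2.1 + m) (p' - g.2.1) q q' (by omega)
      (by omega) (by omega) h', map_zsmul, smul_smul]

/-- The morphism out of a semi-free module with given values at the cells. -/
noncomputable def freeHom (m : ℤ)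
    (x : ∀ g : Cells (fun s => G.obj (l s)) N, T.obj (l g.1) (g.2.1 + m)) :
    Hom k ((semifree (fun s => G.obj (l s)) N).res G) T m :=
  DGMod.homOfApp (fun Y n n' h => freeLin hG m x Y n n' h)
    fun _ _ a p p' q q' h hq hq' h' f y => freeLin_act hG m x a p p' q q' h hq hq' h' f y

theorem freeHom_cel (m : ℤ)
    (x : ∀ g : Cells (fun s => G.obj (l s)) N, T.obj (l g.1) (g.2.1 + m)) (Y : A) (n n' : ℤ)
    (h : n + m = n') (g : Cells (fun s => G.obj (l s)) N) (e : Hom k (G.obj (l g.1)) (G.obj Y) _) :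
    DGMod.happ (freeHom hG m x) Y n n' h (cel g e) =
      sgn (m * (n - g.2.1)) • T.act (n - g.2.1) (g.2.1 + m) n' (by omega) (hG.pre e) (x g) := by
  exact (DGMod.happ_homOfApp (M := (semifree (fun s => G.obj (l s)) N).res G) (N := T) _ _ Y n n' h
    _).trans (freeLin_cel hG m x Y n n' h g e)

theorem freeHom_gen (m : ℤ)
    (x : ∀ g : Cells (fun s => G.obj (l s)) N, T.obj (l g.1) (g.2.1 + m))
    (g : Cells (fun s => G.obj (l s)) N) :
    DGMod.happ (freeHom hG m x) (l g.1) g.2.1 (g.2.1 + m) rfl (cellGen _ N g) = x g := by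
  rw [cellGen, freeHom_cel, hG.pre_idOfEq]
  have : ∀ (a : ℤ) (h0 : a = 0) (h : a + (g.2.1 + m) = g.2.1 + m),
      sgn (m * a) • T.act a (g.2.1 + m) (g.2.1 + m) h (idOfEq rfl h0) (x g) = x g := by
    rintro a rfl h
    rw [mul_zero, sgn_zero, one_smul]
    exact T.id_act _ _
  exact this _ _ _

-- As `G` is full, each multiple of a cell at `G Y` is the result of acting on its generator by a
-- morphism of `A`, so a morphism of `A`-modules is determined there by the value at the generator.
include hG in
theorem happ_cel_eq {m : ℤ} (φ ψ : Hom k ((semifree (fun s => G.obj (l s)) N).res G) T m)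
    (g : Cells (fun s => G.obj (l s)) N)
    (h : DGMod.happ φ (l g.1) g.2.1 (g.2.1 + m) rfl (cellGen _ N g) =
      DGMod.happ ψ (l g.1) g.2.1 (g.2.1 + m) rfl (cellGen _ N g)) (Y : A) (n n' : ℤ)
    (hn : n + m = n') (e : Hom k (G.obj (l g.1)) (G.obj Y) _) :
    DGMod.happ φ Y n n' hn (cel g e) = DGMod.happ ψ Y n n' hn (cel g e) := by
  obtain ⟨e', rfl⟩ := (hG _ _ _).2 e
  have h1 : cel g (G.map _ e') = ((semifree (fun s => G.obj (l s)) N).res G).act (n - g.2.1) g.2.1 n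
      (by omega) e' (cellGen _ N g) :=
    (cellAct_gen _ N g (n - g.2.1) n (by omega) (G.map _ e')).symm
  rw [h1]
  refine ((show DGMod.homs _ _ m from φ).2 _ _ _ _ _ (g.2.1 + m) _ (by omega) rfl hn (by omega)
    e' _).trans (Eq.trans ?_ ((show DGMod.homs _ _ m from ψ).2 _ _ _ _ _ (g.2.1 + m) _ (by omega)
      rfl hn (by omega) e' _).symm)
  exact congrArg (fun y => sgn _ • T.act _ _ _ _ e' y) h

include hG in
theorem free_hom_ext {m : ℤ} {φ ψ : Hom k ((semifree (fun s => G.obj (l s)) N).res G) T m}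
    (h : ∀ g, DGMod.happ φ (l g.1) g.2.1 (g.2.1 + m) rfl (cellGen _ N g) =
      DGMod.happ ψ (l g.1) g.2.1 (g.2.1 + m) rfl (cellGen _ N g)) : φ = ψ := by
  refine DGMod.hom_ext' fun Y n n' hn y => ?_
  change DGMod.happ φ Y n n' hn (show CellObj (fun s => G.obj (l s)) N (G.obj Y) n from y) = _
  induction (show CellObj (fun s => G.obj (l s)) N (G.obj Y) n from y) using cell_induction with
  | zero => exact (map_zero _).trans (map_zero _).symm
  | add y z hy hz =>
    exact (map_add _ _ _).trans ((congrArg₂ (· + ·) hy hz).trans (map_add _ _ _).symm)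
  | homog g e => exact happ_cel_eq hG φ ψ g (h g) Y n n' hn e

open Classical in
/-- The values at the cells of a primitive of a cocycle `φ`. -/
noncomputable def Cell.primitive {m : ℤ}
    (φ : Hom k ((semifree (fun s => G.obj (l s)) N).res G) T m) (m' : ℤ) (hm : m' + 1 = m) :
    ∀ {b : S} {r : ℤ}, Cell (fun s => G.obj (l s)) N b r → T.obj (l b) (r + m')
  | _, _, .mk b r n c s sub coef x =>
    -- A primitive `ψ` of `φ` has to satisfy `d (ψ g) = φ g + (-1)^m' ψ (∂g)`, where `ψ (∂g)`
    -- involves only sub-cells. The default is irrelevant under the hypotheses of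
    -- `Cell.d_primitive`, where a solution always exists.
    if h : ∃ y : T.obj (l b) (r + m'), T.d (r + m') (r + m) (by omega) y =
        DGMod.happ φ (l b) r (r + m) rfl (cellGen _ N ⟨b, r, .mk b r n c s sub coef x⟩) + sgn m' •
          -- The actual boundary of an inconsistent cell is zero although the recorded sum may not
          -- be, hence the case distinction.
          (if (Cell.mk b r n c s sub coef x).val.1 = 0 then 0 else
            ∑ i, sgn (m' * (r + 1 - s i)) • T.act (r + 1 - s i) (s i + m') (r + m) (by omega)
              (hG.pre (coef i)) (primitive φ m' hm (sub i))) then h.choose else 0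

-- Induction over cells. On the boundary of `g` the partially constructed `ψ` already satisfies `dψ
-- = φ`, so the right-hand side of the equation for `ψ g` is a cocycle, and acyclicity of `T` at the
-- object of the cell provides the value.
open Classical in
theorem Cell.d_primitive {m : ℤ} (hT : ∀ s, T.AcyclicAt (l s))
    (φ : Hom k ((semifree (fun s => G.obj (l s)) N).res G) T m)
    (hφ : DG.d m (m + 1) rfl φ = 0) (m' : ℤ) (hm : m' + 1 = m) {b : S} {r : ℤ}
    (g : Cell (fun s => G.obj (l s)) N b r) :
    T.d (r + m') (r + m) (by omega) (g.primitive hG φ m' hm) =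
      DGMod.happ φ (l b) r (r + m) rfl (cellGen _ N ⟨b, r, g⟩) +
        sgn m' • DGMod.happ (freeHom hG m' fun g => g.2.2.primitive hG φ m' hm) (l b) (r + 1)
          (r + m) (by omega) g.val.1 := by
  let ψ := freeHom (T := T) hG m' fun g : Cells (fun s => G.obj (l s)) N =>
    g.2.2.primitive hG φ m' hm
  induction g with
  | mk b r n c s sub coef x ih =>
    let g := Cell.mk b r n c s sub coef x
    have hbd : (if g.val.1 = 0 then 0 else
        ∑ i, sgn (m' * (r + 1 - s i)) • T.act (r + 1 - s i) (s i + m') (r + m) (by omega)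
          (hG.pre (coef i)) ((sub i).primitive hG φ m' hm)) =
        DGMod.happ ψ (l b) (r + 1) (r + m) (by omega) g.val.1 := by
      split_ifs with h
      · rw [h]
        exact (map_zero _).symm
      · have h1 := (Cell.val_apply n c s sub coef x).resolve_left h
        rw [show g.val.1 = _ from h1]
        refine Eq.trans ?_ (map_sum (DGMod.happ ψ (l b) (r + 1) (r + m) (by omega)) _ _).symm
        exact Finset.sum_congr rfl fun i _ => (freeHom_cel (T := T) hG m'
          (fun g => g.2.2.primitive hG φ m' hm) (l b) (r + 1) (r + m) (by omega) ⟨c i, s i, sub i⟩ (coef i)).symm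
    have hφd : ∀ (Y : A) (p q : ℤ) (h : p + 1 = q) (y : _), T.d (p + m) (q + m) (by omega)
        (DGMod.happ φ Y p (p + m) rfl y) = sgn m • DGMod.happ φ Y q (q + m) rfl
          (((semifree (fun s => G.obj (l s)) N).res G).d p q h y) := by
      intro Y p q h y
      have h1 := DGMod.happ_d m (m + 1) rfl φ Y p (p + m) (q + m) q rfl (by omega) h rfl (by omega) y
      rw [hφ, DGMod.happ_zero] at h1
      exact sub_eq_zero.mp h1.symm
    -- The induction hypothesis says that `dψ` and `φ` agree on the generators of the sub-cells,
    -- hence on the boundary.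
    have hψ : DGMod.happ (DG.d m' m hm ψ) (l b) (r + 1) (r + 1 + m) rfl g.val.1 =
        DGMod.happ φ (l b) (r + 1) (r + 1 + m) rfl g.val.1 := by
      rcases Cell.val_apply n c s sub coef x with h | h
      · rw [show g.val.1 = _ from h]
        exact (map_zero _).trans (map_zero _).symm
      · rw [show g.val.1 = _ from h]
        refine (map_sum (DGMod.happ (DG.d m' m hm ψ) (l b) (r + 1) (r + 1 + m) rfl) _ _).trans
          (Eq.trans ?_ (map_sum (DGMod.happ φ (l b) (r + 1) (r + 1 + m) rfl) _ _).symm)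
        refine Finset.sum_congr rfl fun i _ => happ_cel_eq hG _ _ ⟨c i, s i, sub i⟩ ?_ _ _ _ _ _
        refine (DGMod.happ_d m' m hm ψ (l (c i)) (s i) (s i + m') (s i + m) (s i + 1) rfl
          (by omega) rfl (by omega) rfl _).trans (sub_eq_iff_eq_add.mpr ?_)
        refine (congrArg _ (freeHom_gen hG m' _ ⟨c i, s i, sub i⟩)).trans ((ih i).trans ?_)
        exact congrArg (fun y => _ + sgn m' • DGMod.happ ψ _ _ _ _ y)
          (cellD_gen _ N ⟨c i, s i, sub i⟩).symm
    have hval : cellD (r + 1) (r + 1 + 1) rfl g.val.1 = 0 := g.val_spec.1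
    have hex : ∃ y : T.obj (l b) (r + m'), T.d (r + m') (r + m) (by omega) y =
        DGMod.happ φ (l b) r (r + m) rfl (cellGen _ N ⟨b, r, g⟩) + sgn m' •
          (if g.val.1 = 0 then 0 else
            ∑ i, sgn (m' * (r + 1 - s i)) • T.act (r + 1 - s i) (s i + m') (r + m) (by omega)
              (hG.pre (coef i)) ((sub i).primitive hG φ m' hm)) := by
      -- The cocycle condition: `d (φ g) = (-1)^m φ (∂g)` and `d (ψ (∂g)) = φ (∂g)` because `∂∂g =
      -- 0`; the two terms cancel since `m = m' + 1`.
      refine hT b (r + m') (r + m) (r + 1 + m) (by omega) (by omega) _ ?_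
      have h0 := hφd (l b) r (r + 1) rfl (cellGen _ N ⟨b, r, g⟩)
      rw [hbd, map_add, map_zsmul]
      refine (congrArg (· + _) h0).trans ?_
      have h1 := DGMod.happ_d m' m hm ψ (l b) (r + 1) (r + m) (r + 1 + m) (r + 1 + 1) (by omega)
        (by omega) rfl (by omega) rfl g.val.1
      rw [hψ] at h1
      have h2 : DGMod.happ ψ (l b) (r + 1 + 1) (r + 1 + m) (by omega)
          (((semifree (fun s => G.obj (l s)) N).res G).d (r + 1) (r + 1 + 1) rfl g.val.1) = 0 :=
        (congrArg _ hval).trans (map_zero _)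
      rw [h2, smul_zero, sub_zero] at h1
      rw [← h1]
      have h3 : ((semifree (fun s => G.obj (l s)) N).res G).d (X := l b) r (r + 1) rfl
        (cellGen _ N ⟨b, r, g⟩) = g.val.1 := cellD_gen _ N ⟨b, r, g⟩
      refine (congrArg (fun y => sgn m • DGMod.happ φ (l b) (r + 1) (r + 1 + m) rfl y + _) h3).trans ?_
      subst hm
      rw [sgn_add, sgn_one]
      module
    rw [← hbd, Cell.primitive, dif_pos hex]
    exact hex.choose_spec

include hG in
/-- Morphisms from semi-free modules to modules which are acyclic at the objects at which cells
are attached are null-homotopic. -/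
theorem semifree_rep_acyclicAt (hT : ∀ s, T.AcyclicAt (l s)) :
    (DGMod.rep (k := k) ((semifree (fun s => G.obj (l s)) N).res G)).AcyclicAt T := by
  rintro m' m _ hm rfl φ hφ
  refine ⟨freeHom hG m' fun g => g.2.2.primitive hG φ m' hm, free_hom_ext hG fun g => ?_⟩
  have h1 := Cell.d_primitive hG hT φ hφ m' hm g.2.2
  refine (DGMod.happ_d m' m hm _ (l g.1) g.2.1 (g.2.1 + m') (g.2.1 + m) (g.2.1 + 1) rfl (by omega)
    rfl (by omega) rfl _).trans (sub_eq_iff_eq_add.mpr ?_)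
  refine (congrArg _ (freeHom_gen hG m' _ g)).trans (h1.trans ?_)
  exact congrArg (fun y => _ + sgn m' • DGMod.happ _ _ _ _ _ y) (cellD_gen _ N g).symm

end FreeHom

end DG

/-- An object `P` such that `Hom(P, ?)` inverts `W` has the same morphisms in the localization. -/
theorem CategoryTheory.Localization.map_bijective_of_postcomp {C : Type u} {D : Type u'}
    [Category.{v} C] [Category.{w} D] (L : C ⥤ D) (W : MorphismProperty C) [L.IsLocalization W] (P : C)
    (h : ∀ {X Y : C} (f : X ⟶ Y), W f → Function.Bijective (fun g : P ⟶ X => g ≫ f)) (R : C) :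
    Function.Bijective (L.map : (P ⟶ R) → (L.obj P ⟶ L.obj R)) := by
  let T := coyoneda.obj (Opposite.op P) ⋙ uliftFunctor.{w, v}
  have hT : W.IsInvertedBy T := by
    intro X Y f hf
    rw [isIso_iff_bijective]
    refine ⟨fun a b hab => ?_, fun b => ?_⟩
    · exact ULift.ext _ _ ((h f hf).1 (congrArg ULift.down hab))
    · obtain ⟨a, ha⟩ := (h f hf).2 b.down
      exact ⟨⟨a⟩, ULift.ext _ _ ha⟩
  let T' := Localization.lift T hT L
  let e : L ⋙ T' ≅ T := Localization.fac T hT L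
  let Y' := coyoneda.obj (Opposite.op (L.obj P)) ⋙ uliftFunctor.{v, w}
  let τ : T ⟶ L ⋙ Y' := 
    { app := fun R => TypeCat.ofHom (fun x => ⟨L.map x.down⟩)
      naturality := fun X Y f => by
        ext x
        exact ULift.ext _ _ (L.map_comp _ _) }
  let τ' : T' ⟶ Y' := Localization.liftNatTrans L W T (L ⋙ Y') T' Y' τ
  -- A Yoneda argument: `T'` is `Hom(P, ?)` descended to the localization and `u` corresponds to the
  -- identity of `P`. The inverse of `L.map` sends `g` to the element of `Hom(P, R)` corresponding
  -- to `T'.map g u`.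
  let u : T'.obj (L.obj P) := e.inv.app P ⟨𝟙 P⟩
  have hu : e.hom.app P u = ⟨𝟙 P⟩ :=
    congrArg (fun φ => φ (⟨𝟙 P⟩ : T.obj P)) (e.inv_hom_id_app P)
  have hx : ∀ {R : C} (x : P ⟶ R), e.hom.app R (T'.map (L.map x) u) = ⟨x⟩ := by
    intro R x
    have := congrArg (fun φ => φ u) (e.hom.naturality x)
    refine Eq.trans this ?_
    refine (congrArg (T.map x) hu).trans ?_
    exact ULift.ext _ _ (Category.id_comp x)
  refine ⟨fun x y hxy => ?_, fun g => ?_⟩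
  · have := (hx x).symm.trans ((congrArg (fun z => e.hom.app R (T'.map z u)) hxy).trans (hx y))
    exact congrArg ULift.down this
  · have h1 : ∀ (R : C) (x : T'.obj (L.obj R)), τ'.app (L.obj R) x = τ.app R (e.hom.app R x) := by
      intro R x
      simp [τ', e, Localization.liftNatTrans_app]
      rfl
    have h2 := congrArg (fun φ => φ u) (τ'.naturality g)
    have h3 : τ'.app (L.obj P) u = ⟨𝟙 _⟩ := by
      rw [h1, hu]
      exact ULift.ext _ _ (L.map_id P)
    refine ⟨(e.hom.app R (T'.map g u)).down, ?_⟩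
    have h4 : τ'.app (L.obj R) (T'.map g u) = ⟨g⟩ := by
      refine Eq.trans h2 ((congrArg (Y'.map g) h3).trans ?_)
      exact ULift.ext _ _ (Category.id_comp g)
    rw [h1] at h4
    exact congrArg ULift.down h4

namespace DG

/-! ### Morphisms in the homotopy category -/

section HoLemmas

open Tot

variable {k : Type w} [CommRing k] {E : Type u} [DGCategory.{w, v} k E]

theorem Ho.exists_homMk {X Y : Ho k E} (f : X ⟶ Y) : ∃ g : closed k X.of Y.of, f = Ho.homMk g :=
  ⟨Quotient.out f, (Quotient.out_eq f).symm⟩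

theorem Ho.homMk_eq_iff {X Y : E} {f g : closed k X Y} :
    Ho.homMk f = Ho.homMk g ↔ ∃ h : Hom k X Y (-1), D (ι h) = ι f.1 - ι g.1 := by
  refine (Submodule.Quotient.eq _).trans (mem_exact_iff.trans ?_)
  simp

theorem Ho.homMk_comp {X Y Z : E} (f : closed k X Y) (g : closed k Y Z) :
    Ho.homMk f ≫ Ho.homMk g = Ho.homMk (compClosed f g) := rfl

theorem Ho.homMk_id (X : E) : 𝟙 (⟨X⟩ : Ho k E) = Ho.homMk ⟨DGCategory.id X, d_id X⟩ := rfl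

/-- An acyclic Hom complex has only coboundaries as cocycles. -/
theorem DGMod.AcyclicAt.exists_D_eq {P X : E} (h : (DGMod.rep (k := k) P).AcyclicAt X) {m : ℤ}
    (l : ℤ) (hl : l + 1 = m) {x : Hom k P X m} (hx : D (ι x) = 0) :
    ∃ y : Hom k P X l, D (ι y) = ι x := by
  obtain ⟨y, hy⟩ := h l m (m + 1) hl rfl x (by rwa [D_ι m (m + 1) rfl, ι_eq_zero] at hx)
  exact ⟨y, (D_ι l m hl (f := (show Hom k P X l from y))).trans (congrArg ι hy)⟩

/-- The long exact sequence of `Hom(P, ?)` for the cone of `f`, whose third term vanishes. The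
homotopies and preimages are components in `X[1]` of primitives in `Hom(P, K)`. -/
theorem Ho.postcomp_bijective {P X Y K : E} (f : closed k X Y) (c : ConeData f.1 K)
    (h : (DGMod.rep (k := k) P).AcyclicAt K) :
    Function.Bijective (fun g : (⟨P⟩ : Ho k E) ⟶ ⟨X⟩ => g ≫ Ho.homMk f) := by
  constructor
  · intro g g' hg
    obtain ⟨a, rfl⟩ := Ho.exists_homMk g
    obtain ⟨b, rfl⟩ := Ho.exists_homMk g'
    obtain ⟨r, hr⟩ := Ho.homMk_eq_iff.mp hg
    have ha := mem_closed_iff.mp a.2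
    have hb := mem_closed_iff.mp b.2
    obtain ⟨e, he⟩ := h.exists_D_eq (-2) (by simp)
      (x := comp 0 (-1) (-1) (by simp) (a.1 - b.1) c.j - comp (-1) 0 (-1) (by simp) r c.i) (by
        have hr' : D (ι r) = ι a.1 ≫ ι f.1 - ι b.1 ≫ ι f.1 := by
          rw [hr, ← ι_comp 0 0 0 (by simp), ← ι_comp 0 0 0 (by simp)]
          rfl
        simp [ι_comp, D_comp, ha, hb, hr'])
    refine Ho.homMk_eq_iff.mpr ⟨-comp (-2) 1 (-1) (by simp) e c.p, ?_⟩
    rw [map_neg, ι_comp, map_neg, D_comp, he]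
    simp [ι_comp, sg_ι_one]
  · intro g
    obtain ⟨y, rfl⟩ := Ho.exists_homMk g
    have hy := mem_closed_iff.mp y.2
    obtain ⟨e, he⟩ := h.exists_D_eq (-1) (by simp) (x := comp 0 0 0 (by simp) y.1 c.i)
      (by simp [ι_comp, D_comp, hy])
    rw [ι_comp] at he
    have hDe : D (ι (comp (-1) 1 0 (by simp) e c.p)) = 0 := by
      simp [ι_comp, D_comp, he]
    refine ⟨Ho.homMk ⟨comp (-1) 1 0 (by simp) e c.p, mem_closed_iff.mpr hDe⟩,
      Ho.homMk_eq_iff.mpr ⟨-comp (-1) 0 (-1) (by simp) e c.s, ?_⟩⟩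
    change _ = ι (comp 0 0 0 _ _ _) - _
    rw [map_neg, map_neg, ι_comp, D_comp, he]
    simp [ι_comp, sub_eq_neg_add]

end HoLemmas

/-! ### Derived categories -/

section Der

open Tot

variable {k : Type w} [CommRing k] {A : Type u} [DGCategory.{w, u} k A]

/-- DG modules `P` such that the complexes `Hom(P, R)` are acyclic for all acyclic `R`. -/
def DGMod.KProjective (P : DGMod.{w, u, u, u} k A) : Prop :=
  ∀ R : DGMod.{w, u, u, u} k A, R.Acyclic → (DGMod.rep (k := k) P).AcyclicAt R

/-- For K-projective `P` the functor `Hom(P, ?)` inverts morphisms with acyclic cone, so morphisms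
out of `P` in the derived category are homotopy classes. -/
theorem DGMod.KProjective.Q_map_bijective {P : DGMod.{w, u, u, u} k A} (hP : P.KProjective)
    (R : DGMod.{w, u, u, u} k A) : Function.Bijective
      ((acyclicConeClass.{w, u, u, u} k A).Q.map : ((⟨P⟩ : Ho k _) ⟶ ⟨R⟩) → _) := by
  refine Localization.map_bijective_of_postcomp _ (acyclicConeClass.{w, u, u, u} k A) _ ?_ _
  rintro M N f ⟨g, rfl, hg⟩
  exact Ho.postcomp_bijective g (DGMod.coneData g) (hP _ hg)

theorem exists_toDer_eq (M : DerMod k A) : ∃ R : DGMod.{w, u, u, u} k A, toDer R = M := by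
  obtain ⟨R, hR⟩ := (Localization.Construction.objEquiv (acyclicConeClass.{w, u, u, u} k A)).surjective M
  exact ⟨R.of, hR⟩

variable {C : Type u} [DGCategory.{w, u} k C]

theorem derRes_map_Q_map (F : DGFunctor k C A) {M N : Ho k (DGMod.{w, u, u, u} k A)} (f : M ⟶ N) :
    (derRes F).map ((acyclicConeClass.{w, u, u, u} k A).Q.map f) =
      (acyclicConeClass.{w, u, u, u} k C).Q.map (F.res.ho.map f) := by
  have := Functor.congr_hom (Localization.Construction.fac
    (F.res.ho ⋙ (acyclicConeClass.{w, u, u, u} k C).Q) (res_inverts F)) f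
  exact this.trans ((Category.id_comp _).trans (Category.comp_id _))

/-- K-projectivity of `P` and of its restriction lets both Hom groups be computed in the homotopy
categories, where the statement is assumed. -/
theorem derRes_map_bijective (F : DGFunctor k C A) {P : DGMod.{w, u, u, u} k A}
    (hP : P.KProjective) (hPF : (P.res F).KProjective)
    (h : ∀ R : DGMod.{w, u, u, u} k A,
      Function.Bijective (F.res.ho.map : ((⟨P⟩ : Ho k _) ⟶ ⟨R⟩) → _)) (Y : DerMod k A) :
    Function.Bijective ((derRes F).map : (toDer P ⟶ Y) → _) := by
  obtain ⟨R, rfl⟩ := exists_toDer_eq Y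
  have h1 := (hPF.Q_map_bijective (R.res F)).comp (h R)
  have h2 : ((derRes F).map : (toDer P ⟶ toDer R) → _) ∘ (acyclicConeClass.{w, u, u, u} k A).Q.map =
      (acyclicConeClass.{w, u, u, u} k C).Q.map ∘ F.res.ho.map := by
    funext f
    exact derRes_map_Q_map F f
  exact (Function.Bijective.of_comp_iff _ (hP.Q_map_bijective R)).mp (h2 ▸ h1)

/-- The hypothesis says that `P` corepresents `Hom(res P, res ?)`, that is, `P` is the derived
induction of its own restriction. -/
theorem LInd_essImage_of_bijective (F : DGFunctor k C A) {P : DerMod k A}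
    (h : ∀ Y, Function.Bijective ((derRes F).map : (P ⟶ Y) → _)) : (LInd F).essImage P := by
  let c : (derRes F ⋙ coyoneda.obj (Opposite.op ((derRes F).obj P))).CorepresentableBy P :=
    { homEquiv := fun {Y} => Equiv.ofBijective _ (h Y)
      homEquiv_comp := fun g f => (derRes F).map_comp f g }
  have := c.isCorepresentable
  exact ⟨⟨(derRes F).obj P, this⟩, ⟨(Functor.corepresentableBy _).uniqueUpToIso c⟩⟩

/-- A morphism `P → M` which becomes invertible after restriction is invertible, if `M` is in the
image of derived induction and morphisms out of `P` are determined by their restrictions. -/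
theorem isIso_of_LInd_essImage (F : DGFunctor k C A) {P M : DerMod k A} (ε : P ⟶ M)
    (hε : IsIso ((derRes F).map ε))
    (h : Function.Injective ((derRes F).map : (P ⟶ P) → _)) (hM : (LInd F).essImage M) :
    IsIso ε := by
  obtain ⟨V, ⟨e⟩⟩ := hM
  have c : (derRes F ⋙ coyoneda.obj (Opposite.op V.obj)).CorepresentableBy M :=
    (Functor.corepresentableBy (hF := V.property) _).ofIsoObj e.symm
  -- The inverse of `ε`: since `M` is induced, morphisms `M → P` correspond to morphisms from `V` to
  -- the restriction of `P`, and `s` is the one whose restriction inverts that of `ε`. The identity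
  -- `s ≫ ε = 𝟙` is tested in the universal property of `M`, the other one by injectivity on
  -- endomorphisms of `P`.
  obtain ⟨s, hs⟩ : ∃ s, s = c.homEquiv.symm (c.homEquiv (𝟙 M) ≫ inv ((derRes F).map ε)) := ⟨_, rfl⟩
  have hs' : c.homEquiv s = c.homEquiv (𝟙 M) ≫ inv ((derRes F).map ε) := by rw [hs]; simp
  have h1 : s ≫ ε = 𝟙 M := by
    apply c.homEquiv.injective
    rw [c.homEquiv_comp, hs']
    change (_ ≫ _) ≫ (derRes F).map ε = _
    rw [Category.assoc, IsIso.inv_hom_id]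
    exact Category.comp_id _
  have h2 : (derRes F).map s = inv ((derRes F).map ε) := by
    rw [← cancel_mono ((derRes F).map ε), ← Functor.map_comp, h1, IsIso.inv_hom_id]
    exact (derRes F).map_id M
  refine ⟨s, h ?_, h1⟩
  rw [Functor.map_comp, h2, IsIso.hom_inv_id, CategoryTheory.Functor.map_id]

end Der


/-! ### Cohomology of DG modules -/

section Cohomology

open Tot

variable {k : Type w} [CommRing k] {A : Type u} [DGCategory.{w, v} k A]

namespace DGMod

/-- The cocycles of degree `n` of `M(X)`. -/
abbrev cocycles (M : DGMod.{w, v, u, t} k A) (X : A) (n : ℤ) : Submodule k (M.obj X n) :=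
  LinearMap.ker (M.d n (n + 1) rfl)

/-- The coboundaries among the cocycles. -/
abbrev cobounds (M : DGMod.{w, v, u, t} k A) (X : A) (n : ℤ) : Submodule k (M.cocycles X n) :=
  (LinearMap.range (M.d (X := X) (n - 1) n (by omega))).comap (M.cocycles X n).subtype

/-- The action of closed morphisms on cocycles. -/
def mapCocycles {M N : DGMod.{w, v, u, t} k A} (X : A) (n : ℤ) (φ : closed k M N)
    (x : M.cocycles X n) : N.cocycles X n :=
  ⟨app φ X n x.1, ((app_d φ n (n + 1) rfl x.1).symm.trans
    ((congrArg (app φ X (n + 1)) x.2).trans (map_zero _)) :)⟩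

theorem mapCocycles_sub_mem {M N : DGMod.{w, v, u, t} k A} (X : A) (n : ℤ) {φ φ' : closed k M N}
    (h : φ - φ' ∈ exact k M N) {x x' : M.cocycles X n} (hx : x - x' ∈ M.cobounds X n) :
    mapCocycles X n φ x - mapCocycles X n φ' x' ∈ N.cobounds X n := by
  obtain ⟨η, hη⟩ := h
  obtain ⟨y, hy⟩ := hx
  have hη' : DG.d (-1) 0 (by simp) η = φ.1 - φ'.1 := hη
  have hy' : M.d (n - 1) n (by omega) y = x.1 - x'.1 := hy
  have hx' : M.d n (n + 1) rfl x'.1 = 0 := x'.2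
  refine ⟨app φ X (n - 1) y + happ η X n (n - 1) (by omega) x'.1, ?_⟩
  have h1 := happ_d (-1) 0 (by simp) η X n (n - 1) n (n + 1) (by omega) (by omega) rfl
    (by omega) (by omega) x'.1
  rw [hη', hx', map_zero, smul_zero, sub_zero] at h1
  rw [map_add, ← h1, ← app_d, hy', map_sub]
  have h2 : happ (φ.1 - φ'.1) X n n (by omega) x'.1 = app φ X n x'.1 - app φ' X n x'.1 := by
    rw [sub_eq_add_neg, happ_add, happ_neg, ← sub_eq_add_neg]
    rfl
  rw [h2]
  exact sub_add_sub_cancel _ _ _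

/-- The cohomology group `Hⁿ(M(X))`, as a functor on the homotopy category of DG modules. -/
def cohomologyAt (X : A) (n : ℤ) : Ho k (DGMod.{w, v, u, t} k A) ⥤ Type t where
  obj M := M.of.cocycles X n ⧸ M.of.cobounds X n
  map {M N} f := TypeCat.ofHom (Quotient.map₂ (mapCocycles X n) (fun φ φ' h x x' hx => by
    rw [← Quotient.eq_iff_equiv, Quotient.eq, Submodule.quotientRel_def] at h hx ⊢
    exact mapCocycles_sub_mem X n h hx) f)
  map_id M := by
    ext x
    induction x using Submodule.Quotient.induction_on with | _ x
    exact congrArg Submodule.Quotient.mk (Subtype.ext (famId_apply M.of X n _ x.1))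
  map_comp {M N L} f g := by
    ext x
    obtain ⟨f, rfl⟩ := Ho.exists_homMk f
    obtain ⟨g, rfl⟩ := Ho.exists_homMk g
    induction x using Submodule.Quotient.induction_on with | _ x
    exact congrArg Submodule.Quotient.mk (Subtype.ext
      (happ_comp 0 0 0 _ f.1 g.1 X n n n (add_zero n) (add_zero n) (add_zero n) x.1))

variable {M N : DGMod.{w, v, u, t} k A}

theorem cohomologyAt_eq_iff {X : A} (l n : ℤ) (hl : l + 1 = n) {x y : M.cocycles X n} :
    (Submodule.Quotient.mk x : M.cocycles X n ⧸ M.cobounds X n) = Submodule.Quotient.mk y ↔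
      ∃ z, M.d l n hl z = x.1 - y.1 := by
  obtain rfl : l = n - 1 := by omega
  exact Submodule.Quotient.eq _

/-- Cohomology thus descends to the derived category, which is how acyclicity of a cone is recovered
from invertibility there. -/
theorem cohomologyAt_inverts (X : A) (n : ℤ) :
    (acyclicConeClass.{w, v, u, t} k A).IsInvertedBy (cohomologyAt X n) := by
  rintro M N f ⟨φ, rfl, hφ⟩
  have H : ∀ (l m n : ℤ) (h : l + 1 = m) (h' : m + 1 = n) (y : N.of.obj X m)
      (x : M.of.obj X (m + 1)), N.of.d m n h' y + happ φ.1 X (m + 1) n (by omega) x = 0 →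
        M.of.d (m + 1) (n + 1) (by omega) x = 0 →
      ∃ (y' : N.of.obj X l) (x' : M.of.obj X (l + 1)),
        N.of.d l m h y' + happ φ.1 X (l + 1) m (by omega) x' = y ∧
          -M.of.d (l + 1) (m + 1) (by omega) x' = x := by
    intro l m n h h' y x h1 h2
    obtain ⟨z, hz⟩ := hφ X l m n h h' (coneMk φ X m y x) (cone_obj_ext φ
      (by rw [coneFst_d, coneFst_mk, coneSnd_mk, h1, map_zero])
      (by rw [coneSnd_d, coneSnd_mk, h2, map_zero, neg_zero]))
    refine ⟨coneFst φ X l z, coneSnd φ X l z, ?_, ?_⟩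
    · rw [← coneFst_d φ X l m h, hz, coneFst_mk]
    · rw [← coneSnd_d φ X l m h, hz, coneSnd_mk]
  rw [isIso_iff_bijective]
  constructor
  · intro x x' hx
    induction x using Submodule.Quotient.induction_on with | _ x
    induction x' using Submodule.Quotient.induction_on with | _ x'
    obtain ⟨m, rfl⟩ : ∃ m, n = m + 1 := ⟨n - 1, by omega⟩
    obtain ⟨z, hz⟩ := (cohomologyAt_eq_iff m (m + 1) rfl).mp hx
    obtain ⟨y, w, h1, h2⟩ := H (m - 1) m (m + 1) (by omega) rfl (-z) (x.1 - x'.1) (by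
      rw [map_neg, hz, map_sub]
      exact neg_add_cancel _) (by rw [map_sub, x.2, x'.2, sub_zero])
    exact (cohomologyAt_eq_iff (m - 1 + 1) (m + 1) (by omega)).mpr ⟨-w, by rw [map_neg, h2]⟩
  · intro y
    induction y using Submodule.Quotient.induction_on with | _ y
    obtain ⟨l, rfl⟩ : ∃ l, n = l + 1 := ⟨n - 1, by omega⟩
    obtain ⟨y', x', h1, h2⟩ := H l (l + 1) (l + 1 + 1) rfl rfl y.1 0
      (by rw [map_zero, add_zero]; exact y.2) (map_zero _)
    exact ⟨Submodule.Quotient.mk ⟨x', neg_eq_zero.mp h2⟩, (cohomologyAt_eq_iff l (l + 1) rfl).mpr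
      ⟨-y', by rw [map_neg, ← h1]; exact (sub_add_cancel_right _ _).symm⟩⟩

/-- A closed morphism which is invertible in the derived category has acyclic cone. -/
theorem acyclic_cone_of_isIso {A : Type u} [DGCategory.{w, u} k A] {M N : DGMod.{w, u, u, u} k A}
    (φ : closed k M N) (h : IsIso ((acyclicConeClass.{w, u, u, u} k A).Q.map (Ho.homMk φ))) :
    (cone φ).Acyclic := by
  have hb : ∀ (X : A) (n : ℤ), Function.Bijective ((cohomologyAt X n).map (Ho.homMk φ)) := by
    intro X n
    rw [← isIso_iff_bijective, ← NatIso.isIso_map_iff (Localization.fac (cohomologyAt X n)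
      (cohomologyAt_inverts X n) (acyclicConeClass.{w, u, u, u} k A).Q)]
    exact inferInstanceAs (IsIso ((Localization.lift (cohomologyAt X n) (cohomologyAt_inverts X n)
      (acyclicConeClass.{w, u, u, u} k A).Q).map
        ((acyclicConeClass.{w, u, u, u} k A).Q.map (Ho.homMk φ))))
  rintro X l m n rfl h' p hp
  have h1 : N.d (l + 1) n h' (coneFst φ X _ p) +
      app φ X n (M.objCast X (by omega) (coneSnd φ X _ p)) = 0 := by
    subst h'
    exact (coneFst_d φ X (l + 1) (l + 1 + 1) rfl p).symm.trans ((congrArg _ hp).trans (map_zero _))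
  subst h'
  have h2 : M.d (l + 1 + 1) (l + 1 + 1 + 1) rfl (coneSnd φ X (l + 1) p) = 0 :=
    neg_eq_zero.mp ((coneSnd_d φ X (l + 1) (l + 1 + 1) rfl p).symm.trans
      ((congrArg _ hp).trans (map_zero _)))
  -- The component of `p` in the source maps to a coboundary, so injectivity in cohomology gives it
  -- a primitive `z`.
  obtain ⟨z, hz⟩ := (cohomologyAt_eq_iff (l + 1) (l + 1 + 1) rfl).mp ((hb X (l + 1 + 1)).1
    (a₁ := Submodule.Quotient.mk ⟨coneSnd φ X (l + 1) p, h2⟩) (a₂ := Submodule.Quotient.mk 0)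
    ((cohomologyAt_eq_iff (l + 1) (l + 1 + 1) rfl).mpr ⟨-coneFst φ X (l + 1) p, by
      rw [map_neg, neg_eq_iff_add_eq_zero]
      refine (congrArg (_ + ·) ?_).trans h1
      exact (congrArg (_ - ·) (map_zero (app φ X (l + 1 + 1)))).trans (sub_zero _)⟩))
  replace hz : M.d (l + 1) (l + 1 + 1) rfl z = coneSnd φ X (l + 1) p := hz.trans (sub_zero _)
  replace h1 : N.d (l + 1) (l + 1 + 1) rfl (coneFst φ X _ p) +
      app φ X (l + 1 + 1) (coneSnd φ X _ p) = 0 := h1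
  -- What remains in the target is a cocycle; surjectivity in cohomology replaces it, up to a
  -- coboundary, by the image of a cocycle of the source.
  obtain ⟨ξ, hξ⟩ := (hb X (l + 1)).2 (Submodule.Quotient.mk ⟨coneFst φ X _ p + app φ X _ z, by
    rw [LinearMap.mem_ker, map_add, ← app_d, hz, h1]⟩)
  induction ξ using Submodule.Quotient.induction_on with | _ x
  obtain ⟨y, hy⟩ := (cohomologyAt_eq_iff l (l + 1) rfl).mp hξ
  replace hy : N.d l (l + 1) rfl y = app φ X (l + 1) x.1 -
    (coneFst φ X _ p + app φ X _ z) := hy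
  refine ⟨coneMk φ X l (-y) (x.1 - z), cone_obj_ext φ ?_ ?_⟩
  · rw [coneFst_d, coneFst_mk, coneSnd_mk, map_neg, hy, map_sub]
    change _ + (app φ X (l + 1) x.1 - app φ X (l + 1) z) = _
    abel
  · rw [coneSnd_d, coneSnd_mk, map_sub, hz, x.2]
    abel

end DGMod

end Cohomology

/-! ### The essential image of derived induction -/

section EssImage

open Tot

/-- Composition of DG functors. -/
def DGFunctor.comp {k : Type w} [CommRing k] {A : Type u} {C : Type u'} {E : Type u''}
    [DGCategory.{w, v} k A] [DGCategory.{w, v} k C] [DGCategory.{w, v} k E]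
    (F : DGFunctor k A C) (G : DGFunctor k C E) : DGFunctor k A E where
  obj X := G.obj (F.obj X)
  map n := G.map n ∘ₗ F.map n
  map_d n m h f := (congrArg (G.map m) (F.map_d n m h f)).trans (G.map_d n m h _)
  map_id X := (congrArg (G.map 0) (F.map_id X)).trans (G.map_id _)
  map_comp p q n h f g :=
    (congrArg (G.map n) (F.map_comp p q n h f g)).trans (G.map_comp p q n h _ _)

theorem DGFunctor.ho_map_bijective {k : Type w} [CommRing k] {A : Type u} {C : Type u'}
    [DGCategory.{w, v} k A] [DGCategory.{w, v} k C] (F : DGFunctor k A C) {X Y : A}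
    (h : ∀ n, Function.Bijective (F.map n : Hom k X Y n → _)) :
    Function.Bijective (F.ho.map : ((⟨X⟩ : Ho k A) ⟶ ⟨Y⟩) → _) := by
  constructor
  · intro f g hfg
    obtain ⟨f, rfl⟩ := Ho.exists_homMk f
    obtain ⟨g, rfl⟩ := Ho.exists_homMk g
    obtain ⟨a, ha⟩ := Ho.homMk_eq_iff.mp
      (show Ho.homMk (F.mapClosed X Y f) = Ho.homMk (F.mapClosed X Y g) from hfg)
    obtain ⟨b, rfl⟩ := (h (-1)).2 a
    refine Ho.homMk_eq_iff.mpr ⟨b, ?_⟩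
    rw [D_ι (-1) 0 (by simp), ← map_sub] at ha ⊢
    refine congrArg ι ((h 0).1 ?_)
    rw [F.map_d, ι_injective ha, map_sub]
    rfl
  · intro g
    obtain ⟨g, rfl⟩ := Ho.exists_homMk g
    obtain ⟨f, hf⟩ := (h 0).2 g.1
    have hfc : d 0 1 (zero_add 1) f = 0 := (h 1).1 (by
      rw [F.map_d, hf, map_zero]
      exact g.2)
    exact ⟨Ho.homMk ⟨f, hfc⟩, congrArg Ho.homMk (Subtype.ext hf)⟩

variable {k : Type w} [CommRing k] {A : Type u} {E : Type u} [DGCategory.{w, u} k A]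
  [DGCategory.{w, u} k E] {G : DGFunctor k A E} (hG : G.FullyFaithful)

variable {S : Type u} [DGCategory.{w, u} k S] {I : DGFunctor k S A} (hI : I.FullyFaithful)

include hI hG in
theorem DGFunctor.FullyFaithful.comp : (I.comp G).FullyFaithful :=
  fun X Y n => (hG (I.obj X) (I.obj Y) n).comp (hI X Y n)

variable (N : DGMod.{w, u, u, u} k E)

include hG in
theorem semifree_kProjective :
    ((semifree (fun s : S => G.obj (I.obj s)) N).res G).KProjective := fun _ hR =>
  semifree_rep_acyclicAt hG (l := I.obj) fun s => hR (I.obj s)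

-- Restricted to `S` the module is free on the same cells, since all cells sit at objects of `S` and
-- both functors are fully faithful.
include hG hI in
theorem semifree_res_kProjective :
    (((semifree (fun s : S => G.obj (I.obj s)) N).res G).res I).KProjective := fun _ hR =>
  semifree_rep_acyclicAt (DGFunctor.FullyFaithful.comp hG hI) (l := fun s : S => s) fun s => hR s

-- On both sides a morphism amounts to an arbitrary choice of values at the generators, and all
-- generators live at objects of `S`.
include hG hI in
theorem semifree_res_map_bijective (R : DGMod.{w, u, u, u} k A) (n : ℤ) : Function.Bijective
    (I.res.map n : Hom k ((semifree (fun s : S => G.obj (I.obj s)) N).res G) R n → _) := by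
  constructor
  · intro φ ψ h
    refine free_hom_ext hG (l := I.obj) fun g => ?_
    exact congrArg (fun χ => DGMod.happ χ g.1 g.2.1 (g.2.1 + n) rfl (cellGen _ N g)) h
  · intro ψ
    refine ⟨freeHom hG (l := I.obj) n fun g =>
      DGMod.happ ψ g.1 g.2.1 (g.2.1 + n) rfl (cellGen _ N g), ?_⟩
    refine free_hom_ext (DGFunctor.FullyFaithful.comp hG hI) (l := fun s : S => s) fun g => ?_
    exact freeHom_gen hG (l := I.obj) n _ g

include hG hI in
/-- The module `N` restricted to `A` is derived induced from `S` if and only if the cone of its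
semi-free approximation with cells attached at `S` is acyclic. -/
theorem LInd_essImage_res_iff : (LInd I).essImage (toDer (N.res G)) ↔
    ∀ X : A, (DGMod.cone (semifreeAug (fun s : S => G.obj (I.obj s)) N)).AcyclicAt (G.obj X) := by
  let j : S → E := fun s => G.obj (I.obj s)
  let P := (semifree j N).res G
  let ε : closed k P (N.res G) := G.res.mapClosed _ _ (semifreeAug j N)
  let Qε : toDer P ⟶ toDer (N.res G) :=
    (acyclicConeClass.{w, u, u, u} k A).Q.map (Ho.homMk ε)
  have hbij : ∀ Y, Function.Bijective ((derRes I).map : (toDer P ⟶ Y) → _) :=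
    derRes_map_bijective I (semifree_kProjective hG N)
      (semifree_res_kProjective hG hI N) fun R =>
        I.res.ho_map_bijective (semifree_res_map_bijective hG hI N R)
  constructor
  · intro hM
    -- The augmentation is a quasi-isomorphism at the objects where cells are attached, which are
    -- precisely those coming from `S`.
    have hε : IsIso ((derRes I).map Qε) := by
      refine (derRes_map_Q_map I (Ho.homMk ε)).symm ▸ ?_
      exact MorphismProperty.Q_inverts _ _ ⟨I.res.mapClosed _ _ ε, rfl,
        fun b => semifreeAug_acyclicAt j N b⟩
    have := isIso_of_LInd_essImage I Qε hε (hbij _).1 hM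
    exact fun X => DGMod.acyclic_cone_of_isIso ε this X
  · intro h
    have : IsIso Qε := MorphismProperty.Q_inverts _ _ ⟨ε, rfl, fun X => h X⟩
    exact (LInd I).essImage.prop_of_iso (asIso Qε)
      (LInd_essImage_of_bijective I hbij)

end EssImage


/-! ### Comparison of the modules `Cone(Hom(X, Y) → Hom(ξ X, ξ Y))` -/

section Comparison

open Tot

/-- Closed morphisms of degree zero with bijective components have acyclic cones. -/
theorem DGMod.acyclic_cone_of_bijective {k : Type w} [CommRing k] {A : Type u}
    [DGCategory.{w, v} k A] {M N : DGMod.{w, v, u, t} k A} (φ : closed k M N)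
    (h : ∀ X n, Function.Bijective (app φ X n)) : (cone φ).Acyclic := by
  rintro X l m n rfl rfl p hp
  have h1 : N.d (l + 1) (l + 1 + 1) rfl (coneFst φ X _ p) +
      app φ X (l + 1 + 1) (coneSnd φ X _ p) = 0 :=
    (coneFst_d φ X (l + 1) (l + 1 + 1) rfl p).symm.trans ((congrArg _ hp).trans (map_zero _))
  obtain ⟨z, hz⟩ := (h X (l + 1)).2 (coneFst φ X _ p)
  have h2 : -M.d (l + 1) (l + 1 + 1) rfl z = coneSnd φ X _ p := by
    rw [neg_eq_iff_add_eq_zero]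
    refine (h X (l + 1 + 1)).1 ?_
    rw [map_add, app_d, hz, h1, map_zero]
  refine ⟨coneMk φ X l 0 z, cone_obj_ext φ ?_ ?_⟩
  · rw [coneFst_d, coneFst_mk, coneSnd_mk, map_zero, zero_add]
    exact hz
  · rw [coneSnd_d, coneSnd_mk, h2]

/-- An isomorphism between the complexes `Hom(ξ X, ξ Y)` and `Hom(Ξ X, Ξ Y)`, compatible with
compositions and with the maps from `Hom(X, Y)`. -/
structure HomIso {k : Type w} [CommRing k] {A : Type u} {C : Type u'} {E : Type u''}
    [DGCategory.{w, v} k A] [DGCategory.{w, v} k C] [DGCategory.{w, v} k E]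
    (ξ : DGFunctor k A C) (Ξ : DGFunctor k A E) where
  app : ∀ (X Y : A) (n : ℤ), Hom k (ξ.obj X) (ξ.obj Y) n →ₗ[k] Hom k (Ξ.obj X) (Ξ.obj Y) n
  bijective : ∀ X Y n, Function.Bijective (app X Y n)
  app_d : ∀ (X Y : A) (n m : ℤ) (h : n + 1 = m) (f : Hom k (ξ.obj X) (ξ.obj Y) n),
    app X Y m (d n m h f) = d n m h (app X Y n f)
  app_comp : ∀ (X Y Z : A) (p q n : ℤ) (h : p + q = n) (f : Hom k (ξ.obj X) (ξ.obj Y) p)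
    (g : Hom k (ξ.obj Y) (ξ.obj Z) q),
    app X Z n (comp p q n h f g) = comp p q n h (app X Y p f) (app Y Z q g)
  app_map : ∀ (X Y : A) (n : ℤ) (f : Hom k X Y n), app X Y n (ξ.map n f) = Ξ.map n f

/-- The dual isomorphism. -/
def HomIso.op {k : Type w} [CommRing k] {A : Type u} {C : Type u'} {E : Type u''}
    [DGCategory.{w, v} k A] [DGCategory.{w, v} k C] [DGCategory.{w, v} k E]
    {ξ : DGFunctor k A C} {Ξ : DGFunctor k A E} (κ : HomIso ξ Ξ) : HomIso ξ.op Ξ.op where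
  app X Y n := κ.app Y.unop X.unop n
  bijective X Y n := κ.bijective Y.unop X.unop n
  app_d X Y n m h f := κ.app_d Y.unop X.unop n m h f
  app_comp X Y Z p q n h f g := by
    have h' := κ.app_comp Z.unop Y.unop X.unop q p n (by omega) g f
    exact (map_zsmul (κ.app Z.unop X.unop n) (sgn (p * q)) _).trans
      (congrArg (sgn (p * q) • ·) h')
  app_map X Y n f := κ.app_map Y.unop X.unop n f

variable {k : Type w} [CommRing k] {A : Type u} {C : Type u'} {E : Type u} {E' : Type u''}
  [DGCategory.{w, u} k A] [DGCategory.{w, u} k C] [DGCategory.{w, u} k E] [DGCategory.{w, u} k E']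
  {ξ : DGFunctor k A C} {G : DGFunctor k A E} {Ξ : DGFunctor k E E'}

namespace HomIso

variable (κ : HomIso ξ (G.comp Ξ)) (X : A)

/-- The components of the comparison morphism between the cone modules of `ξ` and `Ξ`. -/
def lin (Y : A) (p : ℤ) :
    (coneModule ξ X).obj Y p →ₗ[k] ((coneModule Ξ (G.obj X)).res G).obj Y p :=
  LinearMap.prodMap (κ.app X Y p) (G.map (p + 1) : Hom k X Y (p + 1) →ₗ[k] _)

theorem lin_act {Y Z : A} (a p n : ℤ) (h : a + p = n) (f : Hom k Y Z a)
    (x : (coneModule ξ X).obj Y p) :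
    κ.lin X Z n ((coneModule ξ X).act a p n h f x) =
      ((coneModule Ξ (G.obj X)).res G).act a p n h f (κ.lin X Y p x) := by
  refine Prod.ext ?_ ?_
  · refine (κ.app_comp X Y Z p a n (by omega) x.1 (ξ.map a f)).trans ?_
    exact congrArg (DG.comp p a n (by omega) (κ.app X Y p x.1)) (κ.app_map Y Z a f)
  · refine (map_zsmul (G.map (n + 1)) (sgn a) _).trans (congrArg (sgn a • ·) ?_)
    exact G.map_comp (p + 1) a (n + 1) (by omega) x.2 f

theorem lin_d {Y : A} (p q : ℤ) (h : p + 1 = q) (x : (coneModule ξ X).obj Y p) :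
    κ.lin X Y q ((coneModule ξ X).d p q h x) =
      ((coneModule Ξ (G.obj X)).res G).d p q h (κ.lin X Y p x) := by
  subst h
  refine Prod.ext ?_ ?_
  · refine (map_add (κ.app X Y (p + 1)) _ _).trans (congrArg₂ (· + ·) (κ.app_d X Y p _ rfl x.1) ?_)
    refine (congrArg (κ.app X Y (p + 1)) (repFam_app ξ X Y (p + 1) _ x.2)).trans ?_
    exact (κ.app_map X Y (p + 1) x.2).trans
      (repFam_app Ξ (G.obj X) (G.obj Y) (p + 1) _ (G.map (p + 1) x.2)).symm
  · refine (map_neg (G.map (p + 1 + 1)) _).trans (congrArg Neg.neg ?_)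
    exact G.map_d (p + 1) (p + 1 + 1) rfl x.2

/-- The comparison morphism between the cone modules of `ξ` and `Ξ`. -/
def homZero : Hom k (coneModule ξ X) ((coneModule Ξ (G.obj X)).res G) 0 :=
  DGMod.homOfApp (fun Y _ _ h =>
    ((coneModule Ξ (G.obj X)).res G).objCast Y (by omega) ∘ₗ κ.lin X Y _)
    (fun Y Z a p p' q q' h hq hq' h' f x => by
      obtain rfl : p = q := by omega
      obtain rfl : p' = q' := by omega
      rw [zero_mul, sgn_zero, one_smul]
      exact κ.lin_act X a p p' h f x)

theorem happ_homZero (Y : A) (p : ℤ) (h : p + 0 = p) (x : (coneModule ξ X).obj Y p) :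
    DGMod.happ (κ.homZero X) Y p p h x = κ.lin X Y p x := by
  rw [homZero, DGMod.happ_homOfApp]
  rfl

-- The comparison is the given isomorphism on the target summand and `G` on the source summand,
-- hence bijective, and its cone is acyclic.
include κ in
theorem toDer_iso (hG : G.FullyFaithful) :
    Nonempty (toDer (coneModule ξ X) ≅ toDer ((coneModule Ξ (G.obj X)).res G)) := by
  have hc : DG.d 0 1 (zero_add 1) (κ.homZero X) = 0 := DGMod.hom_ext' fun Y p q h x => by
    rw [DGMod.happ_d 0 1 _ _ Y p p q q (add_zero p) h h (add_zero q), DGMod.happ_zero, sgn_zero,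
      one_smul, happ_homZero, happ_homZero, lin_d, sub_self]
  let φ : closed k (coneModule ξ X) ((coneModule Ξ (G.obj X)).res G) := ⟨κ.homZero X, hc⟩
  have : IsIso ((acyclicConeClass.{w, u, u, u} k A).Q.map (Ho.homMk φ)) := by
    refine MorphismProperty.Q_inverts _ _ ⟨φ, rfl, DGMod.acyclic_cone_of_bijective φ
      fun Y n => ?_⟩
    have h1 : (DGMod.app φ Y n : _ → _) = Prod.map (κ.app X Y n) (G.map (n + 1)) :=
      funext fun x => κ.happ_homZero X Y n (add_zero n) x
    exact h1 ▸ (κ.bijective X Y n).prodMap (hG X Y (n + 1))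
  exact ⟨@asIso _ _ _ _ _ this⟩

end HomIso

end Comparison

/-! ### Killability and semi-free approximations -/

section KillableAcyclic

open Tot

variable {k : Type w} [CommRing k] {E : Type u} {E' : Type u''}
  [DGCategory.{w, u} k E] [DGCategory.{w, u} k E'] {Ξ : DGFunctor k E E'} {X : E}

/-- The element `(c, a)` of `Cone(Hom(X, Y) → Hom(Ξ X, Ξ Y))`. -/
def coneModule.mk {Y : E} (l : ℤ) (c : Hom k (Ξ.obj X) (Ξ.obj Y) l) (a : Hom k X Y (l + 1)) :
    (coneModule Ξ X).obj Y l := (c, a)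

theorem coneModule_d_mk {Y : E} (l n : ℤ) (h : l + 1 = n) (c : Hom k (Ξ.obj X) (Ξ.obj Y) l)
    (a : Hom k X Y (l + 1)) :
    (coneModule Ξ X).d l n h (coneModule.mk l c a) =
      coneModule.mk n (d l n h c + Ξ.map n (degCast h a))
        (-d (l + 1) (n + 1) (by omega) a) := by
  subst h
  refine Prod.ext (congrArg (d l (l + 1) rfl c + ·) ?_) rfl
  exact repFam_app Ξ X Y (l + 1) _ a

theorem coneModule_act_mk {Y Z : E} (l : ℤ) (f : Hom k Y Z 0) (c : Hom k (Ξ.obj X) (Ξ.obj Y) l)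
    (a : Hom k X Y (l + 1)) :
    (coneModule Ξ X).act 0 l l (zero_add l) f (coneModule.mk l c a) =
      coneModule.mk l (comp l 0 l (add_zero l) c (Ξ.map 0 f))
        (comp (l + 1) 0 (l + 1) (add_zero _) a f) := by
  refine Prod.ext rfl ?_
  change sgn 0 • _ = _
  rw [sgn_zero, one_smul]
  rfl

theorem coneModule_mk_inj {Y : E} {l : ℤ} {c c' : Hom k (Ξ.obj X) (Ξ.obj Y) l} {a a' : Hom k X Y (l + 1)} :
    (coneModule.mk l c a : (coneModule Ξ X).obj Y l) = coneModule.mk l c' a' ↔ c = c' ∧ a = a' := Prod.ext_iff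

theorem coneModule.exists_mk {Y : E} {l : ℤ} (x : (coneModule Ξ X).obj Y l) :
    ∃ c a, x = coneModule.mk l c a := ⟨_, _, rfl⟩

theorem coneModule_tD_mk_eq_zero {Y : E} (l : ℤ) (c : Hom k (Ξ.obj X) (Ξ.obj Y) l)
    (a : Hom k X Y (l + 1)) :
    (coneModule Ξ X).tD ((coneModule Ξ X).el (coneModule.mk l c a)) = 0 ↔
      D (ι c) + Ξ.tot (ι a) = 0 ∧ D (ι a) = 0 := by
  rw [DGMod.tD_el_eq_zero _ _ (l + 1) rfl, coneModule_d_mk]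
  refine (coneModule_mk_inj (c' := 0) (a' := 0)).trans (and_congr ?_ ?_)
  · rw [D_ι _ _ rfl, Ξ.tot_ι, ← map_add, ι_eq_zero]
    rfl
  · rw [D_ι _ _ rfl, ι_eq_zero]
    exact neg_eq_zero

theorem coneModule_tact_mk_eq {Y K : E} (l m : ℤ) (h : m + 1 = l) (c : Hom k (Ξ.obj X) (Ξ.obj Y) l)
    (a : Hom k X Y (l + 1)) (t : Hom k Y K 0) (e : Hom k (Ξ.obj X) (Ξ.obj K) m)
    (b : Hom k X K (m + 1)) :
    (coneModule Ξ X).tact (ι t) ((coneModule Ξ X).el (coneModule.mk l c a)) =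
      (coneModule Ξ X).tD ((coneModule Ξ X).el (coneModule.mk m e b)) ↔
      ι c ≫ Ξ.tot (ι t) = D (ι e) + Ξ.tot (ι b) ∧ ι a ≫ ι t = -D (ι b) := by
  subst h
  rw [DGMod.tact_ι_el _ 0 _ _ (zero_add _), DGMod.tD_el _ _ _ rfl, coneModule_act_mk,
    coneModule_d_mk, DGMod.el_inj, coneModule_mk_inj]
  refine and_congr ?_ ?_
  · rw [D_ι _ _ rfl, Ξ.tot_ι, Ξ.tot_ι, ← map_add, ← ι_comp _ _ _ (add_zero _)]
    exact ι_inj.symm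
  · rw [D_ι _ _ rfl, ← map_neg (ι (k := k) (X := X) (Y := K)), ← ι_comp _ _ _ (add_zero _)]
    exact (ι_inj (k := k) (X := X) (Y := K)).symm

/-- Killability, in terms of the module `Cone(Hom(X, ?) → Hom(Ξ X, Ξ ?))`. -/
theorem killable_iff {P : E → Prop} : Killable Ξ P X ↔
    ∀ (Y : E) (m l : ℤ) (_ : m + 1 = l) (x : (coneModule Ξ X).obj Y l),
      (coneModule Ξ X).tD ((coneModule Ξ X).el x) = 0 →
      ∃ (K : E) (t : Hom k Y K 0) (y : (coneModule Ξ X).obj K m), Tower k P t ∧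
        (coneModule Ξ X).tact (ι t) ((coneModule Ξ X).el x) =
          (coneModule Ξ X).tD ((coneModule Ξ X).el y) := by
  constructor
  · rintro H Y m l rfl x hx
    obtain ⟨c, a, rfl⟩ := coneModule.exists_mk x
    rw [coneModule_tD_mk_eq_zero] at hx
    obtain ⟨K, t, b, e, ht, hb, he⟩ := H Y m (m + 1) (m + 1 + 1) rfl rfl a c hx.2 hx.1
    exact ⟨K, t, coneModule.mk m e b, ht, (coneModule_tact_mk_eq _ _ rfl _ _ _ _ _).mpr ⟨he, hb⟩⟩
  · rintro H Y m l n rfl rfl a c ha hac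
    obtain ⟨K, t, y, ht, hy⟩ := H Y m (m + 1) rfl (coneModule.mk (m + 1) c a)
      ((coneModule_tD_mk_eq_zero _ _ _).mpr ⟨hac, ha⟩)
    obtain ⟨e, b, rfl⟩ := coneModule.exists_mk y
    obtain ⟨he, hb⟩ := (coneModule_tact_mk_eq _ _ rfl _ _ _ _ _).mp hy
    exact ⟨K, t, b, e, ht, hb, he⟩

variable {S : Type u} {j : S → E} {P : E → Prop}

/-- By acyclicity a cocycle `x` of `N(Y)` is, up to a coboundary, the image of a cocycle of the
semi-free module, which has the form `f z` with `f : Z → Y` and `Z` in `P`. In the cone of `f` one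
has `f ≫ i = D j`, so `i x` is a coboundary. A tower of a single step suffices. -/
theorem killable_of_acyclic (hE : HasCones k E) (hP : IsHull k j P)
    (h : ∀ Y, (DGMod.cone (semifreeAug j (coneModule Ξ X))).AcyclicAt Y) : Killable Ξ P X := by
  rw [killable_iff]
  generalize coneModule Ξ X = N at h
  intro Y m l hml x hx
  let ε := semifreeAug j N
  obtain ⟨u, hu⟩ := h Y m l (l + 1) hml rfl (DGMod.coneMk ε Y l x 0) (DGMod.cone_obj_ext ε
    (by
      rw [DGMod.coneFst_d, DGMod.coneFst_mk, DGMod.coneSnd_mk, map_zero, map_zero, add_zero]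
      exact (N.tD_el_eq_zero l _ rfl x).mp hx)
    (by rw [DGMod.coneSnd_d, DGMod.coneSnd_mk, map_zero, map_zero, neg_zero]))
  subst hml
  have h1 := congrArg (DGMod.coneFst ε Y _) hu
  have h2 := congrArg (DGMod.coneSnd ε Y _) hu
  rw [DGMod.coneFst_d, DGMod.coneFst_mk] at h1
  rw [DGMod.coneSnd_d, DGMod.coneSnd_mk, neg_eq_zero] at h2
  obtain ⟨Z, f, z, hZ, hf, hz, hfz⟩ := exists_eq_tact_of_closed hP (DGMod.coneSnd ε Y m u)
    ((DGMod.tD_el_eq_zero _ _ _ rfl _).mpr h2)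
  obtain ⟨K, ⟨c⟩⟩ := hE Z Y f hf
  have h3 : N.el x = N.tD (N.el (DGMod.coneFst ε Y m u)) +
      N.tact (ι f) (DGMod.tmap ε ((semifree j N).el z)) := by
    rw [← DGMod.tmap_tact, hfz, DGMod.tmap_el, N.tD_el _ _ rfl, ← map_add]
    exact congrArg N.el h1.symm
  refine ⟨K, c.i, N.act 0 m m (zero_add m) c.i (DGMod.coneFst ε Y m u) +
    N.act (-1) (m + 1) m (by omega) c.j (DGMod.app ε Z (m + 1) z), .of_cone hZ c, ?_⟩
  rw [map_add, map_add, N.el_act, N.el_act, N.tD_tact, N.tD_tact, c.D_i, c.D_j, ← DGMod.tmap_el,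
    ← DGMod.tmap_tD, hz, h3]
  simp [N.tact_comp]

/-- A cocycle `(x, p)` of the cone of the augmentation is made a coboundary along a tower: the first
step kills `p`, killability provides the remaining steps for what is left of `x`. Since this cone is
acyclic at the cells, hence on all of `P`, towers induce injections in its cohomology, and `(x, p)`
was a coboundary already. -/
theorem acyclic_of_killable (hE : HasCones k E) (hP : IsHull k j P) (h : Killable Ξ P X) (Y : E) :
    (DGMod.cone (semifreeAug j (coneModule Ξ X))).AcyclicAt Y := by
  rw [killable_iff] at h
  generalize coneModule Ξ X = N at h
  let ε := semifreeAug j N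
  refine .of_exists fun l m hlm q hq => ?_
  subst hlm
  rw [DGMod.tD_el_eq_zero _ _ (l + 1 + 1) rfl] at hq
  have h1 := congrArg (DGMod.coneFst ε Y _) hq
  have h2 := congrArg (DGMod.coneSnd ε Y _) hq
  rw [DGMod.coneFst_d, map_zero] at h1
  rw [DGMod.coneSnd_d, map_zero, neg_eq_zero] at h2
  obtain ⟨x, hx⟩ : ∃ x, x = DGMod.coneFst ε Y _ q := ⟨_, rfl⟩
  obtain ⟨p, hp⟩ : ∃ p, p = DGMod.coneSnd ε Y _ q := ⟨_, rfl⟩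
  rw [← hx, ← hp] at h1
  rw [← hp] at h2
  obtain ⟨Z, f, z, hZ, hf, hz, hfz⟩ := exists_eq_tact_of_closed hP p
    ((DGMod.tD_el_eq_zero _ _ _ rfl _).mpr h2)
  obtain ⟨K, ⟨c⟩⟩ := hE Z Y f hf
  -- `p = f z` acquires the primitive `y = j z` in the cone of `f`, and `i x + ε y` becomes a
  -- cocycle of `N(K)`.
  let y : (semifree j N).obj K (l + 1) := (semifree j N).act (-1) (l + 1 + 1) (l + 1) (by omega) c.j z
  have hy : (semifree j N).tD ((semifree j N).el y) =
      (semifree j N).tact (ι c.i) ((semifree j N).el p) := by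
    rw [DGMod.el_act, DGMod.tD_tact, c.D_j, hz, ← hfz]
    simp [DGMod.tact_comp]
  clear_value y
  have h1' : N.tD (N.el x) + DGMod.tmap ε ((semifree j N).el p) = 0 := by
    rw [N.tD_el _ _ rfl, DGMod.tmap_el, ← map_add]
    exact (congrArg N.el h1).trans (map_zero _)
  obtain ⟨K', t, e, ht, he⟩ := h K l (l + 1) rfl
    (N.act 0 (l + 1) (l + 1) (zero_add _) c.i x + DGMod.app ε K (l + 1) y) (by
      rw [map_add, map_add, N.el_act, N.tD_tact, c.D_i, ← DGMod.tmap_el, ← DGMod.tmap_tD, hy,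
        DGMod.tmap_tact, sg_ι_zero, map_zero, AddMonoidHom.zero_apply, zero_add, ← map_add, h1',
        map_zero])
  have hT : Tower k P (comp 0 0 0 (zero_add 0) c.i t) := .step hZ c ht
  refine hT.exists_cobound _ (fun Z hZ => DGMod.AcyclicAt.of_generated _
    (semifreeAug_acyclicAt j N) (hP.gen Z hZ)) rfl (e := DGMod.coneMk ε K' l e
      (-(semifree j N).act 0 (l + 1) (l + 1) (zero_add _) t y)) ?_
  rw [DGMod.tact_ι_el _ 0 _ _ (zero_add _), DGMod.tD_el _ _ _ rfl, DGMod.el_inj]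
  have hDt := ht.D_eq_zero
  refine DGMod.cone_obj_ext ε ?_ ?_
  · rw [DGMod.coneFst_d, DGMod.coneFst_mk, DGMod.coneSnd_mk]
    change _ = N.act 0 (l + 1) (l + 1) (zero_add _) (comp 0 0 0 (zero_add 0) c.i t)
      (DGMod.coneFst ε Y _ q)
    rw [← hx]
    refine N.el_injective ?_
    rw [map_add, N.el_d, ← he, N.el_act, ι_comp]
    change _ + N.el (DGMod.app ε K' (l + 1) _) = _
    rw [← DGMod.tmap_el, map_neg, map_neg, DGMod.el_act, DGMod.tmap_tact, map_add, map_add,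
      N.el_act, DGMod.tmap_el, N.tact_comp, add_neg_cancel_right]
  · rw [DGMod.coneSnd_d, DGMod.coneSnd_mk]
    change _ = sgn 0 • (semifree j N).act 0 (l + 1 + 1) (l + 1 + 1) (zero_add _)
      (comp 0 0 0 (zero_add 0) c.i t) (DGMod.coneSnd ε Y _ q)
    rw [← hp, sgn_zero, one_smul, map_neg, neg_neg]
    refine (semifree j N).el_injective ?_
    rw [DGMod.el_d, DGMod.el_act, DGMod.tD_tact, hDt, hy, DGMod.el_act, ι_comp, DGMod.tact_comp,
      sg_ι_zero, map_zero, AddMonoidHom.zero_apply, zero_add]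

end KillableAcyclic


/-! ### Isomorphisms in the homotopy category and cones -/

section HoIso

open Tot

variable {k : Type w} [CommRing k] {E : Type u} [DGCategory.{w, v} k E]

theorem IsContractible.rep_acyclicAt {Z : E} (h : IsContractible k Z) (T : E) :
    (DGMod.rep (k := k) T).AcyclicAt Z := by
  intro l m n hl hm x hx
  have hx' : D (ι (show Hom k T Z m from x)) = 0 := by
    rw [D_ι m n hm, ι_eq_zero]
    exact hx
  obtain ⟨e, he⟩ := h.exists_eq hl hx'
  rw [D_ι l m hl] at he
  exact ⟨e, ι_injective he⟩

theorem isContractible_of_rep_acyclicAt {Z : E} (h : (DGMod.rep (k := k) Z).AcyclicAt Z) :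
    IsContractible k Z := by
  obtain ⟨y, hy⟩ := h.exists_D_eq (-1) (by simp) (x := DGCategory.id Z) (by rw [ι_id, D_id])
  rw [D_ι (-1) 0 (by simp)] at hy
  exact ⟨y, ι_injective hy⟩

/-- A closed morphism with contractible cone is invertible in the homotopy category. -/
theorem Ho.isIso_of_isContractible {X Y K : E} (f : closed k X Y) (c : ConeData f.1 K)
    (hK : IsContractible k K) : IsIso (Ho.homMk f) :=
  isIso_of_yoneda_map_bijective _ fun T => Ho.postcomp_bijective (P := T.of) f c (hK.rep_acyclicAt _)

theorem Ho.exists_inverse {X Y : E} (f : closed k X Y) (h : IsIso (Ho.homMk f)) :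
    ∃ (g : Hom k Y X 0) (α : Hom k X X (-1)) (β : Hom k Y Y (-1)), D (ι g) = 0 ∧
      ι f.1 ≫ ι g = 𝟙 _ + D (ι α) ∧ ι g ≫ ι f.1 = 𝟙 _ + D (ι β) := by
  obtain ⟨g, hg⟩ := Ho.exists_homMk (inv (Ho.homMk f))
  have h1 : Ho.homMk (compClosed f g) = Ho.homMk ⟨DGCategory.id X, d_id X⟩ := by
    rw [← Ho.homMk_comp, ← hg]
    exact IsIso.hom_inv_id _
  have h2 : Ho.homMk (compClosed g f) = Ho.homMk ⟨DGCategory.id Y, d_id Y⟩ := by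
    rw [← Ho.homMk_comp, ← hg]
    exact IsIso.inv_hom_id _
  obtain ⟨α, hα⟩ := Ho.homMk_eq_iff.mp h1
  obtain ⟨β, hβ⟩ := Ho.homMk_eq_iff.mp h2
  refine ⟨g.1, α, β, mem_closed_iff.mp g.2, ?_, ?_⟩
  · rw [hα, ← ι_comp 0 0 0 (by simp), ← ι_id]
    exact (add_sub_cancel _ _).symm
  · rw [hβ, ← ι_comp 0 0 0 (by simp), ← ι_id]
    exact (add_sub_cancel _ _).symm

/-- Mutually inverse closed morphisms up to homotopy. -/
theorem Ho.nonempty_iso {X Y : E} (f : Hom k X Y 0) (g : Hom k Y X 0) (hf : D (ι f) = 0)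
    (hg : D (ι g) = 0) (α : Hom k X X (-1)) (β : Hom k Y Y (-1))
    (h1 : ι f ≫ ι g = 𝟙 _ + D (ι α)) (h2 : ι g ≫ ι f = 𝟙 _ + D (ι β)) :
    Nonempty ((⟨X⟩ : Ho k E) ≅ ⟨Y⟩) := by
  refine ⟨⟨Ho.homMk ⟨f, mem_closed_iff.mpr hf⟩, Ho.homMk ⟨g, mem_closed_iff.mpr hg⟩, ?_, ?_⟩⟩
  · rw [Ho.homMk_comp, Ho.homMk_id]
    refine Ho.homMk_eq_iff.mpr ⟨α, ?_⟩
    change _ = ι (comp 0 0 0 _ f g) - _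
    rw [ι_comp, h1, ι_id, add_sub_cancel_left]
  · rw [Ho.homMk_comp, Ho.homMk_id]
    refine Ho.homMk_eq_iff.mpr ⟨β, ?_⟩
    change _ = ι (comp 0 0 0 _ g f) - _
    rw [ι_comp, h2, ι_id, add_sub_cancel_left]

namespace ConeData

theorem s_i {X Y K : E} {f : Hom k X Y 0} (c : ConeData f K) :
    ι c.s ≫ ι c.i = 𝟙 _ - ι c.p ≫ ι c.j := eq_sub_of_add_eq c.total

theorem s_i_assoc {X Y K : E} {f : Hom k X Y 0} (c : ConeData f K) {T : Tot k E}
    (g : (⟨K⟩ : Tot k E) ⟶ T) : ι c.s ≫ ι c.i ≫ g = g - ι c.p ≫ ι c.j ≫ g := by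
  rw [← Category.assoc, c.s_i, Preadditive.sub_comp, Category.id_comp, Category.assoc]

/-- The cone of a homotopy equivalence is contractible. -/
theorem rep_acyclicAt_of_isIso {X Y K : E} {f : closed k X Y} (c : ConeData f.1 K)
    (h : IsIso (Ho.homMk f)) (T : E) : (DGMod.rep (k := k) T).AcyclicAt K := by
  obtain ⟨g, α, β, hg, hα, hβ⟩ := Ho.exists_inverse f h
  have hf := mem_closed_iff.mp f.2
  intro m n n' hm hn κ hκ
  replace hκ : D (ι (show Hom k T K n from κ)) = 0 := by
    rw [D_ι n n' hn, ι_eq_zero]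
    exact hκ
  obtain ⟨κ, rfl⟩ : ∃ κ' : Hom k T K n, κ' = κ := ⟨κ, rfl⟩
  replace hκ : D (ι κ) = 0 := hκ
  -- `x` is the component of `κ` in `X[1]`, and `y` is a primitive of it, built from the inverse `g`
  -- and the homotopy `α`. This makes `z`, the component in `Y` corrected by `y`, a cocycle, which
  -- is lifted back to `X` through `g` and the homotopy `β`.
  let x : Hom k T X (n + 1) := comp n 1 (n + 1) rfl κ c.p
  let y : Hom k T X n := -comp (n + 1) (-1) n (by omega) x α -
    comp n 0 n (add_zero n) κ (comp 0 0 0 (by simp) c.s g)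
  let z : Hom k T Y n := comp n 0 n (add_zero n) κ c.s + comp n 0 n (add_zero n) y f.1
  let r : Hom k T K m := comp n (-1) m (by omega) z (comp 0 (-1) (-1) (by simp) g c.j) -
    comp m 0 m (add_zero m) (comp n (-1) m (by omega) z β) c.i - comp n (-1) m (by omega) y c.j
  have hx : ι x = ι κ ≫ ι c.p := ι_comp ..
  have hy : ι y = -(ι x ≫ ι α) - ι κ ≫ ι c.s ≫ ι g := by simp [y, ι_comp]
  have hz : ι z = ι κ ≫ ι c.s + ι y ≫ ι f.1 := by simp [z, ι_comp]
  have hr : ι r = ι z ≫ ι g ≫ ι c.j - ι z ≫ ι β ≫ ι c.i - ι y ≫ ι c.j := by simp [r, ι_comp]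
  have hDx : D (ι x) = 0 := by simp [hx, D_comp, hκ]
  have hα' : D (ι α) = ι f.1 ≫ ι g - 𝟙 _ := by rw [hα]; abel
  have hβ' : D (ι β) = ι g ≫ ι f.1 - 𝟙 _ := by rw [hβ]; abel
  have hDy : D (ι y) = ι x := by
    simp only [hy, map_sub, map_neg, D_comp, hDx, hκ, hg, hα', c.D_s]
    simp [hx]
  have hDz : D (ι z) = 0 := by
    simp only [hz, map_add, D_comp, hκ, hf, hDy, c.D_s]
    simp [hx]
  have hDr : D (ι r) = ι κ := by
    simp only [hr, map_sub, D_comp, hDz, hDy, hβ', c.D_i, c.D_j, hg, sg_comp]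
    simp only [sg_ι_zero, sg_ι_neg_one, Preadditive.comp_add, Preadditive.comp_sub,
      Preadditive.sub_comp, Preadditive.add_comp, Limits.zero_comp, Limits.comp_zero,
      Category.assoc, Category.id_comp, Category.comp_id, Preadditive.comp_neg,
      Preadditive.neg_comp, add_zero, zero_add]
    rw [hz, hx]
    simp only [Preadditive.add_comp, Category.assoc, c.s_i]
    simp
    abel
  rw [D_ι m n hm] at hDr
  exact ⟨r, ι_injective hDr⟩

end ConeData

end HoIso

/-! ### Comparison of cones: shifts, octahedra and squares -/

section ConeMaps

open Tot

variable {k : Type w} [CommRing k] {E : Type u} [DGCategory.{w, v} k E]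

/-- The cone of a morphism `i : Y → K` to a cone of `f : Z → Y` is homotopy equivalent to a shift
of `Z`. -/
theorem ConeData.nonempty_iso_shift {Z Y K K' Z' : E} {f : Hom k Z Y 0} (c : ConeData f K)
    (c' : ConeData c.i K') (σ : ShiftData k Z Z' (-1) 1) :
    Nonempty ((⟨Z'⟩ : Ho k E) ≅ ⟨K'⟩) := by
  -- Here `K' = Y ⊕ Z[1] ⊕ Y[1]`. The maps are the projection to `Z[1]` and the inclusion of `Z[1]`,
  -- corrected by a term in `Y[1]` to make it closed; `β` contracts `Y ⊕ Y[1]`.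
  let φ : Hom k K' Z' 0 := comp 0 0 0 (zero_add 0) c'.s (comp 1 (-1) 0 (by simp) c.p σ.σ)
  let ψ : Hom k Z' K' 0 := comp 1 (-1) 0 (by simp) σ.τ (comp (-1) 0 (-1) (by simp) c.j c'.i -
    comp 0 (-1) (-1) (by simp) f c'.j)
  let β : Hom k K' K' (-1) := -comp 0 (-1) (-1) (by simp) c'.s (comp 0 (-1) (-1) (by simp) c.s c'.j)
  have hφ : ι φ = ι c'.s ≫ ι c.p ≫ ι σ.σ := by simp [φ, ι_comp]
  have hψ : ι ψ = ι σ.τ ≫ (ι c.j ≫ ι c'.i - ι f ≫ ι c'.j) := by simp [ψ, ι_comp]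
  have hβ : ι β = -(ι c'.s ≫ ι c.s ≫ ι c'.j) := by simp [β, ι_comp]
  refine Ho.nonempty_iso ψ φ ?_ ?_ 0 β ?_ ?_
  · simp [hψ, D_comp, c.D_base]
  · simp [hφ, D_comp, sg_comp]
  · simp [hψ, hφ]
  · simp [hψ, hφ, hβ, D_comp, c.s_i_assoc, c'.s_i, sg_comp]
    abel

/-- Let `C` be a cone of `s : X → X'` and let `e : Z → C` be a homotopy equivalence. Then `s` factors
up to homotopy equivalence as the inclusion of `X` into the cone of a morphism from a shift of `Z`
to `X`. -/
theorem ConeData.exists_factorization {X X' C Z Z₁ : E} (hE : HasCones k E) {s : closed k X X'}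
    (c : ConeData s.1 C) (e : closed k Z C) (he : IsIso (Ho.homMk e))
    (σ : ShiftData k Z₁ Z (-1) 1) :
    ∃ (f : Hom k Z₁ X 0) (K : E) (cK : ConeData f K) (w : closed k K X'),
      IsIso (Ho.homMk w) ∧ ι cK.i ≫ ι w.1 = ι s.1 := by
  have hs := mem_closed_iff.mp s.2
  have hDe := mem_closed_iff.mp e.2
  -- The connecting morphism of the triangle of `s`, precomposed with `e` and desuspended.
  let f : Hom k Z₁ X 0 := comp (-1) 1 0 (by simp) σ.σ (comp 0 1 1 (by simp) e.1 c.p)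
  have hf : ι f = ι σ.σ ≫ ι e.1 ≫ ι c.p := by simp [f, ι_comp]
  obtain ⟨K, ⟨cK⟩⟩ := hE Z₁ X f (by simp [hf, D_comp, hDe])
  let w : Hom k K X' 0 := comp 0 0 0 (by simp) cK.s s.1 - comp 1 (-1) 0 (by simp) cK.p
    (comp (-1) 0 (-1) (by simp) σ.σ (comp 0 0 0 (by simp) e.1 c.s))
  have hw : ι w = ι cK.s ≫ ι s.1 - ι cK.p ≫ ι σ.σ ≫ ι e.1 ≫ ι c.s := by simp [w, ι_comp]
  have hDw : D (ι w) = 0 := by simp [hw, D_comp, hs, hDe, hf]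
  obtain ⟨Q, ⟨cw⟩⟩ := hE K X' w hDw
  have hiw : ι cK.i ≫ ι w = ι s.1 := by simp [hw]
  have hjw : ι cK.j ≫ ι w = -(ι σ.σ ≫ ι e.1 ≫ ι c.s) := by simp [hw]
  -- The octahedron: the cone `Q = X' ⊕ X[1] ⊕ Z[1]` of `w` is also a cone of `e : Z → C`, and `e`
  -- is a homotopy equivalence, so `Q` is contractible.
  let ce : ConeData e.1 Q :=
    { i := comp 0 0 0 (by simp) c.s cw.i + comp 1 (-1) 0 (by simp) c.p
        (comp 0 (-1) (-1) (by simp) cK.i cw.j)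
      j := -comp 1 (-2) (-1) (by simp) σ.τ (comp (-1) (-1) (-2) (by simp) cK.j cw.j)
      p := -comp 1 0 1 (by simp) cw.p (comp 1 (-1) 0 (by simp) cK.p σ.σ)
      s := comp 0 0 0 (by simp) cw.s c.i + comp 1 (-1) 0 (by simp) cw.p
        (comp 0 (-1) (-1) (by simp) cK.s c.j)
      i_s := by simp [ι_comp, c.s_i]
      j_p := by simp [ι_comp]
      i_p := by simp [ι_comp]
      j_s := by simp [ι_comp]
      total := by simp [ι_comp, cw.s_i, cK.s_i_assoc]
      D_i := by simp [ι_comp, D_comp, reassoc_of% hiw]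
      D_p := by simp [ι_comp, D_comp]
      D_j := by simp [ι_comp, D_comp, sg_comp, reassoc_of% hjw, hf]; abel
      D_s := by simp [ι_comp, D_comp, sg_comp, hw, hf, c.s_i]; abel }
  refine ⟨f, K, cK, ⟨w, mem_closed_iff.mpr hDw⟩, Ho.isIso_of_isContractible _ cw ?_, hiw⟩
  exact isContractible_of_rep_acyclicAt (ce.rep_acyclicAt_of_isIso he Q)

/-- A homotopy commutative square whose vertical maps are homotopy equivalences induces a homotopy
equivalence of cones. -/
theorem ConeData.nonempty_iso_of_square (hE : HasCones k E) {X Y X₁ Y₁ K K₁ : E} {f : Hom k X Y 0}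
    {f₁ : Hom k X₁ Y₁ 0} (c : ConeData f K) (c₁ : ConeData f₁ K₁) (u : closed k X X₁)
    (v : closed k Y Y₁) (hu : IsIso (Ho.homMk u)) (hv : IsIso (Ho.homMk v)) (h : Hom k X Y₁ (-1))
    (hh : D (ι h) = ι f ≫ ι v.1 - ι u.1 ≫ ι f₁) : Nonempty ((⟨K⟩ : Ho k E) ≅ ⟨K₁⟩) := by
  have hDu := mem_closed_iff.mp u.2
  have hDv := mem_closed_iff.mp v.2
  have hf := c.D_base
  have hf₁ := c₁.D_base
  let w : Hom k K K₁ 0 := comp 0 0 0 (by simp) c.s (comp 0 0 0 (by simp) v.1 c₁.i) +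
    comp 1 (-1) 0 (by simp) c.p (comp 0 (-1) (-1) (by simp) u.1 c₁.j) +
    comp 1 (-1) 0 (by simp) c.p (comp (-1) 0 (-1) (by simp) h c₁.i)
  have hw : ι w = ι c.s ≫ ι v.1 ≫ ι c₁.i + ι c.p ≫ ι u.1 ≫ ι c₁.j + ι c.p ≫ ι h ≫ ι c₁.i := by
    simp [w, ι_comp]
  have hDw : D (ι w) = 0 := by
    simp [hw, D_comp, hDu, hDv, hh, sg_comp]
  have hiw : ι c.i ≫ ι w = ι v.1 ≫ ι c₁.i := by simp [hw]
  have hjw : ι c.j ≫ ι w = ι u.1 ≫ ι c₁.j + ι h ≫ ι c₁.i := by simp [hw]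
  have hwp : ι w ≫ ι c₁.p = ι c.p ≫ ι u.1 := by simp [hw]
  have hws : ι w ≫ ι c₁.s = ι c.s ≫ ι v.1 + ι c.p ≫ ι h := by simp [hw]
  obtain ⟨Q, ⟨cw⟩⟩ := hE K K₁ w hDw
  obtain ⟨Ku, ⟨cu⟩⟩ := hE X X₁ u.1 hDu
  obtain ⟨Kv, ⟨cv⟩⟩ := hE Y Y₁ v.1 hDv
  let θ : Hom k Ku Kv 0 := comp 0 0 0 (by simp) cu.s (comp 0 0 0 (by simp) f₁ cv.i) +
    comp 1 (-1) 0 (by simp) cu.p (comp 0 (-1) (-1) (by simp) f cv.j) -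
    comp 1 (-1) 0 (by simp) cu.p (comp (-1) 0 (-1) (by simp) h cv.i)
  have hθ : ι θ = ι cu.s ≫ ι f₁ ≫ ι cv.i + ι cu.p ≫ ι f ≫ ι cv.j - ι cu.p ≫ ι h ≫ ι cv.i := by
    simp [θ, ι_comp]
  -- The cone of the induced morphism `w` of cones is also a cone of `θ`, a morphism between the
  -- contractible cones of `u` and `v`; hence it is contractible.
  let cθ : ConeData θ Q :=
    { i := comp 0 0 0 (by simp) cv.s (comp 0 0 0 (by simp) c₁.i cw.i) +
        comp 1 (-1) 0 (by simp) cv.p (comp 0 (-1) (-1) (by simp) c.i cw.j)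
      j := comp 0 (-1) (-1) (by simp) cu.s (comp (-1) 0 (-1) (by simp) c₁.j cw.i) -
        comp 1 (-2) (-1) (by simp) cu.p (comp (-1) (-1) (-2) (by simp) c.j cw.j)
      p := comp 0 1 1 (by simp) cw.s (comp 1 0 1 (by simp) c₁.p cu.i) -
        comp 1 0 1 (by simp) cw.p (comp 1 (-1) 0 (by simp) c.p cu.j)
      s := comp 0 0 0 (by simp) cw.s (comp 0 0 0 (by simp) c₁.s cv.i) +
        comp 1 (-1) 0 (by simp) cw.p (comp 0 (-1) (-1) (by simp) c.s cv.j)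
      i_s := by simp [ι_comp, cv.s_i]
      j_p := by simp [ι_comp, cu.s_i]
      i_p := by simp [ι_comp]
      j_s := by simp [ι_comp]
      total := by simp [ι_comp, cw.s_i, c.s_i_assoc, c₁.s_i_assoc]; abel
      D_i := by simp [ι_comp, D_comp, sg_comp, reassoc_of% hiw]
      D_p := by simp [ι_comp, D_comp, sg_comp, reassoc_of% hwp]
      D_j := by simp [ι_comp, D_comp, sg_comp, reassoc_of% hjw, hθ]; abel
      D_s := by simp [ι_comp, D_comp, sg_comp, reassoc_of% hws, hθ]; abel }
  have := Ho.isIso_of_isContractible ⟨w, mem_closed_iff.mpr hDw⟩ cw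
    (isContractible_of_rep_acyclicAt (DGMod.AcyclicAt.cone _ cθ
      (cu.rep_acyclicAt_of_isIso hu Q) (cv.rep_acyclicAt_of_isIso hv Q)))
  exact ⟨asIso (Ho.homMk ⟨w, mem_closed_iff.mpr hDw⟩)⟩

end ConeMaps


/-! ### The calculus of fractions for towers of cones -/

section TowerClass

open Tot

variable {k : Type w} [CommRing k] {E : Type u} [DGCategory.{w, v} k E]

/-- The predicate `P` is stable under shifts. -/
def ShiftClosed (k : Type w) [CommRing k] {E : Type u} [DGCategory.{w, v} k E] (P : E → Prop) :
    Prop :=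
  ∀ X, P X → ∀ n m : ℤ, n + m = 0 → ∃ X', P X' ∧ Nonempty (ShiftData k X X' n m)

variable {P : E → Prop}

/-- The cancellation axiom for fractions. A null-homotopy of `t ≫ g` on `Y` extends over a cone of
`Z → Y` up to an obstruction `Z → T` of degree `-1`; this is killed by passing to the cone of the
corresponding morphism `Z[1] → T`, and one continues along the tower. -/
theorem Tower.exists_coequalizing (hE : HasCones k E) (hP : ShiftClosed k P) {Y K : E}
    {t : Hom k Y K 0} (ht : Tower k P t) {T : E} (g : Hom k K T 0) (hg : D (ι g) = 0)
    (h : Hom k Y T (-1)) (hh : D (ι h) = ι t ≫ ι g) :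
    ∃ (T' : E) (t' : Hom k T T' 0) (e : Hom k K T' (-1)), Tower k P t' ∧
      D (ι e) = ι g ≫ ι t' := by
  induction ht generalizing T with
  | id Y => exact ⟨T, DGCategory.id T, h, .id T, by simp [hh, ι_id]⟩
  | @step Z Y K₁ K f hZ c t ht ih =>
    have hDt := ht.D_eq_zero
    rw [ι_comp, Category.assoc] at hh
    obtain ⟨Z₁, hZ₁, ⟨z⟩⟩ := hP Z hZ (-1) 1 (by simp)
    -- The obstruction to extending `h` over the cone: `t ≫ g` equals `D (s ≫ h) + p ≫ r`.
    let r : Hom k Z T (-1) := comp (-1) 0 (-1) (by simp) c.j (comp 0 0 0 (by simp) t g) -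
      comp 0 (-1) (-1) (by simp) f h
    have hr : ι r = ι c.j ≫ ι t ≫ ι g - ι f ≫ ι h := by simp [r, ι_comp]
    have hDr : D (ι r) = 0 := by simp [hr, D_comp, hh, hDt, hg, c.D_base, sg_comp]
    obtain ⟨T₁, ⟨c'⟩⟩ := hE Z₁ T (comp 1 (-1) 0 (by simp) z.τ r) (by simp [ι_comp, D_comp, hDr])
    have htg : ι t ≫ ι g = D (ι c.s ≫ ι h) + ι c.p ≫ ι r := by
      simp [D_comp, hh, hr, c.s_i_assoc]
    have hzr : ι z.σ ≫ D (ι c'.j) = ι r ≫ ι c'.i := by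
      rw [c'.D_j, ι_comp, Category.assoc, ← Category.assoc, z.σ_τ, Category.id_comp]
    obtain ⟨T', t', e, ht', he⟩ := ih (comp 0 0 0 (by simp) g c'.i) (by simp [ι_comp, D_comp, hg])
      (comp 0 (-1) (-1) (by simp) c.s (comp (-1) 0 (-1) (by simp) h c'.i) +
        comp 1 (-2) (-1) (by simp) c.p (comp (-1) (-1) (-2) (by simp) z.σ c'.j)) (by
        have h1 : D (ι c.s ≫ ι h ≫ ι c'.i) = D (ι c.s ≫ ι h) ≫ ι c'.i := by
          rw [← Category.assoc, D_comp (ι c.s ≫ ι h), c'.D_i]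
          simp
        have h2 : D (ι c.p ≫ ι z.σ ≫ ι c'.j) = ι c.p ≫ ι z.σ ≫ D (ι c'.j) := by
          rw [D_comp, D_comp, c.D_p, z.D_σ]
          simp
        rw [map_add, map_add, ι_comp, ι_comp, ι_comp, ι_comp, ι_comp, h1, h2, hzr,
          ← Category.assoc (ι t), htg, Preadditive.add_comp, Category.assoc])
    exact ⟨T', comp 0 0 0 (by simp) c'.i t', e, .step hZ₁ c' ht', by
      rw [he, ι_comp, ι_comp, Category.assoc]⟩

variable (k P) in
/-- The morphisms of the homotopy category represented by towers of cones. -/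
def towerClass : MorphismProperty (Ho k E) := fun X Y f =>
  ∃ t : closed k X.of Y.of, f = Ho.homMk t ∧ Tower k P t.1

theorem Tower.closed {Y K : E} {t : Hom k Y K 0} (ht : Tower k P t) : t ∈ closed k Y K :=
  mem_closed_iff.mpr ht.D_eq_zero

/-- The Ore condition is the pushout of towers, and cancellation is `Tower.exists_coequalizing`
applied to a difference of morphisms. -/
theorem hasLeftCalculusOfFractions_towerClass (hE : HasCones k E) (hP : ShiftClosed k P) :
    (towerClass k P).HasLeftCalculusOfFractions where
  id_mem X := ⟨⟨DGCategory.id X.of, d_id X.of⟩, rfl, .id _⟩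
  comp_mem := by
    rintro X Y Z f g ⟨t, rfl, ht⟩ ⟨s, rfl, hs⟩
    exact ⟨compClosed t s, rfl, ht.trans hs⟩
  exists_leftFraction := by
    rintro X Y ⟨s, ⟨t, rfl, ht⟩, f⟩
    obtain ⟨f, rfl⟩ := Ho.exists_homMk f
    obtain ⟨K', t', u', ht', hu', h⟩ := ht.exists_pushout hE f.1 (mem_closed_iff.mp f.2)
    refine ⟨⟨Ho.homMk ⟨u', mem_closed_iff.mpr hu'⟩, Ho.homMk ⟨t', ht'.closed⟩, _, rfl, ht'⟩, ?_⟩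
    refine congrArg Ho.homMk (Subtype.ext (ι_injective ?_))
    refine (ι_comp 0 0 0 _ f.1 t').trans (h.symm.trans (ι_comp 0 0 0 _ t.1 u').symm)
  ext := by
    rintro X' X Y f₁ f₂ _ ⟨t, rfl, ht⟩ h
    obtain ⟨f₁, rfl⟩ := Ho.exists_homMk f₁
    obtain ⟨f₂, rfl⟩ := Ho.exists_homMk f₂
    obtain ⟨h, hh⟩ := Ho.homMk_eq_iff.mp h
    obtain ⟨T', t', e, ht', he⟩ := ht.exists_coequalizing hE hP (f₁.1 - f₂.1)
      (by rw [map_sub, map_sub, mem_closed_iff.mp f₁.2, mem_closed_iff.mp f₂.2, sub_zero]) h (by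
        rw [hh, map_sub, Preadditive.comp_sub, ← ι_comp 0 0 0 (by simp), ← ι_comp 0 0 0 (by simp)]
        rfl)
    refine ⟨⟨T'⟩, Ho.homMk ⟨t', ht'.closed⟩, ⟨_, rfl, ht'⟩, Ho.homMk_eq_iff.mpr ⟨e, ?_⟩⟩
    rw [he, map_sub, Preadditive.sub_comp, ← ι_comp 0 0 0 (by simp), ← ι_comp 0 0 0 (by simp)]
    rfl

/-- Two classes of morphisms inverted by the same functors have the same localizations. -/
theorem _root_.CategoryTheory.Functor.IsLocalization.of_isInvertedBy_iff {C : Type u} {D : Type u'}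
    [Category.{v} C] [Category.{w} D] {W W' : MorphismProperty C}
    (h : ∀ {T : Type u} [Category.{max u v} T] (F : C ⥤ T), W.IsInvertedBy F ↔ W'.IsInvertedBy F)
    (L : C ⥤ D) [L.IsLocalization W] : L.IsLocalization W' := by
  have : W.Q.IsLocalization W' := .mk' _ _
    { inverts := (h _).mp W.Q_inverts
      lift := fun F hF => Localization.Construction.lift F ((h _).mpr hF)
      fac := fun F hF => Localization.Construction.fac F ((h _).mpr hF)
      uniq := Localization.Construction.uniq }
    { inverts := (h _).mp W.Q_inverts
      lift := fun F hF => Localization.Construction.lift F ((h _).mpr hF)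
      fac := fun F hF => Localization.Construction.fac F ((h _).mpr hF)
      uniq := Localization.Construction.uniq }
  exact .of_equivalence_target W.Q W' L (Localization.equivalenceFromModel L W)
    (Localization.qCompEquivalenceFromModelFunctorIso L W)

/-- The first morphism of the triangle attached to the cone of a morphism with contractible source
is invertible in the homotopy category. -/
theorem ConeData.isIso_of_isContractible {Z Y K : E} {f : Hom k Z Y 0} (c : ConeData f K)
    (hZ : IsContractible k Z) : IsIso (Ho.homMk ⟨c.i, c.closed_i⟩) := by
  obtain ⟨h, hh⟩ := hZ
  have hD : D (ι h) = 𝟙 (⟨Z⟩ : Tot k E) := by rw [D_ι (-1) 0 (by simp), hh, ι_id]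
  have hf := c.D_base
  let g : Hom k K Y 0 := c.s + comp 1 (-1) 0 (by simp) c.p (comp (-1) 0 (-1) (by simp) h f)
  have hg : ι g = ι c.s + ι c.p ≫ ι h ≫ ι f := by simp [g, ι_comp]
  have hDg : D (ι g) = 0 := by simp [hg, D_comp, hD, hf]
  let β : Hom k K K (-1) := -comp 1 (-2) (-1) (by simp) c.p (comp (-1) (-1) (-2) (by simp) h c.j)
  have hβ : ι β = -(ι c.p ≫ ι h ≫ ι c.j) := by simp [β, ι_comp]
  refine ⟨Ho.homMk ⟨g, mem_closed_iff.mpr hDg⟩, ?_, ?_⟩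
  · rw [Ho.homMk_comp, Ho.homMk_id]
    refine congrArg Ho.homMk (Subtype.ext (ι_injective ?_))
    refine (ι_comp 0 0 0 _ c.i g).trans ?_
    simp [hg, ι_id]
  · rw [Ho.homMk_comp, Ho.homMk_id]
    refine Ho.homMk_eq_iff.mpr ⟨-β, ?_⟩
    change _ = ι (comp 0 0 0 _ g c.i) - _
    rw [ι_comp, ι_id, map_neg, hβ, hg]
    simp [D_comp, hD, c.s_i]
    abel

theorem Tower.isIso_of_isContractible (hP : ∀ Z, P Z → IsContractible k Z) {Y K : E}
    {t : Hom k Y K 0} (ht : Tower k P t) : IsIso (Ho.homMk ⟨t, ht.closed⟩) := by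
  induction ht with
  | id Y => exact inferInstanceAs (IsIso (𝟙 (⟨Y⟩ : Ho k E)))
  | step hZ c ht ih =>
    have := c.isIso_of_isContractible (hP _ hZ)
    exact inferInstanceAs (IsIso (Ho.homMk ⟨c.i, c.closed_i⟩ ≫ Ho.homMk ⟨_, ht.closed⟩))

theorem ho_inverts_towerClass {E' : Type u'} [DGCategory.{w, v} k E'] (Ξ : DGFunctor k E E')
    (hΞ : ∀ Z, P Z → IsContractible k (Ξ.obj Z)) : (towerClass k P).IsInvertedBy Ξ.ho := by
  rintro X Y f ⟨t, rfl, ht⟩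
  exact (ht.map Ξ (P' := IsContractible k) hΞ).isIso_of_isContractible fun _ h => h

end TowerClass


/-! ### Killable objects and localizations -/

section Localization

open Tot

variable {k : Type w} [CommRing k] {E : Type u} [DGCategory.{w, v} k E] {E' : Type u'}
  [DGCategory.{w, v} k E'] {Ξ : DGFunctor k E E'} {P : E → Prop}

theorem DGFunctor.homMk_comp_ho_map {X : E'} {Y K : E} (c : closed k X (Ξ.obj Y)) (t : closed k Y K)
    (b : closed k X (Ξ.obj K)) : Ho.homMk c ≫ Ξ.ho.map (Ho.homMk t) = Ho.homMk b ↔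
      ∃ h : Hom k X (Ξ.obj K) (-1), D (ι h) = ι c.1 ≫ Ξ.tot (ι t.1) - ι b.1 := by
  refine (show _ ↔ Ho.homMk (compClosed c (Ξ.mapClosed Y K t)) = Ho.homMk b from Iff.rfl).trans
    (Ho.homMk_eq_iff.trans ?_)
  have : ι (compClosed c (Ξ.mapClosed Y K t)).1 = ι c.1 ≫ Ξ.tot (ι t.1) :=
    (ι_comp 0 0 0 _ c.1 (Ξ.map 0 t.1)).trans (congrArg _ (Ξ.tot_ι t.1).symm)
  rw [this]

/-- Killability of the cocycle `(c, 0)` in degree `0`: fullness up to a fraction. -/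
theorem Killable.exists_homMk {X : E} (h : Killable Ξ P X) {Y : E}
    (c : (⟨Ξ.obj X⟩ : Ho k E') ⟶ ⟨Ξ.obj Y⟩) : ∃ (K : E) (t : (⟨Y⟩ : Ho k E) ⟶ ⟨K⟩)
      (b : (⟨X⟩ : Ho k E) ⟶ ⟨K⟩), towerClass k P t ∧ c ≫ Ξ.ho.map t = Ξ.ho.map b := by
  obtain ⟨c, rfl⟩ := Ho.exists_homMk c
  have hc := mem_closed_iff.mp c.2
  obtain ⟨K, t, b, e, ht, hb, he⟩ := h Y (-1) 0 1 (by simp) (by simp) 0 c.1 (by simp)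
    (by rw [hc, map_zero, map_zero, add_zero])
  rw [map_zero, Limits.zero_comp, eq_comm, neg_eq_zero] at hb
  refine ⟨K, Ho.homMk ⟨t, ht.closed⟩, Ho.homMk ⟨b, mem_closed_iff.mpr hb⟩, ⟨_, rfl, ht⟩,
    (DGFunctor.homMk_comp_ho_map c ⟨t, ht.closed⟩ (Ξ.mapClosed X K ⟨b, _⟩)).mpr ⟨e, ?_⟩⟩
  rw [he, Ξ.tot_ι]
  exact (add_sub_cancel_right _ _).symm

/-- Killability in degree `-1`, applied to `f - g` and a homotopy between the images: faithfulness
up to a tower. -/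
theorem Killable.exists_comp_eq {X : E} (h : Killable Ξ P X) {Y : E}
    (f g : (⟨X⟩ : Ho k E) ⟶ ⟨Y⟩) (hfg : Ξ.ho.map f = Ξ.ho.map g) :
    ∃ (K : E) (t : (⟨Y⟩ : Ho k E) ⟶ ⟨K⟩), towerClass k P t ∧ f ≫ t = g ≫ t := by
  obtain ⟨f, rfl⟩ := Ho.exists_homMk f
  obtain ⟨g, rfl⟩ := Ho.exists_homMk g
  obtain ⟨c, hc⟩ := Ho.homMk_eq_iff.mp
    (show Ho.homMk (Ξ.mapClosed X Y f) = Ho.homMk (Ξ.mapClosed X Y g) from hfg)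
  have hc' : D (ι c) = Ξ.tot (ι (f.1 - g.1)) := by
    rw [hc, map_sub, map_sub, Ξ.tot_ι, Ξ.tot_ι]
    rfl
  obtain ⟨K, t, b, e, ht, hb, he⟩ := h Y (-2) (-1) 0 (by simp) (by simp) (f.1 - g.1) (-c)
    (by rw [map_sub, map_sub, mem_closed_iff.mp f.2, mem_closed_iff.mp g.2, sub_zero])
    (by rw [map_neg, map_neg, hc', neg_add_cancel])
  refine ⟨K, Ho.homMk ⟨t, ht.closed⟩, ⟨_, rfl, ht⟩, Ho.homMk_eq_iff.mpr ⟨-b, ?_⟩⟩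
  rw [map_neg, map_neg, ← hb, map_sub, Preadditive.sub_comp, ← ι_comp 0 0 0 (by simp),
    ← ι_comp 0 0 0 (by simp)]
  rfl

/-- If `Ho(Ξ)` is the localization at the class of towers, then all objects are killable. -/
theorem Killable.of_isLocalization (hE : HasCones k E) (hP : ShiftClosed k P) (hS : HasShifts k E)
    [Ξ.ho.IsLocalization (towerClass k P)] (X : E) : Killable Ξ P X := by
  have := hasLeftCalculusOfFractions_towerClass hE hP
  intro Y m l n hm hl a c ha hc
  -- On `X₁ = X[-n]` the cocycle `a` has degree zero; on `X₂ = X₁[1]` the morphisms of degree `-1`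
  -- out of `X₁` have degree zero.
  obtain ⟨X₁, ⟨x⟩⟩ := hS X n (-n) (by simp)
  obtain ⟨X₂, ⟨y⟩⟩ := hS X₁ (-1) 1 (by simp)
  have hxΞ : D (Ξ.tot (ι x.τ)) = 0 := by rw [Ξ.D_tot, x.D_τ, map_zero]
  have hyΞ : D (Ξ.tot (ι y.τ)) = 0 := by rw [Ξ.D_tot, y.D_τ, map_zero]
  have hxσΞ : D (Ξ.tot (ι x.σ)) = 0 := by rw [Ξ.D_tot, x.D_σ, map_zero]
  have hyσΞ : D (Ξ.tot (ι y.σ)) = 0 := by rw [Ξ.D_tot, y.D_σ, map_zero]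
  have hxx : Ξ.tot (ι x.σ) ≫ Ξ.tot (ι x.τ) = 𝟙 _ := by rw [← Ξ.tot_comp, x.σ_τ, Ξ.tot_id]
  have hyy : Ξ.tot (ι y.σ) ≫ Ξ.tot (ι y.τ) = 𝟙 _ := by rw [← Ξ.tot_comp, y.σ_τ, Ξ.tot_id]
  let a₁ : Hom k X₁ Y 0 := comp (-n) n 0 (by simp) x.τ a
  have ha₁ : ι a₁ = ι x.τ ≫ ι a := ι_comp ..
  let c₁ : Hom k (Ξ.obj X₁) (Ξ.obj Y) (-1) := comp (-n) l (-1) (by omega) (Ξ.map (-n) x.τ) c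
  have hc₁ : ι c₁ = Ξ.tot (ι x.τ) ≫ ι c := by simp [c₁, ι_comp, Ξ.ι_map]
  have hDa₁ : D (ι a₁) = 0 := by simp [ha₁, D_comp, ha]
  have hDc₁ : D (ι c₁) = -Ξ.tot (ι a₁) := by
    rw [hc₁, D_comp, hxΞ, Limits.zero_comp, add_zero, eq_neg_of_add_eq_zero_left hc, ha₁,
      Ξ.tot_comp, Preadditive.comp_neg]
  -- Since `c₁` makes `Ξ a₁` null-homotopic, faithfulness of the localization yields a tower after
  -- which `a₁` itself is null-homotopic, through `b₁`.
  have h0 : Ξ.ho.map (Ho.homMk ⟨a₁, mem_closed_iff.mpr hDa₁⟩) = Ξ.ho.map (Ho.homMk 0) := by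
    refine Ho.homMk_eq_iff.mpr ⟨-c₁, ?_⟩
    rw [map_neg, map_neg, hDc₁, neg_neg, Ξ.tot_ι, map_zero]
    change _ = _ - ι 0
    rw [map_zero, sub_zero]
    rfl
  obtain ⟨K, _, ⟨t, rfl, ht⟩, h1⟩ :=
    (MorphismProperty.map_eq_iff_postcomp Ξ.ho (towerClass k P) _ _).mp h0
  obtain ⟨b₁, hb₁⟩ := Ho.homMk_eq_iff.mp h1
  have hDt := ht.D_eq_zero
  replace hb₁ : D (ι b₁) = ι a₁ ≫ ι t.1 := by
    rw [hb₁, ← ι_comp 0 0 0 (by simp)]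
    change _ - ι (comp 0 0 0 _ 0 _) = _
    rw [map_zero, LinearMap.zero_apply, map_zero, sub_zero]
    rfl
  -- After correction by `Ξ b₁` the component in `C^pretr`-style degree `-1` is closed. Regarded as
  -- a morphism out of `Ξ X₂`, it is a left fraction `(b₂, s)`, and `s` extends the tower.
  let c₂ : Hom k (Ξ.obj X₂) (Ξ.obj K.of) 0 := comp 1 (-1) 0 (by simp) (Ξ.map 1 y.τ)
    (comp (-1) 0 (-1) (by simp) c₁ (Ξ.map 0 t.1) + Ξ.map (-1) b₁)
  have hc₂ : ι c₂ = Ξ.tot (ι y.τ) ≫ (ι c₁ ≫ Ξ.tot (ι t.1) + Ξ.tot (ι b₁)) := by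
    simp [c₂, ι_comp, Ξ.ι_map]
  have hDc₂ : D (ι c₂) = 0 := by
    rw [hc₂, D_comp, hyΞ, map_add, D_comp, Ξ.D_tot, Ξ.D_tot, hDt, hb₁, hDc₁, Ξ.tot_comp,
      ← Ξ.tot_sg, sg_ι_zero]
    simp
  obtain ⟨⟨f, _, ⟨s, rfl, hs⟩⟩, hφ⟩ := Localization.exists_leftFraction Ξ.ho (towerClass k P)
    (X := ⟨X₂⟩) (Y := ⟨K.of⟩) (Ho.homMk ⟨c₂, mem_closed_iff.mpr hDc₂⟩)
  obtain ⟨b₂, rfl⟩ := Ho.exists_homMk f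
  have h2 := MorphismProperty.LeftFraction.map_comp_map_s
    (MorphismProperty.LeftFraction.mk (W := towerClass k P) (Ho.homMk b₂) (Ho.homMk s)
      ⟨s, rfl, hs⟩) Ξ.ho (Localization.inverts Ξ.ho (towerClass k P))
  rw [← hφ] at h2
  obtain ⟨e, he⟩ := (DGFunctor.homMk_comp_ho_map _ _ (Ξ.mapClosed _ _ b₂)).mp h2
  have hDs := hs.D_eq_zero
  clear_value c₂ c₁ a₁
  have hDb₂ := mem_closed_iff.mp b₂.2
  replace he : D (ι e) = ι c₂ ≫ Ξ.tot (ι s.1) - Ξ.tot (ι b₂.1) := he.trans (by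
    rw [Ξ.tot_ι b₂.1]; rfl)
  refine ⟨_, comp 0 0 0 (by simp) t.1 s.1,
    comp n (-1) l (by omega) x.σ (comp (-1) 0 (-1) (by simp) y.σ b₂.1 -
      comp (-1) 0 (-1) (by simp) b₁ s.1),
    comp n (-2) m (by omega) (Ξ.map n x.σ) (comp (-1) (-1) (-2) (by simp) (Ξ.map (-1) y.σ) e),
    ht.trans hs, ?_, ?_⟩
  · simp [ι_comp, D_comp, hDb₂, hDs, hb₁, ha₁]
  · have h3 : ι c = Ξ.tot (ι x.σ) ≫ ι c₁ := by
      rw [hc₁, ← Category.assoc, hxx, Category.id_comp]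
    have h4 : ι c₁ ≫ Ξ.tot (ι t.1) = Ξ.tot (ι y.σ) ≫ ι c₂ - Ξ.tot (ι b₁) := by
      rw [hc₂, ← Category.assoc, hyy, Category.id_comp, add_sub_cancel_right]
    have h5 : ι c₂ ≫ Ξ.tot (ι s.1) = D (ι e) + Ξ.tot (ι b₂.1) := by rw [he, sub_add_cancel]
    rw [h3, ι_comp 0 0 0, Ξ.tot_comp, Category.assoc, ← Category.assoc (ι c₁), h4]
    simp only [Preadditive.sub_comp, Preadditive.comp_sub, Category.assoc, h5, ι_comp, Ξ.ι_map,
      D_comp, hxσΞ, hyσΞ, map_sub, Ξ.tot_comp, Preadditive.comp_add]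
    simp
    abel

end Localization


/-! ### The localization theorem -/

section Localization

open Tot

variable {k : Type w} [CommRing k] {E : Type u} [DGCategory.{w, v} k E] {E' : Type u'}
  [DGCategory.{w, v} k E'] {Ξ : DGFunctor k E E'} {P : E → Prop}

theorem ShiftData.nonempty_iso {X X₁ Y Y₁ : E} {n m : ℤ} (hnm : n + m = 0)
    (x : ShiftData k X X₁ n m) (y : ShiftData k Y Y₁ n m) (e : (⟨X⟩ : Ho k E) ≅ ⟨Y⟩) :
    Nonempty ((⟨X₁⟩ : Ho k E) ≅ ⟨Y₁⟩) := by
  obtain ⟨f, hf⟩ := Ho.exists_homMk e.hom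
  have hfi : IsIso (Ho.homMk f) := hf ▸ inferInstance
  obtain ⟨g, α, β, hg, hα, hβ⟩ := Ho.exists_inverse f hfi
  have hDf := mem_closed_iff.mp f.2
  refine Ho.nonempty_iso (comp m n 0 (by omega) x.τ (comp 0 n n (zero_add n) f.1 y.σ))
    (comp m n 0 (by omega) y.τ (comp 0 n n (zero_add n) g x.σ)) (by simp [ι_comp, D_comp, hDf])
    (by simp [ι_comp, D_comp, hg])
    (sgn n • comp m (n - 1) (-1) (by omega) x.τ (comp (-1) n (n - 1) (by omega) α x.σ))
    (sgn n • comp m (n - 1) (-1) (by omega) y.τ (comp (-1) n (n - 1) (by omega) β y.σ)) ?_ ?_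
  · have h : ι y.σ ≫ ι y.τ ≫ ι g ≫ ι x.σ = ι g ≫ ι x.σ := by
      rw [← Category.assoc, y.σ_τ, Category.id_comp]
    simp only [ι_comp, Category.assoc, h]
    rw [← Category.assoc (ι f.1), hα, map_zsmul, map_zsmul, ι_comp, ι_comp, D_comp, D_comp, x.D_σ,
      x.D_τ]
    simp [smul_smul, sgn_mul_self, sg_ι, sg_comp]
  · have h : ι x.σ ≫ ι x.τ ≫ ι f.1 ≫ ι y.σ = ι f.1 ≫ ι y.σ := by
      rw [← Category.assoc, x.σ_τ, Category.id_comp]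
    simp only [ι_comp, Category.assoc, h]
    rw [← Category.assoc (ι g), hβ, map_zsmul, map_zsmul, ι_comp, ι_comp, D_comp, D_comp, y.D_σ,
      y.D_τ]
    simp [smul_smul, sgn_mul_self, sg_ι, sg_comp]

theorem exists_comp_eq_of_isIso {C : Type u} [Category.{v} C] {X X' Y Y' Z : C} (e₁ : X ≅ X')
    (f : X' ⟶ Y') (e₂ : Y ≅ Y') {t : Y ⟶ Z} (ht : IsIso t) {b : X ⟶ Z}
    (h : (e₁.hom ≫ f ≫ e₂.inv) ≫ t = b) : ∃ v : Z ⟶ Y', IsIso v ∧ b ≫ v = e₁.hom ≫ f :=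
  ⟨inv t ≫ e₂.hom, inferInstance, by simp [← h]⟩

/-- Up to homotopy equivalence, all objects generated by objects in the image of `Ξ` are in the
image of `Ξ`. -/
theorem exists_nonempty_iso_of_generated (hE : HasCones k E) (hS : HasShifts k E)
    (hE' : HasCones k E') (hzero : ∃ X : E, 𝟙 (⟨X⟩ : Tot k E) = 0)
    (hΞ : ∀ Z, P Z → IsContractible k (Ξ.obj Z)) (h : ∀ X, Killable Ξ P X)
    {S : Type u''} {j : S → E'} (hj : ∀ s, ∃ X, Nonempty ((⟨Ξ.obj X⟩ : Ho k E') ≅ ⟨j s⟩)) {K : E'}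
    (hK : Generated k j K) : ∃ X, Nonempty ((⟨Ξ.obj X⟩ : Ho k E') ≅ ⟨K⟩) := by
  induction hK with
  | zero K hK =>
    obtain ⟨X, hX⟩ := hzero
    have hX' : 𝟙 (⟨Ξ.obj X⟩ : Tot k E') = 0 := by rw [← Ξ.tot_id, hX, map_zero]
    exact ⟨X, Ho.nonempty_iso 0 0 (by simp) (by simp) 0 0 (by simp [hX']) (by simp [hK])⟩
  | base s => exact hj s
  | @shift K K' n m hnm c _ ih =>
    obtain ⟨X, ⟨e⟩⟩ := ih
    obtain ⟨X', ⟨x⟩⟩ := hS X n m hnm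
    exact ⟨X', (Ξ.mapShift x).nonempty_iso hnm c e⟩
  | @cone K₁ K₂ K f c _ _ ih₁ ih₂ =>
    obtain ⟨X₁, ⟨e₁⟩⟩ := ih₁
    obtain ⟨X₂, ⟨e₂⟩⟩ := ih₂
    have hinv := ho_inverts_towerClass Ξ hΞ
    -- The morphism between objects in the image need not be in the image itself, but it becomes `Ξ
    -- b` after a tower `t`. Since `Ξ` inverts `t`, the cone of `Ξ b` is homotopy equivalent to `K`.
    obtain ⟨X₃, t, b, ht, hb⟩ := (h X₁).exists_homMk (Y := X₂)
      (e₁.hom ≫ Ho.homMk ⟨f, mem_closed_iff.mpr c.D_base⟩ ≫ e₂.inv)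
    obtain ⟨v, hv, hbv⟩ := exists_comp_eq_of_isIso e₁ _ e₂ (hinv t ht) hb
    obtain ⟨b, rfl⟩ := Ho.exists_homMk b
    obtain ⟨u, hu⟩ := Ho.exists_homMk e₁.hom
    obtain ⟨v, rfl⟩ := Ho.exists_homMk v
    obtain ⟨X, ⟨cX⟩⟩ := hE X₁ X₃ b.1 (mem_closed_iff.mp b.2)
    have hsq : Ξ.ho.map (Ho.homMk b) ≫ Ho.homMk v =
        Ho.homMk u ≫ Ho.homMk ⟨f, mem_closed_iff.mpr c.D_base⟩ :=
      hbv.trans (congrArg (· ≫ _) hu)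
    obtain ⟨η, hη⟩ := Ho.homMk_eq_iff.mp
      (show Ho.homMk (compClosed (Ξ.mapClosed X₁ X₃ b) v) =
        Ho.homMk (compClosed u ⟨f, mem_closed_iff.mpr c.D_base⟩) from hsq)
    exact ⟨X, ConeData.nonempty_iso_of_square hE' (Ξ.mapCone cX) c u v
      (hu ▸ inferInstance) hv η (hη.trans (congrArg₂ (· - ·)
        (ι_comp 0 0 0 _ _ _) (ι_comp 0 0 0 _ _ _)))⟩

/-- If all objects are killable, then `Ho(Ξ)` is the localization at the class of towers. -/
theorem isLocalization_of_killable (hE : HasCones k E) (hP : ShiftClosed k P)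
    (hΞ : ∀ Z, P Z → IsContractible k (Ξ.obj Z)) (h : ∀ X, Killable Ξ P X)
    (hess : ∀ K, ∃ X, Nonempty ((⟨Ξ.obj X⟩ : Ho k E') ≅ ⟨K⟩)) :
    Ξ.ho.IsLocalization (towerClass k P) := by
  have := hasLeftCalculusOfFractions_towerClass hE hP
  have hinv := ho_inverts_towerClass Ξ hΞ
  let W := towerClass k P
  let Λ := Localization.Construction.lift Ξ.ho hinv
  have hΛ : ∀ {X Y : Ho k E} (f : X ⟶ Y), Λ.map (W.Q.map f) = Ξ.ho.map f := fun f =>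
    (Functor.congr_hom (Localization.Construction.fac Ξ.ho hinv) f).trans
      ((Category.id_comp _).trans (Category.comp_id _))
  have hobj : ∀ Y : W.Localization, ∃ X : Ho k E, W.Q.obj X = Y :=
    (Localization.Construction.objEquiv W).surjective
  have hfaithful : Λ.Faithful :=
    Functor.faithful_of_comp_of_hasLeftCalculusOfFractions W.Q W Λ fun X Y f g hfg => by
      rw [hΛ, hΛ] at hfg
      obtain ⟨K, t, ht, he⟩ := (h X.of).exists_comp_eq f g hfg
      exact (MorphismProperty.map_eq_iff_postcomp W.Q W f g).mpr ⟨⟨K⟩, t, ht, he⟩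
  have hfull : Λ.Full := ⟨fun {X Y} c => by
    obtain ⟨X, rfl⟩ := hobj X
    obtain ⟨Y, rfl⟩ := hobj Y
    obtain ⟨K, t, b, ht, hb⟩ := (h X.of).exists_homMk (Y := Y.of) c
    have ht' : IsIso (W.Q.map t) := W.Q_inverts t ht
    have ht'' : IsIso (Ξ.ho.map t) := hinv t ht
    refine ⟨W.Q.map b ≫ inv (W.Q.map t), ?_⟩
    rw [Functor.map_comp, Functor.map_inv]
    refine (IsIso.comp_inv_eq _).mpr ?_
    exact (hΛ b).trans (hb.symm.trans (congrArg (c ≫ ·) (hΛ t).symm))⟩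
  have hessSurj : Λ.EssSurj := ⟨fun K => by
    obtain ⟨X, ⟨e⟩⟩ := hess K.of
    exact ⟨W.Q.obj ⟨X⟩, ⟨e⟩⟩⟩
  exact ⟨hinv, {}⟩

end Localization

/-! ### Towers over `B` and the Verdier quotient -/

section Verdier

open Tot

variable {k : Type w} [CommRing k] {A : Type u} [DGCategory.{w, v} k A] (B : Set A)

theorem PreTr.hasCones : HasCones k (PreTr k A) := fun _ _ f hf =>
  ⟨_, ⟨PreTr.coneData ⟨f, mem_closed_iff.mpr hf⟩⟩⟩

theorem PreTr.shiftClosed_isOver : ShiftClosed k (PreTr.IsOver (k := k) B) :=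
  (PreTr.isHull_isOver B).shift

/-- The morphisms with cone in `B^tr` and the towers of cones of morphisms with source in `B^tr`
are inverted by the same functors. -/
theorem verdierClass_isInvertedBy_iff {T : Type u'} [Category.{u''} T]
    (F : Ho k (PreTr k A) ⥤ T) : (verdierClass B).IsInvertedBy F ↔
      (towerClass k (PreTr.IsOver (k := k) B)).IsInvertedBy F := by
  constructor
  · intro h
    have H : ∀ {X Y : PreTr k A} {t : Hom k X Y 0} (ht : Tower k (PreTr.IsOver (k := k) B) t),
        IsIso (F.map (Ho.homMk ⟨t, ht.closed⟩)) := by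
      intro X Y t ht
      induction ht with
      | id Y => exact inferInstanceAs (IsIso (F.map (𝟙 (⟨Y⟩ : Ho k (PreTr k A)))))
      | @step Z Y K K' f hZ c t ht ih =>
        -- The cone of `i : Y → K` is homotopy equivalent to `Z[1]`, so each step of a tower lies in
        -- the Verdier class.
        obtain ⟨_, ⟨Z', rfl⟩, ⟨σ⟩⟩ := PreTr.shiftClosed_isOver B Z hZ (-1) 1 (by simp)
        have h1 : IsIso (F.map (Ho.homMk ⟨c.i, c.closed_i⟩)) := h _
          ⟨⟨c.i, c.closed_i⟩, rfl, ⟨Z'⟩, c.nonempty_iso_shift (PreTr.coneData ⟨c.i, c.closed_i⟩) σ⟩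
        have h2 := F.map_comp (Ho.homMk ⟨c.i, c.closed_i⟩) (Ho.homMk ⟨t, ht.closed⟩)
        exact h2 ▸ IsIso.comp_isIso
    rintro X Y f ⟨t, rfl, ht⟩
    exact H ht
  · rintro h X Y f ⟨s, rfl, Z, ⟨e⟩⟩
    obtain ⟨e', he⟩ := Ho.exists_homMk e.hom
    -- Conversely, a morphism whose cone is equivalent to `Z` is the inclusion into the cone of a
    -- morphism out of `Z[-1]`, followed by a homotopy equivalence: a one-step tower up to
    -- isomorphism.
    obtain ⟨Z₁, hZ₁, ⟨σ⟩⟩ := PreTr.shiftClosed_isOver B _ ⟨Z.of, rfl⟩ 1 (-1) (by simp)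
    obtain ⟨f, K, c, w, hw, hs⟩ := (PreTr.coneData s).exists_factorization PreTr.hasCones e'
      (he ▸ inferInstance) σ.symm
    have h1 : IsIso (F.map (Ho.homMk ⟨c.i, c.closed_i⟩)) := h _ ⟨_, rfl, .of_cone hZ₁ c⟩
    have h2 : Ho.homMk s = Ho.homMk ⟨c.i, c.closed_i⟩ ≫ Ho.homMk w :=
      congrArg Ho.homMk (Subtype.ext (ι_injective (hs.symm.trans (ι_comp 0 0 0 _ c.i w.1).symm)))
    rw [h2, F.map_comp]
    infer_instance

theorem isLocalization_verdierClass_iff {T : Type u'} [Category.{u''} T]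
    (F : Ho k (PreTr k A) ⥤ T) : F.IsLocalization (verdierClass B) ↔
      F.IsLocalization (towerClass k (PreTr.IsOver (k := k) B)) :=
  ⟨fun _ => .of_isInvertedBy_iff (fun F => verdierClass_isInvertedBy_iff B F) F,
    fun _ => .of_isInvertedBy_iff (fun F => (verdierClass_isInvertedBy_iff B F).symm) F⟩

end Verdier


/-! ### Characterizations of DG quotients -/

section EssImageKillable

variable {k : Type w} [CommRing k] {A : Type u} {C : Type u'} {E : Type u} {E' : Type u''}
  {S : Type u} [DGCategory.{w, u} k A] [DGCategory.{w, u} k C] [DGCategory.{w, u} k E]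
  [DGCategory.{w, u} k E'] [DGCategory.{w, u} k S] {ξ : DGFunctor k A C} {G : DGFunctor k A E}
  {Ξ : DGFunctor k E E'} {I : DGFunctor k S A} {P : E → Prop}

/-- The cone module of `ξ` is the restriction of that of `Ξ`, up to isomorphism in the derived
category. Its membership in the image means acyclicity of the cone of the semi-free approximation on
`A`; as `A` generates `E` this holds on `E`, where it is equivalent to killability. -/
theorem essImage_coneModule_iff (hG : G.FullyFaithful) (hI : I.FullyFaithful)
    (κ : HomIso ξ (G.comp Ξ)) (hE : HasCones k E)
    (hP : IsHull k (fun s : S => G.obj (I.obj s)) P) (hgen : ∀ Y : E, Generated k G.obj Y)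
    (X : A) : (LInd I).essImage (toDer (coneModule ξ X)) ↔ Killable Ξ P (G.obj X) := by
  obtain ⟨e⟩ := κ.toDer_iso X hG
  have h1 : (LInd I).essImage (toDer (coneModule ξ X)) ↔
      (LInd I).essImage (toDer ((coneModule Ξ (G.obj X)).res G)) :=
    ⟨(LInd I).essImage.prop_of_iso e, (LInd I).essImage.prop_of_iso e.symm⟩
  rw [h1, LInd_essImage_res_iff hG hI]
  exact ⟨fun h => killable_of_acyclic hE hP fun Y => DGMod.AcyclicAt.of_generated _ h (hgen Y),
    fun h Y => acyclic_of_killable hE hP h (G.obj Y)⟩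

/-- Killable objects are closed under shifts and cones, so the objects of `A` decide about all of
`E`. -/
theorem forall_essImage_coneModule_iff (hG : G.FullyFaithful) (hI : I.FullyFaithful)
    (κ : HomIso ξ (G.comp Ξ)) (hE : HasCones k E)
    (hP : IsHull k (fun s : S => G.obj (I.obj s)) P) (hgen : ∀ Y : E, Generated k G.obj Y) :
    (∀ X : A, (LInd I).essImage (toDer (coneModule ξ X))) ↔ ∀ X : E, Killable Ξ P X := by
  simp only [essImage_coneModule_iff hG hI κ hE hP hgen]
  exact ⟨fun h X => .of_generated h (hgen X), fun h X => h _⟩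

end EssImageKillable

/-! ### Twisted complexes with one component, and the final equivalences -/

section PreTrSingle

open Tot

namespace PreTr

variable {k : Type w} [CommRing k] {A : Type u} {C : Type u'} [DGCategory.{w, v} k A]
  [DGCategory.{w, v} k C] (ξ : DGFunctor k A C)

/-- The zero entry of `q` is mapped to `ξ 0`, which equals zero only propositionally. For this
reason Hom complexes are compared through `HomIso` and not by rewriting objects. -/
theorem pretr_obj_single (a : A) :
    ξ.pretr.obj (single (k := k) a 0) = single (k := k) (ξ.obj a) 0 := by
  change PreTr.mk _ _ _ _ _ _ = PreTr.mk _ _ _ _ _ _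
  congr 1
  funext i j
  exact map_zero _

theorem ι_d_apply_of_q_eq_zero {X Y : PreTr k A} (l m : ℤ) (h : l + 1 = m)
    (hY : ∀ i a, Y.q i a = 0) (hX : ∀ a j, X.q a j = 0) (f : Hom k X Y l) (i : Fin Y.n)
    (j : Fin X.n) : ι (d l m h f i j) = sgn (Y.r i) • D (ι (f i j)) := by
  rw [ι_d_apply]
  simp [hX, hY]

/-- The complex `Hom(ξ X, ξ Y)` in terms of twisted complexes. -/
def homIso : HomIso ξ ((singleFunctor k A).comp ξ.pretr) where
  app X Y n :=
    { toFun := fun f _ _ => degCast (by simp only [DGFunctor.comp, DGFunctor.pretr, single]; omega) f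
      map_add' := fun f g => by funext i j; exact map_add _ _ _
      map_smul' := fun c f => by funext i j; exact map_smul _ _ _ }
  bijective X Y n := by
    constructor
    · intro f g h
      have := congrArg (ι (k := k)) (congrFun (congrFun h (0 : Fin 1)) (0 : Fin 1))
      exact ι_injective ((ι_degCast _ f).symm.trans (this.trans (ι_degCast _ g)))
    · intro f
      refine ⟨degCast (by simp only [DGFunctor.comp, DGFunctor.pretr, singleFunctor, single]; omega)
        (f (0 : Fin 1) (0 : Fin 1)), ?_⟩
      refine ι_injective (mat_ext fun i j => ?_)
      obtain rfl : i = (0 : Fin 1) := Subsingleton.elim (α := Fin 1) _ _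
      obtain rfl : j = (0 : Fin 1) := Subsingleton.elim (α := Fin 1) _ _
      exact (ι_degCast _ _).trans (ι_degCast _ _)
  app_d X Y n m h f := by
    refine ι_injective (mat_ext fun i j => ?_)
    refine Eq.trans ?_ (ι_d_apply_of_q_eq_zero n m h (fun i a => map_zero (ξ.map _))
      (fun a j => map_zero (ξ.map _)) _ i j).symm
    refine (ι_degCast _ _).trans ((ι_d n m h (f := f)).trans ?_)
    refine Eq.trans ?_ (congrArg (sgn 0 • ·) (congrArg D (ι_degCast _ f))).symm
    rw [sgn_zero, one_smul]
  app_comp X Y Z p q n h f g := by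
    refine ι_injective (mat_ext fun i j => ?_)
    rw [ι_comp_apply]
    refine (ι_degCast _ _).trans ((ι_comp p q n h f g).trans (Eq.symm ?_))
    refine (Fin.sum_univ_one _).trans ?_
    exact congrArg₂ (· ≫ ·) (ι_degCast _ f) (ι_degCast _ g)
  app_map X Y n f := by
    refine ι_injective (mat_ext fun i j => ?_)
    refine (ι_degCast _ _).trans ?_
    refine (ξ.tot_ι f).symm.trans (((congrArg ξ.tot (ι_degCast _ f)).symm).trans (ξ.tot_ι _))

theorem exists_nonempty_iso (hξ : ξ.ho.EssSurj) (c : C) :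
    ∃ X, Nonempty ((⟨ξ.pretr.obj X⟩ : Ho k (PreTr k C)) ≅ ⟨(singleFunctor k C).obj c⟩) := by
  obtain ⟨a, ⟨e⟩⟩ := hξ.mem_essImage ⟨c⟩
  refine ⟨single a.of 0, ⟨?_⟩⟩
  rw [pretr_obj_single]
  exact (singleFunctor k C).ho.mapIso e

/-- Contractibility amounts to acyclicity of the Hom complexes into the object, and this passes from
the objects of `B` to everything they generate. -/
theorem isContractible_pretr_obj (B : Set A) (hB : ∀ X ∈ B, IsContractible k (ξ.obj X))
    (Z : PreTr k A) (hZ : IsOver (k := k) B Z) : IsContractible k (ξ.pretr.obj Z) := by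
  refine isContractible_of_rep_acyclicAt (DGMod.AcyclicAt.of_generated _ (fun b => ?_)
    (((isHull_isOver B).gen Z hZ).map ξ.pretr))
  refine IsContractible.rep_acyclicAt ?_ _
  change IsContractible k (ξ.pretr.obj (single b.1 0))
  rw [pretr_obj_single]
  obtain ⟨h, hh⟩ := hB b.1 b.2
  exact ⟨(singleFunctor k C).map _ h, by
    rw [← (singleFunctor k C).map_d, hh, (singleFunctor k C).map_id]⟩

end PreTr

/-- Replace the Verdier class by the class of towers. Killability then says that the functor induced
on the localization is fully faithful, and its essential surjectivity is propagated from `C` to the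
twisted complexes over `C`. -/
theorem isDGQuotient_iff {k : Type w} [CommRing k] {A : Type u} {C : Type u'}
    [DGCategory.{w, v} k A] [DGCategory.{w, v} k C] (ξ : DGFunctor k A C) (B : Set A)
    (hB : ∀ X ∈ B, IsContractible k (ξ.obj X)) (hξ : ξ.ho.EssSurj) :
    IsDGQuotient ξ B ↔ ∀ X, Killable ξ.pretr (PreTr.IsOver (k := k) B) X := by
  constructor
  · rintro ⟨_, h⟩ X
    have := (isLocalization_verdierClass_iff B ξ.tr).mp h
    exact .of_isLocalization PreTr.hasCones (PreTr.shiftClosed_isOver B) PreTr.hasShifts X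
  · intro h
    have hΞ := PreTr.isContractible_pretr_obj ξ B hB
    refine ⟨hξ, (isLocalization_verdierClass_iff B ξ.tr).mpr (isLocalization_of_killable
      PreTr.hasCones (PreTr.shiftClosed_isOver B) hΞ h fun K => ?_)⟩
    exact exists_nonempty_iso_of_generated PreTr.hasCones PreTr.hasShifts PreTr.hasCones
      ⟨_, PreTr.id_eq_zero_of_n_eq_zero PreTr.empty rfl⟩ hΞ h
      (PreTr.exists_nonempty_iso ξ hξ) (PreTr.generated K)

theorem IsHull.hasCones {k : Type w} [CommRing k] {E : Type u} [DGCategory.{w, v} k E] {S : Type u'}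
    {j : S → E} {P : E → Prop} (h : IsHull k j P) (hP : ∀ X, P X) : HasCones k E := by
  intro X Y f hf
  obtain ⟨K, _, c⟩ := h.cone X Y f (hP X) (hP Y) hf
  exact ⟨K, c⟩

/-- `Killable.op` in one direction; in the other it is applied to the dual categories and followed
by the return from the double dual. -/
theorem forall_killable_op_iff {k : Type w} [CommRing k] {A : Type u} {C : Type u'}
    [DGCategory.{w, v} k A] [DGCategory.{w, v} k C] (ξ : DGFunctor k A C) (B : Set A)
    (hB : ∀ X ∈ B, IsContractible k (ξ.obj X)) :
    (∀ X, Killable ξ.pretr.op (fun X => PreTr.IsOver (k := k) B X.unop) X) ↔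
      ∀ X, Killable ξ.pretr (PreTr.IsOver (k := k) B) X := by
  have hΞ := PreTr.isContractible_pretr_obj ξ B hB
  have hE := (PreTr.isHull (k := k) (A := A)).op PreTr.hasShifts
  have hP := (PreTr.isHull_isOver (k := k) B).op PreTr.hasShifts
  refine ⟨fun h X => .of_op_op (.op hP.shift ((hE.op PreTr.hasShifts.op).hasCones fun _ => trivial)
    (fun Z hZ => hΞ Z.unop hZ) h _), fun h X => .op (PreTr.isHull_isOver B).shift
      (hE.hasCones fun _ => trivial) hΞ h X⟩

end PreTrSingle

end DG

theorem proposition1p4 {k : Type w} [CommRing k] {A : Type u} {C : Type u'}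
    [DG.DGCategory.{w, u} k A] [DG.DGCategory.{w, u} k C] (ξ : DG.DGFunctor k A C) (B : Set A)
    (hB : ∀ X ∈ B, DG.IsContractible k (ξ.obj X)) (hξ : ξ.ho.EssSurj) :
    List.TFAE [
      DG.IsDGQuotient ξ B,
      ∀ Y : A, (DG.LInd (DG.incl k B).op).essImage
        (DG.toDer (DG.coneModule ξ.op (Opposite.op Y))),
      ∀ X : A, (DG.LInd (DG.incl k B)).essImage (DG.toDer (DG.coneModule ξ X))] := by
  have h3 := DG.forall_essImage_coneModule_iff (I := DG.incl k B)
    (fun X Y n => DG.PreTr.singleFunctor_bijective n) (fun X Y n => Function.bijective_id)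
    (DG.PreTr.homIso ξ) DG.PreTr.hasCones (DG.PreTr.isHull_isOver B) DG.PreTr.generated
  have h2 := DG.forall_essImage_coneModule_iff (G := (DG.PreTr.singleFunctor k A).op)
    (Ξ := ξ.pretr.op) (I := (DG.incl k B).op)
    (P := fun X => DG.PreTr.IsOver (k := k) B X.unop)
    (fun X Y n => DG.PreTr.singleFunctor_bijective n) (fun X Y n => Function.bijective_id)
    (DG.PreTr.homIso ξ).op
    (((DG.PreTr.isHull (k := k) (A := A)).op DG.PreTr.hasShifts).hasCones fun _ => trivial)
    ((DG.PreTr.isHull_isOver B).op DG.PreTr.hasShifts)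
    (fun Y => (DG.PreTr.generated Y.unop).op DG.PreTr.hasShifts)
  -- Self-duality of killability turns `h2` into the equivalence of (ii) and (ii°).
  rw [DG.forall_killable_op_iff ξ B hB, ← h3] at h2
  rw [← DG.isDGQuotient_iff ξ B hB hξ] at h3
  tfae_have 1 ↔ 3 := h3.symm
  tfae_have 2 ↔ 3 := ⟨fun h => h2.mp fun Y => h Y.unop, fun h Y => h2.mpr h (Opposite.op Y)⟩
  tfae_finish
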